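/- **Setting.** Units $(A_i,X_i,U_i,Y_i(0),Y_i(1))$, $i\ge 1$, are IID with $A_i\in\{0,1\}$, $X_i\in\mathbb R^p$, $U_i\in\mathbb R^q$, integrable $Y_i(a)$, and $Y_i=Y_i(A_i)$. Along a sequence of studies the main data are $\mathcal S_1=\{1,\dots,n_1\}$ and the validation set $\mathcal S_2\subset\mathcal S_1$ is a simple random sample of size $n_2\ge 1$, independent of the units, with $n_2\to\infty$ and $n_2/n_1\to\rho$. Put $\tau=E\{Y(1)-Y(0)\}$. Let $\hat\tau_2$ be an estimator of $\tau$ from $\mathcal S_2$, and $\hat\tau_{d,\mathrm{ep}}\in\mathbb R^L$ an error-prone estimator from the $(A,X,Y)$-data of $\mathcal S_d$ $(d=1,2)$, with estimated linear terms $\hat\psi_j$ and $\hat\phi_{d,j}$ described below. **Bootstrap.** For $b=1,\dots,B$, with $B=B_n\to\infty$ at any rate, draw $n_1$ units from $\mathcal S_1$ with replacement, independently of the data; let $\mathcal S_1^{*(b)}$ be the multiset of drawn units and $\mathcal S_2^{*(b)}$ the drawn units that belong to $\mathcal S_2$. Let $$t_b=n_2^{-1}\sum_{j\in\mathcal S_2^{*(b)}}\hat\psi_j,\qquad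 e_b=n_2^{-1}\sum_{j\in\mathcal S_2^{*(b)}}\hat\phi_{2,j}-n_1^{-1}\sum_{j\in\mathcal S_1^{*(b)}}\hat\phi_{1,j},$$ $\hat\Gamma=(B-1)^{-1}\sum_b t_be_b$, $\hat V=(B-1)^{-1}\sum_b e_be_b^{T}$, $\hat v_2=(B-1)^{-1}\sum_b t_b^2$, $\hat v=\hat v_2-\hat\Gamma^T\hat V^{-1}\hat\Gamma$ and $\hat\tau=\hat\tau_2-\hat\Gamma^T\hat V^{-1}(\hat\tau_{2,\mathrm{ep}}-\hat\tau_{1,\mathrm{ep}})$. **Conclusion.** In each of the cases (a), (b) below, with the stated $v_2,\Gamma,V$, $$n_2^{1/2}\begin{pmatrix}\hat\tau_2-\tau\\ \hat\tau_{2,\mathrm{ep}}-\hat\tau_{1,\mathrm{ep}}\end{pmatrix}\to\mathcal N\left\{0,\begin{pmatrix}v_2&\Gamma^T\\ \Gamma&V\end{pmatrix}\right\}\ \text{in distribution},$$ so that $\mathrm{var}(\hat\tau_2)=v_2/n_2$ is the asymptotic variance of $\hat\tau_2$, and the bootstrap is consistent: $n_2\hat\Gamma\to\Gamma$, $n_2\hat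 V\to V$ and $n_2\hat v_2\to v_2$ in probability. If $V$ is invertible, then also $n_2^{1/2}(\hat\tau-\tau)\to\mathcal N(0,v_2-\Gamma^TV^{-1}\Gamma)$ in distribution, so that $\mathrm{var}(\hat\tau)=(v_2-\Gamma^TV^{-1}\Gamma)/n_2$ is the asymptotic variance of $\hat\tau$, and $n_2\hat v\to v_2-\Gamma^TV^{-1}\Gamma$ in probability. **(a) RAL estimators.** $\hat\tau_2-\tau=n_2^{-1}\sum_{j\in\mathcal S_2}\psi(A_j,X_j,U_j,Y_j)+o_P(n_2^{-1/2})$ and $\hat\tau_{d,\mathrm{ep}}-\tau_{\mathrm{ep}}=n_d^{-1}\sum_{j\in\mathcal S_d}\phi(A_j,X_j,Y_j)+o_P(n_d^{-1/2})$ $(d=1,2)$, where $\psi,\phi$ have mean zero and finite second moments. The $\hat\psi_j=\hat\psi(A_j,X_j,U_j,Y_j)$ and $\hat\phi_{d,j}=\hat\phi_d(A_j,X_j,Y_j)$ are values of estimated influence functions with $n_2^{-1}\sum_{j\in\mathcal S_2}|\hat\psi_j-\psi_j|^2\to0$ and $n_d^{-1}\sum_{j\in\mathcal S_d}|\hat\phi_{d,j}-\phi_j|^2\to0$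 in probability, whose empirical means vanish up to the error: $n_2^{-1}\sum_{\mathcal S_2}\hat\psi_j=o_P(n_2^{-1/2})$ and $n_d^{-1}\sum_{\mathcal S_d}\hat\phi_{d,j}=o_P(n_d^{-1/2})$. Then $v_2=\mathrm{var}(\psi)$, $\Gamma=(1-\rho)\,\mathrm{cov}(\psi,\phi)$, $V=(1-\rho)\,\mathrm{var}(\phi)$. **(b) Matching estimators** ($L=1$, $p\ge1$). Assume: * $Y(a)\perp A\mid(X,U)$ for $a=0,1$, and $0<c_1\le P(A=1\mid X,U)\le c_2<1$ almost surely; * $(X,U)$ has a compact convex support and a density that is bounded and bounded away from zero on it; * $\mu_a(x,u),\sigma_a^2(x,u)$ (the conditional mean and variance of $Y$ given $A=a,X=x,U=u$) and $\mu_a(x),\sigma_a^2(x)$ (given $A=a,X=x$) are Lipschitz on the supports, the variances are bounded away from zero, and $E(Y^4\mid A,X,U)$ and $E(Y^4\mid A,X)$ are bounded. For fixed $M\ge1$, $\hat\tau_2$ is the bias-corrected estimator by matching with replacement to the $M$ nearest units of the opposite treatment within $\mathcal S_2$, in the Euclidean distance of $(X,U)$: $$\hat\tau_2=n_2^{-1}\sum_{j\in\mathcal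 S_2}(2A_j-1)\Big[Y_j-M^{-1}\sum_{l\in\mathcal J_j}\big\{Y_l+\hat\mu_{1-A_j}(X_j,U_j)-\hat\mu_{1-A_j}(X_l,U_l)\big\}\Big],$$ with $\mathcal J_j$ the set of matches of $j$. The $\hat\tau_{d,\mathrm{ep}}$ are the analogous estimators on $\mathcal S_d$ that match on $X$ only and use estimators $\hat\mu_{d,a}(x)$ of $\mu_a(x)$. Each estimated mean function has an error that tends to zero in probability uniformly on the support, and whose Lipschitz constant there is $o_P(n_2^{-1/2+1/k})$, $k$ being the dimension of its argument. The estimated linear terms are $$\hat\psi_j=\hat\mu_1(X_j,U_j)-\hat\mu_0(X_j,U_j)-\hat\tau_2+(2A_j-1)\,w_j\,\{Y_j-\hat\mu_{A_j}(X_j,U_j)\},$$ $$\hat\phi_{d,j}=\hat\mu_{d,1}(X_j)-\hat\mu_{d,0}(X_j)-\hat\tau_{d,\mathrm{ep}}+(2A_j-1)\,w_{d,j}\,\{Y_j-\hat\mu_{d,A_j}(X_j)\},$$ where $w_j$ (resp. $w_{d,j}$) is $1+M^{-1}$ times the number of times unit $j$ is used as a match in $\mathcal S_2$ when matching on $(X,U)$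 (resp. in $\mathcal S_d$ when matching on $X$). Write $\tau(x,u)=\mu_1(x,u)-\mu_0(x,u)$ and $\tau_{\mathrm{ep}}(x)=\mu_1(x)-\mu_0(x)$. Assume that the following probability limits exist; $v_2$, $\Gamma$ and $V$ are then defined by $$v_2=\mathrm{var}\{\tau(X,U)\}+\mathrm{plim}\;n_2^{-1}\sum_{j\in\mathcal S_2}w_j^2\,\sigma^2_{A_j}(X_j,U_j),$$ $$\Gamma=(1-\rho)\,\mathrm{cov}\{\tau(X,U),\tau_{\mathrm{ep}}(X)\}+\mathrm{plim}\;n_2^{-1}\sum_{j\in\mathcal S_2}(w_{2,j}-\rho w_{1,j})\big[w_j\sigma^2_{A_j}(X_j,U_j)+(2A_j-1)\{\tau(X_j,U_j)-\tau\}\{\mu_{A_j}(X_j,U_j)-\mu_{A_j}(X_j)\}\big],$$ $$V=(1-\rho)\,\mathrm{var}\{\tau_{\mathrm{ep}}(X)\}+\mathrm{plim}\Big[n_2^{-1}\sum_{j\in\mathcal S_2}(w_{2,j}^2-2\rho w_{1,j}w_{2,j})\,\sigma^2_{A_j}(X_j)+\rho\,n_1^{-1}\sum_{i\in\mathcal S_1}w_{1,i}^2\,\sigma^2_{A_i}(X_i)\Big].$$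 -/

import Mathlib

open MeasureTheory ProbabilityTheory Filter Topology Finset Matrix
open scoped NNReal ENNReal

noncomputable section

namespace TwoPhase

/-! ### Population -/

/-- The record `(A, (X, U), (Y(0), Y(1)))` of one unit; `A = true` is the active treatment. -/
abbrev Rec (p q : ℕ) : Type :=
  Bool × (EuclideanSpace ℝ (Fin p) × EuclideanSpace ℝ (Fin q)) × (ℝ × ℝ)

variable {p q : ℕ}

/-- Treatment `A`. -/
def trt (r : Rec p q) : Bool := r.1

/-- The full covariate vector `(X, U)`. -/
def covXU (r : Rec p q) : EuclideanSpace ℝ (Fin p) × EuclideanSpace ℝ (Fin q) := r.2.1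

/-- The covariate `X` available for all units. -/
def covX (r : Rec p q) : EuclideanSpace ℝ (Fin p) := r.2.1.1

/-- Potential outcome `Y(a)`. -/
def pot (a : Bool) (r : Rec p q) : ℝ := if a then r.2.2.2 else r.2.2.1

/-- Observed outcome `Y = Y(A)`. -/
def outcome (r : Rec p q) : ℝ := pot (trt r) r

/-- The observation `(A, X, U, Y)` of a validation unit. -/
def obsFull (r : Rec p q) :
    Bool × (EuclideanSpace ℝ (Fin p) × EuclideanSpace ℝ (Fin q)) × ℝ :=
  (trt r, covXU r, outcome r)

/-- The observation `(A, X, Y)` of a main-data unit. -/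
def obsMain (r : Rec p q) : Bool × EuclideanSpace ℝ (Fin p) × ℝ :=
  (trt r, covX r, outcome r)

/-- `2 A - 1`. -/
def sgn (a : Bool) : ℝ := if a then 1 else -1

lemma measurable_covXU : Measurable (covXU : Rec p q → _) :=
  measurable_fst.comp measurable_snd

/-- The average causal effect `τ = E{Y(1) - Y(0)}` under the superpopulation law `Q`. -/
def ace (Q : Measure (Rec p q)) : ℝ := ∫ r, (pot true r - pot false r) ∂Q

/-- Ignorability: `Y(a) ⫫ A ∣ (X, U)` for `a = 0, 1`. -/
def Ignorable (Q : Measure (Rec p q)) [IsProbabilityMeasure Q] : Prop :=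
  ∀ a : Bool, CondIndepFun (MeasurableSpace.comap covXU inferInstance)
    measurable_covXU.comap_le (pot a) trt Q

/-- Overlap: `0 < c₁ ≤ e(X, U) ≤ c₂ < 1` almost surely, `e(X, U) = P(A = 1 ∣ X, U)`. -/
def Overlap (Q : Measure (Rec p q)) : Prop :=
  ∃ c₁ c₂ : ℝ, 0 < c₁ ∧ c₂ < 1 ∧ ∀ᵐ r ∂Q,
    c₁ ≤ (Q[fun r' => if trt r' then (1 : ℝ) else 0 |
      MeasurableSpace.comap covXU inferInstance]) r ∧
    (Q[fun r' => if trt r' then (1 : ℝ) else 0 |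
      MeasurableSpace.comap covXU inferInstance]) r ≤ c₂

/-- `(X, U)` is continuously distributed with compact convex support `K`, and its density is
bounded and bounded away from zero on `K`. -/
def RegularCovariates (Q : Measure (Rec p q))
    (K : Set (EuclideanSpace ℝ (Fin p) × EuclideanSpace ℝ (Fin q))) : Prop :=
  IsCompact K ∧ Convex ℝ K ∧
    ∃ f : EuclideanSpace ℝ (Fin p) × EuclideanSpace ℝ (Fin q) → ℝ, Measurable f ∧
      (∃ c C : ℝ, 0 < c ∧ ∀ w ∈ K, c ≤ f w ∧ f w ≤ C) ∧ (∀ w, w ∉ K → f w = 0) ∧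
      Q.map covXU = volume.withDensity fun w => ENNReal.ofReal (f w)

/-- For a covariate vector `V` (either `(X, U)` or `X`) with support `K`: `m a` and `s a` are the
conditional mean and variance functions of `Y` given `A = a` and `V`; they are Lipschitz on `K`,
`s a` is bounded away from zero on `K`, and `E(Y⁴ ∣ A, V)` is bounded. -/
structure RegularOutcome {W : Type*} [PseudoMetricSpace W] [MeasurableSpace W]
    (Q : Measure (Rec p q)) (V : Rec p q → W) (K : Set W) (m s : Bool → W → ℝ) : Prop where
  measurable_mean : ∀ a, Measurable (m a)
  measurable_var : ∀ a, Measurable (s a)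
  integrable_pow_four : Integrable (fun r => outcome r ^ 4) Q
  condMean : Q[outcome | MeasurableSpace.comap (fun r => (trt r, V r)) inferInstance]
    =ᵐ[Q] fun r => m (trt r) (V r)
  condVar : Q[fun r => (outcome r - m (trt r) (V r)) ^ 2 |
      MeasurableSpace.comap (fun r => (trt r, V r)) inferInstance]
    =ᵐ[Q] fun r => s (trt r) (V r)
  lipschitz : ∃ C : ℝ≥0, ∀ a, LipschitzOnWith C (m a) K ∧ LipschitzOnWith C (s a) K
  var_lower : ∃ c : ℝ, 0 < c ∧ ∀ a, ∀ w ∈ K, c ≤ s a w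
  fourth_moment : ∃ C : ℝ, ∀ᵐ r ∂Q, (Q[fun r' => outcome r' ^ 4 |
      MeasurableSpace.comap (fun r' => (trt r', V r')) inferInstance]) r ≤ C

/-! ### Samples and bootstrap draws -/

variable {Ω : Type*} {mΩ : MeasurableSpace Ω}

/-- The sampling scheme along a sequence of studies indexed by `n`.
The units `Z 0, Z 1, …` are IID with law `Q`; in study `n` the main data consist of the units
`0, …, n₁ n - 1` and the validation set `S₂ n` is a simple random sample of `n₂ n` of them;
`D n b k` is the unit obtained at the `k`-th of the `n₁ n` draws with replacement from the main
data in the `b`-th of the `B n` bootstrap replications. The σ-algebra `𝒢 n` contains the data of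
study `n` (and everything computed from them); the bootstrap draws are independent of it. -/
structure Design (P : Measure Ω) (Q : Measure (Rec p q)) (𝒢 : ℕ → MeasurableSpace Ω)
    (Z : ℕ → Ω → Rec p q) (n₁ n₂ B : ℕ → ℕ) (ρ : ℝ) (S₂ : ℕ → Ω → Finset ℕ)
    (D : ℕ → ℕ → ℕ → Ω → ℕ) : Prop where
  le_ambient : ∀ n, 𝒢 n ≤ mΩ
  measurable_unit : ∀ n i, Measurable[𝒢 n] (Z i)
  measurable_validation : ∀ n, Measurable[𝒢 n] (S₂ n)
  measurable_draw : ∀ n b k, Measurable (D n b k)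
  iid_indep : iIndepFun Z P
  iid_law : ∀ i, P.map (Z i) = Q
  size_pos : ∀ n, 0 < n₂ n
  size_le : ∀ n, n₂ n ≤ n₁ n
  size_tendsto : Tendsto n₂ atTop atTop
  ratio_tendsto : Tendsto (fun n => (n₂ n : ℝ) / (n₁ n : ℝ)) atTop (𝓝 ρ)
  replications_tendsto : Tendsto B atTop atTop
  srs_uniform : ∀ n, ∀ s ∈ powersetCard (n₂ n) (range (n₁ n)),
    P {ω | S₂ n ω = s} = ((n₁ n).choose (n₂ n) : ℝ≥0∞)⁻¹
  srs_indep : ∀ n, IndepFun (S₂ n) (fun ω i => Z i ω) P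
  draw_uniform : ∀ n b k, ∀ i ∈ range (n₁ n), P {ω | D n b k ω = i} = (n₁ n : ℝ≥0∞)⁻¹
  draw_indep : ∀ n, iIndepFun (fun bk : ℕ × ℕ => D n bk.1 bk.2) P
  draw_indep_data : ∀ n, Indep
    (MeasurableSpace.comap (fun ω (bk : ℕ × ℕ) => D n bk.1 bk.2 ω) inferInstance) (𝒢 n) P

/-! ### Bootstrap estimators -/

variable {L : ℕ}

/-- `size⁻¹ ∑_{j ∈ S*} f j`, where the bootstrap sample `S*` consists of those of the `N` drawn
units `draw 0, …, draw (N - 1)`, with multiplicity, that belong to `S`. -/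
def bootMean {E : Type*} [AddCommGroup E] [Module ℝ E] (size N : ℕ) (draw : ℕ → ℕ)
    (S : Finset ℕ) (f : ℕ → E) : E :=
  (size : ℝ)⁻¹ • ∑ k ∈ range N, if draw k ∈ S then f (draw k) else 0

/-- The bootstrap replicate `τ̂₂⁽ᵇ⁾ - τ̂₂`. -/
def bootTau (n₁ n₂ : ℕ) (S₂ : Finset ℕ) (draw : ℕ → ℕ) (ψ : ℕ → ℝ) : ℝ :=
  bootMean n₂ n₁ draw S₂ ψ

/-- The bootstrap replicate
`τ̂₂,ₑₚ⁽ᵇ⁾ - τ̂₁,ₑₚ⁽ᵇ⁾ - τ̂₂,ₑₚ + τ̂₁,ₑₚ`. -/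
def bootEp (n₁ n₂ : ℕ) (S₂ : Finset ℕ) (draw : ℕ → ℕ) (φ₁ φ₂ : ℕ → Fin L → ℝ) : Fin L → ℝ :=
  bootMean n₂ n₁ draw S₂ φ₂ - bootMean n₁ n₁ draw (range n₁) φ₁

/-- `Γ̂` from replicates `t b` and `e b`, `b < B`. -/
def gammaHat (B : ℕ) (t : ℕ → ℝ) (e : ℕ → Fin L → ℝ) : Fin L → ℝ :=
  ((B : ℝ) - 1)⁻¹ • ∑ b ∈ range B, t b • e b

/-- `V̂` from replicates `e b`, `b < B`. -/
def VHat (B : ℕ) (e : ℕ → Fin L → ℝ) : Matrix (Fin L) (Fin L) ℝ :=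
  ((B : ℝ) - 1)⁻¹ • ∑ b ∈ range B, vecMulVec (e b) (e b)

/-- `v̂₂` from replicates `t b`, `b < B`. -/
def v2Hat (B : ℕ) (t : ℕ → ℝ) : ℝ := ((B : ℝ) - 1)⁻¹ * ∑ b ∈ range B, t b ^ 2

/-- `v - Γᵀ V⁻¹ Γ`. -/
def schur (v : ℝ) (Γ : Fin L → ℝ) (V : Matrix (Fin L) (Fin L) ℝ) : ℝ :=
  v - Γ ⬝ᵥ (V⁻¹ *ᵥ Γ)

/-- The covariance matrix with blocks `v₂, Γᵀ; Γ, V`. -/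
def blockCov (v₂ : ℝ) (Γ : Fin L → ℝ) (V : Matrix (Fin L) (Fin L) ℝ) :
    Matrix (Unit ⊕ Fin L) (Unit ⊕ Fin L) ℝ :=
  Matrix.fromBlocks (Matrix.of fun _ _ => v₂) (Matrix.of fun _ l => Γ l)
    (Matrix.of fun l _ => Γ l) V

/-- `v₂`, `Γ`, `V` are the parameters of the limiting normal law of
`n₂^{1/2} (τ̂₂ - τ, τ̂₂,ₑₚ - τ̂₁,ₑₚ)`. -/
def AsympNormal (P : Measure Ω) [IsProbabilityMeasure P] (n₂ : ℕ → ℕ) (τ : ℝ) (τ₂ : ℕ → Ω → ℝ)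
    (ep₁ ep₂ : ℕ → Ω → Fin L → ℝ) (v₂ : ℝ) (Γ : Fin L → ℝ)
    (V : Matrix (Fin L) (Fin L) ℝ) : Prop :=
  (blockCov v₂ Γ V).PosSemidef ∧
    TendstoInDistribution
      (fun n ω => (WithLp.toLp 2 (Sum.elim (fun _ => √(n₂ n : ℝ) * (τ₂ n ω - τ))
        (fun l => √(n₂ n : ℝ) * (ep₂ n ω l - ep₁ n ω l))) : EuclideanSpace ℝ (Unit ⊕ Fin L)))
      atTop id (fun _ => P) (multivariateGaussian 0 (blockCov v₂ Γ V))

/-- `Γ̂` in study `n`, for resampled linear terms `ψ n ω j`, `φ₁ n ω j`, `φ₂ n ω j`. -/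
def bootGamma (n₁ n₂ B : ℕ → ℕ) (S₂ : ℕ → Ω → Finset ℕ) (D : ℕ → ℕ → ℕ → Ω → ℕ)
    (ψ : ℕ → Ω → ℕ → ℝ) (φ₁ φ₂ : ℕ → Ω → ℕ → Fin L → ℝ) (n : ℕ) (ω : Ω) : Fin L → ℝ :=
  gammaHat (B n) (fun b => bootTau (n₁ n) (n₂ n) (S₂ n ω) (fun k => D n b k ω) (ψ n ω))
    (fun b => bootEp (n₁ n) (n₂ n) (S₂ n ω) (fun k => D n b k ω) (φ₁ n ω) (φ₂ n ω))

/-- `V̂` in study `n`. -/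
def bootV (n₁ n₂ B : ℕ → ℕ) (S₂ : ℕ → Ω → Finset ℕ) (D : ℕ → ℕ → ℕ → Ω → ℕ)
    (φ₁ φ₂ : ℕ → Ω → ℕ → Fin L → ℝ) (n : ℕ) (ω : Ω) : Matrix (Fin L) (Fin L) ℝ :=
  VHat (B n)
    (fun b => bootEp (n₁ n) (n₂ n) (S₂ n ω) (fun k => D n b k ω) (φ₁ n ω) (φ₂ n ω))

/-- `v̂₂` in study `n`. -/
def bootV2 (n₁ n₂ B : ℕ → ℕ) (S₂ : ℕ → Ω → Finset ℕ) (D : ℕ → ℕ → ℕ → Ω → ℕ)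
    (ψ : ℕ → Ω → ℕ → ℝ) (n : ℕ) (ω : Ω) : ℝ :=
  v2Hat (B n) (fun b => bootTau (n₁ n) (n₂ n) (S₂ n ω) (fun k => D n b k ω) (ψ n ω))

/-- Validity of the bootstrap that resamples the estimated linear terms `ψ n ω j`, `φ₁ n ω j`,
`φ₂ n ω j` of `τ̂₂`, `τ̂₁,ₑₚ`, `τ̂₂,ₑₚ`. The replicates are on the scale of the estimators, so that
`Γ̂`, `V̂`, `v̂₂` and `v̂ = v̂₂ - Γ̂ᵀ V̂⁻¹ Γ̂` estimate `Γ / n₂`, `V / n₂`, `var(τ̂₂) = v₂ / n₂` and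
`var(τ̂) = (v₂ - Γᵀ V⁻¹ Γ) / n₂`; consistency holds on the scale `1 / n₂`. The first and the last
field say that these are the asymptotic (co)variances of the estimators, where
`τ̂ = τ̂₂ - Γ̂ᵀ V̂⁻¹ (τ̂₂,ₑₚ - τ̂₁,ₑₚ)`. -/
structure BootstrapConsistent (P : Measure Ω) [IsProbabilityMeasure P] (n₁ n₂ B : ℕ → ℕ)
    (S₂ : ℕ → Ω → Finset ℕ) (D : ℕ → ℕ → ℕ → Ω → ℕ) (τ : ℝ) (τ₂ : ℕ → Ω → ℝ)
    (ep₁ ep₂ : ℕ → Ω → Fin L → ℝ) (ψ : ℕ → Ω → ℕ → ℝ) (φ₁ φ₂ : ℕ → Ω → ℕ → Fin L → ℝ)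
    (v₂ : ℝ) (Γ : Fin L → ℝ) (V : Matrix (Fin L) (Fin L) ℝ) : Prop where
  asympNormal : AsympNormal P n₂ τ τ₂ ep₁ ep₂ v₂ Γ V
  gamma_consistent : ∀ l, TendstoInMeasure P
    (fun n ω => (n₂ n : ℝ) * bootGamma n₁ n₂ B S₂ D ψ φ₁ φ₂ n ω l) atTop (fun _ => Γ l)
  V_consistent : ∀ k l, TendstoInMeasure P
    (fun n ω => (n₂ n : ℝ) * bootV n₁ n₂ B S₂ D φ₁ φ₂ n ω k l) atTop (fun _ => V k l)
  v2_consistent : TendstoInMeasure P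
    (fun n ω => (n₂ n : ℝ) * bootV2 n₁ n₂ B S₂ D ψ n ω) atTop (fun _ => v₂)
  v_consistent : V.det ≠ 0 → TendstoInMeasure P
    (fun n ω => (n₂ n : ℝ) * schur (bootV2 n₁ n₂ B S₂ D ψ n ω)
      (bootGamma n₁ n₂ B S₂ D ψ φ₁ φ₂ n ω) (bootV n₁ n₂ B S₂ D φ₁ φ₂ n ω))
    atTop (fun _ => schur v₂ Γ V)
  asympNormal_combined : V.det ≠ 0 → TendstoInDistribution
    (fun n ω => √(n₂ n : ℝ) * (τ₂ n ω
      - bootGamma n₁ n₂ B S₂ D ψ φ₁ φ₂ n ω ⬝ᵥ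
        ((bootV n₁ n₂ B S₂ D φ₁ φ₂ n ω)⁻¹ *ᵥ (ep₂ n ω - ep₁ n ω)) - τ))
    atTop id (fun _ => P) (gaussianReal 0 (schur v₂ Γ V).toNNReal)

/-! ### Regular asymptotically linear estimators -/

/-- `est n - θ = (size n)⁻¹ ∑_{j ∈ S n} f (o (Z j)) + o_P((size n)^{-1/2})`, where the influence
function `f` of the observation `o (Z j)` has mean zero and finite second moment. -/
structure IsRAL {O E : Type*} [MeasurableSpace O] [NormedAddCommGroup E] [NormedSpace ℝ E]
    [MeasurableSpace E] (P : Measure Ω) (Q : Measure (Rec p q)) (Z : ℕ → Ω → Rec p q)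
    (size : ℕ → ℕ) (S : ℕ → Ω → Finset ℕ) (est : ℕ → Ω → E) (θ : E) (o : Rec p q → O)
    (f : O → E) : Prop where
  measurable_est : ∀ n, Measurable (est n)
  measurable_influence : Measurable f
  memLp_influence : MemLp (fun r => f (o r)) 2 Q
  mean_influence : ∫ r, f (o r) ∂Q = 0
  expansion : TendstoInMeasure P
    (fun n ω => √(size n : ℝ) • (est n ω - θ - (size n : ℝ)⁻¹ • ∑ j ∈ S n ω, f (o (Z j ω))))
    atTop (fun _ => 0)

/-- `fhat n` is an estimated version of the influence function `f` computed from the data of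
study `n`: it is consistent in empirical mean square, and, as `f` has mean zero, its empirical
mean is zero up to `o_P((size n)^{-1/2})`. -/
structure EstimatesInfluence {O E : Type*} [MeasurableSpace O] [NormedAddCommGroup E]
    [NormedSpace ℝ E] [MeasurableSpace E] (P : Measure Ω) (𝒢 : ℕ → MeasurableSpace Ω)
    (Z : ℕ → Ω → Rec p q) (size : ℕ → ℕ) (S : ℕ → Ω → Finset ℕ) (o : Rec p q → O) (f : O → E)
    (fhat : ℕ → Ω → O → E) : Prop where
  measurable_est : ∀ n, @Measurable (Ω × O) E ((𝒢 n).prod inferInstance) inferInstance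
    fun z => fhat n z.1 z.2
  mean_square : TendstoInMeasure P
    (fun n ω => (size n : ℝ)⁻¹ * ∑ j ∈ S n ω, ‖fhat n ω (o (Z j ω)) - f (o (Z j ω))‖ ^ 2)
    atTop (fun _ => 0)
  centred : TendstoInMeasure P
    (fun n ω => (√(size n : ℝ))⁻¹ • ∑ j ∈ S n ω, fhat n ω (o (Z j ω))) atTop (fun _ => 0)

/-! ### Matching estimators -/

open Classical in
/-- `𝒥_j`: the `M` units of `S` with treatment different from unit `j` that are nearest to `j`
(ties, which have probability zero, are broken by the index). -/
def matchSet (S : Finset ℕ) (A : ℕ → Bool) (d : ℕ → ℕ → ℝ) (M j : ℕ) : Finset ℕ :=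
  S.filter fun l => A l ≠ A j ∧
    (S.filter fun k => A k ≠ A j ∧ (d j k < d j l ∨ (d j k = d j l ∧ k < l))).card < M

open Classical in
/-- `1 + M⁻¹ K_j`, where `K_j` is the number of units of `S` for which unit `j` is a match. -/
def matchWeight (S : Finset ℕ) (A : ℕ → Bool) (d : ℕ → ℕ → ℝ) (M j : ℕ) : ℝ :=
  1 + (M : ℝ)⁻¹ * (S.filter fun l => j ∈ matchSet S A d M l).card

/-- The matching estimator without bias correction. -/
def matchRaw (S : Finset ℕ) (A : ℕ → Bool) (Y : ℕ → ℝ) (d : ℕ → ℕ → ℝ) (M : ℕ) : ℝ :=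
  (S.card : ℝ)⁻¹ * ∑ j ∈ S, sgn (A j) * (Y j - (M : ℝ)⁻¹ * ∑ l ∈ matchSet S A d M j, Y l)

/-- The estimated bias `B̂`; `mu a j` is the estimated value of `μ_a` at the covariates of `j`. -/
def matchBias (S : Finset ℕ) (A : ℕ → Bool) (d : ℕ → ℕ → ℝ) (M : ℕ) (mu : Bool → ℕ → ℝ) : ℝ :=
  (√(S.card : ℝ))⁻¹ * ∑ j ∈ S, sgn (A j) *
    ((M : ℝ)⁻¹ * ∑ l ∈ matchSet S A d M j, (mu (!A j) j - mu (!A j) l))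

/-- The bias-corrected matching estimator. -/
def matchEst (S : Finset ℕ) (A : ℕ → Bool) (Y : ℕ → ℝ) (d : ℕ → ℕ → ℝ) (M : ℕ)
    (mu : Bool → ℕ → ℝ) : ℝ :=
  matchRaw S A Y d M - (√(S.card : ℝ))⁻¹ * matchBias S A d M mu

/-- The linear term of the matching estimator at unit `j`, for mean functions with values `mu a j`
and centre `t`. -/
def matchTerm (S : Finset ℕ) (A : ℕ → Bool) (Y : ℕ → ℝ) (d : ℕ → ℕ → ℝ) (M : ℕ)
    (mu : Bool → ℕ → ℝ) (t : ℝ) (j : ℕ) : ℝ :=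
  mu true j - mu false j - t + sgn (A j) * matchWeight S A d M j * (Y j - mu (A j) j)

/-- Euclidean distance between the `(X, U)`-covariates of two units. -/
def distXU (r r' : Rec p q) : ℝ :=
  √(dist r.2.1.1 r'.2.1.1 ^ 2 + dist r.2.1.2 r'.2.1.2 ^ 2)

/-- Euclidean distance between the `X`-covariates of two units. -/
def distX (r r' : Rec p q) : ℝ := dist (covX r) (covX r')

/-- The bias-corrected matching estimator from the units of `S`, matching on the distance `δ`, with
estimated mean functions `mhat a` of the covariate vector `V`. -/
def matchEstOn {W : Type*} (S : Finset ℕ) (z : ℕ → Rec p q) (δ : Rec p q → Rec p q → ℝ) (M : ℕ)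
    (V : Rec p q → W) (mhat : Bool → W → ℝ) : ℝ :=
  matchEst S (fun i => trt (z i)) (fun i => outcome (z i)) (fun i l => δ (z i) (z l)) M
    (fun a i => mhat a (V (z i)))

/-- The estimated linear term of `matchEstOn` at unit `j`: the mean functions are replaced by
`mhat`, and the estimand by `matchEstOn`. -/
def matchTermOn {W : Type*} (S : Finset ℕ) (z : ℕ → Rec p q) (δ : Rec p q → Rec p q → ℝ) (M : ℕ)
    (V : Rec p q → W) (mhat : Bool → W → ℝ) (j : ℕ) : ℝ :=
  matchTerm S (fun i => trt (z i)) (fun i => outcome (z i)) (fun i l => δ (z i) (z l)) M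
    (fun a i => mhat a (V (z i))) (matchEstOn S z δ M V mhat) j

/-- `1 + M⁻¹ K_j` for the units of `S`, matching on the distance `δ`. -/
def weightOn (S : Finset ℕ) (z : ℕ → Rec p q) (δ : Rec p q → Rec p q → ℝ) (M j : ℕ) : ℝ :=
  matchWeight S (fun i => trt (z i)) (fun i l => δ (z i) (z l)) M j

/-- Estimators `mhat n · a` of the mean functions `m a` on the support `K` of a `dim`-dimensional
covariate: the estimation error tends to zero in probability uniformly on `K`, and its Lipschitz
constant on `K` is `o_P(n₂^{-1/2 + 1/dim})`. -/
structure MeanEstimator {W : Type*} [PseudoMetricSpace W] [MeasurableSpace W] (P : Measure Ω)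
    (𝒢 : ℕ → MeasurableSpace Ω) (n₂ : ℕ → ℕ) (dim : ℕ) (K : Set W) (m : Bool → W → ℝ)
    (mhat : ℕ → Ω → Bool → W → ℝ) : Prop where
  measurable_est : ∀ n a, @Measurable (Ω × W) ℝ ((𝒢 n).prod inferInstance) inferInstance
    fun z => mhat n z.1 a z.2
  uniform : ∀ a, ∀ ε : ℝ, 0 < ε →
    Tendsto (fun n => P {ω | ∃ w ∈ K, ε ≤ |mhat n ω a w - m a w|}) atTop (𝓝 0)
  lipschitz : ∀ a, ∀ ε : ℝ, 0 < ε →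
    Tendsto (fun n => P {ω | ∃ w ∈ K, ∃ w' ∈ K,
      ε * (n₂ n : ℝ) ^ (-(1 / 2 : ℝ) + 1 / (dim : ℝ)) * dist w w' <
        |(mhat n ω a w - m a w) - (mhat n ω a w' - m a w')|}) atTop (𝓝 0)

/-- The treatment effect function `μ₁ - μ₀`. -/
def effect {W : Type*} (m : Bool → W → ℝ) (w : W) : ℝ := m true w - m false w

/-- Existence of the probability limits `κv`, `κΓ`, `κV` of the matching-dependent parts of the
normalized variances and covariance of the linear terms. Here `w₂ⱼ = 1 + M⁻¹ K_{2,(X,U),j}`,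
`w_{d,j} = 1 + M⁻¹ K_{d,X,j}`, and `m, s`, `mX, sX` are the conditional mean and variance functions
of the outcome given `(X, U)` and given `X`:
* `κv = plim n₂⁻¹ ∑_{j ∈ S₂} w₂ⱼ² σ²_{A_j}(X_j, U_j)`;
* `κΓ = plim n₂⁻¹ ∑_{j ∈ S₂} (w_{2,j} - ρ w_{1,j}) {w₂ⱼ σ²_{A_j}(X_j, U_j)
    + (2A_j - 1) (μ₁(X_j,U_j) - μ₀(X_j,U_j) - τ) (μ_{A_j}(X_j,U_j) - μ_{A_j}(X_j))}`;
* `κV = plim [n₂⁻¹ ∑_{j ∈ S₂} (w_{2,j}² - 2 ρ w_{1,j} w_{2,j}) σ²_{A_j}(X_j)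
    + ρ n₁⁻¹ ∑_{i ∈ S₁} w_{1,i}² σ²_{A_i}(X_i)]`. -/
structure MatchingLimits (P : Measure Ω) (Z : ℕ → Ω → Rec p q) (n₁ n₂ : ℕ → ℕ) (ρ : ℝ)
    (S₂ : ℕ → Ω → Finset ℕ) (M : ℕ) (τ : ℝ)
    (m s : Bool → EuclideanSpace ℝ (Fin p) × EuclideanSpace ℝ (Fin q) → ℝ)
    (mX sX : Bool → EuclideanSpace ℝ (Fin p) → ℝ) (κv κΓ κV : ℝ) : Prop where
  limit_v : TendstoInMeasure P (fun n ω => (n₂ n : ℝ)⁻¹ * ∑ j ∈ S₂ n ω,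
      weightOn (S₂ n ω) (fun i => Z i ω) distXU M j ^ 2 * s (trt (Z j ω)) (covXU (Z j ω)))
    atTop (fun _ => κv)
  limit_Γ : TendstoInMeasure P (fun n ω => (n₂ n : ℝ)⁻¹ * ∑ j ∈ S₂ n ω,
      (weightOn (S₂ n ω) (fun i => Z i ω) distX M j
        - ρ * weightOn (range (n₁ n)) (fun i => Z i ω) distX M j) *
      (weightOn (S₂ n ω) (fun i => Z i ω) distXU M j * s (trt (Z j ω)) (covXU (Z j ω))
        + sgn (trt (Z j ω)) * (effect m (covXU (Z j ω)) - τ) *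
          (m (trt (Z j ω)) (covXU (Z j ω)) - mX (trt (Z j ω)) (covX (Z j ω)))))
    atTop (fun _ => κΓ)
  limit_V : TendstoInMeasure P (fun n ω =>
      (n₂ n : ℝ)⁻¹ * ∑ j ∈ S₂ n ω,
        (weightOn (S₂ n ω) (fun i => Z i ω) distX M j ^ 2
          - 2 * ρ * weightOn (range (n₁ n)) (fun i => Z i ω) distX M j *
            weightOn (S₂ n ω) (fun i => Z i ω) distX M j) * sX (trt (Z j ω)) (covX (Z j ω))
      + ρ * ((n₁ n : ℝ)⁻¹ * ∑ i ∈ range (n₁ n),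
        weightOn (range (n₁ n)) (fun i => Z i ω) distX M i ^ 2 *
          sX (trt (Z i ω)) (covX (Z i ω))))
    atTop (fun _ => κV)

end TwoPhase

end

noncomputable section

namespace TwoPhase

set_option linter.unusedSectionVars false

local notation "cis" x:max => Complex.exp (Complex.I * ((x : ℝ) : ℂ))

/-! ### Convergence in probability as convergence along a filter -/

section ProbFilter

variable {Ω : Type*} {mΩ : MeasurableSpace Ω}

/-- The filter on `ℕ × Ω` of the events whose probability tends to one. A sequence of random
variables converges in probability to a constant if and only if it converges along this filter as
a function on `ℕ × Ω`, so that the calculus of limits along filters applies. -/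
def probFilter (P : Measure Ω) : Filter (ℕ × Ω) where
  sets := {A | Tendsto (fun n => P {ω | (n, ω) ∉ A}) atTop (𝓝 0)}
  univ_sets := by simp
  sets_of_superset := by
    intro A A' hA hAA'
    refine tendsto_of_tendsto_of_tendsto_of_le_of_le tendsto_const_nhds hA (fun _ => zero_le) ?_
    exact fun n => measure_mono fun ω hω h => hω (hAA' h)
  inter_sets := by
    intro A A' hA hA'
    have h := Tendsto.add hA hA'
    rw [add_zero] at h
    refine tendsto_of_tendsto_of_tendsto_of_le_of_le tendsto_const_nhds h (fun _ => zero_le) ?_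
    intro n
    refine le_trans (measure_mono ?_) (measure_union_le _ _)
    intro ω hω
    by_cases h : (n, ω) ∈ A
    · exact Or.inr fun h' => hω ⟨h, h'⟩
    · exact Or.inl h

lemma eventually_probFilter {P : Measure Ω} {p : ℕ × Ω → Prop} :
    (∀ᶠ z in probFilter P, p z) ↔ Tendsto (fun n => P {ω | ¬ p (n, ω)}) atTop (𝓝 0) :=
  Iff.rfl

lemma tendstoInMeasure_iff_probFilter {E : Type*} [PseudoMetricSpace E] {P : Measure Ω} {X : ℕ → Ω →
    E} {c : E} : TendstoInMeasure P X atTop (fun _ => c) ↔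
      Tendsto (fun z : ℕ × Ω => X z.1 z.2) (probFilter P) (𝓝 c) := by
  rw [tendstoInMeasure_iff_dist, Metric.tendsto_nhds]
  refine forall₂_congr fun ε _ => ?_
  rw [eventually_probFilter]
  simp only [not_lt]

lemma tendsto_fst_probFilter (P : Measure Ω) : Tendsto Prod.fst (probFilter P) atTop := by
  intro A hA
  change ∀ᶠ z in probFilter P, z.1 ∈ A
  rw [eventually_probFilter]
  refine tendsto_const_nhds.congr' ?_
  filter_upwards [hA] with n hn
  simp [hn]

lemma tendsto_probFilter_of_tendsto {P : Measure Ω} {E : Type*} {l : Filter E} {a : ℕ → E}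
    (h : Tendsto a atTop l) : Tendsto (fun z : ℕ × Ω => a z.1) (probFilter P) l :=
  h.comp (tendsto_fst_probFilter P)

lemma eventually_probFilter_of_ae {P : Measure Ω} {p : ℕ → Ω → Prop}
    (h : ∀ᶠ n in atTop, ∀ᵐ ω ∂P, p n ω) : ∀ᶠ z in probFilter P, p z.1 z.2 := by
  rw [eventually_probFilter]
  refine tendsto_const_nhds.congr' ?_
  filter_upwards [h] with n hn
  exact (ae_iff.1 hn).symm

lemma probFilter_neBot (P : Measure Ω) [IsProbabilityMeasure P] : (probFilter P).NeBot := by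
  refine ⟨fun h => ?_⟩
  have : ∀ᶠ z in probFilter P, False := by rw [h]; simp
  rw [eventually_probFilter] at this
  simp only [not_false_eq_true, Set.ofPred_true, measure_univ] at this
  exact one_ne_zero (tendsto_nhds_unique tendsto_const_nhds this)

lemma eventually_probFilter_iff {P : Measure Ω} {p : ℕ × Ω → Prop} : (∀ᶠ z in probFilter P, p z) ↔
    ∀ η : ℝ, 0 < η → ∀ᶠ n in atTop, P {ω | ¬ p (n, ω)} ≤ ENNReal.ofReal η := by
  rw [eventually_probFilter, ENNReal.tendsto_nhds_zero]
  refine ⟨fun h η hη => h _ (by simpa using hη), fun h ε hε => ?_⟩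
  rcases eq_or_ne ε ∞ with rfl | hf
  · exact Eventually.of_forall fun _ => le_top
  · simpa only [ENNReal.ofReal_toReal hf] using h ε.toReal (ENNReal.toReal_pos hε.ne' hf)

lemma measure_le_abs_le {P : Measure Ω} {X : Ω → ℝ} (hX : Integrable X P) {ε : ℝ} (hε : 0 < ε) :
    P {ω | ε ≤ |X ω|} ≤ ENNReal.ofReal ((∫ ω, |X ω| ∂P) / ε) := by
  have h := meas_ge_le_lintegral_div (μ := P) (f := fun ω => ENNReal.ofReal |X ω|)
    (ε := ENNReal.ofReal ε) (by have := hX.aestronglyMeasurable.aemeasurable; fun_prop)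
    (by simpa using hε) ENNReal.ofReal_ne_top
  rw [← ofReal_integral_eq_lintegral_ofReal hX.abs (ae_of_all _ fun _ => abs_nonneg _),
    ← ENNReal.ofReal_div_of_pos hε] at h
  exact (measure_mono fun ω hω => ENNReal.ofReal_le_ofReal hω).trans h

lemma tendsto_probFilter_of_integral_abs {P : Measure Ω} {X : ℕ → Ω → ℝ} {a : ℕ → ℝ} (hX : ∀ᶠ n in
    atTop, Integrable (X n) P) (h : ∀ᶠ n in atTop, ∫ ω, |X n ω| ∂P ≤ a n) (ha : Tendsto a atTop (𝓝
    0)) : Tendsto (fun z : ℕ × Ω => X z.1 z.2) (probFilter P) (𝓝 0) := by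
  refine Metric.tendsto_nhds.2 fun ε hε => eventually_probFilter_iff.2 fun η hη => ?_
  filter_upwards [hX, h, ha.eventually_lt_const (mul_pos hη hε)] with n h1 h2 h3
  simp only [Real.dist_eq, sub_zero, not_lt]
  exact (measure_le_abs_le h1 hε).trans
    (ENNReal.ofReal_le_ofReal ((div_le_iff₀ hε).2 (h2.trans h3.le)))

lemma tendsto_probFilter_of_integral_sq {P : Measure Ω} {X : ℕ → Ω → ℝ} {a : ℕ → ℝ} (hX : ∀ᶠ n in
    atTop, Integrable (fun ω => X n ω ^ 2) P) (h : ∀ᶠ n in atTop, ∫ ω, X n ω ^ 2 ∂P ≤ a n) (ha :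
    Tendsto a atTop (𝓝 0)) : Tendsto (fun z : ℕ × Ω => X z.1 z.2) (probFilter P) (𝓝 0) := by
  have h1 : Tendsto (fun z : ℕ × Ω => X z.1 z.2 ^ 2) (probFilter P) (𝓝 0) :=
    tendsto_probFilter_of_integral_abs (X := fun n ω => X n ω ^ 2) hX
      (by simpa only [abs_pow, sq_abs] using h) ha
  have h2 := (Real.continuous_sqrt.tendsto 0).comp h1
  simp only [Function.comp_def, Real.sqrt_sq_eq_abs, Real.sqrt_zero] at h2
  exact (tendsto_zero_iff_abs_tendsto_zero _).2 h2

/-- Bounded convergence theorem for convergence in probability. -/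
lemma tendsto_integral_of_bounded_probFilter {P : Measure Ω} [IsProbabilityMeasure P] {F : ℕ → Ω →
    ℂ} {C : ℝ} (hF : ∀ n, AEStronglyMeasurable (F n) P) (hC : ∀ n ω, ‖F n ω‖ ≤ C) (h : Tendsto (fun
    z : ℕ × Ω => F z.1 z.2) (probFilter P) (𝓝 0)) : Tendsto (fun n => ∫ ω, F n ω ∂P) atTop (𝓝 0) :=
    by
  have hmeas : TendstoInMeasure P F atTop (fun _ => 0) := tendstoInMeasure_iff_probFilter.2 h
  refine tendsto_of_subseq_tendsto fun ns hns => ?_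
  obtain ⟨ms, -, hms⟩ := (hmeas.comp hns).exists_seq_tendsto_ae
  refine ⟨ms, ?_⟩
  have := tendsto_integral_of_dominated_convergence (μ := P) (F := fun n => F (ns (ms n)))
    (f := fun _ => 0) (fun _ => C) (fun n => hF _) (integrable_const _)
    (fun n => ae_of_all _ fun ω => hC _ ω) (by simpa [Function.comp_def] using hms)
  simpa using this

/-- Tightness of a sequence of real random variables. -/
def IsTightSeq (P : Measure Ω) (X : ℕ → Ω → ℝ) : Prop :=
  ∀ ε : ℝ, 0 < ε → ∃ C : ℝ, 0 < C ∧ ∀ᶠ n in atTop, P {ω | C < |X n ω|} ≤ ENNReal.ofReal ε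

lemma IsTightSeq.mul_tendsto_zero {P : Measure Ω} {X Y : ℕ → Ω → ℝ} (hX : IsTightSeq P X)
    (hY : Tendsto (fun z : ℕ × Ω => Y z.1 z.2) (probFilter P) (𝓝 0)) :
    Tendsto (fun z : ℕ × Ω => X z.1 z.2 * Y z.1 z.2) (probFilter P) (𝓝 0) := by
  refine Metric.tendsto_nhds.2 fun δ hδ => eventually_probFilter_iff.2 fun η hη => ?_
  obtain ⟨C, hC, hCX⟩ := hX (η / 2) (half_pos hη)
  filter_upwards [hCX, eventually_probFilter_iff.1 (Metric.tendsto_nhds.1 hY (δ / C)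
    (by positivity)) (η / 2) (half_pos hη)] with n h1 h2
  refine (measure_mono ?_).trans ((measure_union_le _ _).trans ((add_le_add h1 h2).trans_eq
    (by rw [← ENNReal.ofReal_add (by positivity) (by positivity), add_halves])))
  intro ω hω
  simp only [Real.dist_eq, sub_zero, not_lt, Set.mem_ofPred_eq, Set.mem_union, abs_mul] at hω ⊢
  by_contra! hcon
  have h3 : |X n ω| * |Y n ω| ≤ C * |Y n ω| := by gcongr; exact hcon.1
  have h4 : C * |Y n ω| < C * (δ / C) := by gcongr; exact hcon.2
  rw [mul_div_cancel₀ _ hC.ne'] at h4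
  linarith

lemma isTightSeq_of_integral_abs {P : Measure Ω} {X : ℕ → Ω → ℝ} {C : ℝ} (hX : ∀ᶠ n in atTop,
    Integrable (X n) P) (h : ∀ᶠ n in atTop, ∫ ω, |X n ω| ∂P ≤ C) : IsTightSeq P X := by
  refine fun ε hε => ⟨(|C| + 1) / ε, by positivity, ?_⟩
  filter_upwards [hX, h] with n h1 h2
  have hs : {ω | (|C| + 1) / ε < |X n ω|} ⊆ {ω | (|C| + 1) / ε ≤ |X n ω|} :=
    fun ω hω => by simp only [Set.mem_ofPred_eq] at hω ⊢; exact hω.le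
  refine (measure_mono hs).trans ((measure_le_abs_le h1 (by positivity)).trans
    (ENNReal.ofReal_le_ofReal ?_))
  rw [div_le_iff₀ (by positivity), mul_div_cancel₀ _ hε.ne']
  linarith [le_abs_self C]

/-- Convergence in probability to zero follows from approximation by sequences that converge to
zero in probability, up to an error that is small in mean. -/
lemma tendsto_probFilter_of_approx {P : Measure Ω} {X : ℕ → Ω → ℝ}
    (h : ∀ δ : ℝ, 0 < δ → ∃ A R : ℕ → Ω → ℝ, (∀ n ω, |X n ω| ≤ |A n ω| + |R n ω|) ∧
      Tendsto (fun z : ℕ × Ω => A z.1 z.2) (probFilter P) (𝓝 0) ∧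
      (∀ᶠ n in atTop, Integrable (R n) P ∧ ∫ ω, |R n ω| ∂P ≤ δ)) :
    Tendsto (fun z : ℕ × Ω => X z.1 z.2) (probFilter P) (𝓝 0) := by
  refine Metric.tendsto_nhds.2 fun ε hε => eventually_probFilter_iff.2 fun η hη => ?_
  obtain ⟨A, R, hX, hA, hR⟩ := h (η / 2 * (ε / 2)) (by positivity)
  filter_upwards [eventually_probFilter_iff.1 (Metric.tendsto_nhds.1 hA (ε / 2) (half_pos hε))
    (η / 2) (half_pos hη), hR] with n h1 h2
  have h3 := (measure_le_abs_le h2.1 (half_pos hε)).trans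
    (ENNReal.ofReal_le_ofReal ((div_le_iff₀ (half_pos hε)).2 h2.2))
  refine (measure_mono ?_).trans ((measure_union_le _ _).trans ((add_le_add h1 h3).trans_eq
    (by rw [← ENNReal.ofReal_add (by positivity) (by positivity), add_halves])))
  intro ω hω
  simp only [Real.dist_eq, sub_zero, not_lt, Set.mem_ofPred_eq, Set.mem_union] at hω ⊢
  by_contra! hcon
  linarith [hX n ω, hcon.1, hcon.2]

end ProbFilter

/-! ### Sums of conditionally centred terms -/

section Block

variable {Ω : Type*}

lemma norm_cis (x : ℝ) : ‖cis x‖ = 1 := by rw [mul_comm]; exact Complex.norm_exp_ofReal_mul_I x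

lemma cis_mul_cis (x y : ℝ) : cis x * cis y = cis (x + y) := by
  rw [← Complex.exp_add, ← mul_add, Complex.ofReal_add]

lemma norm_cis_sub_le (x y : ℝ) : ‖cis x - cis y‖ ≤ |x - y| := by
  rw [show cis x - cis y = cis y * (cis (x - y) - 1) by
    rw [mul_sub, cis_mul_cis, add_sub_cancel, mul_one], norm_mul, norm_cis, one_mul]
  exact Real.norm_exp_I_mul_ofReal_sub_one_le

lemma measurable_cis {m : MeasurableSpace Ω} {f : Ω → ℝ} (hf : Measurable f) :
    Measurable fun ω => cis (f ω) := by fun_prop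

lemma integrable_cis {m : MeasurableSpace Ω} {P : Measure Ω} [IsProbabilityMeasure P] {f : Ω → ℝ}
    (hf : Measurable f) : Integrable (fun ω => cis (f ω)) P :=
  Integrable.of_bound (measurable_cis hf).aestronglyMeasurable 1
    (ae_of_all _ fun _ => (norm_cis _).le)

lemma norm_cexp_mul_I_sub_taylor_le (x : ℝ) :
    ‖cis x - 1 - Complex.I * x + (x : ℂ) ^ 2 / 2‖
      ≤ 4 * (x ^ 2 * min 1 |x|) := by
  rcases le_or_gt |x| 1 with h | h
  · have h1 : ‖Complex.I * (x : ℂ)‖ ≤ 1 := by simpa using h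
    have h2 := Complex.exp_bound h1 (n := 3) (by norm_num)
    have h3 : cis x - 1 - Complex.I * x + (x : ℂ) ^ 2 / 2
        = cis x - ∑ m ∈ range 3, (Complex.I * (x : ℂ)) ^ m / m.factorial := by
      simp only [sum_range_succ, sum_range_zero, Nat.factorial]
      simp only [mul_pow, Complex.I_sq]
      push_cast
      ring
    rw [h3]
    refine h2.trans ?_
    rw [min_eq_right h, show x ^ 2 * |x| = |x| ^ 3 by rw [← sq_abs x]; ring]
    simp only [norm_mul, Complex.norm_I, one_mul, Complex.norm_real, Real.norm_eq_abs,
      Nat.factorial]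
    have : 0 ≤ |x| ^ 3 := by positivity
    norm_num
    nlinarith [sq_abs x]
  · rw [min_eq_left h.le, mul_one]
    calc _ ≤ ‖cis x‖ + ‖(1 : ℂ)‖ + ‖Complex.I * (x : ℂ)‖
          + ‖(x : ℂ) ^ 2 / 2‖ := by
          refine (norm_add_le _ _).trans ?_
          gcongr
          refine (norm_sub_le _ _).trans ?_
          gcongr
          exact norm_sub_le _ _
      _ = 1 + 1 + |x| + |x| ^ 2 / 2 := by rw [norm_cis]; simp
      _ ≤ 4 * x ^ 2 := by rw [← sq_abs x]; nlinarith

lemma abs_exp_neg_half_sub_taylor_le {s : ℝ} (hs : 0 ≤ s) :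
    |Real.exp (-s / 2) - 1 + s / 2| ≤ s ^ 2 := by
  rcases le_or_gt s 2 with h | h
  · have h1 : |(-s / 2)| ≤ 1 := by rw [abs_le]; constructor <;> linarith
    have h2 := Real.abs_exp_sub_one_sub_id_le h1
    have : Real.exp (-s / 2) - 1 + s / 2 = Real.exp (-s / 2) - 1 - -s / 2 := by ring
    rw [this]
    nlinarith
  · have h1 : Real.exp (-s / 2) ≤ 1 := Real.exp_le_one_iff.2 (by linarith)
    have h2 := Real.exp_pos (-s / 2)
    rw [abs_le]
    constructor <;> nlinarith

lemma integral_smul_eq_of_condExp {m mΩ : MeasurableSpace Ω} {P : Measure Ω} [IsProbabilityMeasure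
    P] (hm : m ≤ mΩ) {X Y : Ω → ℝ} {G : Ω → ℂ} {C : ℝ} (hX : Integrable X P) (hXY : P[X | m] =ᵐ[P]
    Y) (hG : StronglyMeasurable[m] G) (hGC : ∀ ω, ‖G ω‖ ≤ C) : ∫ ω, (X ω : ℂ) * G ω ∂P = ∫ ω, (Y ω :
    ℂ) * G ω ∂P := by
  have hi : Integrable (X • G) P := by
    have h := hX.ofReal (𝕜 := ℂ)
    refine (h.mul_bdd (c := C) (hG.mono hm).aestronglyMeasurable (ae_of_all _ hGC)).congr ?_
    exact ae_of_all _ fun ω => by simp [Complex.real_smul]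
  have h1 := condExp_smul_of_aestronglyMeasurable_right (μ := P) (m := m) hX hi
    hG.aestronglyMeasurable
  calc ∫ ω, (X ω : ℂ) * G ω ∂P = ∫ ω, (X • G) ω ∂P := by simp [Complex.real_smul]
    _ = ∫ ω, (P[X • G | m]) ω ∂P := (integral_condExp hm).symm
    _ = ∫ ω, (Y ω : ℂ) * G ω ∂P := by
        refine integral_congr_ae ?_
        filter_upwards [h1, hXY] with ω h2 h3
        rw [h2]
        simp [Complex.real_smul, h3]

/-- One step of the telescoping sum that compares the characteristic function of a sum of
conditionally centred terms with that of a normal law. -/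
lemma norm_integral_step_le {m mΩ : MeasurableSpace Ω} {P : Measure Ω} [IsProbabilityMeasure P] (hm
    : m ≤ mΩ) {X s : Ω → ℝ} {G : Ω → ℂ} (hXm : AEStronglyMeasurable X P) (hX2 : Integrable (fun ω =>
    X ω ^ 2) P) (hs2 : Integrable (fun ω => s ω ^ 2) P) (hsm : AEStronglyMeasurable s P) (hs0 : ∀ ω,
    0 ≤ s ω) (hmean : P[X | m] =ᵐ[P] 0) (hvar : P[fun ω => X ω ^ 2 | m] =ᵐ[P] s) (hG :
    StronglyMeasurable[m] G) (hG1 : ∀ ω, ‖G ω‖ ≤ 1) : ‖∫ ω, G ω * cis (X ω) ∂P -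
    ∫ ω, G ω * (Real.exp (-s ω / 2) : ℝ) ∂P‖
      ≤ 4 * ∫ ω, X ω ^ 2 * min 1 |X ω| ∂P + ∫ ω, s ω ^ 2 ∂P := by
  have hX1 : Integrable X P := ((memLp_two_iff_integrable_sq hXm).2 hX2).integrable one_le_two
  have hs1 : Integrable s P := ((memLp_two_iff_integrable_sq hsm).2 hs2).integrable one_le_two
  have hGm : AEStronglyMeasurable G P := (hG.mono hm).aestronglyMeasurable
  have e1 : ∫ ω, (X ω : ℂ) * G ω ∂P = 0 := by
    rw [integral_smul_eq_of_condExp hm hX1 hmean hG hG1]; simp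
  have e2 : ∫ ω, ((X ω ^ 2 : ℝ) : ℂ) * G ω ∂P = ∫ ω, (s ω : ℂ) * G ω ∂P :=
    integral_smul_eq_of_condExp hm hX2 hvar hG hG1
  have hb : ∀ {f : Ω → ℝ}, Integrable f P → Integrable (fun ω => (f ω : ℂ) * G ω) P :=
    fun hf => hf.ofReal.mul_bdd (c := 1) hGm (ae_of_all _ hG1)
  have hmin : Integrable (fun ω => X ω ^ 2 * min 1 |X ω|) P := by
    refine hX2.mul_bdd (c := 1) (by fun_prop) (ae_of_all _ fun ω => ?_)
    rw [Real.norm_of_nonneg (by positivity)]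
    exact min_le_left _ _
  have i1 : Integrable (fun ω => G ω * cis (X ω)) P := by
    refine Integrable.of_bound (by fun_prop) 1 (ae_of_all _ fun ω => ?_)
    rw [norm_mul, norm_cis, mul_one]
    exact hG1 ω
  have i2 : Integrable (fun ω => G ω * (Real.exp (-s ω / 2) : ℝ)) P := by
    refine Integrable.of_bound (by fun_prop) 1 (ae_of_all _ fun ω => ?_)
    rw [norm_mul, Complex.norm_real, Real.norm_of_nonneg (Real.exp_pos _).le]
    exact mul_le_one₀ (hG1 ω) (Real.exp_pos _).le (Real.exp_le_one_iff.2 (by linarith [hs0 ω]))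
  have key : ∫ ω, G ω * cis (X ω) ∂P - ∫ ω, G ω * (Real.exp (-s ω / 2) : ℝ) ∂P =
      ∫ ω, (G ω * (cis (X ω) - 1 - Complex.I * X ω + (X ω : ℂ) ^ 2 / 2)
        - G ω * ((Real.exp (-s ω / 2) - 1 + s ω / 2 : ℝ) : ℂ)) ∂P := by
    have e3 : ∀ ω, (G ω * (cis (X ω) - 1 - Complex.I * X ω
          + (X ω : ℂ) ^ 2 / 2) - G ω * ((Real.exp (-s ω / 2) - 1 + s ω / 2 : ℝ) : ℂ))
        = (G ω * cis (X ω) - G ω * (Real.exp (-s ω / 2) : ℝ)) - Complex.I * ((X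
          ω : ℂ) * G ω) + (1 / 2) * (((X ω ^ 2 : ℝ) : ℂ) * G ω) - (1 / 2) * ((s ω : ℂ) * G ω) := by
      intro ω; push_cast; ring
    simp_rw [e3]
    have j1 : Integrable (fun ω => G ω * cis (X ω)
      - G ω * (Real.exp (-s ω / 2) : ℝ)) P := i1.sub i2
    have j2 : Integrable (fun ω => G ω * cis (X ω) - G ω * (Real.exp (-s ω / 2)
      : ℝ) - Complex.I * ((X ω : ℂ) * G ω)) P := j1.sub ((hb hX1).const_mul _)
    have j3 : Integrable (fun ω => G ω * cis (X ω)
      - G ω * (Real.exp (-s ω / 2) : ℝ) - Complex.I * ((X ω : ℂ) * G ω)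
      + (1 / 2) * (((X ω ^ 2 : ℝ) : ℂ) * G ω)) P := j2.add ((hb hX2).const_mul _)
    rw [integral_sub j3 ((hb hs1).const_mul _), integral_add j2 ((hb hX2).const_mul _),
      integral_sub j1 ((hb hX1).const_mul _), integral_sub i1 i2, integral_const_mul, integral_const_mul, integral_const_mul, e1, e2]
    ring
  rw [key, ← integral_const_mul, ← integral_add (hmin.const_mul 4) hs2]
  refine norm_integral_le_of_norm_le ((hmin.const_mul 4).add hs2) (ae_of_all _ fun ω => ?_)
  refine (norm_sub_le _ _).trans (add_le_add ?_ ?_)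
  · rw [norm_mul]
    calc _ ≤ 1 * (4 * (X ω ^ 2 * min 1 |X ω|)) :=
          mul_le_mul (hG1 ω) (norm_cexp_mul_I_sub_taylor_le _) (norm_nonneg _) zero_le_one
      _ = _ := one_mul _
  · rw [norm_mul, Complex.norm_real, Real.norm_eq_abs]
    calc _ ≤ 1 * s ω ^ 2 :=
          mul_le_mul (hG1 ω) (abs_exp_neg_half_sub_taylor_le (hs0 ω)) (abs_nonneg _) zero_le_one
      _ = _ := one_mul _

/-- Conditional central limit theorem, in the form of an error bound. Let `X k` be centred with
variance `s k` given `ℬ k`, where `ℬ k` contains the earlier terms and all the conditional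
variances. Then `∑ k, X k` may be replaced, inside the expectation of a product with a bounded
factor `F` that is measurable for every `ℬ k`, by a normal variable with variance `∑ k, s k`. As
the *remaining* variances enter the telescoping sum, no factor exceeds one. -/
lemma norm_integral_cexp_sum_sub_le {mΩ : MeasurableSpace Ω} {P : Measure Ω} [IsProbabilityMeasure
    P] (N : ℕ) {ℬ : ℕ → MeasurableSpace Ω} (hℬ : ∀ k, ℬ k ≤ mΩ) {X s : ℕ → Ω → ℝ} {F : Ω → ℂ} (hF :
    ∀ k, StronglyMeasurable[ℬ k] F) (hF1 : ∀ ω, ‖F ω‖ ≤ 1) (hX : ∀ k i, i < k → Measurable[ℬ k] (X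
    i)) (hXm : ∀ i, Measurable (X i)) (hs : ∀ k i, Measurable[ℬ k] (s i)) (hs0 : ∀ i ω, 0 ≤ s i ω)
    (hX2 : ∀ i < N, Integrable (fun ω => X i ω ^ 2) P) (hs2 : ∀ i < N, Integrable (fun ω => s i ω ^
    2) P) (hmean : ∀ k < N, P[X k | ℬ k] =ᵐ[P] 0) (hvar : ∀ k < N, P[fun ω => X k ω ^ 2 | ℬ k] =ᵐ[P]
    s k) : ‖∫ ω, F ω * cis (∑ i ∈ range N, X i ω) ∂P
        - ∫ ω, F ω * (Real.exp (-(∑ i ∈ range N, s i ω) / 2) : ℝ) ∂P‖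
      ≤ ∑ i ∈ range N, (4 * ∫ ω, X i ω ^ 2 * min 1 |X i ω| ∂P + ∫ ω, s i ω ^ 2 ∂P) := by
  induction N generalizing F with
  | zero => simp
  | succ n ih =>
    have ih' := ih (F := fun ω => F ω * (Real.exp (-s n ω / 2) : ℝ)) (fun k => (hF k).mul (by
        have := hs k n
        have h2 : Measurable[ℬ k] (fun ω => ((Real.exp (-s n ω / 2) : ℝ) : ℂ)) := by fun_prop
        exact h2.stronglyMeasurable))
      (fun ω => by
        rw [norm_mul, Complex.norm_real, Real.norm_of_nonneg (Real.exp_pos _).le]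
        exact mul_le_one₀ (hF1 ω) (Real.exp_pos _).le
          (Real.exp_le_one_iff.2 (by linarith [hs0 n ω])))
      (fun i hi => hX2 i (by omega)) (fun i hi => hs2 i (by omega))
      (fun i hi => hmean i (by omega)) (fun i hi => hvar i (by omega))
    have step := norm_integral_step_le (hℬ n) (X := X n) (s := s n)
      (G := fun ω => F ω * cis (∑ i ∈ range n, X i ω))
      (hXm n).aestronglyMeasurable (hX2 n (by omega)) (hs2 n (by omega))
      ((hs n n).mono (hℬ n) le_rfl).aestronglyMeasurable (hs0 n) (hmean n (by omega))
      (hvar n (by omega)) ((hF n).mul (by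
        have h1 : Measurable[ℬ n] (fun ω => ∑ i ∈ range n, X i ω) :=
          Finset.measurable_fun_sum _ fun i hi => hX n i (mem_range.1 hi)
        have h2 : Measurable[ℬ n]
          (fun ω => cis (∑ i ∈ range n, X i ω)) := by fun_prop
        exact h2.stronglyMeasurable))
      (fun ω => by
        rw [norm_mul, norm_cis, mul_one]
        exact hF1 ω)
    have e1 : ∀ ω, F ω * cis (∑ i ∈ range (n + 1), X i ω)
        = F ω * cis (∑ i ∈ range n, X i ω)
          * cis (X n ω) := by
      intro ω
      rw [sum_range_succ, mul_assoc, ← Complex.exp_add]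
      push_cast
      ring_nf
    have e2 : ∀ ω, F ω * (Real.exp (-(∑ i ∈ range (n + 1), s i ω) / 2) : ℝ)
        = F ω * (Real.exp (-s n ω / 2) : ℝ) * (Real.exp (-(∑ i ∈ range n, s i ω) / 2) : ℝ) := by
      intro ω
      rw [sum_range_succ, mul_assoc, ← Complex.ofReal_mul, ← Real.exp_add]
      ring_nf
    have e3 : ∀ ω, F ω * (Real.exp (-s n ω / 2) : ℝ)
          * cis (∑ i ∈ range n, X i ω)
        = F ω * cis (∑ i ∈ range n, X i ω)
          * (Real.exp (-s n ω / 2) : ℝ) := fun ω => by ring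
    simp_rw [e1, e2]
    simp_rw [e3] at ih'
    rw [sum_range_succ, add_comm (∑ i ∈ range n, _)]
    refine le_trans ?_ (add_le_add step ih')
    refine le_trans (le_of_eq ?_) (norm_add_le _ _)
    congr 1
    ring

/-- Conditionally centred terms are orthogonal. -/
lemma integral_sq_sum_of_condExp_eq_zero {mΩ : MeasurableSpace Ω} {P : Measure Ω}
    [IsProbabilityMeasure P] (N : ℕ) {ℬ : ℕ → MeasurableSpace Ω} (hℬ : ∀ k, ℬ k ≤ mΩ) {X : ℕ → Ω →
    ℝ} (hX : ∀ k i, i < k → Measurable[ℬ k] (X i)) (hX2 : ∀ i < N, MemLp (X i) 2 P) (hmean : ∀ k <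
    N, P[X k | ℬ k] =ᵐ[P] 0) : MemLp (fun ω => ∑ i ∈ range N, X i ω) 2 P ∧ ∫ ω, (∑ i ∈ range N, X i
    ω) ^ 2 ∂P = ∑ i ∈ range N, ∫ ω, X i ω ^ 2 ∂P := by
  induction N with
  | zero => simp
  | succ n ih =>
    obtain ⟨ihm, ih⟩ := ih (fun i hi => hX2 i (by omega)) (fun i hi => hmean i (by omega))
    have hn := hX2 n (by omega)
    have h1 : Measurable[ℬ n] (fun ω => ∑ i ∈ range n, X i ω) :=
      Finset.measurable_fun_sum _ fun i hi => hX n i (mem_range.1 hi)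
    have hprod : Integrable ((fun ω => ∑ i ∈ range n, X i ω) * X n) P := ihm.integrable_mul hn
    have h0 : ∫ ω, (∑ i ∈ range n, X i ω) * X n ω ∂P = 0 := by
      have h2 := condExp_mul_of_stronglyMeasurable_left (μ := P) h1.stronglyMeasurable hprod
        (hn.integrable one_le_two)
      calc _ = ∫ ω, (P[(fun ω => ∑ i ∈ range n, X i ω) * X n | ℬ n]) ω ∂P :=
            (integral_condExp (hℬ n)).symm
        _ = ∫ ω, 0 ∂P := by
            refine integral_congr_ae ?_
            filter_upwards [h2, hmean n (by omega)] with ω h3 h4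
            rw [h3]; simp [h4]
        _ = 0 := by simp
    refine ⟨(ihm.add hn).ae_eq (ae_of_all _ fun ω => by simp [sum_range_succ]), ?_⟩
    have e : ∀ ω, (∑ i ∈ range (n + 1), X i ω) ^ 2 = (∑ i ∈ range n, X i ω) ^ 2 + X n ω ^ 2
        + 2 * ((∑ i ∈ range n, X i ω) * X n ω) := by
      intro ω; rw [sum_range_succ]; ring
    simp_rw [e]
    have hi2 : Integrable (fun ω => 2 * ((∑ i ∈ range n, X i ω) * X n ω)) P := hprod.const_mul 2
    have hi1 : Integrable (fun ω => (∑ i ∈ range n, X i ω) ^ 2 + X n ω ^ 2) P :=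
      ihm.integrable_sq.add hn.integrable_sq
    rw [integral_add hi1 hi2, integral_add ihm.integrable_sq hn.integrable_sq, integral_const_mul,
      h0, ih, sum_range_succ]
    ring

end Block

/-! ### Conditioning on partially revealed independent units -/

section Revealed

variable {Ω : Type*} {𝒵 : Type*}

/-- If `H` is independent of `Z`, then conditioning `f (Z)` on `H` together with the
σ-algebra `m` of `Z` amounts to conditioning on `m` alone. -/
lemma condExp_comp_sup_of_indep {H : MeasurableSpace Ω} {mΩ : MeasurableSpace Ω} {m m𝒵 :
    MeasurableSpace 𝒵} {P : Measure Ω} [IsProbabilityMeasure P] {Q : Measure 𝒵}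
    [IsProbabilityMeasure Q] {Z : Ω → 𝒵} (hZ : Measurable Z) (hQ : P.map Z = Q) (hm : m ≤ m𝒵) (hH :
    H ≤ mΩ) (hind : Indep H (MeasurableSpace.comap Z m𝒵) P) {f : 𝒵 → ℝ} (hf : Integrable f Q) :
    P[fun ω => f (Z ω) | H ⊔ MeasurableSpace.comap Z m] =ᵐ[P] fun ω => (Q[f | m]) (Z ω) := by
  have hZm : MeasurableSpace.comap Z m ≤ mΩ := (MeasurableSpace.comap_mono hm).trans hZ.comap_le
  have hle : H ⊔ MeasurableSpace.comap Z m ≤ mΩ := sup_le hH hZm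
  have hmp : MeasurePreserving Z P Q := ⟨hZ, hQ⟩
  have hfZ : Integrable (fun ω => f (Z ω)) P := hmp.integrable_comp_of_integrable hf
  have hfm : StronglyMeasurable[m] (Q[f | m]) := stronglyMeasurable_condExp
  have hci : Integrable (Q[f | m]) Q := integrable_condExp
  have hcZ : Integrable (fun ω => (Q[f | m]) (Z ω)) P := hmp.integrable_comp_of_integrable hci
  have hcm : Measurable[MeasurableSpace.comap Z m] (fun ω => (Q[f | m]) (Z ω)) :=
    hfm.measurable.comp (comap_measurable Z)
  have hprodset : ∀ (g : 𝒵 → ℝ), Integrable g Q → ∀ A, MeasurableSet[m𝒵] A → ∀ B, MeasurableSet[H] B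
      → ∫ ω in B ∩ Z ⁻¹' A, g (Z ω) ∂P = P.real B * ∫ z in A, g z ∂Q := by
    intro g hg A hA B hB
    have hgA : AEStronglyMeasurable (A.indicator g) Q := hg.aestronglyMeasurable.indicator hA
    have hind' : IndepFun (B.indicator (fun _ => (1 : ℝ))) Z P := by
      rw [IndepFun_iff_Indep]
      refine indep_of_indep_of_le_left hind ?_
      have : Measurable[H] (B.indicator (fun _ => (1 : ℝ))) := measurable_const.indicator hB
      exact this.comap_le
    have h1 := hind'.integral_fun_comp_mul_comp (f := fun x : ℝ => x) (g := A.indicator g)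
      ((measurable_const.indicator (hH _ hB)).aemeasurable) hZ.aemeasurable
      (by fun_prop) (by rw [hQ]; exact hgA)
    rw [← integral_indicator ((hH _ hB).inter (hZ hA))]
    calc _ = ∫ ω, B.indicator (fun _ => (1 : ℝ)) ω * A.indicator g (Z ω) ∂P := by
          refine integral_congr_ae (ae_of_all _ fun ω => ?_)
          by_cases h2 : ω ∈ B <;> by_cases h3 : Z ω ∈ A <;> simp [Set.indicator, h2, h3]
      _ = _ := by
          have h5 : ∫ ω, A.indicator g (Z ω) ∂P = ∫ z in A, g z ∂Q := by
            rw [← integral_indicator hA, ← hQ, integral_map hZ.aemeasurable (by rw [hQ]; exact hgA)]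
          rw [h1, integral_indicator (hH _ hB), h5]
          simp
  refine (ae_eq_condExp_of_forall_setIntegral_eq hle hfZ (fun s _ _ => hcZ.integrableOn) ?_
    (show Measurable[H ⊔ MeasurableSpace.comap Z m] _ from
      hcm.mono le_sup_right le_rfl).stronglyMeasurable.aestronglyMeasurable).symm
  intro s hs _
  have hgen : H ⊔ MeasurableSpace.comap Z m = MeasurableSpace.generateFrom
      {t | ∃ B, MeasurableSet[H] B ∧ ∃ A, MeasurableSet[m] A ∧ t = B ∩ Z ⁻¹' A} := by
    apply le_antisymm
    · refine sup_le ?_ ?_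
      · intro B hB
        exact MeasurableSpace.measurableSet_generateFrom ⟨B, hB, Set.univ, .univ, by simp⟩
      · rintro _ ⟨A, hA, rfl⟩
        exact MeasurableSpace.measurableSet_generateFrom ⟨Set.univ, .univ, A, hA, by simp⟩
    · refine MeasurableSpace.generateFrom_le ?_
      rintro t ⟨B, hB, A, hA, rfl⟩
      exact MeasurableSet.inter ((le_sup_left : H ≤ H ⊔ MeasurableSpace.comap Z m) _ hB)
        ((le_sup_right : _ ≤ H ⊔ MeasurableSpace.comap Z m) _ ⟨A, hA, rfl⟩)
  have hpi : IsPiSystem {t | ∃ B, MeasurableSet[H] B ∧ ∃ A, MeasurableSet[m] A ∧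
      t = B ∩ Z ⁻¹' A} := by
    rintro _ ⟨B, hB, A, hA, rfl⟩ _ ⟨B', hB', A', hA', rfl⟩ _
    refine ⟨B ∩ B', hB.inter hB', A ∩ A', hA.inter hA', ?_⟩
    rw [Set.preimage_inter]
    ac_rfl
  have hbase : ∀ B, MeasurableSet[H] B → ∀ A, MeasurableSet[m] A →
      ∫ ω in B ∩ Z ⁻¹' A, (Q[f | m]) (Z ω) ∂P = ∫ ω in B ∩ Z ⁻¹' A, f (Z ω) ∂P := by
    intro B hB A hA
    rw [hprodset _ hci A (hm _ hA) B hB, hprodset _ hf A (hm _ hA) B hB, setIntegral_condExp hm hf hA]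
  induction s, hs using MeasurableSpace.induction_on_inter hgen hpi with
  | empty => simp
  | basic t ht => obtain ⟨B, hB, A, hA, rfl⟩ := ht; exact hbase B hB A hA
  | compl t ht ih =>
    have huniv := hbase Set.univ .univ Set.univ .univ
    simp only [Set.preimage_univ, Set.inter_self, Measure.restrict_univ] at huniv
    have e1 := integral_add_compl (hle _ ht) hcZ
    have e2 := integral_add_compl (hle _ ht) hfZ
    linarith [ih (measure_lt_top P _)]
  | iUnion t des ht ih =>
    rw [integral_iUnion (fun i => hle _ (ht i)) des hcZ.integrableOn,
      integral_iUnion (fun i => hle _ (ht i)) des hfZ.integrableOn]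
    exact tsum_congr fun i => ih i (measure_lt_top P _)

/-- The information consisting of the validation set, all units but unit `j`, and, of unit `j`,
the σ-algebra `m`. -/
@[reducible] def revealed (m : MeasurableSpace 𝒵) [m𝒵 : MeasurableSpace 𝒵] (S : Ω → Finset ℕ)
    (Z : ℕ → Ω → 𝒵) (j : ℕ) : MeasurableSpace Ω :=
  MeasurableSpace.comap (fun ω => (S ω, fun i : {i // i ≠ j} => Z i ω)) Prod.instMeasurableSpace ⊔
    MeasurableSpace.comap (Z j) m

variable {m : MeasurableSpace 𝒵} {mΩ : MeasurableSpace Ω} [m𝒵 : MeasurableSpace 𝒵]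
  {P : Measure Ω} {Q : Measure 𝒵} {S : Ω → Finset ℕ} {Z : ℕ → Ω → 𝒵}

lemma revealed_le (hm : m ≤ m𝒵) (hS : Measurable S) (hZ : ∀ i, Measurable (Z i)) (j : ℕ) :
    revealed m S Z j ≤ mΩ := by
  refine sup_le (Measurable.comap_le ?_) ((MeasurableSpace.comap_mono hm).trans (hZ j).comap_le)
  exact hS.prodMk (measurable_pi_lambda _ fun i => hZ i)

lemma measurable_revealed_set (j : ℕ) : Measurable[revealed m S Z j] S := by
  have h : Measurable[revealed m S Z j] (fun ω => (S ω, fun i : {i // i ≠ j} => Z i ω)) :=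
    Measurable.mono (comap_measurable _) le_sup_left le_rfl
  exact measurable_fst.comp h

lemma measurable_revealed_of_ne {i j : ℕ} (hij : i ≠ j) : Measurable[revealed m S Z j] (Z i) := by
  have h : Measurable[revealed m S Z j] (fun ω => (S ω, fun i : {i // i ≠ j} => Z i ω)) :=
    Measurable.mono (comap_measurable _) le_sup_left le_rfl
  exact (measurable_pi_apply (⟨i, hij⟩ : {i // i ≠ j})).comp (measurable_snd.comp h)

lemma measurable_revealed_comp {β : Type*} [MeasurableSpace β] {f : 𝒵 → β} (hm : m ≤ m𝒵)
    (hf : Measurable[m] f) (i j : ℕ) : Measurable[revealed m S Z j] (fun ω => f (Z i ω)) := by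
  rcases eq_or_ne i j with rfl | hij
  · have h : Measurable[revealed m S Z i, m] (Z i) :=
      Measurable.mono (comap_measurable (Z i)) le_sup_right le_rfl
    exact hf.comp h
  · exact (hf.mono hm le_rfl).comp (measurable_revealed_of_ne hij)

lemma indepFun_rest [IsProbabilityMeasure P] (hS : Measurable S) (hZ : ∀ i, Measurable (Z i))
    (hind : iIndepFun Z P) (hSZ : IndepFun S (fun ω i => Z i ω) P) (j : ℕ) :
    IndepFun (fun ω => (S ω, fun i : {i // i ≠ j} => Z i ω)) (Z j) P := by
  have hrest : Measurable (fun ω (i : {i // i ≠ j}) => Z i ω) :=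
    measurable_pi_lambda _ fun i => hZ i
  have h1 : IndepFun (fun ω (i : {i // i ≠ j}) => Z i ω) (Z j) P := by
    rw [IndepFun_iff_Indep]
    have h := indep_iSup_of_disjoint (fun i => (hZ i).comap_le) hind.iIndep
      (S := {i | i ≠ j}) (T := {j}) (by simp)
    refine indep_of_indep_of_le h ?_ ?_
    · refine Measurable.comap_le ?_
      refine @measurable_pi_lambda _ _ _ (_) _ _ fun i => ?_
      have hle : MeasurableSpace.comap (Z i) m𝒵 ≤
          ⨆ i ∈ {i | i ≠ j}, MeasurableSpace.comap (Z i) m𝒵 :=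
        le_iSup₂_of_le (i : ℕ) i.2 le_rfl
      exact Measurable.mono (comap_measurable _) hle le_rfl
    · exact le_iSup₂_of_le j rfl le_rfl
  have h2 : IndepFun S (fun ω => ((fun i : {i // i ≠ j} => Z i ω), Z j ω)) P :=
    hSZ.comp (φ := id) (ψ := fun z : ℕ → 𝒵 => ((fun i : {i // i ≠ j} => z i), z j))
      measurable_id (by fun_prop)
  have h3 : IndepFun S (fun ω (i : {i // i ≠ j}) => Z i ω) P :=
    hSZ.comp (φ := id) (ψ := fun z : ℕ → 𝒵 => (fun i : {i // i ≠ j} => z i))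
      measurable_id (by fun_prop)
  rw [indepFun_iff_map_prod_eq_prod_map_map (by fun_prop) (by fun_prop)] at h1 h2 h3 ⊢
  rw [h3]
  rw [h1] at h2
  have h4 := congrArg (Measure.map MeasurableEquiv.prodAssoc.symm) h2
  rw [Measure.map_map (MeasurableEquiv.measurable _) (by fun_prop)] at h4
  have : IsProbabilityMeasure (P.map S) := Measure.isProbabilityMeasure_map hS.aemeasurable
  have : IsProbabilityMeasure (P.map (Z j)) := Measure.isProbabilityMeasure_map (hZ j).aemeasurable
  have : IsProbabilityMeasure (P.map (fun ω (i : {i // i ≠ j}) => Z i ω)) :=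
    Measure.isProbabilityMeasure_map hrest.aemeasurable
  rw [← Measure.prodAssoc_prod, Measure.map_map (MeasurableEquiv.measurable _)
    (MeasurableEquiv.measurable _)] at h4
  rw [MeasurableEquiv.symm_comp_self, Measure.map_id] at h4
  exact h4

lemma condExp_revealed [IsProbabilityMeasure P] [IsProbabilityMeasure Q] (hm : m ≤ m𝒵) (hS :
    Measurable S) (hZ : ∀ i, Measurable (Z i)) (hind : iIndepFun Z P) (hSZ : IndepFun S (fun ω i =>
    Z i ω) P) (hlaw : ∀ i, P.map (Z i) = Q) (j : ℕ) {f : 𝒵 → ℝ} (hf : Integrable f Q) : P[fun ω => f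
    (Z j ω) | revealed m S Z j] =ᵐ[P] fun ω => (Q[f | m]) (Z j ω) := by
  refine condExp_comp_sup_of_indep (hZ j) (hlaw j) hm (Measurable.comap_le ?_) ?_ hf
  · exact hS.prodMk (measurable_pi_lambda _ fun i => hZ i)
  · exact (IndepFun_iff_Indep _ _ _).1 (indepFun_rest hS hZ hind hSZ j)

/-- A factor that is measurable with respect to the revealed information is pulled out. -/
lemma condExp_mul_revealed [IsProbabilityMeasure P] [IsProbabilityMeasure Q] (hm : m ≤ m𝒵) (hS :
    Measurable S) (hZ : ∀ i, Measurable (Z i)) (hind : iIndepFun Z P) (hSZ : IndepFun S (fun ω i =>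
    Z i ω) P) (hlaw : ∀ i, P.map (Z i) = Q) (j : ℕ) {f : 𝒵 → ℝ} (hf : Integrable f Q) {G : Ω → ℝ}
    (hG : Measurable[revealed m S Z j] G) (hGf : Integrable (fun ω => G ω * f (Z j ω)) P) : P[fun ω
    => G ω * f (Z j ω) | revealed m S Z j] =ᵐ[P] fun ω => G ω * (Q[f | m]) (Z j ω) := by
  have hmp : MeasurePreserving (Z j) P Q := ⟨hZ j, hlaw j⟩
  have h1 := condExp_mul_of_stronglyMeasurable_left (μ := P) hG.stronglyMeasurable hGf
    (hmp.integrable_comp_of_integrable hf)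
  filter_upwards [h1, condExp_revealed hm hS hZ hind hSZ hlaw j hf] with ω h2 h3
  simp only [Pi.mul_apply] at h2
  rw [← h3]
  exact h2

lemma integral_mul_revealed [IsProbabilityMeasure P] [IsProbabilityMeasure Q] (hm : m ≤ m𝒵) (hS :
    Measurable S) (hZ : ∀ i, Measurable (Z i)) (hind : iIndepFun Z P) (hSZ : IndepFun S (fun ω i =>
    Z i ω) P) (hlaw : ∀ i, P.map (Z i) = Q) (j : ℕ) {f : 𝒵 → ℝ} (hf : Integrable f Q) {G : Ω → ℝ}
    (hG : Measurable[revealed m S Z j] G) (hGf : Integrable (fun ω => G ω * f (Z j ω)) P) : ∫ ω, G ω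
    * f (Z j ω) ∂P = ∫ ω, G ω * (Q[f | m]) (Z j ω) ∂P := by
  rw [← integral_condExp (revealed_le hm hS hZ j)]
  exact integral_congr_ae (condExp_mul_revealed hm hS hZ hind hSZ hlaw j hf hG hGf)

lemma integrable_bdd_mul_comp [IsProbabilityMeasure P] (hZ : ∀ i, Measurable (Z i)) (hlaw : ∀ i,
    P.map (Z i) = Q) (j : ℕ) {f : 𝒵 → ℝ} (hf : Integrable f Q) {G : Ω → ℝ} (hG : Measurable G) {b :
    ℝ} (hb : ∀ ω, |G ω| ≤ b) : Integrable (fun ω => G ω * f (Z j ω)) P :=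
  ((⟨hZ j, hlaw j⟩ : MeasurePreserving (Z j) P Q).integrable_comp_of_integrable hf).bdd_mul
    hG.aestronglyMeasurable (ae_of_all _ hb)

lemma integral_mul_le_revealed [IsProbabilityMeasure P] [IsProbabilityMeasure Q] (hm : m ≤ m𝒵) (hS :
    Measurable S) (hZ : ∀ i, Measurable (Z i)) (hind : iIndepFun Z P) (hSZ : IndepFun S (fun ω i =>
    Z i ω) P) (hlaw : ∀ i, P.map (Z i) = Q) (j : ℕ) {f : 𝒵 → ℝ} (hf : Integrable f Q) {C : ℝ} (hC :
    ∀ᵐ z ∂Q, (Q[f | m]) z ≤ C) {G : Ω → ℝ} (hG : Measurable[revealed m S Z j] G) (hG0 : ∀ ω, 0 ≤ G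
    ω) {b : ℝ} (hb : ∀ ω, G ω ≤ b) : ∫ ω, G ω * f (Z j ω) ∂P ≤ C * ∫ ω, G ω ∂P := by
  have hGm : Measurable G := hG.mono (revealed_le hm hS hZ j) le_rfl
  have hb' : ∀ ω, |G ω| ≤ b := fun ω => by rw [abs_of_nonneg (hG0 ω)]; exact hb ω
  have hmp : MeasurePreserving (Z j) P Q := ⟨hZ j, hlaw j⟩
  rw [integral_mul_revealed hm hS hZ hind hSZ hlaw j hf hG
    (integrable_bdd_mul_comp hZ hlaw j hf hGm hb'), ← integral_const_mul]
  refine integral_mono_ae (integrable_bdd_mul_comp hZ hlaw j integrable_condExp hGm hb')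
    ((Integrable.of_bound hGm.aestronglyMeasurable b (ae_of_all _ hb')).const_mul C) ?_
  filter_upwards [hmp.quasiMeasurePreserving.ae hC] with ω hω
  rw [mul_comm C]
  exact mul_le_mul_of_nonneg_left hω (hG0 ω)

end Revealed

/-! ### Coefficients of linear statistics -/

/-- A common bound for the order of magnitude of the coefficient of unit `j` in linear statistics
on the scale `√N₂`: of order `N₂^{-1/2}` on the validation set `s`, and `N₁^{-1/2}` elsewhere. -/
def rate (N₁ N₂ : ℕ) (s : Finset ℕ) (j : ℕ) : ℝ :=
  (if j ∈ s then (√N₂)⁻¹ else 0) + (√N₁)⁻¹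

/-- The coefficient of unit `j` in `√n₂` times the mean over the validation set. -/
def coefVal (n₂ : ℕ) (s : Finset ℕ) (j : ℕ) : ℝ := √n₂ * ((n₂ : ℝ)⁻¹ * if j ∈ s then 1 else 0)

/-- The coefficient of unit `j` in `√n₂` times the difference between the mean over the validation
set and the mean over the main data. -/
def coefDiff (n₁ n₂ : ℕ) (s : Finset ℕ) (j : ℕ) : ℝ :=
  √n₂ * ((n₂ : ℝ)⁻¹ * (if j ∈ s then 1 else 0) - (n₁ : ℝ)⁻¹)

/-- The σ-algebra of the space of unit records, as a term. -/
abbrev recAlg (p q : ℕ) : MeasurableSpace (Rec p q) := inferInstance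

/-- The information `revealed` for unit records: the validation set, all units but unit `j`, and,
of unit `j`, the σ-algebra `m`. -/
@[reducible] def known {p q : ℕ} {Ω : Type*} (m : MeasurableSpace (Rec p q)) (S : Ω → Finset ℕ) (Z : ℕ → Ω → Rec p q)
    (j : ℕ) : MeasurableSpace Ω :=
  @revealed Ω (Rec p q) m (recAlg p q) S Z j

section Studies

variable {p q L : ℕ} {Ω : Type*} {mΩ : MeasurableSpace Ω} {P : Measure Ω} [IsProbabilityMeasure P]
  {Q : Measure (Rec p q)} [IsProbabilityMeasure Q] {𝒢 : ℕ → MeasurableSpace Ω}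
  {Z : ℕ → Ω → Rec p q} {n₁ n₂ B : ℕ → ℕ} {ρ : ℝ} {S₂ : ℕ → Ω → Finset ℕ}
  {D : ℕ → ℕ → ℕ → Ω → ℕ}

/-- The sampling scheme of the studies. -/
local notation "IsDesign" => Design P Q 𝒢 Z n₁ n₂ B ρ S₂ D

local notation "𝒫" => probFilter P

/-- Convergence in probability along the sequence of studies. -/
local notation "plim" X:max c:max => Tendsto (X : ℕ × Ω → _) 𝒫 (𝓝 c)

local notation "rateₙ" n:max ω:max j:max => rate (n₁ n) (n₂ n) (S₂ n ω) j

local notation "valₙ" n:max ω:max j:max => coefVal (n₂ n) (S₂ n ω) j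

local notation "diffₙ" n:max ω:max j:max => coefDiff (n₁ n) (n₂ n) (S₂ n ω) j

local notation "𝒦" m:max n:max k:max => known m (S₂ n) Z k

/-- Arrays of random terms. -/
local notation "Terms" => ℕ → ℕ → Ω → ℝ

local notation "𝕏" => EuclideanSpace ℝ (Fin p)

local notation "𝕌" => EuclideanSpace ℝ (Fin q)

/-! ### Consequences of the sampling scheme -/

section DesignFacts

lemma rate_nonneg (N₁ N₂ : ℕ) (s : Finset ℕ) (j : ℕ) : 0 ≤ rate N₁ N₂ s j := by
  unfold rate
  split_ifs <;> positivity

lemma rate_le {N₁ N₂ : ℕ} (h2 : 0 < N₂) (h12 : N₂ ≤ N₁) (s : Finset ℕ) (j : ℕ) :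
    rate N₁ N₂ s j ≤ 2 * (√N₂)⁻¹ := by
  have h : (√N₁)⁻¹ ≤ (√N₂)⁻¹ := by gcongr
  have h' : (0 : ℝ) ≤ (√N₂)⁻¹ := by positivity
  unfold rate
  split_ifs <;> linarith

lemma sum_rate_sq_le {N₁ N₂ : ℕ} (h2 : 0 < N₂) (h12 : N₂ ≤ N₁) {s : Finset ℕ}
    (hs : s ∈ powersetCard N₂ (range N₁)) : ∑ j ∈ range N₁, rate N₁ N₂ s j ^ 2 ≤ 4 := by
  obtain ⟨hsub, hcard⟩ := mem_powersetCard.1 hs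
  have hN2 : (0 : ℝ) < N₂ := by exact_mod_cast h2
  have hN1 : (0 : ℝ) < N₁ := by exact_mod_cast h2.trans_le h12
  have hb : ∀ j ∈ range N₁, rate N₁ N₂ s j ^ 2
      ≤ 2 * (if j ∈ s then (N₂ : ℝ)⁻¹ else 0) + 2 * (N₁ : ℝ)⁻¹ := by
    intro j _
    have e1 : ((√N₁)⁻¹) ^ 2 = (N₁ : ℝ)⁻¹ := by rw [inv_pow, Real.sq_sqrt hN1.le]
    have e2 : ((√N₂)⁻¹) ^ 2 = (N₂ : ℝ)⁻¹ := by rw [inv_pow, Real.sq_sqrt hN2.le]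
    unfold rate
    split_ifs
    · nlinarith [sq_nonneg ((√N₁)⁻¹ - (√N₂)⁻¹)]
    · nlinarith [sq_nonneg ((√N₁)⁻¹)]
  refine (sum_le_sum hb).trans (le_of_eq ?_)
  rw [sum_add_distrib, ← mul_sum, sum_ite_mem, inter_eq_right.2 hsub]
  simp only [sum_const, hcard, nsmul_eq_mul, card_range]
  field_simp
  norm_num

lemma measurable_known_coef {α : Type*} [MeasurableSpace α] {m : MeasurableSpace (Rec p q)} {n : ℕ}
    (c : Finset ℕ → α) (k : ℕ) : Measurable[𝒦 m n k] fun ω => c (S₂ n ω) :=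
  (Measurable.of_discrete (f := c)).comp (measurable_revealed_set (m𝒵 := recAlg p q) k)

lemma measurable_sgn : Measurable sgn := .of_discrete

namespace Design

lemma measurable_S (des : IsDesign) (n : ℕ) : Measurable (S₂ n) :=
  (des.measurable_validation n).mono (des.le_ambient n) le_rfl

lemma measurable_coef {α : Type*} [MeasurableSpace α] (des : IsDesign) (c : Finset ℕ → α) (n : ℕ) :
    Measurable fun ω => c (S₂ n ω) :=
  (Measurable.of_discrete (f := c)).comp (des.measurable_S n)

lemma measurable_Z (des : IsDesign) (i : ℕ) : Measurable (Z i) :=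
  (des.measurable_unit 0 i).mono (des.le_ambient 0) le_rfl

lemma n₁_pos (des : IsDesign) (n : ℕ) : 0 < n₁ n :=
  (des.size_pos n).trans_le (des.size_le n)

lemma ae_validation (des : IsDesign) (n : ℕ) :
    ∀ᵐ ω ∂P, S₂ n ω ∈ powersetCard (n₂ n) (range (n₁ n)) := by
  have hm : ∀ s, MeasurableSet {ω | S₂ n ω = s} := fun s =>
    des.measurable_S n (measurableSet_singleton s)
  have h1 : P (⋃ s ∈ powersetCard (n₂ n) (range (n₁ n)), {ω | S₂ n ω = s}) = 1 := by
    rw [measure_biUnion_finset _ (fun s _ => hm s),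
      sum_congr rfl (fun s hs => des.srs_uniform n s hs)]
    · rw [sum_const, card_powersetCard, card_range, nsmul_eq_mul]
      refine ENNReal.mul_inv_cancel ?_ (ENNReal.natCast_ne_top _)
      exact_mod_cast (Nat.choose_pos (des.size_le n)).ne'
    · intro s _ t _ hst
      exact Set.disjoint_left.2 fun ω h1 h2 => hst (h1.symm.trans h2)
  have h2 := (prob_compl_eq_zero_iff (measurableSet_biUnion _ (fun s _ => hm s))).2 h1
  refine measure_mono_null (fun ω hω => ?_) h2
  simp only [Set.mem_compl_iff, Set.mem_iUnion, not_exists] at hω ⊢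
  rintro s hs rfl
  exact hω hs

lemma ae_unit (des : IsDesign) {r : Rec p q → Prop}
    (h : ∀ᵐ z ∂Q, r z) (i : ℕ) : ∀ᵐ ω ∂P, r (Z i ω) :=
  (⟨des.measurable_Z i, des.iid_law i⟩ :
    MeasurePreserving (Z i) P Q).quasiMeasurePreserving.ae h

lemma tendsto_inv_n₂ (des : IsDesign) : Tendsto (fun n => ((n₂ n : ℝ))⁻¹) atTop (𝓝 0) :=
  tendsto_inv_atTop_zero.comp (tendsto_natCast_atTop_atTop.comp des.size_tendsto)

lemma rate_sq_le (des : IsDesign) (n : ℕ) (s : Finset ℕ) (j : ℕ) :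
    rate (n₁ n) (n₂ n) s j ^ 2 ≤ 4 * (n₂ n : ℝ)⁻¹ :=
  (pow_le_pow_left₀ (rate_nonneg _ _ _ _) (rate_le (des.size_pos n) (des.size_le n) _ _) 2).trans_eq
    (by rw [mul_pow, inv_pow, Real.sq_sqrt (Nat.cast_nonneg _)]; norm_num)

lemma integral_sum_rate_sq_mul_le (des : IsDesign) (n : ℕ)
    {f : Rec p q → ℝ} (hf : Integrable f Q) (hf0 : ∀ z, 0 ≤ f z) :
    ∑ j ∈ range (n₁ n), ∫ ω, rateₙ n ω j ^ 2 * f (Z j ω) ∂P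
      ≤ 4 * ∫ z, f z ∂Q := by
  have hSm := des.measurable_S n
  have h1 : ∀ j, ∫ ω, rateₙ n ω j ^ 2 * f (Z j ω) ∂P
      = (∫ ω, rateₙ n ω j ^ 2 ∂P) * ∫ z, f z ∂Q := by
    intro j
    have hi : IndepFun (S₂ n) (Z j) P :=
      (des.srs_indep n).comp measurable_id (measurable_pi_apply j)
    have := hi.integral_fun_comp_mul_comp (f := fun s => rate (n₁ n) (n₂ n) s j ^ 2) (g := f)
      hSm.aemeasurable (des.measurable_Z j).aemeasurable
      (Measurable.of_discrete).aestronglyMeasurable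
      (by rw [des.iid_law]; exact hf.aestronglyMeasurable)
    rw [this, ← des.iid_law j, integral_map (des.measurable_Z j).aemeasurable
      (by rw [des.iid_law]; exact hf.aestronglyMeasurable)]
  simp_rw [h1]
  rw [← sum_mul, ← integral_finsetSum]
  · refine mul_le_mul_of_nonneg_right ?_ (integral_nonneg hf0)
    calc _ ≤ ∫ ω, (4 : ℝ) ∂P := by
          refine integral_mono_of_nonneg (ae_of_all _ fun ω => by positivity)
            (integrable_const _) ?_
          filter_upwards [des.ae_validation n] with ω hω
          exact sum_rate_sq_le (des.size_pos n) (des.size_le n) hω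
      _ = 4 := by simp
  · intro j _
    refine Integrable.of_bound (des.measurable_coef
      (fun s => rate (n₁ n) (n₂ n) s j ^ 2) n).aestronglyMeasurable (4 * (n₂ n : ℝ)⁻¹)
      (ae_of_all _ fun ω => ?_)
    rw [Real.norm_of_nonneg (by positivity)]
    exact des.rate_sq_le n _ j

/-- Law of large numbers for arrays of terms that are centred given everything but, at most, the
rest of the unit they belong to. -/
lemma tendsto_sum_of_condExp_eq_zero (des : IsDesign) {m : MeasurableSpace (Rec p q)} (hm : m ≤
    recAlg p q) {X : Terms} (hX : ∀ n k i, i < k → Measurable[𝒦 m n k] (X n i))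
    (hX2 : ∀ n, ∀ i < n₁ n, MemLp (X n i) 2 P) (hmean : ∀ n, ∀ k < n₁ n, P[X n k | 𝒦 m n
    k] =ᵐ[P] 0) (hsum : Tendsto (fun n => ∑ i ∈ range (n₁ n), ∫ ω, X n i ω ^ 2 ∂P) atTop (𝓝 0)) :
    plim (fun z => ∑ i ∈ range (n₁ z.1), X z.1 i z.2) 0 := by
  have h := fun n => integral_sq_sum_of_condExp_eq_zero (P := P) (n₁ n) (fun k => revealed_le (m𝒵 :=
    recAlg p q) hm (des.measurable_S n) des.measurable_Z k) (hX n) (hX2 n) (hmean n)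
  exact tendsto_probFilter_of_integral_sq (X := fun n ω => ∑ i ∈ range (n₁ n), X n i ω)
    (Eventually.of_forall fun n => (h n).1.integrable_sq)
    (Eventually.of_forall fun n => (h n).2.le) hsum

/-- Given everything but unit `j`, a term that is centred under `Q` remains centred after
multiplication by coefficients that do not involve unit `j`. -/
lemma condExp_coeff_mul (des : IsDesign) (n : ℕ) {m : MeasurableSpace (Rec p q)} (hm : m ≤ recAlg
    p q) {f : Rec p q → ℝ} (hf : Integrable f Q) {j : ℕ} {G : Ω → ℝ} (hG : Measurable[𝒦 m n j] G) (hGf : Integrable (fun ω => G ω * f (Z j ω)) P) : P[fun ω => G ω * f (Z j ω) | 𝒦 m n j] =ᵐ[P]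
      fun ω => G ω * (Q[f | m]) (Z j ω) :=
  condExp_mul_revealed (m𝒵 := recAlg p q) hm (des.measurable_S n) des.measurable_Z des.iid_indep
    (des.srs_indep n) des.iid_law j hf hG hGf

lemma integral_mul_le (des : IsDesign) (n : ℕ) {m : MeasurableSpace (Rec p q)} (hm : m ≤ recAlg p
    q) {f : Rec p q → ℝ} (hf : Integrable f Q) (j : ℕ) {C : ℝ} (hC : ∀ᵐ z ∂Q, (Q[f | m]) z ≤ C) {G :
    Ω → ℝ} (hG : Measurable[𝒦 m n j] G) (hG0 : ∀ ω, 0 ≤ G ω) {b : ℝ} (hb : ∀ ω, G ω ≤ b)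
    : ∫ ω, G ω * f (Z j ω) ∂P ≤ C * ∫ ω, G ω ∂P :=
  integral_mul_le_revealed (m𝒵 := recAlg p q) hm (des.measurable_S n) des.measurable_Z des.iid_indep
    (des.srs_indep n) des.iid_law j hf hC hG hG0 hb

end Design

end DesignFacts

/-! ### Law of large numbers for the bootstrap replications -/

/-- `D b k`, for `b k : ℕ`, are independent and uniform on `{0, …, N - 1}`. -/
structure UniformDraws (P : Measure Ω) (N : ℕ) (D : ℕ → ℕ → Ω → ℕ) : Prop where
  pos : 0 < N
  measurable : ∀ b k, Measurable (D b k)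
  uniform : ∀ b k, ∀ i ∈ range N, P {ω | D b k ω = i} = (N : ℝ≥0∞)⁻¹
  indep : iIndepFun (fun bk : ℕ × ℕ => D bk.1 bk.2) P

namespace UniformDraws

variable {N : ℕ} {D : ℕ → ℕ → Ω → ℕ}

lemma ae_lt (hD : UniformDraws P N D) (b k : ℕ) : ∀ᵐ ω ∂P, D b k ω < N := by
  have hm : ∀ i, MeasurableSet {ω | D b k ω = i} := fun i =>
    hD.measurable b k (measurableSet_singleton i)
  have h1 : P (⋃ i ∈ range N, {ω | D b k ω = i}) = 1 := by
    rw [measure_biUnion_finset _ (fun s _ => hm s), sum_congr rfl (fun s hs => hD.uniform b k s hs)]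
    · rw [sum_const, card_range, nsmul_eq_mul]
      exact ENNReal.mul_inv_cancel (by exact_mod_cast hD.pos.ne') (ENNReal.natCast_ne_top _)
    · intro s _ t _ hst
      exact Set.disjoint_left.2 fun ω h1 h2 => hst (h1.symm.trans h2)
  have h2 := (prob_compl_eq_zero_iff (measurableSet_biUnion _ (fun s _ => hm s))).2 h1
  refine measure_mono_null (fun ω hω => ?_) h2
  simp only [Set.mem_compl_iff, Set.mem_iUnion, not_exists] at hω ⊢
  rintro s hs rfl
  exact hω (mem_range.1 hs)

lemma ae_abs_le (hD : UniformDraws P N D) (f : ℕ → ℝ) (b k : ℕ) :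
    ∀ᵐ ω ∂P, |f (D b k ω)| ≤ ∑ j ∈ range N, |f j| := by
  filter_upwards [hD.ae_lt b k] with ω hω
  exact single_le_sum (f := fun j => |f j|) (fun _ _ => abs_nonneg _) (mem_range.2 hω)

lemma measurable_comp (hD : UniformDraws P N D) (f : ℕ → ℝ) (b k : ℕ) :
    Measurable (fun ω => f (D b k ω)) :=
  (Measurable.of_discrete (f := f)).comp (hD.measurable b k)

lemma integral_comp (hD : UniformDraws P N D) (f : ℕ → ℝ) (b k : ℕ) :
    ∫ ω, f (D b k ω) ∂P = (N : ℝ)⁻¹ * ∑ j ∈ range N, f j := by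
  have hm : ∀ i, MeasurableSet {ω | D b k ω = i} := fun i =>
    hD.measurable b k (measurableSet_singleton i)
  have h1 : ∀ᵐ ω ∂P, f (D b k ω) = ∑ j ∈ range N, {ω | D b k ω = j}.indicator (fun _ => f j) ω := by
    filter_upwards [hD.ae_lt b k] with ω hω
    rw [sum_eq_single_of_mem (D b k ω) (mem_range.2 hω)]
    · simp
    · intro j _ hj
      exact Set.indicator_of_notMem (fun h => hj h.symm) _
  rw [integral_congr_ae h1, integral_finsetSum _ fun j _ => (integrable_const _).indicator (hm j),
    mul_sum]
  refine sum_congr rfl fun j hj => ?_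
  rw [integral_indicator (hm j)]
  simp [measureReal_def, hD.uniform b k j hj]

/-- The `b`-th replicate of the total of `f`. -/
def _root_.TwoPhase.replicate (N : ℕ) (D : ℕ → ℕ → Ω → ℕ) (f : ℕ → ℝ) (b : ℕ) (ω : Ω) : ℝ :=
  ∑ k ∈ range N, f (D b k ω)

local notation "ℛ" => replicate N D

lemma measurable_replicate (hD : UniformDraws P N D) (f : ℕ → ℝ) (b : ℕ) :
    Measurable (ℛ f b) :=
  Finset.measurable_fun_sum _ fun k _ => hD.measurable_comp f b k

lemma ae_abs_replicate_le (hD : UniformDraws P N D) (f : ℕ → ℝ) (b : ℕ) :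
    ∀ᵐ ω ∂P, |ℛ f b ω| ≤ N * ∑ j ∈ range N, |f j| := by
  filter_upwards [ae_all_iff.2 fun k => hD.ae_abs_le f b k] with ω hω
  calc _ ≤ ∑ k ∈ range N, |f (D b k ω)| := abs_sum_le_sum_abs _ _
    _ ≤ ∑ k ∈ range N, ∑ j ∈ range N, |f j| := sum_le_sum fun k _ => hω k
    _ = _ := by simp

lemma integrable_comp_replicate (hD : UniformDraws P N D) (f : ℕ → ℝ) (b : ℕ) {F : ℝ → ℝ}
    (hF : Continuous F) : Integrable (fun ω => F (ℛ f b ω)) P := by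
  obtain ⟨C, hC⟩ := (isCompact_Icc (a := -(N * ∑ j ∈ range N, |f j|))
    (b := N * ∑ j ∈ range N, |f j|)).exists_bound_of_continuousOn hF.continuousOn
  refine Integrable.of_bound
    (hF.measurable.comp (hD.measurable_replicate f b)).aestronglyMeasurable C ?_
  filter_upwards [hD.ae_abs_replicate_le f b] with ω hω
  exact hC _ (abs_le.1 hω)

lemma integrable_replicate_pow (hD : UniformDraws P N D) (f : ℕ → ℝ) (b r : ℕ) :
    Integrable (fun ω => ℛ f b ω ^ r) P :=
  hD.integrable_comp_replicate f b (continuous_pow r)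

lemma indep_comp (hD : UniformDraws P N D) (f : ℕ → ℝ) (b : ℕ) :
    iIndepFun (fun k ω => f (D b k ω)) P :=
  (hD.indep.precomp (g := fun k => (b, k)) fun _ _ h => (Prod.ext_iff.1 h).2).comp (fun _ => f)
    fun _ => Measurable.of_discrete

lemma integral_replicate_sq (hD : UniformDraws P N D) (f : ℕ → ℝ) (b : ℕ) :
    ∫ ω, ℛ f b ω ^ 2 ∂P = ∑ j ∈ range N, f j ^ 2 + (∑ j ∈ range N, f j) ^ 2
      - (N : ℝ)⁻¹ * (∑ j ∈ range N, f j) ^ 2 := by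
  have hN : (N : ℝ) ≠ 0 := by exact_mod_cast hD.pos.ne'
  have hL : ∀ k, MemLp (fun ω => f (D b k ω)) 2 P := fun k =>
    MemLp.of_bound (hD.measurable_comp f b k).aestronglyMeasurable _ (hD.ae_abs_le f b k)
  have e : ℛ f b = ∑ k ∈ range N, fun ω => f (D b k ω) := by
    ext ω; simp [replicate]
  have hv := IndepFun.variance_sum (s := range N) (fun k _ => hL k)
    fun i _ j _ h => (hD.indep_comp f b).indepFun h
  rw [← e, variance_eq_sub (by rw [e]; exact memLp_finsetSum' _ fun k _ => hL k)] at hv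
  have hm : ∫ ω, ℛ f b ω ∂P = ∑ j ∈ range N, f j := by
    simp only [replicate]
    rw [integral_finsetSum _ fun k _ => (hL k).integrable one_le_two]
    simp [hD.integral_comp, hN]
  have h2 : ∀ k, Var[fun ω => f (D b k ω); P] = (N : ℝ)⁻¹ * ∑ j ∈ range N, f j ^ 2
      - ((N : ℝ)⁻¹ * ∑ j ∈ range N, f j) ^ 2 := fun k => by
    rw [variance_eq_sub (hL k), hD.integral_comp, ← hD.integral_comp (fun j => f j ^ 2) b k]; rfl
  simp only [h2, hm, sum_const, card_range, nsmul_eq_mul, Pi.pow_apply] at hv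
  rw [sub_eq_iff_eq_add.1 hv]
  field_simp
  ring

/-- The exponential moments of a resampled total of small terms are bounded. -/
lemma integral_exp_replicate_le (hD : UniformDraws P N D) {f : ℕ → ℝ} (hf : ∀ j, |f j| ≤ 1)
    (b : ℕ) : ∫ ω, Real.exp (ℛ f b ω) ∂P
      ≤ Real.exp (∑ j ∈ range N, f j + ∑ j ∈ range N, f j ^ 2) := by
  have hN : (N : ℝ) ≠ 0 := by exact_mod_cast hD.pos.ne'
  have h := (hD.indep_comp f b).mgf_sum (t := 1) (fun k => hD.measurable_comp f b k) (range N)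
  have h1 : ∀ k, mgf (fun ω => f (D b k ω)) P 1
      ≤ Real.exp ((N : ℝ)⁻¹ * (∑ j ∈ range N, f j + ∑ j ∈ range N, f j ^ 2)) := fun k => by
    refine le_trans ?_ (Real.add_one_le_exp _)
    rw [mgf, hD.integral_comp (fun j => Real.exp (1 * f j)), ← sum_add_distrib,
      show (1 : ℝ) = (N : ℝ)⁻¹ * ∑ j ∈ range N, 1 by simp [hN], ← mul_add, ← sum_add_distrib]
    gcongr with j
    have := (abs_le.1 (Real.abs_exp_sub_one_sub_id_le (hf j))).2
    simp only [sum_const, card_range, nsmul_eq_mul, mul_one, inv_mul_cancel₀ hN, one_mul]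
    linarith
  calc _ = ∏ k ∈ range N, mgf (fun ω => f (D b k ω)) P 1 := by rw [← h]; simp [mgf, replicate]
    _ ≤ ∏ k ∈ range N, Real.exp ((N : ℝ)⁻¹ * (∑ j ∈ range N, f j + ∑ j ∈ range N, f j ^ 2)) :=
        prod_le_prod (fun _ _ => mgf_nonneg) fun k _ => h1 k
    _ = _ := by rw [prod_const, card_range, ← Real.exp_nat_mul, mul_inv_cancel_left₀ hN]

lemma integral_replicate_pow_four_le (hD : UniformDraws P N D) {f : ℕ → ℝ} (hf : ∀ j, |f j| ≤ 1)
    (b : ℕ) : ∫ ω, ℛ f b ω ^ 4 ∂P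
      ≤ 48 * Real.exp (|∑ j ∈ range N, f j| + ∑ j ∈ range N, f j ^ 2) := by
  have hpow : ∀ x : ℝ, x ^ 4 ≤ 24 * (Real.exp x + Real.exp (-x)) := fun x => by
    have h := Real.pow_div_factorial_le_exp |x| (abs_nonneg x) 4
    rw [Even.pow_abs (by decide), div_le_iff₀ (by positivity)] at h
    have h2 := Real.exp_abs_le x
    norm_num [Nat.factorial] at h
    linarith
  have hi := hD.integrable_comp_replicate f b Real.continuous_exp
  have hi' : Integrable (fun ω => Real.exp (-ℛ f b ω)) P :=
    hD.integrable_comp_replicate f b (Real.continuous_exp.comp continuous_neg)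
  have h1 := hD.integral_exp_replicate_le hf b
  have h2 := hD.integral_exp_replicate_le (f := fun j => -f j) (by simpa using hf) b
  simp only [replicate, sum_neg_distrib, neg_sq] at h2
  calc _ ≤ ∫ ω, 24 * (Real.exp (ℛ f b ω) + Real.exp (-ℛ f b ω)) ∂P :=
        integral_mono (hD.integrable_replicate_pow f b 4) ((hi.add hi').const_mul _)
          fun ω => hpow _
    _ ≤ 24 * (Real.exp (|∑ j ∈ range N, f j| + ∑ j ∈ range N, f j ^ 2)
        + Real.exp (|∑ j ∈ range N, f j| + ∑ j ∈ range N, f j ^ 2)) := by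
        rw [integral_const_mul, integral_add hi hi']
        gcongr
        · exact h1.trans (by gcongr; exact le_abs_self _)
        · exact h2.trans (by gcongr; exact neg_le_abs _)
    _ = _ := by ring

end UniformDraws

namespace UniformDraws

variable {N : ℕ} {D : ℕ → ℕ → Ω → ℕ}

local notation "ℛ" => replicate N D

lemma indepFun_replicate (hD : UniformDraws P N D) (f : ℕ → ℝ) {b b' : ℕ} (hb : b ≠ b') :
    IndepFun (ℛ f b) (ℛ f b') P := by
  have hdisj : Disjoint (({b} : Finset ℕ) ×ˢ range N) ({b'} ×ˢ range N) :=
    disjoint_product.2 (Or.inl (disjoint_singleton.2 hb))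
  have hrep : ∀ c, ℛ f c = (fun v : ((({c} : Finset ℕ) ×ˢ range N) → ℕ) =>
      ∑ k ∈ (range N).attach, f (v ⟨(c, k), by simp⟩)) ∘
      fun ω (bk : (({c} : Finset ℕ) ×ˢ range N)) => D bk.1.1 bk.1.2 ω := fun c =>
    funext fun ω => (sum_attach (range N) fun k => f (D c k ω)).symm
  rw [hrep b, hrep b']
  exact (hD.indep.indepFun_finset _ _ hdisj fun bk => hD.measurable bk.1 bk.2).comp
    Measurable.of_discrete Measurable.of_discrete

/-- The average of the squared replicates is close in mean to its expectation. -/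
lemma integral_abs_average_sub_le (hD : UniformDraws P N D) (f : ℕ → ℝ) {B : ℕ} (hB : 0 < B)
    {K μ l : ℝ} (hl : 0 < l) (hμ : ∀ b, ∫ ω, ℛ f b ω ^ 2 ∂P = μ)
    (hK : ∀ b, ∫ ω, ℛ f b ω ^ 4 ∂P ≤ K) :
    ∫ ω, |(B : ℝ)⁻¹ * ∑ b ∈ range B, ℛ f b ω ^ 2 - μ| ∂P ≤ l / 2 + K / (2 * l * B) := by
  have hsq : ∀ b, MemLp (fun ω => ℛ f b ω ^ 2) 2 P := fun b =>
    (memLp_two_iff_integrable_sq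
      (hD.integrable_replicate_pow f b 2).aestronglyMeasurable).2 <| by
      simpa only [← pow_mul] using hD.integrable_replicate_pow f b 4
  set W : Ω → ℝ := ∑ b ∈ range B, fun ω => ℛ f b ω ^ 2 with hW
  have hWe : ∀ ω, W ω = ∑ b ∈ range B, ℛ f b ω ^ 2 := fun ω => by simp [hW]
  have hWL : MemLp W 2 P := memLp_finsetSum' _ fun b _ => hsq b
  have hWmean : ∫ ω, W ω ∂P = B * μ := by
    simp only [hWe]
    rw [integral_finsetSum _ fun b _ => (hsq b).integrable one_le_two]
    simp [hμ]
  have hvar : ∫ ω, (W ω - B * μ) ^ 2 ∂P ≤ B * K := by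
    rw [← hWmean, ← variance_eq_integral hWL.aestronglyMeasurable.aemeasurable, hW,
      IndepFun.variance_sum (fun b _ => hsq b) fun b _ b' _ hbb => (hD.indepFun_replicate f
        hbb).comp (φ := fun x : ℝ => x ^ 2) (ψ := fun x : ℝ => x ^ 2) (by fun_prop) (by fun_prop)]
    refine (sum_le_card_nsmul _ _ K fun b _ => ?_).trans_eq (by simp)
    refine (variance_le_expectation_sq (hsq b).aestronglyMeasurable).trans (le_trans ?_ (hK b))
    simp only [Pi.pow_apply, ← pow_mul]
    exact le_rfl
  have hdev : MemLp (fun ω => W ω - B * μ) 2 P := hWL.sub (memLp_const _)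
  have hamgm : ∀ w : ℝ, |w| ≤ l / 2 + w ^ 2 / (2 * l) := fun w => by
    rw [← sub_nonneg, ← sq_abs w,
      show l / 2 + |w| ^ 2 / (2 * l) - |w| = (l - |w|) ^ 2 / (2 * l) by field_simp; ring]
    positivity
  calc _ ≤ ∫ ω, (l / 2 + ((B : ℝ)⁻¹ ^ 2 / (2 * l)) * (W ω - B * μ) ^ 2) ∂P := by
        refine integral_mono_of_nonneg (ae_of_all _ fun ω => abs_nonneg _)
          ((integrable_const _).add (hdev.integrable_sq.const_mul _)) (ae_of_all _ fun ω => ?_)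
        refine (hamgm _).trans_eq ?_
        simp only [hWe]
        field_simp
    _ = l / 2 + ((B : ℝ)⁻¹ ^ 2 / (2 * l)) * ∫ ω, (W ω - B * μ) ^ 2 ∂P := by
        rw [integral_add (integrable_const _) (hdev.integrable_sq.const_mul _), integral_const_mul]
        simp
    _ ≤ l / 2 + ((B : ℝ)⁻¹ ^ 2 / (2 * l)) * (B * K) := by gcongr
    _ = _ := by field_simp

lemma integral_abs_sq_sub_sq_le (hD : UniformDraws P N D) (f g : ℕ → ℝ) (b : ℕ) {l : ℝ}
    (hl : 0 < l) : ∫ ω, |ℛ f b ω ^ 2 - ℛ g b ω ^ 2| ∂P ≤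
      (∑ j ∈ range N, (f j - g j) ^ 2 + (∑ j ∈ range N, (f j - g j)) ^ 2) / (2 * l)
      + l / 2 * (∑ j ∈ range N, (f j + g j) ^ 2 + (∑ j ∈ range N, (f j + g j)) ^ 2) := by
  have hm : ∀ h : ℕ → ℝ, ∫ ω, ℛ h b ω ^ 2 ∂P
      ≤ ∑ j ∈ range N, h j ^ 2 + (∑ j ∈ range N, h j) ^ 2 := fun h => by
    rw [hD.integral_replicate_sq]
    exact sub_le_self _ (by positivity)
  have i1 := (hD.integrable_replicate_pow (fun j => f j - g j) b 2).div_const (2 * l)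
  have i2 := (hD.integrable_replicate_pow (fun j => f j + g j) b 2).const_mul (l / 2)
  have hamgm : ∀ x y : ℝ, |x * y| ≤ y ^ 2 / (2 * l) + l / 2 * x ^ 2 := fun x y => by
    rw [← sub_nonneg, abs_mul, ← sq_abs x, ← sq_abs y, show |y| ^ 2 / (2 * l) + l / 2 * |x| ^ 2
      - |x| * |y| = (|y| - l * |x|) ^ 2 / (2 * l) by field_simp; ring]
    positivity
  calc _ ≤ ∫ ω, (ℛ (fun j => f j - g j) b ω ^ 2 / (2 * l)
        + l / 2 * ℛ (fun j => f j + g j) b ω ^ 2) ∂P := by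
        refine integral_mono_of_nonneg (ae_of_all _ fun ω => abs_nonneg _) (i1.add i2)
          (ae_of_all _ fun ω => ?_)
        simp only [replicate, sum_sub_distrib, sum_add_distrib, sq_sub_sq]
        exact hamgm _ _
    _ ≤ _ := by
        rw [integral_add i1 i2, integral_div, integral_const_mul]
        gcongr <;> exact hm _

/-- The average of the squared replicates of a total that is close to zero, with few large terms,
estimates the sum of the squared terms. The large terms are cut off: the cut-off changes
the squared replicates little in mean, and after it their fourth moments are bounded. -/
lemma integral_abs_average_sub_sum_le (hD : UniformDraws P N D) {f : ℕ → ℝ} {v δ l : ℝ}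
    (hl : 0 < l) (hδ : δ ≤ 1) (hs : |∑ j ∈ range N, f j| ≤ δ) (hF : ∑ j ∈ range N, f j ^ 2 ≤ v)
    (hL : ∑ j ∈ range N, (if 1 < |f j| then f j ^ 2 else 0) ≤ δ) {B : ℕ} (hB : 0 < B) :
    ∫ ω, |(B : ℝ)⁻¹ * ∑ b ∈ range B, ℛ f b ω ^ 2 - ∑ j ∈ range N, f j ^ 2| ∂P
      ≤ δ * (l⁻¹ + 5) + l / 2 * (4 * v + 17) + 48 * Real.exp (2 + v) / (2 * l * B) := by
  have hBpos : (0 : ℝ) < B := by exact_mod_cast hB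
  have hδ0 : 0 ≤ δ := (abs_nonneg _).trans hs
  set g : ℕ → ℝ := fun j => if 1 < |f j| then 0 else f j with hg
  set h : ℕ → ℝ := fun j => if 1 < |f j| then f j else 0 with hh
  have hfg : ∀ j, f j - g j = h j := fun j => by simp only [hg, hh]; split_ifs <;> ring
  have hh2 : ∑ j ∈ range N, h j ^ 2 ≤ δ := by simpa [hh, ite_pow] using hL
  have hh1 : |∑ j ∈ range N, h j| ≤ δ := by
    refine (abs_sum_le_sum_abs _ _).trans (le_trans (sum_le_sum fun j _ => ?_) hh2)
    simp only [hh]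
    split_ifs with h1
    · rw [← sq_abs]; nlinarith
    · simp
  have hF' : ∑ j ∈ range N, f j ^ 2 = ∑ j ∈ range N, g j ^ 2 + ∑ j ∈ range N, h j ^ 2 := by
    rw [← sum_add_distrib]
    exact sum_congr rfl fun j _ => by simp only [hg, hh]; split_ifs <;> ring
  have hh0 : 0 ≤ ∑ j ∈ range N, h j ^ 2 := sum_nonneg fun _ _ => sq_nonneg _
  have hgs : ∑ j ∈ range N, f j - ∑ j ∈ range N, g j = ∑ j ∈ range N, h j := by
    rw [← sum_sub_distrib]
    exact sum_congr rfl fun j _ => hfg j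
  set s := ∑ j ∈ range N, f j
  set t := ∑ j ∈ range N, g j
  have ht : |t| ≤ 2 * δ := by
    rw [show t = s - (s - t) by ring]; exact (abs_sub _ _).trans (by rw [hgs]; linarith)
  have ht2 : t ^ 2 ≤ 4 * δ := by rw [← sq_abs]; nlinarith [abs_nonneg t]
  have step1 : ∀ b, ∫ ω, |ℛ f b ω ^ 2 - ℛ g b ω ^ 2| ∂P
      ≤ (δ + δ) / (2 * l) + l / 2 * (4 * v + 16) := fun b => by
    refine (hD.integral_abs_sq_sub_sq_le f g b hl).trans ?_
    simp only [hfg]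
    gcongr ?_ / _ + _ * (?_ + ?_)
    · refine add_le_add hh2 ?_
      rw [← sq_abs]; nlinarith [abs_nonneg (∑ j ∈ range N, h j)]
    · refine le_trans ?_ (mul_le_mul_of_nonneg_left hF zero_le_four)
      rw [mul_sum]
      refine sum_le_sum fun j _ => ?_
      simp only [hg]; split_ifs <;> nlinarith [sq_nonneg (f j)]
    · rw [sum_add_distrib, ← sq_abs]
      have : |s + t| ≤ 4 := (abs_add_le _ _).trans (by linarith)
      nlinarith [abs_nonneg (s + t)]
  set μ := ∑ j ∈ range N, g j ^ 2 + t ^ 2 - (N : ℝ)⁻¹ * t ^ 2 with hμ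
  have hμF : |μ - ∑ j ∈ range N, f j ^ 2| ≤ 5 * δ := by
    have h0 : 0 ≤ (N : ℝ)⁻¹ * t ^ 2 := by positivity
    have h1 : (N : ℝ)⁻¹ * t ^ 2 ≤ t ^ 2 := mul_le_of_le_one_left (sq_nonneg _)
      (inv_le_one_of_one_le₀ (by exact_mod_cast hD.pos))
    rw [abs_le]; constructor <;> linarith
  have step2 := hD.integral_abs_average_sub_le g hB (K := 48 * Real.exp (2 + v)) (μ := μ) hl
    (hD.integral_replicate_sq g) fun b => by
      refine (hD.integral_replicate_pow_four_le (fun j => ?_) b).trans ?_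
      · simp only [hg]; split_ifs with h1
        · simp
        · exact not_lt.1 h1
      · gcongr <;> linarith
  have hfi := fun b => hD.integrable_replicate_pow f b 2
  have hgi := fun b => hD.integrable_replicate_pow g b 2
  have hdi : ∀ b, Integrable (fun ω => |ℛ f b ω ^ 2 - ℛ g b ω ^ 2|) P := fun b =>
    ((hfi b).sub (hgi b)).abs
  have hsumi : Integrable (fun ω => (B : ℝ)⁻¹ * ∑ b ∈ range B, |ℛ f b ω ^ 2 - ℛ g b ω ^ 2|) P :=
    (integrable_finsetSum _ fun b _ => hdi b).const_mul _
  have hgavg : Integrable (fun ω => |(B : ℝ)⁻¹ * ∑ b ∈ range B, ℛ g b ω ^ 2 - μ| + 5 * δ) P :=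
    (((integrable_finsetSum _ fun b _ => hgi b).const_mul _).sub (integrable_const _)).abs.add
      (integrable_const _)
  calc _ ≤ ∫ ω, ((B : ℝ)⁻¹ * ∑ b ∈ range B, |ℛ f b ω ^ 2 - ℛ g b ω ^ 2|
        + (|(B : ℝ)⁻¹ * ∑ b ∈ range B, ℛ g b ω ^ 2 - μ| + 5 * δ)) ∂P := by
        refine integral_mono_of_nonneg (ae_of_all _ fun ω => abs_nonneg _) (hsumi.add hgavg)
          (ae_of_all _ fun ω => ?_)
        dsimp only
        refine (abs_sub_le _ ((B : ℝ)⁻¹ * ∑ b ∈ range B, ℛ g b ω ^ 2) _).trans (add_le_add ?_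
          ((abs_sub_le _ μ _).trans (by gcongr)))
        rw [← mul_sub, ← sum_sub_distrib, abs_mul, abs_of_pos (inv_pos.2 hBpos)]
        gcongr
        exact abs_sum_le_sum_abs _ _
    _ = (B : ℝ)⁻¹ * ∑ b ∈ range B, ∫ ω, |ℛ f b ω ^ 2 - ℛ g b ω ^ 2| ∂P
        + (∫ ω, |(B : ℝ)⁻¹ * ∑ b ∈ range B, ℛ g b ω ^ 2 - μ| ∂P + 5 * δ) := by
        rw [integral_add hsumi hgavg, integral_add ((hgavg.sub (integrable_const (5 * δ))).congr
          (ae_of_all _ fun ω => by simp)) (integrable_const _),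
          integral_const_mul, integral_finsetSum _ fun b _ => hdi b]
        simp
    _ ≤ (B : ℝ)⁻¹ * ∑ b ∈ range B, ((δ + δ) / (2 * l) + l / 2 * (4 * v + 16))
        + (l / 2 + 48 * Real.exp (2 + v) / (2 * l * B) + 5 * δ) := by
        gcongr with b _
        exact step1 b
    _ = _ := by
        rw [sum_const, card_range, nsmul_eq_mul, inv_mul_cancel_left₀ hBpos.ne']
        field_simp
        ring

end UniformDraws

lemma Design.uniformDraws (des : IsDesign) (n : ℕ) : UniformDraws P (n₁ n) (D n) :=
  ⟨des.n₁_pos n, des.measurable_draw n, des.draw_uniform n, des.draw_indep n⟩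

lemma measure_prodMk_mem_le {E F : Type*} [MeasurableSpace E] [MeasurableSpace F] {X : Ω → E}
    {Y : Ω → F} (hX : Measurable X) (hY : Measurable Y) (h : IndepFun X Y P) {A : Set (E × F)}
    (hA : MeasurableSet A) {G : Set E} (hG : MeasurableSet G) {c : ℝ≥0∞}
    (hc : ∀ x ∈ G, P {ω | (x, Y ω) ∈ A} ≤ c) :
    P {ω | (X ω, Y ω) ∈ A} ≤ c + P {ω | X ω ∉ G} := by
  have : IsProbabilityMeasure (P.map X) := Measure.isProbabilityMeasure_map hX.aemeasurable
  have : IsProbabilityMeasure (P.map Y) := Measure.isProbabilityMeasure_map hY.aemeasurable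
  calc _ = ∫⁻ x, P.map Y (Prod.mk x ⁻¹' A) ∂P.map X := by
        rw [← Measure.prod_apply hA, ← (indepFun_iff_map_prod_eq_prod_map_map hX.aemeasurable
          hY.aemeasurable).1 h, Measure.map_apply (hX.prodMk hY) hA]
        rfl
    _ ≤ ∫⁻ x, (c + Gᶜ.indicator 1 x) ∂P.map X := by
        refine lintegral_mono fun x => ?_
        by_cases hx : x ∈ G
        · rw [Measure.map_apply hY (measurable_prodMk_left hA)]
          exact (hc x hx).trans le_self_add
        · rw [Set.indicator_of_mem (by exact hx)]
          exact prob_le_one.trans le_add_self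
    _ = _ := by
        rw [lintegral_add_left measurable_const, lintegral_indicator_one hG.compl,
          Measure.map_apply hX hG.compl]
        simp
        rfl

/-- Law of large numbers for the bootstrap: conditionally on the data the replicates are
independent, and the data only enter through the three sums that control them. -/
lemma Design.tendsto_average_replicate (des : IsDesign) {h : ℕ → Ω → ℕ → ℝ} (hm : ∀ n j,
    Measurable[𝒢 n] (fun ω => h n ω j)) {v : ℝ}
    (hsum : plim (fun z => ∑ j ∈ range (n₁ z.1), h z.1 z.2 j) 0)
    (hsq : plim (fun z => ∑ j ∈ range (n₁ z.1), h z.1 z.2 j ^ 2) v)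
    (hlarge : plim (fun z => ∑ j ∈ range (n₁ z.1),
      if 1 < |h z.1 z.2 j| then h z.1 z.2 j ^ 2 else 0) 0) :
    plim (fun z => ((B z.1 : ℝ) - 1)⁻¹ * ∑ b ∈ range (B z.1),
      replicate (n₁ z.1) (D z.1) (h z.1 z.2) b z.2 ^ 2) v := by
  have hNB := probFilter_neBot P
  have hv : 0 ≤ v := ge_of_tendsto' hsq fun z => sum_nonneg fun _ _ => sq_nonneg _
  -- the average of the squared replicates differs little from the sum of squares
  have key : plim (fun z => (B z.1 : ℝ)⁻¹ * ∑ b ∈ range (B z.1),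
      replicate (n₁ z.1) (D z.1) (h z.1 z.2) b z.2 ^ 2 - ∑ j ∈ range (n₁ z.1), h z.1 z.2 j ^ 2) 0 := by
    rw [Metric.tendsto_nhds]
    intro ε hε
    rw [eventually_probFilter, ENNReal.tendsto_nhds_zero]
    intro η hη
    obtain ⟨c, hc0, hc⟩ := ENNReal.lt_iff_exists_nnreal_btwn.1 (ENNReal.half_pos hη.ne')
    have hc0' : (0 : ℝ) < c := by exact_mod_cast hc0
    set l : ℝ := c * ε / (4 * (v + 1) + 17) with hl
    have hl0 : 0 < l := by positivity
    set δ : ℝ := min 1 (c * ε / (4 * (l⁻¹ + 5))) with hδ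
    have hδ0 : 0 < δ := by positivity
    have hδ1 : δ * (l⁻¹ + 5) ≤ c * ε / 4 := by
      refine (mul_le_mul_of_nonneg_right (min_le_right _ _) (by positivity)).trans_eq ?_
      field_simp
    have hB : Tendsto (fun n => 48 * Real.exp (2 + (v + 1)) / (2 * l * B n)) atTop (𝓝 0) :=
      tendsto_const_nhds.div_atTop ((tendsto_natCast_atTop_atTop.comp
        des.replications_tendsto).const_mul_atTop (by positivity))
    set G : ℕ → Set (ℕ → ℝ) := fun n => {f | |∑ j ∈ range (n₁ n), f j| ≤ δ ∧
      ∑ j ∈ range (n₁ n), f j ^ 2 ≤ v + 1 ∧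
      ∑ j ∈ range (n₁ n), (if 1 < |f j| then f j ^ 2 else 0) ≤ δ}
    have hgood : ∀ᶠ z in 𝒫, h z.1 z.2 ∈ G z.1 := by
      filter_upwards [hsum.abs.eventually_le_const (by simpa using hδ0),
        hsq.eventually_le_const (lt_add_one v), hlarge.eventually_le_const hδ0] with z e1 e2 e3
      exact ⟨e1, e2, e3⟩
    rw [eventually_probFilter, ENNReal.tendsto_nhds_zero] at hgood
    filter_upwards [hgood c (by exact_mod_cast hc0), hB.eventually_le_const
      (show 0 < c * ε / 4 by positivity), des.replications_tendsto.eventually_gt_atTop 0]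
      with n hn hBn hB1
    have hXm' : Measurable[𝒢 n] (h n) := @measurable_pi_lambda _ _ _ (𝒢 n) _ _ fun j => hm n j
    have hind : IndepFun (h n) (fun ω (bk : ℕ × ℕ) => D n bk.1 bk.2 ω) P :=
      (IndepFun_iff_Indep _ _ _).2 (indep_of_indep_of_le_left (des.draw_indep_data n).symm
        hXm'.comap_le)
    set avg : (ℕ → ℝ) × (ℕ × ℕ → ℕ) → ℝ := fun x => (B n : ℝ)⁻¹ * ∑ b ∈ range (B n),
      (∑ k ∈ range (n₁ n), x.1 (x.2 (b, k))) ^ 2 - ∑ j ∈ range (n₁ n), x.1 j ^ 2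
    have havgm : Measurable avg := by
      have hbk : ∀ b k, Measurable (fun x : (ℕ → ℝ) × (ℕ × ℕ → ℕ) => x.1 (x.2 (b, k))) :=
        fun b k => (measurable_from_prod_countable_left (f := fun x : (ℕ → ℝ) × ℕ => x.1 x.2)
          fun j => measurable_pi_apply j).comp
          (measurable_fst.prodMk ((measurable_pi_apply (b, k)).comp measurable_snd))
      fun_prop
    calc _ = P {ω | (h n ω, fun bk : ℕ × ℕ => D n bk.1 bk.2 ω) ∈ {x | ε ≤ |avg x|}} := by
          simp only [Real.dist_eq, sub_zero, not_lt]
          rfl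
      _ ≤ c + c := (measure_prodMk_mem_le (hXm'.mono (des.le_ambient n) le_rfl)
          (measurable_pi_lambda _ fun bk => des.measurable_draw n _ _) hind
          (measurableSet_le measurable_const havgm.abs) (G := G n) ?_ fun f hf => ?_).trans
          (add_le_add_right hn _)
      _ ≤ η := (add_le_add hc.le hc.le).trans_eq (ENNReal.add_halves η)
    · have e : ∀ j, Measurable (fun f : ℕ → ℝ => f j) := fun j => measurable_pi_apply j
      exact (measurableSet_le (Finset.measurable_fun_sum _ fun j _ => e j).abs
        measurable_const).inter ((measurableSet_le (Finset.measurable_fun_sum _ fun j _ =>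
        (e j).pow_const 2) measurable_const).inter (measurableSet_le (Finset.measurable_fun_sum _
        fun j _ => Measurable.ite (measurableSet_lt measurable_const (e j).abs)
        ((e j).pow_const 2) measurable_const) measurable_const))
    · have hE := (des.uniformDraws n).integral_abs_average_sub_sum_le hl0 (min_le_left _ _)
        hf.1 hf.2.1 hf.2.2 hB1
      have hint : Integrable (fun ω => avg (f, fun bk : ℕ × ℕ => D n bk.1 bk.2 ω)) P :=
        ((integrable_finsetSum _ fun b _ =>
          (des.uniformDraws n).integrable_replicate_pow f b 2).const_mul _).sub
          (integrable_const (∑ j ∈ range (n₁ n), f j ^ 2))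
      have hM := mul_meas_ge_le_integral_of_nonneg (ae_of_all _ fun _ => abs_nonneg _) hint.abs ε
      rw [← ofReal_measureReal]
      refine (ENNReal.ofReal_le_ofReal ?_).trans_eq ENNReal.ofReal_coe_nnreal
      refine le_of_mul_le_mul_left (hM.trans (hE.trans ?_)) hε
      rw [show l / 2 * (4 * (v + 1) + 17) = c * ε / 2 by rw [hl]; field_simp]
      linarith
  have hratio : Tendsto (fun n => ((B n : ℝ) - 1)⁻¹ * B n) atTop (𝓝 1) := by
    have h1 := (tendsto_const_nhds (x := (1 : ℝ))).sub (tendsto_inv_atTop_zero.comp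
      (tendsto_natCast_atTop_atTop (R := ℝ).comp des.replications_tendsto))
    rw [sub_zero] at h1
    have h2 := h1.inv₀ one_ne_zero
    rw [inv_one] at h2
    refine h2.congr' ?_
    filter_upwards [des.replications_tendsto.eventually_gt_atTop 1] with n hn
    have : (1 : ℝ) < B n := by exact_mod_cast hn
    have h3 : (B n : ℝ) - 1 ≠ 0 := by linarith
    simp only [Function.comp_apply]
    field_simp
  have hfin := (tendsto_probFilter_of_tendsto (P := P) hratio).mul (key.add hsq)
  rw [one_mul, zero_add] at hfin
  refine hfin.congr' ?_
  filter_upwards [(tendsto_fst_probFilter P).eventually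
    (des.replications_tendsto.eventually_ge_atTop 1)] with z hz
  have : (B z.1 : ℝ) ≠ 0 := by exact_mod_cast (Nat.one_le_iff_ne_zero.1 hz)
  field_simp
  ring

/-- The contribution of unit `j` to a bootstrap replicate, scaled by `√n₂`: the sum of these
vectors over the drawn units is `√n₂` times the pair of replicates. -/
def scaledTerm (n₁ n₂ : ℕ) (S : Finset ℕ) (ψ : ℕ → ℝ) (φ₁ φ₂ : ℕ → Fin L → ℝ) (j : ℕ) :
    Unit ⊕ Fin L → ℝ :=
  Sum.elim (fun _ => √n₂ * ((n₂ : ℝ)⁻¹ * if j ∈ S then ψ j else 0))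
    (fun l => √n₂ * ((n₂ : ℝ)⁻¹ * (if j ∈ S then φ₂ j l else 0)
      - (n₁ : ℝ)⁻¹ * if j ∈ range n₁ then φ₁ j l else 0))

lemma sqrt_mul_bootTau (n₁ n₂ : ℕ) (S : Finset ℕ) (draw : ℕ → ℕ) (ψ : ℕ → ℝ) (φ₁ φ₂ : ℕ → Fin L → ℝ)
    : √n₂ * bootTau n₁ n₂ S draw ψ
      = ∑ k ∈ range n₁, scaledTerm n₁ n₂ S ψ φ₁ φ₂ (draw k) (Sum.inl ()) := by
  simp only [bootTau, bootMean, scaledTerm, Sum.elim_inl, smul_eq_mul, mul_sum]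

lemma sqrt_mul_bootEp (n₁ n₂ : ℕ) (S : Finset ℕ) (draw : ℕ → ℕ) (ψ : ℕ → ℝ) (φ₁ φ₂ : ℕ → Fin L → ℝ)
    (l : Fin L) : √n₂ * bootEp n₁ n₂ S draw φ₁ φ₂ l
      = ∑ k ∈ range n₁, scaledTerm n₁ n₂ S ψ φ₁ φ₂ (draw k) (Sum.inr l) := by
  simp only [bootEp, bootMean, scaledTerm, Sum.elim_inr, Pi.sub_apply, Pi.smul_apply,
    Finset.sum_apply, smul_eq_mul, mul_sum, ← sum_sub_distrib, mul_sub]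
  refine sum_congr rfl fun k _ => ?_
  split_ifs <;> simp

lemma tendsto_matrix_inv {α : Type*} {F : Filter α} {ι : Type*} [Fintype ι] [DecidableEq ι]
    {A : α → Matrix ι ι ℝ} {A₀ : Matrix ι ι ℝ} (h : Tendsto A F (𝓝 A₀)) (h0 : A₀.det ≠ 0) :
    Tendsto (fun x => (A x)⁻¹) F (𝓝 A₀⁻¹) := by
  have hc : ContinuousAt (fun A : Matrix ι ι ℝ => A⁻¹) A₀ := by
    simp only [Matrix.inv_def, Ring.inverse_eq_inv']
    exact ((continuous_id.matrix_det.continuousAt).inv₀ h0).smul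
      continuous_id.matrix_adjugate.continuousAt
  exact hc.tendsto.comp h

lemma measurable_matrix_det {ι : Type*} [Fintype ι] [DecidableEq ι] {A : Ω → Matrix ι ι ℝ} (h : ∀ i
    j, Measurable fun ω => A ω i j) : Measurable fun ω => (A ω).det := by
  simp only [det_apply]
  exact Finset.measurable_fun_sum _ fun σ _ =>
    (Finset.measurable_fun_prod _ fun i _ => h _ _).const_smul _

lemma measurable_matrix_inv {ι : Type*} [Fintype ι] [DecidableEq ι] {A : Ω → Matrix ι ι ℝ} (h : ∀ i
    j, Measurable fun ω => A ω i j) (i j : ι) : Measurable fun ω => (A ω)⁻¹ i j := by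
  simp only [Matrix.inv_def, Ring.inverse_eq_inv', Matrix.smul_apply, smul_eq_mul, adjugate_apply]
  refine (measurable_matrix_det h).inv.mul (measurable_matrix_det fun k l => ?_)
  by_cases hk : k = j
  · subst hk
    simp only [updateRow_self]
    exact measurable_const
  · simp only [updateRow_ne hk]
    exact h k l

lemma mul_schur_smul (c : ℝ) (hc : c ≠ 0) (v : ℝ) (Γ : Fin L → ℝ) (V : Matrix (Fin L) (Fin L) ℝ)
    (hV : V.det ≠ 0) : c * schur v Γ V = schur (c * v) (c • Γ) (c • V) := by
  have : Invertible c := invertibleOfNonzero hc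
  rw [schur, schur, inv_smul _ _ (isUnit_iff_ne_zero.2 hV), invOf_eq_inv, smul_mulVec, mulVec_smul,
    smul_smul, inv_mul_cancel₀ hc, one_smul, smul_dotProduct, smul_eq_mul]
  ring

/-- A sum of squares is unchanged in the limit, and its terms stay uniformly small, under a
perturbation that is small in the sum of squares. -/
lemma tendsto_sum_sq_of_approx {α : Type*} {F : Filter α} {N : α → ℕ} {f g : α → ℕ → ℝ} {v : ℝ}
    (hf : Tendsto (fun z => ∑ j ∈ range (N z), f z j ^ 2) F (𝓝 v))
    (hl : Tendsto (fun z => ∑ j ∈ range (N z), if 1 / 2 < |f z j| then f z j ^ 2 else 0) F (𝓝 0))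
    (hd : Tendsto (fun z => ∑ j ∈ range (N z), (g z j - f z j) ^ 2) F (𝓝 0)) :
    Tendsto (fun z => ∑ j ∈ range (N z), g z j ^ 2) F (𝓝 v) ∧
    Tendsto (fun z => ∑ j ∈ range (N z), if 1 < |g z j| then g z j ^ 2 else 0) F (𝓝 0) := by
  constructor
  · have hcross : Tendsto (fun z => ∑ j ∈ range (N z), f z j * (g z j - f z j)) F (𝓝 0) := by
      refine squeeze_zero_norm (fun z => ?_) (by simpa using hf.sqrt.mul hd.sqrt)
      rw [Real.norm_eq_abs, ← Real.sqrt_mul (sum_nonneg fun _ _ => sq_nonneg _)]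
      exact Real.abs_le_sqrt (sum_mul_sq_le_sq_mul_sq _ _ _)
    have h2 := (hf.add (hcross.const_mul 2)).add hd
    simp only [mul_zero, add_zero] at h2
    refine h2.congr fun z => ?_
    rw [mul_sum, ← sum_add_distrib, ← sum_add_distrib]
    exact sum_congr rfl fun j _ => by ring
  · have h1 := (hd.const_mul 4).add (hl.const_mul 2)
    simp only [mul_zero, add_zero] at h1
    refine squeeze_zero (fun z => sum_nonneg fun j _ => by positivity) (fun z => ?_) h1
    rw [mul_sum, mul_sum, ← sum_add_distrib]
    refine sum_le_sum fun j _ => ?_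
    have h4 := abs_sub_abs_le_abs_sub (g z j) (f z j)
    rw [← sq_abs (g z j - f z j), ← sq_abs (f z j), ← sq_abs (g z j)]
    split_ifs <;> nlinarith [sq_nonneg (|f z j| - |g z j - f z j|), abs_nonneg (g z j),
      abs_nonneg (f z j), abs_nonneg (g z j - f z j)]

/-- Convergence in distribution from convergence of the characteristic functions. -/
lemma tendstoInDistribution_of_charFun {ι : Type*} [Fintype ι] [DecidableEq ι] {X : ℕ → Ω → ι → ℝ}
    (hX : ∀ n i, Measurable fun ω => X n ω i) {C : Matrix ι ι ℝ} (hC : C.PosSemidef) (h : ∀ t : ι →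
    ℝ, Tendsto (fun n => ∫ ω, cis (t ⬝ᵥ X n ω) ∂P)
      atTop (𝓝 (Complex.exp (-((t ⬝ᵥ C *ᵥ t : ℝ) : ℂ) / 2)))) :
    TendstoInDistribution (fun n ω => (WithLp.toLp 2 (X n ω) : EuclideanSpace ℝ ι)) atTop id
      (fun _ => P) (multivariateGaussian 0 C) := by
  have hm : ∀ n, Measurable fun ω => (WithLp.toLp 2 (X n ω) : EuclideanSpace ℝ ι) := fun n =>
    (WithLp.measurable_toLp 2 _).comp (measurable_pi_lambda _ fun i => hX n i)
  refine ⟨fun n => (hm n).aemeasurable, aemeasurable_id, ?_⟩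
  refine ProbabilityMeasure.tendsto_iff_tendsto_charFun.2 fun t => ?_
  simp only [ProbabilityMeasure.coe_mk, Measure.map_id, charFun_multivariateGaussian hC,
    inner_zero_right]
  convert h t.ofLp using 2 with n
  · rw [charFun_apply, integral_map (hm n).aemeasurable (by fun_prop)]
    refine integral_congr_ae (ae_of_all _ fun ω => ?_)
    dsimp only
    rw [mul_comm, EuclideanSpace.inner_eq_star_dotProduct]
    simp
  · congr 1
    push_cast
    ring

/-- Slutsky's theorem for the adjustment of an estimator by estimated coefficients. -/
lemma tendstoInDistribution_adjusted {v₂ : ℝ} {Γ : Fin L → ℝ} {V : Matrix (Fin L) (Fin L) ℝ}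
    (hV : V.IsSymm) (h0 : V.det ≠ 0) (hC : (blockCov v₂ Γ V).PosSemidef)
    {X : ℕ → Ω → EuclideanSpace ℝ (Unit ⊕ Fin L)} (hX : TendstoInDistribution X atTop id
      (fun _ => P) (multivariateGaussian 0 (blockCov v₂ Γ V)))
    {Y : ℕ → Ω → Fin L → ℝ} (hYm : ∀ n, Measurable (Y n))
    (hY : plim (fun z => Y z.1 z.2) (Γ ᵥ* V⁻¹)) :
    TendstoInDistribution (fun n ω => X n ω (.inl ()) - ∑ l, Y n ω l * X n ω (.inr l)) atTop id
      (fun _ => P) (gaussianReal 0 (schur v₂ Γ V).toNNReal) := by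
  set g : EuclideanSpace ℝ (Unit ⊕ Fin L) × (Fin L → ℝ) → ℝ := fun x =>
    x.1 (.inl ()) - ∑ l, x.2 l * x.1 (.inr l) with hg
  have hsl := hX.continuous_comp_prodMk_of_tendstoInMeasure_const (g := g) (by fun_prop)
    (tendstoInMeasure_iff_probFilter.2 hY) fun n => (hYm n).aemeasurable
  set c : Fin L → ℝ := Γ ᵥ* V⁻¹ with hc
  have hcV : c = V⁻¹ *ᵥ Γ := by rw [hc, ← mulVec_transpose, transpose_nonsing_inv, hV.eq]
  set u : EuclideanSpace ℝ (Unit ⊕ Fin L) := WithLp.toLp 2 (Sum.elim (fun _ => 1) (-c)) with hu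
  have hquad : u ⬝ᵥ blockCov v₂ Γ V *ᵥ u = schur v₂ Γ V := by
    have hVc : V *ᵥ c = Γ := by
      rw [hcV, mulVec_mulVec, mul_nonsing_inv _ (isUnit_iff_ne_zero.2 h0), one_mulVec]
    have e : (Matrix.of fun l (_ : Unit) => Γ l) *ᵥ (fun _ => 1) = Γ := by
      ext; simp [mulVec, dotProduct]
    rw [schur, ← hcV, blockCov, hu, fromBlocks_mulVec, sumElim_dotProduct_sumElim,
      Sum.elim_comp_inl, Sum.elim_comp_inr, e, mulVec_neg c V, hVc, add_neg_cancel, dotProduct_zero]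
    simp [mulVec, dotProduct, sub_eq_add_neg]
  have hgu : ∀ x, g (x, c) = innerSL ℝ u x := fun x => by
    simp [hg, hu, PiLp.inner_apply, Fintype.sum_sum_type, mul_comm, sub_eq_add_neg]
  refine ⟨hsl.forall_aemeasurable, aemeasurable_id, ?_⟩
  convert hsl.tendsto using 2
  congr 1
  refine Subtype.ext (Measure.map_id.trans ?_)
  simp only [id, hgu]
  have hmean := (innerSL ℝ u).integral_comp_comm (IsGaussian.integrable_fun_id
    (μ := multivariateGaussian 0 (blockCov v₂ Γ V)))
  rw [IsGaussian.map_eq_gaussianReal, hmean, integral_id_multivariateGaussian, map_zero, ← hquad,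
    ← covarianceBilin_multivariateGaussian (μ := 0) hC,
    covarianceBilin_self IsGaussian.memLp_two_id]
  rfl

/-- The array `Y` of terms, of which study `n` has `N n`, obeys the limit theorems on which a
bootstrap rests: the sums are asymptotically normal with variance `v`, the sums of squares converge
to `v`, and no single term matters. -/
structure NormalLimit (P : Measure Ω) (N : ℕ → ℕ) (Y : ℕ → ℕ → Ω → ℝ) (v : ℝ) : Prop where
  charFun : Tendsto (fun n => ∫ ω, cis (∑ j ∈ range (N n), Y n j ω) ∂P) atTop
    (𝓝 (Complex.exp (-(v : ℂ) / 2)))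
  sum_sq : Tendsto (fun z => ∑ j ∈ range (N z.1), Y z.1 j z.2 ^ 2) (probFilter P) (𝓝 v)
  large : Tendsto (fun z => ∑ j ∈ range (N z.1),
    if 1 / 2 < |Y z.1 j z.2| then Y z.1 j z.2 ^ 2 else 0) (probFilter P) (𝓝 0)

lemma NormalLimit.congr {N : ℕ → ℕ} {Y Y' : Terms} {v : ℝ} (h : NormalLimit P N Y v)
    (e : ∀ n ω, ∀ j ∈ range (N n), Y' n j ω = Y n j ω) : NormalLimit P N Y' v :=
  ⟨h.charFun.congr fun n => by simp_rw [sum_congr rfl (e n _)],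
    h.sum_sq.congr fun z => sum_congr rfl fun j hj => by rw [e _ _ j hj],
    h.large.congr fun z => sum_congr rfl fun j hj => by rw [e _ _ j hj]⟩

/-- The estimator `est` of `θ` from the sample `S n` of the given size is asymptotically linear, on
the scale `√n₂`, with terms `x₀`; the terms `x`, computed from the data, are centred and close to
`x₀` in empirical mean square. -/
structure LinearApprox (P : Measure Ω) (𝒢 : ℕ → MeasurableSpace Ω) (n₂ size : ℕ → ℕ)
    (S : ℕ → Ω → Finset ℕ) (est : ℕ → Ω → ℝ) (θ : ℝ) (x x₀ : ℕ → Ω → ℕ → ℝ) : Prop where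
  measurable_est : ∀ n, Measurable (est n)
  measurable_term : ∀ n j, Measurable[𝒢 n] fun ω => x n ω j
  measurable_oracle : ∀ n j, Measurable fun ω => x₀ n ω j
  mean_square : Tendsto (fun z => (size z.1 : ℝ)⁻¹ * ∑ j ∈ S z.1 z.2,
    (x z.1 z.2 j - x₀ z.1 z.2 j) ^ 2) (probFilter P) (𝓝 0)
  centred : Tendsto (fun z => (√(size z.1))⁻¹ * ∑ j ∈ S z.1 z.2, x z.1 z.2 j) (probFilter P) (𝓝 0)
  expansion : Tendsto (fun z => √(n₂ z.1) * (est z.1 z.2 - θ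
    - (size z.1 : ℝ)⁻¹ * ∑ j ∈ S z.1 z.2, x₀ z.1 z.2 j)) (probFilter P) (𝓝 0)

lemma sqrt_mul_inv_self (N : ℕ) : √N * (N : ℝ)⁻¹ = (√N)⁻¹ := by
  rw [← div_eq_mul_inv, Real.sqrt_div_self, inv_eq_one_div]

lemma sum_scaledTerm_inl {N₁ N₂ : ℕ} {s : Finset ℕ} (hs : s ⊆ range N₁) (ψ : ℕ → ℝ)
    (φ₁ φ₂ : ℕ → Fin L → ℝ) :
    ∑ j ∈ range N₁, scaledTerm N₁ N₂ s ψ φ₁ φ₂ j (Sum.inl ()) = √N₂ * (N₂ : ℝ)⁻¹ * ∑ j ∈ s, ψ j := by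
  simp only [scaledTerm, Sum.elim_inl, ← mul_assoc]
  rw [← mul_sum, sum_ite_mem, inter_eq_right.2 hs]

lemma sum_scaledTerm_inr {N₁ N₂ : ℕ} {s : Finset ℕ} (hs : s ⊆ range N₁) (ψ : ℕ → ℝ)
    (φ₁ φ₂ : ℕ → Fin L → ℝ) (l : Fin L) :
    ∑ j ∈ range N₁, scaledTerm N₁ N₂ s ψ φ₁ φ₂ j (Sum.inr l) = √N₂ * (N₂ : ℝ)⁻¹ * ∑ j ∈ s, φ₂ j l
      - √N₂ * (N₁ : ℝ)⁻¹ * ∑ j ∈ range N₁, φ₁ j l := by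
  simp only [scaledTerm, Sum.elim_inr, mul_sub, ← mul_assoc]
  rw [sum_sub_distrib, ← mul_sum, ← mul_sum, sum_ite_mem,
    sum_ite_mem, inter_eq_right.2 hs, inter_self]

lemma sum_scaledTerm_sub_sq_inl {N₁ N₂ : ℕ} (h2 : 0 < N₂) {s : Finset ℕ} (hs : s ⊆ range N₁)
    (ψ ψ' : ℕ → ℝ) (φ₁ φ₂ φ₁' φ₂' : ℕ → Fin L → ℝ) :
    ∑ j ∈ range N₁, (scaledTerm N₁ N₂ s ψ φ₁ φ₂ j (Sum.inl ())
      - scaledTerm N₁ N₂ s ψ' φ₁' φ₂' j (Sum.inl ())) ^ 2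
      = (N₂ : ℝ)⁻¹ * ∑ j ∈ s, (ψ j - ψ' j) ^ 2 := by
  have hN : (0 : ℝ) < N₂ := by exact_mod_cast h2
  have : ∀ j, (scaledTerm N₁ N₂ s ψ φ₁ φ₂ j (Sum.inl ()) - scaledTerm N₁ N₂ s ψ' φ₁' φ₂' j (Sum.inl
      ())) ^ 2 = (N₂ : ℝ)⁻¹ * if j ∈ s then (ψ j - ψ' j) ^ 2 else 0 := fun j => by
    simp only [scaledTerm, Sum.elim_inl]
    rw [← mul_sub, mul_pow, Real.sq_sqrt hN.le]
    split_ifs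
    · field_simp
    · simp
  simp only [this]
  rw [← mul_sum, sum_ite_mem, inter_eq_right.2 hs]

lemma sum_scaledTerm_sub_sq_inr {N₁ N₂ : ℕ} (h2 : 0 < N₂) (h12 : N₂ ≤ N₁) {s : Finset ℕ}
    (hs : s ⊆ range N₁) (ψ ψ' : ℕ → ℝ) (φ₁ φ₂ φ₁' φ₂' : ℕ → Fin L → ℝ) (l : Fin L) :
    ∑ j ∈ range N₁, (scaledTerm N₁ N₂ s ψ φ₁ φ₂ j (Sum.inr l)
      - scaledTerm N₁ N₂ s ψ' φ₁' φ₂' j (Sum.inr l)) ^ 2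
      ≤ 2 * ((N₂ : ℝ)⁻¹ * ∑ j ∈ s, (φ₂ j l - φ₂' j l) ^ 2)
        + 2 * ((N₁ : ℝ)⁻¹ * ∑ j ∈ range N₁, (φ₁ j l - φ₁' j l) ^ 2) := by
  have hN : (0 : ℝ) < N₂ := by exact_mod_cast h2
  have hN1 : (0 : ℝ) < N₁ := by exact_mod_cast h2.trans_le h12
  have : ∀ j ∈ range N₁, (scaledTerm N₁ N₂ s ψ φ₁ φ₂ j (Sum.inr l) - scaledTerm N₁ N₂ s ψ' φ₁' φ₂' j
      (Sum.inr l)) ^ 2 ≤ 2 * ((N₂ : ℝ)⁻¹ * if j ∈ s then (φ₂ j l - φ₂' j l) ^ 2 else 0)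
        + 2 * ((N₁ : ℝ)⁻¹ * (φ₁ j l - φ₁' j l) ^ 2) := fun j hj => by
    simp only [scaledTerm, Sum.elim_inr, if_pos hj]
    set x := if j ∈ s then φ₂ j l - φ₂' j l else 0 with hx
    have e1 : (if j ∈ s then (φ₂ j l - φ₂' j l) ^ 2 else 0) = x ^ 2 := by
      rw [hx]; split_ifs <;> simp
    have e2 : (√N₂ * ((N₂ : ℝ)⁻¹ * (if j ∈ s then φ₂ j l else 0) - (N₁ : ℝ)⁻¹ * φ₁ j l)
        - √N₂ * ((N₂ : ℝ)⁻¹ * (if j ∈ s then φ₂' j l else 0) - (N₁ : ℝ)⁻¹ * φ₁' j l))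
        = √N₂ * ((N₂ : ℝ)⁻¹ * x - (N₁ : ℝ)⁻¹ * (φ₁ j l - φ₁' j l)) := by
      rw [hx]; split_ifs <;> ring
    rw [e1, e2, mul_pow, Real.sq_sqrt hN.le]
    set y := φ₁ j l - φ₁' j l
    have h3 : (N₂ : ℝ) * ((N₁ : ℝ)⁻¹) ^ 2 ≤ (N₁ : ℝ)⁻¹ := by
      rw [sq, ← mul_assoc]
      refine mul_le_of_le_one_left (by positivity) ?_
      rw [← div_eq_mul_inv, div_le_one hN1]
      exact_mod_cast h12
    calc (N₂ : ℝ) * ((N₂ : ℝ)⁻¹ * x - (N₁ : ℝ)⁻¹ * y) ^ 2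
        ≤ (N₂ : ℝ) * (2 * ((N₂ : ℝ)⁻¹ * x) ^ 2 + 2 * ((N₁ : ℝ)⁻¹ * y) ^ 2) := by
          refine mul_le_mul_of_nonneg_left ?_ hN.le
          nlinarith [sq_nonneg ((N₂ : ℝ)⁻¹ * x + (N₁ : ℝ)⁻¹ * y)]
      _ = 2 * ((N₂ : ℝ)⁻¹ * x ^ 2) + 2 * ((N₂ : ℝ) * ((N₁ : ℝ)⁻¹) ^ 2 * y ^ 2) := by field_simp
      _ ≤ _ := by gcongr
  refine (sum_le_sum this).trans (le_of_eq ?_)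
  rw [sum_add_distrib, ← mul_sum, ← mul_sum, ← mul_sum, ← mul_sum, sum_ite_mem, inter_eq_right.2 hs]

lemma measurable_scaledTerm {m : MeasurableSpace Ω} {N₁ N₂ : ℕ} {S : Ω → Finset ℕ} (hS : Measurable
    S) {ψ : Ω → ℕ → ℝ} {φ₁ φ₂ : Ω → ℕ → Fin L → ℝ} {j : ℕ} (hψ : Measurable fun ω => ψ ω j) (hφ₁ : ∀
    l, Measurable fun ω => φ₁ ω j l) (hφ₂ : ∀ l, Measurable fun ω => φ₂ ω j l) (i : Unit ⊕ Fin L) :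
    Measurable fun ω => scaledTerm N₁ N₂ (S ω) (ψ ω) (φ₁ ω) (φ₂ ω) j i := by
  have hS' : MeasurableSet {ω | j ∈ S ω} :=
    hS (MeasurableSet.of_discrete (s := {s : Finset ℕ | j ∈ s}))
  rcases i with i | l
  · exact ((hψ.ite hS' measurable_const).const_mul _).const_mul _
  · refine Measurable.const_mul (Measurable.sub
      (((hφ₂ l).ite hS' measurable_const).const_mul _) ?_) _
    by_cases hj : j ∈ range N₁
    · simpa only [if_pos hj] using (hφ₁ l).const_mul _
    · simp only [if_neg hj, mul_zero]; exact measurable_const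

/-- The factor that converts the scale of a larger sample into `√n₂` is bounded. -/
lemma tendsto_scale_mul {N : ℕ → ℕ} (hN : ∀ n, n₂ n ≤ N n) {X : ℕ × Ω → ℝ}
    (h : Tendsto X 𝒫 (𝓝 0)) : Tendsto (fun z => √(n₂ z.1) * (√(N z.1))⁻¹ * X z) 𝒫 (𝓝 0) := by
  refine squeeze_zero_norm (fun z => ?_) (by simpa using h.abs)
  rw [norm_mul, Real.norm_of_nonneg (by positivity)]
  refine mul_le_of_le_one_left (abs_nonneg _) ?_
  rw [← div_eq_mul_inv]
  exact div_le_one_of_le₀ (Real.sqrt_le_sqrt (by exact_mod_cast hN z.1)) (Real.sqrt_nonneg _)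

/-- The bootstrap is consistent as soon as the linear combinations of the scaled oracle terms obey
the limit theorems: by the law of large numbers for the replicates, which their sums of squares
control, and by Slutsky's theorem. -/
theorem Design.bootstrapConsistent_of_linearApprox (des : IsDesign) {τ : ℝ} {τ₂ : ℕ → Ω → ℝ}
    {θ : Fin L → ℝ} {ep₁ ep₂ : ℕ → Ω → Fin L → ℝ} {ψ ψ₀ : ℕ → Ω → ℕ → ℝ}
    {φ₁ φ₂ φ₁₀ φ₂₀ : ℕ → Ω → ℕ → Fin L → ℝ} {v₂ : ℝ} {Γ : Fin L → ℝ}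
    {V : Matrix (Fin L) (Fin L) ℝ} (hV : V.IsSymm) (h : LinearApprox P 𝒢 n₂ n₂ S₂ τ₂ τ ψ ψ₀)
    (h₁ : ∀ l, LinearApprox P 𝒢 n₂ n₁ (fun n _ => range (n₁ n)) (fun n ω => ep₁ n ω l) (θ l)
      (fun n ω j => φ₁ n ω j l) fun n ω j => φ₁₀ n ω j l)
    (h₂ : ∀ l, LinearApprox P 𝒢 n₂ n₂ S₂ (fun n ω => ep₂ n ω l) (θ l)
      (fun n ω j => φ₂ n ω j l) fun n ω j => φ₂₀ n ω j l)
    (hlim : ∀ t : Unit ⊕ Fin L → ℝ, NormalLimit P n₁ (fun n j ω => t ⬝ᵥ scaledTerm (n₁ n) (n₂ n)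
      (S₂ n ω) (ψ₀ n ω) (φ₁₀ n ω) (φ₂₀ n ω) j) (t ⬝ᵥ blockCov v₂ Γ V *ᵥ t)) :
    BootstrapConsistent P n₁ n₂ B S₂ D τ τ₂ ep₁ ep₂ ψ φ₁ φ₂ v₂ Γ V := by
  have hNB := probFilter_neBot P
  set C := blockCov v₂ Γ V with hC
  set T : ℕ → Ω → ℕ → Unit ⊕ Fin L → ℝ := fun n ω j =>
    scaledTerm (n₁ n) (n₂ n) (S₂ n ω) (ψ n ω) (φ₁ n ω) (φ₂ n ω) j with hT
  set H : ℕ → Ω → ℕ → Unit ⊕ Fin L → ℝ := fun n ω j =>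
    scaledTerm (n₁ n) (n₂ n) (S₂ n ω) (ψ₀ n ω) (φ₁₀ n ω) (φ₂₀ n ω) j with hH
  set X : ℕ → Ω → Unit ⊕ Fin L → ℝ := fun n ω => Sum.elim (fun _ => √(n₂ n) * (τ₂ n ω - τ))
    (fun l => √(n₂ n) * (ep₂ n ω l - ep₁ n ω l)) with hX
  have hsub : ∀ᶠ z : ℕ × Ω in 𝒫, S₂ z.1 z.2 ⊆ range (n₁ z.1) :=
    (eventually_probFilter_of_ae (Eventually.of_forall des.ae_validation)).mono fun z hz =>
      (mem_powersetCard.1 hz).1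
  have happrox : ∀ i, plim (fun z => ∑ j ∈ range (n₁ z.1), (T z.1 z.2 j i - H z.1 z.2 j i) ^ 2) 0 := by
    rintro (i | l)
    · refine h.mean_square.congr' (hsub.mono fun z hz => ?_)
      exact (sum_scaledTerm_sub_sq_inl (des.size_pos _) hz _ _ _ _ _ _).symm
    · have h := ((h₂ l).mean_square.const_mul 2).add ((h₁ l).mean_square.const_mul 2)
      simp only [mul_zero, add_zero] at h
      exact tendsto_of_tendsto_of_tendsto_of_le_of_le' tendsto_const_nhds h
        (Eventually.of_forall fun z => sum_nonneg fun _ _ => sq_nonneg _) (hsub.mono fun z hz =>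
        sum_scaledTerm_sub_sq_inr (des.size_pos _) (des.size_le _) hz _ _ _ _ _ _ l)
  have hcentred : ∀ i, plim (fun z => ∑ j ∈ range (n₁ z.1), T z.1 z.2 j i) 0 := by
    rintro (i | l)
    · refine h.centred.congr' (hsub.mono fun z hz => ?_)
      simp only [hT]
      rw [sum_scaledTerm_inl hz, sqrt_mul_inv_self]
    · have h := (h₂ l).centred.sub (tendsto_scale_mul des.size_le (h₁ l).centred)
      rw [sub_zero] at h
      refine h.congr' (hsub.mono fun z hz => ?_)
      simp only [hT]
      rw [sum_scaledTerm_inr hz, sqrt_mul_inv_self, ← Real.mul_self_sqrt (n₁ z.1).cast_nonneg,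
        mul_inv, Real.mul_self_sqrt (n₁ z.1).cast_nonneg]
      ring
  have hest : ∀ i, plim (fun z => X z.1 z.2 i - ∑ j ∈ range (n₁ z.1), H z.1 z.2 j i) 0 := by
    rintro (i | l)
    · refine h.expansion.congr' (hsub.mono fun z hz => ?_)
      simp only [hX, hH, Sum.elim_inl]
      rw [sum_scaledTerm_inl hz]
      ring
    · have h := (h₂ l).expansion.sub (h₁ l).expansion
      rw [sub_zero] at h
      refine h.congr' (hsub.mono fun z hz => ?_)
      simp only [hX, hH, Sum.elim_inr]
      rw [sum_scaledTerm_inr hz]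
      ring
  have hTm : ∀ n j i, Measurable[𝒢 n] fun ω => T n ω j i := fun n j i =>
    measurable_scaledTerm (des.measurable_validation n) (h.measurable_term n j)
      (fun l => (h₁ l).measurable_term n j) (fun l => (h₂ l).measurable_term n j) i
  have hHm : ∀ n j i, Measurable fun ω => H n ω j i := fun n j i =>
    measurable_scaledTerm (des.measurable_S n) (h.measurable_oracle n j)
      (fun l => (h₁ l).measurable_oracle n j) (fun l => (h₂ l).measurable_oracle n j) i
  -- the replicates
  set R : ℕ → Ω → ℕ → Unit ⊕ Fin L → ℝ := fun n ω b i =>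
    ∑ k ∈ range (n₁ n), T n ω (D n b k ω) i with hR
  have hLLN : ∀ t : Unit ⊕ Fin L → ℝ, plim (fun z => ((B z.1 : ℝ) - 1)⁻¹ *
      ∑ b ∈ range (B z.1), (t ⬝ᵥ R z.1 z.2 b) ^ 2) (t ⬝ᵥ C *ᵥ t) := by
    intro t
    have hd : plim (fun z => ∑ j ∈ range (n₁ z.1),
        (t ⬝ᵥ T z.1 z.2 j - t ⬝ᵥ H z.1 z.2 j) ^ 2) 0 := by
      have h1 := (tendsto_finsetSum Finset.univ fun i _ => happrox i).const_mul (∑ i, t i ^ 2)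
      rw [sum_const_zero, mul_zero] at h1
      refine squeeze_zero (fun z => sum_nonneg fun _ _ => sq_nonneg _) (fun z => ?_) h1
      rw [sum_comm, mul_sum]
      refine sum_le_sum fun j _ => ?_
      rw [← dotProduct_sub]
      exact sum_mul_sq_le_sq_mul_sq _ _ _
    obtain ⟨h1, h2⟩ := tendsto_sum_sq_of_approx (N := fun z : ℕ × Ω => n₁ z.1)
      (f := fun z j => t ⬝ᵥ H z.1 z.2 j) (hlim t).sum_sq (hlim t).large hd
    have h3 : plim (fun z => ∑ j ∈ range (n₁ z.1), t ⬝ᵥ T z.1 z.2 j) 0 := by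
      have := tendsto_finsetSum Finset.univ fun i _ => (hcentred i).const_mul (t i)
      simp only [mul_zero, sum_const_zero] at this
      refine this.congr fun z => ?_
      simp only [dotProduct, mul_sum]
      rw [sum_comm]
    refine (des.tendsto_average_replicate (h := fun n ω j => t ⬝ᵥ T n ω j) (fun n j =>
      Finset.measurable_fun_sum _ fun i _ => (hTm n j i).const_mul _) h3 h1 h2).congr fun z => ?_
    congr 1
    refine sum_congr rfl fun b _ => ?_
    simp only [replicate, hR, dotProduct, mul_sum]
    rw [sum_comm]
  have hCsymm : C.IsSymm := Matrix.IsSymm.fromBlocks (by ext; simp) (by ext; simp) hV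
  have hPSD : C.PosSemidef := by
    refine Matrix.PosSemidef.of_dotProduct_mulVec_nonneg ?_ fun t => ?_
    · rw [Matrix.IsHermitian, conjTranspose_eq_transpose_of_trivial]; exact hCsymm
    · exact ge_of_tendsto' (hlim t).sum_sq fun z => sum_nonneg fun _ _ => sq_nonneg _
  -- entries of the covariance of the replicates, by polarization
  set M : ℕ → Ω → Matrix (Unit ⊕ Fin L) (Unit ⊕ Fin L) ℝ := fun n ω i i' =>
    ((B n : ℝ) - 1)⁻¹ * ∑ b ∈ range (B n), R n ω b i * R n ω b i' with hM
  have hent : ∀ i i', plim (fun z => M z.1 z.2 i i') (C i i') := fun i i' => by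
    convert (((hLLN (Pi.single i 1 + Pi.single i' 1)).sub (hLLN (Pi.single i 1))).sub
      (hLLN (Pi.single i' 1))).const_mul (1 / 2) using 2 with z
    · simp only [hM, add_dotProduct, single_dotProduct, one_mul, mul_sum, ← sum_sub_distrib]
      exact sum_congr rfl fun b _ => by ring
    · simp only [add_dotProduct, single_dotProduct, one_mul, mulVec_add,
        mulVec_single_one, Pi.add_apply, col_apply]
      rw [hCsymm.apply i i']; ring
  have hn₂0 : ∀ n, (n₂ n : ℝ) ≠ 0 := fun n => by exact_mod_cast (des.size_pos n).ne'
  have hprod : ∀ n (x y : ℕ → ℝ), (n₂ n : ℝ) * (((B n : ℝ) - 1)⁻¹ * ∑ b ∈ range (B n), x b * y b) =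
      ((B n : ℝ) - 1)⁻¹ * ∑ b ∈ range (B n), √(n₂ n) * x b * (√(n₂ n) * y b) := fun n x y => by
    simp only [mul_sum]
    refine sum_congr rfl fun b _ => ?_
    rw [mul_mul_mul_comm (√(n₂ n)), Real.mul_self_sqrt (Nat.cast_nonneg (n₂ n))]
    ring
  have hRt : ∀ n ω b, R n ω b (.inl ()) = √(n₂ n) *
      bootTau (n₁ n) (n₂ n) (S₂ n ω) (fun k => D n b k ω) (ψ n ω) := fun n ω b =>
    (sqrt_mul_bootTau _ _ _ _ _ (φ₁ n ω) (φ₂ n ω)).symm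
  have hRe : ∀ n ω b l, R n ω b (.inr l) = √(n₂ n) *
      bootEp (n₁ n) (n₂ n) (S₂ n ω) (fun k => D n b k ω) (φ₁ n ω) (φ₂ n ω) l := fun n ω b l =>
    (sqrt_mul_bootEp _ _ _ _ (ψ n ω) _ _ l).symm
  set v2h := bootV2 n₁ n₂ B S₂ D ψ with hv2h
  set Γh := bootGamma n₁ n₂ B S₂ D ψ φ₁ φ₂ with hΓh
  set Vh := bootV n₁ n₂ B S₂ D φ₁ φ₂ with hVh
  have e2 : ∀ n ω, (n₂ n : ℝ) * v2h n ω = M n ω (.inl ()) (.inl ()) := fun n ω => by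
    simp only [hM, hRt, hv2h, bootV2, v2Hat, sq, hprod]
  have eΓ : ∀ n ω l, (n₂ n : ℝ) * Γh n ω l = M n ω (.inl ()) (.inr l) := fun n ω l => by
    simp only [hM, hRt, hRe, hΓh, bootGamma, gammaHat, Pi.smul_apply, Finset.sum_apply,
      smul_eq_mul, hprod]
  have eV : ∀ n ω k l, (n₂ n : ℝ) * Vh n ω k l = M n ω (.inr k) (.inr l) := fun n ω k l => by
    simp only [hM, hRe, hVh, bootV, VHat, Matrix.smul_apply, Matrix.sum_apply, vecMulVec_apply,
      smul_eq_mul, hprod]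
  have c2 : plim (fun z => (n₂ z.1 : ℝ) * v2h z.1 z.2) v₂ := by
    simp only [e2]; exact hent (.inl ()) (.inl ())
  have cΓ : plim (fun z => (n₂ z.1 : ℝ) • Γh z.1 z.2) Γ := tendsto_pi_nhds.2 fun l => by
    simp only [Pi.smul_apply, smul_eq_mul, eΓ]; exact hent (.inl ()) (.inr l)
  have cV : plim (fun z => (n₂ z.1 : ℝ) • Vh z.1 z.2) V :=
    tendsto_pi_nhds.2 fun k => tendsto_pi_nhds.2 fun l => by
      simp only [Matrix.smul_apply, smul_eq_mul, eV]; exact hent (.inr k) (.inr l)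
  have hdet : V.det ≠ 0 → ∀ᶠ z in 𝒫, (Vh z.1 z.2).det ≠ 0 := fun h0 => by
    have h1 := ((continuous_id (X := Matrix (Fin L) (Fin L) ℝ)).matrix_det.tendsto V).comp cV
    filter_upwards [h1.eventually_ne h0] with z hz h2
    exact hz (by simp [h2])
  -- the central limit theorem
  have hXm : ∀ n i, Measurable fun ω => X n ω i := by
    rintro n (i | l)
    · exact ((h.measurable_est n).sub_const _).const_mul _
    · exact (((h₂ l).measurable_est n).sub ((h₁ l).measurable_est n)).const_mul _
  have hasymp : TendstoInDistribution
      (fun n ω => (WithLp.toLp 2 (X n ω) : EuclideanSpace ℝ (Unit ⊕ Fin L)))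
      atTop id (fun _ => P) (multivariateGaussian 0 C) := by
    refine tendstoInDistribution_of_charFun hXm hPSD fun t => ?_
    have hXt : ∀ n, Measurable fun ω => t ⬝ᵥ X n ω := fun n =>
      Finset.measurable_fun_sum _ fun i _ => (hXm n i).const_mul _
    have hYt : ∀ n, Measurable fun ω => ∑ j ∈ range (n₁ n), t ⬝ᵥ H n ω j := fun n =>
      Finset.measurable_fun_sum _ fun j _ => Finset.measurable_fun_sum _ fun i _ =>
        (hHm n j i).const_mul _
    have hXY : plim (fun z => t ⬝ᵥ X z.1 z.2 - ∑ j ∈ range (n₁ z.1), t ⬝ᵥ H z.1 z.2 j) 0 := by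
      have h1 := tendsto_finsetSum Finset.univ fun i _ => (hest i).const_mul (t i)
      simp only [mul_zero, sum_const_zero] at h1
      refine h1.congr fun z => ?_
      simp only [dotProduct, mul_sub, sum_sub_distrib, mul_sum]
      rw [sum_comm]
    have hdiff : Tendsto (fun n => ∫ ω, (cis (t ⬝ᵥ X n ω)
        - cis (∑ j ∈ range (n₁ n), t ⬝ᵥ H n ω j)) ∂P) atTop (𝓝 0) :=
      tendsto_integral_of_bounded_probFilter (C := 2) (fun n => ((integrable_cis (hXt n)).sub
        (integrable_cis (hYt n))).aestronglyMeasurable) (fun n ω => (norm_sub_le _ _).trans (by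
          rw [norm_cis, norm_cis]; norm_num))
        (squeeze_zero_norm (fun z => norm_cis_sub_le _ _) (by simpa using hXY.abs))
    have := hdiff.add (hlim t).charFun
    rw [zero_add] at this
    refine this.congr fun n => ?_
    rw [integral_sub (integrable_cis (hXt n)) (integrable_cis (hYt n))]
    exact sub_add_cancel _ _
  refine ⟨⟨hPSD, hasymp⟩, fun l => tendstoInMeasure_iff_probFilter.2 (tendsto_pi_nhds.1 cΓ l),
    fun k l => tendstoInMeasure_iff_probFilter.2 (tendsto_pi_nhds.1 (tendsto_pi_nhds.1 cV k) l),
    tendstoInMeasure_iff_probFilter.2 c2, fun h0 => tendstoInMeasure_iff_probFilter.2 ?_,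
    fun h0 => ?_⟩
  · have h2 := ((continuous_fst (X := Matrix (Fin L) (Fin L) ℝ) (Y := Fin L → ℝ)).matrix_mulVec
      continuous_snd).tendsto (V⁻¹, Γ) |>.comp ((tendsto_matrix_inv cV h0).prodMk_nhds cΓ)
    have h1 := c2.sub (((continuous_fst (X := Fin L → ℝ) (Y := Fin L → ℝ)).dotProduct
      continuous_snd).tendsto (Γ, V⁻¹ *ᵥ Γ) |>.comp (cΓ.prodMk_nhds h2))
    exact h1.congr' ((hdet h0).mono fun z hz => (mul_schur_smul _ (hn₂0 _) _ _ _ hz).symm)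
  · have hYc : plim (fun z => Γh z.1 z.2 ᵥ* (Vh z.1 z.2)⁻¹) (Γ ᵥ* V⁻¹) := by
      refine (((continuous_fst (X := Fin L → ℝ) (Y := Matrix (Fin L) (Fin L) ℝ)).matrix_vecMul
        continuous_snd).tendsto (Γ, V⁻¹) |>.comp
        (cΓ.prodMk_nhds (tendsto_matrix_inv cV h0))).congr' ((hdet h0).mono fun z hz => ?_)
      have : Invertible (n₂ z.1 : ℝ) := invertibleOfNonzero (hn₂0 _)
      simp only [Function.comp_apply]
      rw [inv_smul _ _ (isUnit_iff_ne_zero.2 hz), invOf_eq_inv, vecMul_smul,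
        smul_vecMul, smul_smul, inv_mul_cancel₀ (hn₂0 _), one_smul]
    have hRm : ∀ n b i, Measurable fun ω => R n ω b i := fun n b i =>
      Finset.measurable_fun_sum _ fun k _ => (measurable_from_prod_countable_left
        (f := fun x : Ω × ℕ => T n x.1 x.2 i) fun j => (hTm n j i).mono (des.le_ambient n)
        le_rfl).comp (measurable_id.prodMk (des.measurable_draw n b k))
    have hm : ∀ {F : Ω → ℝ} {n i i'}, (∀ ω, (n₂ n : ℝ) * F ω = M n ω i i') → Measurable F :=
      fun {F n i i'} hF => by
        rw [show F = fun ω => (n₂ n : ℝ)⁻¹ * M n ω i i' from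
          funext fun ω => by rw [← hF, inv_mul_cancel_left₀ (hn₂0 n)]]
        exact ((Finset.measurable_fun_sum _ fun b _ =>
          (hRm n b _).mul (hRm n b _)).const_mul _).const_mul _
    have hYm : ∀ n, Measurable fun ω => Γh n ω ᵥ* (Vh n ω)⁻¹ := fun n =>
      measurable_pi_lambda _ fun l => by
        simp only [vecMul, dotProduct]
        exact Finset.measurable_fun_sum _ fun k _ => (hm fun ω => eΓ n ω k).mul
          (measurable_matrix_inv (fun k l => hm fun ω => eV n ω k l) k l)
    convert tendstoInDistribution_adjusted hV h0 hPSD hasymp hYm hYc using 3 with n ω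
    simp only [hX, Sum.elim_inl, Sum.elim_inr, mul_left_comm _ (√(n₂ n)), ← mul_sum, ← mul_sub]
    rw [dotProduct_mulVec]
    simp only [dotProduct, Pi.sub_apply]
    ring

/-! ### Linear statistics of the main and the validation data -/

section Linear

lemma sqrt_mul_inv_le {N₁ N₂ : ℕ} (h12 : N₂ ≤ N₁) : √N₂ * (N₁ : ℝ)⁻¹ ≤ (√N₁)⁻¹ := by
  rw [← sqrt_mul_inv_self N₁]
  gcongr

lemma abs_coefVal_le (N₁ N₂ : ℕ) (s : Finset ℕ) (j : ℕ) :
    |coefVal N₂ s j| ≤ rate N₁ N₂ s j := by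
  have h1 : (0 : ℝ) ≤ (√N₁)⁻¹ := by positivity
  have h2 : (0 : ℝ) ≤ (√N₂)⁻¹ := by positivity
  unfold coefVal rate
  rw [← mul_assoc, sqrt_mul_inv_self]
  split_ifs
  · rw [mul_one, abs_of_nonneg h2]; linarith
  · simp

lemma abs_coefDiff_le {N₁ N₂ : ℕ} (h12 : N₂ ≤ N₁) (s : Finset ℕ) (j : ℕ) :
    |coefDiff N₁ N₂ s j| ≤ rate N₁ N₂ s j := by
  have h1 : (0 : ℝ) ≤ √N₂ * (N₁ : ℝ)⁻¹ := by positivity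
  have h2 : (0 : ℝ) ≤ (√N₂)⁻¹ := by positivity
  have h3 := sqrt_mul_inv_le h12
  unfold coefDiff rate
  rw [mul_sub, ← mul_assoc, sqrt_mul_inv_self]
  refine (abs_sub _ _).trans (add_le_add ?_ ?_)
  · split_ifs
    · rw [mul_one, abs_of_nonneg h2]
    · simp
  · rwa [abs_of_nonneg h1]

section Sums

variable {N₁ N₂ : ℕ} {s : Finset ℕ}

lemma sum_ite_validation (hs : s ∈ powersetCard N₂ (range N₁)) :
    ∑ j ∈ range N₁, (if j ∈ s then (1 : ℝ) else 0) = N₂ := by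
  obtain ⟨hsub, hcard⟩ := mem_powersetCard.1 hs
  rw [sum_ite_mem, inter_eq_right.2 hsub]
  simp [hcard]

lemma sum_coefVal_sq (h2 : 0 < N₂) (hs : s ∈ powersetCard N₂ (range N₁)) :
    ∑ j ∈ range N₁, coefVal N₂ s j ^ 2 = 1 := by
  have hN : (0 : ℝ) < N₂ := by exact_mod_cast h2
  have : ∀ j, coefVal N₂ s j ^ 2 = (N₂ : ℝ)⁻¹ * if j ∈ s then 1 else 0 := fun j => by
    rw [coefVal, mul_pow, Real.sq_sqrt hN.le]; split_ifs <;> field_simp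
    simp
  simp only [this]
  rw [← mul_sum, sum_ite_validation hs, inv_mul_cancel₀ hN.ne']

lemma sum_coefVal_mul_coefDiff (h2 : 0 < N₂) (h12 : N₂ ≤ N₁) (hs : s ∈ powersetCard N₂ (range N₁)) :
    ∑ j ∈ range N₁, coefVal N₂ s j * coefDiff N₁ N₂ s j = 1 - (N₂ : ℝ) / N₁ := by
  have hN : (0 : ℝ) < N₂ := by exact_mod_cast h2
  have hN1 : (0 : ℝ) < N₁ := by exact_mod_cast h2.trans_le h12
  have : ∀ j, coefVal N₂ s j * coefDiff N₁ N₂ s j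
      = ((N₂ : ℝ)⁻¹ - (N₁ : ℝ)⁻¹) * if j ∈ s then 1 else 0 := fun j => by
    rw [coefVal, coefDiff, mul_mul_mul_comm, Real.mul_self_sqrt hN.le]
    split_ifs <;> field_simp
    simp
  simp only [this]
  rw [← mul_sum, sum_ite_validation hs]
  field_simp

lemma sum_coefDiff_sq (h2 : 0 < N₂) (h12 : N₂ ≤ N₁) (hs : s ∈ powersetCard N₂ (range N₁)) :
    ∑ j ∈ range N₁, coefDiff N₁ N₂ s j ^ 2 = 1 - (N₂ : ℝ) / N₁ := by
  have hN : (0 : ℝ) < N₂ := by exact_mod_cast h2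
  have hN1 : (0 : ℝ) < N₁ := by exact_mod_cast h2.trans_le h12
  have : ∀ j, coefDiff N₁ N₂ s j ^ 2
      = ((N₂ : ℝ)⁻¹ - 2 * (N₁ : ℝ)⁻¹) * (if j ∈ s then 1 else 0) + N₂ * ((N₁ : ℝ)⁻¹) ^ 2 :=
    fun j => by
      rw [coefDiff, mul_pow, Real.sq_sqrt hN.le]
      split_ifs <;> field_simp <;> ring
  simp only [this]
  rw [sum_add_distrib, ← mul_sum, sum_ite_validation hs]
  simp only [sum_const, card_range, nsmul_eq_mul]
  field_simp
  ring

end Sums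

namespace Design

/-- Conditional expectation of a linear combination, with coefficients that are known, of functions
of unit `j`. -/
lemma condExp_sum_coeff_mul (des : IsDesign) (n : ℕ) {m : MeasurableSpace (Rec p q)} (hm : m ≤
    recAlg p q) {ι : Type*} (s : Finset ι) {f : ι → Rec p q → ℝ} (hf : ∀ i ∈ s, Integrable (f i) Q)
    {j : ℕ} {G : ι → Ω → ℝ} (hG : ∀ i ∈ s, Measurable[𝒦 m n j] (G i)) (hGf : ∀ i ∈ s,
    Integrable (fun ω => G i ω * f i (Z j ω)) P) : P[fun ω => ∑ i ∈ s, G i ω * f i (Z j ω) | 𝒦 m n j] =ᵐ[P]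
      fun ω => ∑ i ∈ s, G i ω * (Q[f i | m]) (Z j ω) := by
  have h1 := condExp_finsetSum (μ := P) (f := fun i ω => G i ω * f i (Z j ω)) hGf
    (𝒦 m n j)
  have h2 : (∑ i ∈ s, fun ω => G i ω * f i (Z j ω)) = fun ω => ∑ i ∈ s, G i ω * f i (Z j ω) := by
    ext ω; simp
  rw [h2] at h1
  have h3 : ∀ᵐ ω ∂P, ∀ i ∈ s, (P[fun ω => G i ω * f i (Z j ω) | 𝒦 m n j]) ω
      = G i ω * (Q[f i | m]) (Z j ω) := by
    rw [eventually_all_finset]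
    exact fun i hi => des.condExp_coeff_mul n hm (hf i hi) (hG i hi) (hGf i hi)
  filter_upwards [h1, h3] with ω e1 e2
  rw [e1, Finset.sum_apply]
  exact sum_congr rfl e2

lemma ratio_tendsto' (des : IsDesign) :
    Tendsto (fun n => 1 - (n₂ n : ℝ) / n₁ n) atTop (𝓝 (1 - ρ)) :=
  tendsto_const_nhds.sub des.ratio_tendsto

lemma integrable_rate_sq_mul (des : IsDesign) (n j : ℕ) {f : Rec p q → ℝ} (hf : Integrable f Q) :
    Integrable (fun ω => rateₙ n ω j ^ 2 * f (Z j ω)) P := by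
  refine integrable_bdd_mul_comp (b := 4 * (n₂ n : ℝ)⁻¹) des.measurable_Z
    des.iid_law j hf (des.measurable_coef
      (fun s => rate (n₁ n) (n₂ n) s j ^ 2) n) fun ω => ?_
  rw [abs_of_nonneg (by positivity)]
  exact des.rate_sq_le n _ j

lemma abs_linear_le (des : IsDesign) (n : ℕ) (s : Finset ℕ) (j : ℕ)
    (x y : ℝ) : |coefVal (n₂ n) s j * x + coefDiff (n₁ n) (n₂ n) s j * y|
      ≤ rate (n₁ n) (n₂ n) s j * (|x| + |y|) := by
  refine (abs_add_le _ _).trans ?_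
  rw [abs_mul, abs_mul, mul_add]
  exact add_le_add (mul_le_mul_of_nonneg_right (abs_coefVal_le _ _ _ _) (abs_nonneg _))
    (mul_le_mul_of_nonneg_right (abs_coefDiff_le (des.size_le n) _ _) (abs_nonneg _))

end Design

end Linear

/-- A unit's vector of scaled terms, applied to `t`, for terms that are functions of its record. -/
lemma dotProduct_scaledTerm {N₁ N₂ : ℕ} (s : Finset ℕ) (t : Unit ⊕ Fin L → ℝ) (ψ : ℕ → ℝ)
    (φ : ℕ → Fin L → ℝ) {j : ℕ} (hj : j ∈ range N₁) :
    t ⬝ᵥ scaledTerm N₁ N₂ s ψ φ φ j = coefVal N₂ s j * (t (Sum.inl ()) * ψ j)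
      + coefDiff N₁ N₂ s j * ∑ l, t (Sum.inr l) * φ j l := by
  simp only [dotProduct, Fintype.sum_sum_type, univ_unique, sum_singleton, scaledTerm,
    Sum.elim_inl, Sum.elim_inr, coefVal, coefDiff, if_pos hj, PUnit.default_eq_unit, mul_sum]
  congr 1
  · split_ifs <;> ring
  · refine sum_congr rfl fun l _ => ?_
    split_ifs <;> ring

lemma dotProduct_blockCov (t : Unit ⊕ Fin L → ℝ) (v : ℝ) (Γ : Fin L → ℝ) (V : Matrix (Fin L) (Fin L)
    ℝ) : t ⬝ᵥ blockCov v Γ V *ᵥ t = t (Sum.inl ()) ^ 2 * v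
      + 2 * (t (Sum.inl ()) * ∑ l, t (Sum.inr l) * Γ l)
      + ∑ k, ∑ l, t (Sum.inr k) * t (Sum.inr l) * V k l := by
  simp only [dotProduct, mulVec, Fintype.sum_sum_type, univ_unique, sum_singleton, blockCov,
    fromBlocks_apply₁₁, fromBlocks_apply₁₂, fromBlocks_apply₂₁, fromBlocks_apply₂₂, of_apply,
    PUnit.default_eq_unit, mul_add, sum_add_distrib]
  have e1 : ∑ l, Γ l * t (Sum.inr l) = ∑ l, t (Sum.inr l) * Γ l :=
    sum_congr rfl fun l _ => mul_comm _ _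
  have e2 : ∑ l, t (Sum.inr l) * (Γ l * t (Sum.inl ())) = t (Sum.inl ()) * ∑ l, t (Sum.inr l) * Γ l := by
    rw [mul_sum]; exact sum_congr rfl fun l _ => by ring
  have e3 : ∑ k, t (Sum.inr k) * ∑ l, V k l * t (Sum.inr l)
      = ∑ k, ∑ l, t (Sum.inr k) * t (Sum.inr l) * V k l := by
    refine sum_congr rfl fun k _ => ?_
    rw [mul_sum]; exact sum_congr rfl fun l _ => by ring
  rw [e1, e2, e3]
  ring

lemma measurable_comp_of_prod {O E : Type*} [MeasurableSpace O] [MeasurableSpace E]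
    {m : MeasurableSpace Ω} {f : Ω → O → E}
    (hf : @Measurable (Ω × O) E (m.prod inferInstance) inferInstance fun z => f z.1 z.2)
    {Y : Ω → O} (hY : Measurable Y) : Measurable fun ω => f ω (Y ω) :=
  hf.comp (measurable_id.prodMk hY)

lemma measurable_pot (a : Bool) : Measurable (pot a : Rec p q → ℝ) := by
  cases a
  · exact measurable_fst.comp (measurable_snd.comp measurable_snd)
  · exact measurable_snd.comp (measurable_snd.comp measurable_snd)

lemma measurable_trt : Measurable (trt : Rec p q → Bool) := measurable_fst

lemma measurable_covX : Measurable (covX : Rec p q → _) := measurable_fst.comp measurable_covXU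

lemma measurable_outcome : Measurable (outcome : Rec p q → ℝ) :=
  Measurable.ite (measurable_trt (measurableSet_singleton true)) (by fun_prop) (by fun_prop)

lemma measurable_obsFull : Measurable (obsFull : Rec p q → _) :=
  measurable_trt.prodMk (measurable_covXU.prodMk measurable_outcome)

lemma measurable_obsMain : Measurable (obsMain : Rec p q → _) :=
  measurable_trt.prodMk (measurable_covX.prodMk measurable_outcome)

lemma Design.linearApprox_of_isRAL {O E : Type*} [MeasurableSpace O] [NormedAddCommGroup E]
    [NormedSpace ℝ E] [MeasurableSpace E] [OpensMeasurableSpace E] (des : IsDesign) {N : ℕ → ℕ}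
    (hN : ∀ n, n₂ n ≤ N n) {S : ℕ → Ω → Finset ℕ} {est : ℕ → Ω → E} {θ : E} {o : Rec p q → O}
    (ho : Measurable[recAlg p q] o) {f : O → E} {fhat : ℕ → Ω → O → E}
    (h : IsRAL P Q Z N S est θ o f) (h' : EstimatesInfluence P 𝒢 Z N S o f fhat) (ℓ : E →L[ℝ] ℝ)
    (hℓ : ∀ x, |ℓ x| ≤ ‖x‖) : LinearApprox P 𝒢 n₂ N S (fun n ω => ℓ (est n ω)) (ℓ θ)
      (fun n ω j => ℓ (fhat n ω (o (Z j ω)))) fun n ω j => ℓ (f (o (Z j ω))) where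
  measurable_est n := ℓ.measurable.comp (h.measurable_est n)
  measurable_term n j := ℓ.measurable.comp (measurable_comp_of_prod (h'.measurable_est n)
    (ho.comp (des.measurable_unit n j)))
  measurable_oracle n j :=
    ℓ.measurable.comp (h.measurable_influence.comp (ho.comp (des.measurable_Z j)))
  mean_square := by
    refine squeeze_zero (fun z => mul_nonneg (by positivity) (sum_nonneg fun _ _ => sq_nonneg _))
      (fun z => ?_) (tendstoInMeasure_iff_probFilter.1 h'.mean_square)
    refine mul_le_mul_of_nonneg_left (sum_le_sum fun j _ => ?_) (by positivity)
    rw [← map_sub]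
    exact sq_le_sq.2 ((hℓ _).trans (le_abs_self _))
  centred := by
    simpa [Function.comp_def] using
      (ℓ.continuous.tendsto 0).comp (tendstoInMeasure_iff_probFilter.1 h'.centred)
  expansion := by
    have t := tendsto_scale_mul hN ((map_zero ℓ ▸ ℓ.continuous.tendsto 0).comp
      (tendstoInMeasure_iff_probFilter.1 h.expansion))
    refine t.congr fun z => ?_
    have hN0 : (0 : ℝ) < N z.1 := by exact_mod_cast (des.size_pos z.1).trans_le (hN z.1)
    simp only [Function.comp_apply, map_smul, map_sub, map_sum, smul_eq_mul]
    rw [← mul_assoc, inv_mul_cancel_right₀ (Real.sqrt_pos.2 hN0).ne']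

/-! ### Nearest neighbours of points in a normed space -/

section Geometry

/-- If every nonempty subset of `T` has an element whose value of `f` is at least the number of the
other elements, plus `r`, then the values of `f` are as spread out as `r, r + 1, …`. -/
lemma sum_pow_le_of_spread {β : ℝ} (h0 : 0 ≤ β) (h1 : β < 1) {ι : Type*} [DecidableEq ι] (T : Finset
    ι) (f : ι → ℕ) (r : ℕ) (h : ∀ T' ⊆ T, T'.Nonempty → ∃ l ∈ T', r + (T'.card - 1) ≤ f l) : ∑ l ∈
    T, β ^ f l ≤ β ^ r / (1 - β) := by
  have key : ∀ n, ∀ T' ⊆ T, T'.card = n → ∑ l ∈ T', β ^ f l ≤ ∑ i ∈ range n, β ^ (r + i) := by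
    intro n
    induction n with
    | zero => intro T' _ hc; rw [card_eq_zero.1 hc]; simp
    | succ n ih =>
      intro T' hT hc
      obtain ⟨l, hl, hf⟩ := h T' hT (card_pos.1 (by omega))
      rw [← add_sum_erase _ _ hl, sum_range_succ, add_comm]
      have hce : (T'.erase l).card = n := by rw [card_erase_of_mem hl, hc]; rfl
      refine add_le_add (ih _ ((erase_subset _ _).trans hT) hce) ?_
      exact pow_le_pow_of_le_one h0 h1.le (by omega)
  refine (key _ T subset_rfl rfl).trans ?_
  simp only [pow_add, ← mul_sum]
  rw [div_eq_mul_inv]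
  refine mul_le_mul_of_nonneg_left ?_ (by positivity)
  rw [← tsum_geometric_of_lt_one h0 h1]
  exact (summable_geometric_of_lt_one h0 h1).sum_le_tsum _ fun _ _ => by positivity

variable {E : Type*} [NormedAddCommGroup E] [NormedSpace ℝ E]

lemma norm_sub_lt_of_direction {u v : E} (hu : u ≠ 0) (huv : ‖u‖ ≤ ‖v‖)
    (h : ‖‖v‖⁻¹ • v - ‖u‖⁻¹ • u‖ < 1) : ‖v - u‖ < ‖v‖ := by
  have hu0 : 0 < ‖u‖ := norm_pos_iff.2 hu
  have hv0 : 0 < ‖v‖ := hu0.trans_le huv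
  have e : v - u = (1 - ‖u‖ * ‖v‖⁻¹) • v + ‖u‖ • (‖v‖⁻¹ • v - ‖u‖⁻¹ • u) := by
    rw [smul_sub, smul_smul, smul_smul, mul_inv_cancel₀ hu0.ne', sub_smul, one_smul, one_smul]
    abel
  rw [e]
  refine (norm_add_le _ _).trans_lt ?_
  rw [norm_smul, norm_smul, Real.norm_of_nonneg hu0.le, Real.norm_of_nonneg (by
    rw [sub_nonneg, ← div_eq_mul_inv, div_le_one hv0]; exact huv)]
  have : (1 - ‖u‖ * ‖v‖⁻¹) * ‖v‖ = ‖v‖ - ‖u‖ := by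
    rw [sub_mul, inv_mul_cancel_right₀ hv0.ne', one_mul]
  rw [this]
  nlinarith

variable [FiniteDimensional ℝ E]

lemma sum_biUnion_le_sum {ι κ : Type*} [DecidableEq ι] (t : Finset κ) (F : κ → Finset ι)
    {g : ι → ℝ} (hg : ∀ i, 0 ≤ g i) : ∑ i ∈ t.biUnion F, g i ≤ ∑ c ∈ t, ∑ i ∈ F c, g i := by
  classical
  induction t using Finset.induction_on with
  | empty => simp
  | insert c t hc ih =>
    rw [biUnion_insert, sum_insert hc]
    have := sum_union_inter (s₁ := F c) (s₂ := t.biUnion F) (f := g)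
    have : 0 ≤ ∑ i ∈ F c ∩ t.biUnion F, g i := sum_nonneg fun i _ => hg i
    linarith

open Classical in
/-- Stone's lemma. Seen from a point `y`, the points of a configuration lie in finitely many narrow
cones, and in each cone the ranks of `y` as a neighbour of the points are spread out. -/
lemma exists_sum_pow_rank_le (E : Type*) [NormedAddCommGroup E] [NormedSpace ℝ E]
    [FiniteDimensional ℝ E] : ∃ γ : ℝ, 0 ≤ γ ∧ ∀ β : ℝ, 0 ≤ β → β < 1 →
    ∀ (S : Finset ℕ) (x : ℕ → E) (y : E) (f : ℕ → ℕ),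
      (∀ l ∈ S, x l ≠ y → (S.filter fun k => k ≠ l ∧ ‖x k - x l‖ < ‖x l - y‖).card ≤ f l) →
      ∑ l ∈ S with x l ≠ y, β ^ f l ≤ γ / (1 - β) := by
  have hcpt : IsCompact (Metric.sphere (0 : E) 1) := isCompact_sphere _ _
  obtain ⟨t, -, htf, ht⟩ := hcpt.finite_cover_balls (show (0 : ℝ) < 1 / 2 by norm_num)
  refine ⟨htf.toFinset.card, by positivity, fun β h0 h1 S x y f hf => ?_⟩
  set dir : ℕ → E := fun l => ‖x l - y‖⁻¹ • (x l - y) with hdir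
  have hcov : S.filter (fun l => x l ≠ y) ⊆
      htf.toFinset.biUnion fun c => S.filter fun l => x l ≠ y ∧ dir l ∈ Metric.ball c (1 / 2) := by
    intro l hl
    rw [mem_filter] at hl
    have h3 : dir l ∈ Metric.sphere (0 : E) 1 := by
      rw [mem_sphere_zero_iff_norm, hdir, norm_smul, norm_inv, norm_norm,
        inv_mul_cancel₀ (norm_ne_zero_iff.2 (sub_ne_zero.2 hl.2))]
    obtain ⟨c, hc, hlc⟩ := Set.mem_iUnion₂.1 (ht h3)
    exact mem_biUnion.2 ⟨c, htf.mem_toFinset.2 hc, mem_filter.2 ⟨hl.1, hl.2, hlc⟩⟩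
  have hcone : ∀ c, ∑ l ∈ S.filter (fun l => x l ≠ y ∧ dir l ∈ Metric.ball c (1 / 2)), β ^ f l
      ≤ 1 / (1 - β) := by
    intro c
    refine (sum_pow_le_of_spread h0 h1 _ f 0 fun T' hT' hne => ?_).trans (by rw [pow_zero])
    obtain ⟨l, hl, hmax⟩ := exists_max_image T' (fun l => ‖x l - y‖) hne
    refine ⟨l, hl, ?_⟩
    have hlS := mem_filter.1 (hT' hl)
    rw [zero_add, ← card_erase_of_mem hl]
    refine le_trans (card_le_card fun k hk => ?_) (hf l hlS.1 hlS.2.1)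
    rw [mem_erase] at hk
    have hkS := mem_filter.1 (hT' hk.2)
    refine mem_filter.2 ⟨hkS.1, hk.1, ?_⟩
    have h4 : ‖dir l - dir k‖ < 1 := by
      rw [← dist_eq_norm]
      calc _ ≤ dist (dir l) c + dist (dir k) c := dist_triangle_right _ _ _
        _ < 1 / 2 + 1 / 2 := add_lt_add hlS.2.2 hkS.2.2
        _ = 1 := by norm_num
    have h5 := norm_sub_lt_of_direction (sub_ne_zero.2 hkS.2.1) (hmax k hk.2) h4
    rw [norm_sub_rev]
    rwa [sub_sub_sub_cancel_right] at h5
  calc _ ≤ ∑ l ∈ htf.toFinset.biUnion fun c => S.filter fun l => x l ≠ y ∧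
          dir l ∈ Metric.ball c (1 / 2), β ^ f l :=
        sum_le_sum_of_subset_of_nonneg hcov fun _ _ _ => by positivity
    _ ≤ ∑ c ∈ htf.toFinset, ∑ l ∈ S.filter fun l => x l ≠ y ∧
          dir l ∈ Metric.ball c (1 / 2), β ^ f l :=
        sum_biUnion_le_sum _ _ fun _ => by positivity
    _ ≤ ∑ c ∈ htf.toFinset, 1 / (1 - β) := sum_le_sum fun c _ => hcone c
    _ = _ := by rw [sum_const, nsmul_eq_mul, mul_one_div]

/-- `j` precedes `l` as a neighbour of `i`, for the distances `d`. -/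
def Closer (d : ℕ → ℕ → ℝ) (i j l : ℕ) : Prop := d i j < d i l ∨ (d i j = d i l ∧ j < l)

lemma Closer.trans {d : ℕ → ℕ → ℝ} {i j k l : ℕ} (h1 : Closer d i j k) (h2 : Closer d i k l) :
    Closer d i j l := by
  unfold Closer at *; grind

lemma Closer.total (d : ℕ → ℕ → ℝ) (i : ℕ) {j l : ℕ} (h : j ≠ l) :
    Closer d i j l ∨ Closer d i l j := by
  unfold Closer; grind

open Classical in
/-- The number of units of `S` that precede `j` as a neighbour of unit `l`. -/
def nbrRank (S : Finset ℕ) (d : ℕ → ℕ → ℝ) (l j : ℕ) : ℕ :=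
  (S.filter fun k => k ≠ l ∧ Closer d l k j).card

open Classical in
/-- Every finite set of units has a last one in the order of closeness to `i`. -/
lemma exists_last_closer (d : ℕ → ℕ → ℝ) (i : ℕ) {T : Finset ℕ} (hT : T.Nonempty) :
    ∃ l ∈ T, ∀ k ∈ T, k ≠ l → Closer d i k l := by
  obtain ⟨l, hl, hmax⟩ := exists_max_image T (fun l => toLex (d i l, l)) hT
  refine ⟨l, hl, fun k hk hkl => ?_⟩
  have := hmax k hk
  rw [Prod.Lex.le_iff] at this
  simp only [ofLex_toLex] at this
  unfold Closer
  rcases this with h | ⟨h, h'⟩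
  · exact Or.inl h
  · exact Or.inr ⟨h, lt_of_le_of_ne h' hkl⟩

/-- Summed over the pairs of points of a bounded configuration, the `k`-th powers of the distances,
discounted by rank, are bounded, `k` being the dimension: write the powers as volumes of
balls, and apply Stone's lemma at each point. -/
lemma exists_sum_pow_rank_mul_dist_le (E : Type*) [NormedAddCommGroup E] [NormedSpace ℝ E]
    [FiniteDimensional ℝ E] [Nontrivial E] {β : ℝ} (h0 : 0 ≤ β) (h1 : β < 1) (Δ : ℝ) :
    ∃ C : ℝ, 0 ≤ C ∧ ∀ (S : Finset ℕ) (x : ℕ → E), (∀ j ∈ S, ‖x j‖ ≤ Δ) →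
      ∑ j ∈ S, ∑ l ∈ S.erase j, β ^ nbrRank S (fun i k => dist (x i) (x k)) j l *
        dist (x j) (x l) ^ Module.finrank ℝ E ≤ C := by
  classical
  obtain ⟨γ, hγ0, hγ⟩ := exists_sum_pow_rank_le E
  let _ : MeasurableSpace E := borel E
  have : BorelSpace E := ⟨rfl⟩
  set μ : Measure E := Measure.addHaar
  set b : ℝ := μ.real (Metric.ball 0 1) with hb
  have hb0 : 0 < b := ENNReal.toReal_pos (Metric.measure_ball_pos μ _ one_pos).ne'
    measure_ball_lt_top.ne
  set U : Set E := Metric.ball 0 (3 * Δ)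
  have hU : μ U ≠ ∞ := measure_ball_lt_top.ne
  have hβ : 0 < 1 - β := by linarith
  refine ⟨b⁻¹ * (μ.real U * (γ / (1 - β) / (1 - β))), by positivity, fun S x hx => ?_⟩
  set d : ℕ → ℕ → ℝ := fun i k => dist (x i) (x k) with hd
  have hball : ∀ j l, d j l ^ Module.finrank ℝ E = b⁻¹ * μ.real (Metric.ball (x j) (d j l)) := by
    intro j l
    rw [measureReal_def, Measure.addHaar_ball μ _ dist_nonneg, ENNReal.toReal_mul,
      ENNReal.toReal_ofReal (by positivity), ← measureReal_def, ← hb,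
      mul_comm, mul_assoc, mul_inv_cancel₀ hb0.ne', mul_one]
  have hsub : ∀ j ∈ S, ∀ l ∈ S, Metric.ball (x j) (d j l) ⊆ U := by
    intro j hj l hl y hy
    rw [Metric.mem_ball] at hy
    rw [mem_ball_zero_iff]
    have h3 : d j l ≤ Δ + Δ := (dist_le_norm_add_norm _ _).trans (add_le_add (hx j hj) (hx l hl))
    have h4 : ‖y‖ ≤ ‖x j‖ + dist y (x j) := by
      rw [dist_eq_norm]; simpa using norm_add_le (x j) (y - x j)
    linarith [hx j hj]
  set F : E → ℝ := fun y => ∑ j ∈ S, ∑ l ∈ S.erase j, β ^ nbrRank S d j l *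
    (Metric.ball (x j) (d j l)).indicator (fun _ => (1 : ℝ)) y with hF
  have hind : ∀ j l, Integrable ((Metric.ball (x j) (d j l)).indicator fun _ => (1 : ℝ)) μ :=
    fun j l => (integrable_indicator_iff measurableSet_ball).2
      (integrableOn_const measure_ball_lt_top.ne)
  have hFint : ∫ y, F y ∂μ = ∑ j ∈ S, ∑ l ∈ S.erase j, β ^ nbrRank S d j l *
      μ.real (Metric.ball (x j) (d j l)) := by
    rw [hF, integral_finsetSum _ fun j _ => integrable_finsetSum _ fun l _ =>
      (hind j l).const_mul _]
    refine sum_congr rfl fun j _ => ?_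
    rw [integral_finsetSum _ fun l _ => (hind j l).const_mul _]
    refine sum_congr rfl fun l _ => ?_
    rw [integral_const_mul, integral_indicator measurableSet_ball]
    simp
  have hnull : ∀ᵐ y ∂μ, ∀ j ∈ S, x j ≠ y := by
    rw [eventually_all_finset]
    exact fun j _ => by
      rw [ae_iff]; simp only [ne_eq, not_not]
      exact measure_mono_null (t := {x j}) (fun y hy => (Set.mem_singleton_iff.2 hy.symm))
        (measure_singleton _)
  have hpt : ∀ᵐ y ∂μ, F y ≤ U.indicator (fun _ => γ / (1 - β) / (1 - β)) y := by
    filter_upwards [hnull] with y hy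
    by_cases hyU : y ∈ U
    · rw [Set.indicator_of_mem hyU]
      set r : ℕ → ℕ := fun j => (S.filter fun k => k ≠ j ∧ ‖x k - x j‖ < ‖x j - y‖).card with hr
      have hin : ∀ j ∈ S, ∑ l ∈ S.erase j, β ^ nbrRank S d j l *
          (Metric.ball (x j) (d j l)).indicator (fun _ => (1 : ℝ)) y ≤ β ^ r j / (1 - β) := by
        intro j hj
        have e : ∑ l ∈ S.erase j, β ^ nbrRank S d j l * (Metric.ball (x j) (d j l)).indicator (fun _
            => (1 : ℝ)) y = ∑ l ∈ (S.erase j).filter (fun l => y ∈ Metric.ball (x j) (d j l)),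
              β ^ nbrRank S d j l := by
          rw [sum_filter]
          refine sum_congr rfl fun l _ => ?_
          rw [Set.indicator_apply]; split_ifs <;> simp
        rw [e]
        refine sum_pow_le_of_spread h0 h1 _ _ _ fun T' hT' hne => ?_
        obtain ⟨l, hl, hlast⟩ := exists_last_closer d j hne
        refine ⟨l, hl, ?_⟩
        have hlm := mem_filter.1 (hT' hl)
        have hly : ‖x j - y‖ < d j l := by
          have := Metric.mem_ball.1 hlm.2
          rwa [dist_comm, dist_eq_norm] at this
        rw [← card_erase_of_mem hl, hr, ← card_union_of_disjoint]
        · refine card_le_card fun k hk => ?_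
          rcases mem_union.1 hk with hk | hk
          · obtain ⟨hkS, hkj, hlt⟩ := mem_filter.1 hk
            refine mem_filter.2 ⟨hkS, hkj, Or.inl ?_⟩
            rw [hd]; simp only [dist_eq_norm]; rw [norm_sub_rev]
            refine hlt.trans ?_
            rw [hd] at hly; simpa only [dist_eq_norm] using hly
          · rw [mem_erase] at hk
            have hkm := mem_erase.1 (mem_filter.1 (hT' hk.2)).1
            exact mem_filter.2 ⟨hkm.2, hkm.1, hlast k hk.2 hk.1⟩
        · rw [disjoint_left]
          intro k hk hk'
          have hky := Metric.mem_ball.1 (mem_filter.1 (hT' (mem_of_mem_erase hk'))).2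
          have hlt := (mem_filter.1 hk).2.2
          rw [hd] at hky; simp only [dist_eq_norm] at hky
          rw [norm_sub_rev (x k), norm_sub_rev (x j) y] at hlt
          linarith
      calc F y ≤ ∑ j ∈ S, β ^ r j / (1 - β) := sum_le_sum hin
        _ = (∑ j ∈ S with x j ≠ y, β ^ r j) / (1 - β) := by
          rw [filter_true_of_mem fun j hj => hy j hj, sum_div]
        _ ≤ _ := by refine div_le_div_of_nonneg_right (hγ β h0 h1 S x y r fun j _ _ => le_rfl) hβ.le
    · rw [Set.indicator_of_notMem hyU]
      refine (sum_eq_zero fun j hj => sum_eq_zero fun l hl => ?_).le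
      rw [Set.indicator_of_notMem fun h => hyU (hsub j hj l (mem_of_mem_erase hl) h), mul_zero]
  calc _ = b⁻¹ * ∫ y, F y ∂μ := by
        rw [hFint, mul_sum]
        refine sum_congr rfl fun j _ => ?_
        rw [mul_sum]
        refine sum_congr rfl fun l _ => ?_
        rw [show dist (x j) (x l) = d j l from rfl, hball]; ring
    _ ≤ b⁻¹ * ∫ y, U.indicator (fun _ => γ / (1 - β) / (1 - β)) y ∂μ := by
        refine mul_le_mul_of_nonneg_left (integral_mono_ae ?_ ?_ hpt) (by positivity)
        · exact integrable_finsetSum _ fun j _ => integrable_finsetSum _ fun l _ =>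
            (hind j l).const_mul _
        · exact (integrable_indicator_iff measurableSet_ball).2 (integrableOn_const hU)
    _ = _ := by rw [integral_indicator measurableSet_ball, setIntegral_const, smul_eq_mul]

end Geometry

/-! ### Matching with replacement -/

section Matching

variable {S : Finset ℕ} {A : ℕ → Bool} {Y : ℕ → ℝ} {d : ℕ → ℕ → ℝ} {M : ℕ}

open Classical in
/-- The units of `S` with treatment different from that of unit `j` that precede `l` as a neighbour
of `j`. -/
def oppCloser (S : Finset ℕ) (A : ℕ → Bool) (d : ℕ → ℕ → ℝ) (j l : ℕ) : Finset ℕ :=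
  S.filter fun k => A k ≠ A j ∧ (d j k < d j l ∨ (d j k = d j l ∧ k < l))

lemma mem_oppCloser {j k l : ℕ} : k ∈ oppCloser S A d j l ↔ k ∈ S ∧ A k ≠ A j ∧ Closer d j k l := by
  simp [oppCloser, Closer]

lemma mem_matchSet {j l : ℕ} :
    l ∈ matchSet S A d M j ↔ l ∈ S ∧ A l ≠ A j ∧ (oppCloser S A d j l).card < M := by
  simp only [matchSet, mem_filter, oppCloser]

lemma card_matchSet_le (S : Finset ℕ) (A : ℕ → Bool) (d : ℕ → ℕ → ℝ) (M j : ℕ) :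
    (matchSet S A d M j).card ≤ M := by
  rcases (matchSet S A d M j).eq_empty_or_nonempty with h | h
  · rw [h]; simp
  · obtain ⟨l, hl, hlast⟩ := exists_last_closer d j h
    have h1 := (mem_matchSet.1 hl).2.2
    have h2 : (matchSet S A d M j).erase l ⊆ oppCloser S A d j l := fun k hk => by
      rw [mem_erase] at hk
      have := mem_matchSet.1 hk.2
      exact mem_oppCloser.2 ⟨this.1, this.2.1, hlast k hk.2 hk.1⟩
    have h3 := card_le_card h2
    rw [card_erase_of_mem hl] at h3
    omega

lemma card_matchSet_eq {j : ℕ} (h : M ≤ (S.filter fun k => A k ≠ A j).card) :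
    (matchSet S A d M j).card = M := by
  refine le_antisymm (card_matchSet_le S A d M j) (not_lt.1 fun hlt => ?_)
  have hne : ((S.filter fun k => A k ≠ A j) \ matchSet S A d M j).Nonempty := by
    rw [sdiff_nonempty]
    exact fun hs => absurd (card_le_card hs) (by omega)
  obtain ⟨l, hl, hmin⟩ := exists_min_image _ (fun l => toLex (d j l, l)) hne
  rw [Finset.mem_sdiff, mem_filter] at hl
  refine hl.2 (mem_matchSet.2 ⟨hl.1.1, hl.1.2, (card_le_card fun k hk => ?_).trans_lt hlt⟩)
  by_contra hk'
  have hk := mem_oppCloser.1 hk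
  have := hmin k (Finset.mem_sdiff.2 ⟨mem_filter.2 ⟨hk.1, hk.2.1⟩, hk'⟩)
  rw [Prod.Lex.le_iff] at this
  simp only [ofLex_toLex] at this
  have := hk.2.2
  unfold Closer at this
  grind

lemma matchEst_eq_sum (S : Finset ℕ) (A : ℕ → Bool) (Y : ℕ → ℝ) (d : ℕ → ℕ → ℝ) (M : ℕ)
    (mu : Bool → ℕ → ℝ) : matchEst S A Y d M mu = (S.card : ℝ)⁻¹ * ∑ j ∈ S, sgn (A j) *
      (Y j - (M : ℝ)⁻¹ * ∑ l ∈ matchSet S A d M j, (Y l + (mu (!A j) j - mu (!A j) l))) := by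
  unfold matchEst matchRaw matchBias
  rw [← mul_assoc, ← mul_inv, Real.mul_self_sqrt (Nat.cast_nonneg _), ← mul_sub, ← sum_sub_distrib]
  congr 1
  refine sum_congr rfl fun j _ => ?_
  rw [sum_add_distrib]
  ring

lemma sgn_mul_self (a : Bool) : sgn a * sgn a = 1 := by cases a <;> simp [sgn]

lemma abs_sgn (a : Bool) : |sgn a| = 1 := by cases a <;> simp [sgn]

/-- When every unit has `M` matches, the bias-corrected estimator is an average over units of
regression differences and weighted residuals. -/
lemma matchEst_eq (hM : 0 < M) (h : ∀ j ∈ S, (matchSet S A d M j).card = M)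
    (mu : Bool → ℕ → ℝ) : matchEst S A Y d M mu = (S.card : ℝ)⁻¹ * ∑ j ∈ S,
      (mu true j - mu false j + sgn (A j) * matchWeight S A d M j * (Y j - mu (A j) j)) := by
  classical
  have hM0 : (M : ℝ) ≠ 0 := by positivity
  rw [matchEst_eq_sum]
  congr 1
  set r : ℕ → ℝ := fun l => sgn (A l) * (Y l - mu (A l) l) with hr
  have h1 : ∀ j ∈ S, sgn (A j) * (Y j - (M : ℝ)⁻¹ * ∑ l ∈ matchSet S A d M j, (Y l + (mu (!A j) j -
      mu (!A j) l))) = mu true j - mu false j + r j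
        + (M : ℝ)⁻¹ * ∑ l ∈ S, if l ∈ matchSet S A d M j then r l else 0 := by
    intro j hj
    have e0 : ∑ l ∈ S, (if l ∈ matchSet S A d M j then r l else 0)
        = ∑ l ∈ matchSet S A d M j, r l := by
      rw [← sum_filter]
      congr 1
      ext l
      simp only [mem_filter, and_iff_right_iff_imp]
      exact fun hl => (mem_matchSet.1 hl).1
    have e1 : ∑ l ∈ matchSet S A d M j, r l
        = - sgn (A j) * ∑ l ∈ matchSet S A d M j, (Y l - mu (!A j) l) := by
      rw [mul_sum]
      refine sum_congr rfl fun l hl => ?_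
      have : A l = !A j := Bool.eq_not.2 (mem_matchSet.1 hl).2.1
      simp only [hr, this]
      cases A j <;> simp [sgn]
    have e2 : ∑ l ∈ matchSet S A d M j, (Y l + (mu (!A j) j - mu (!A j) l))
        = M * mu (!A j) j + ∑ l ∈ matchSet S A d M j, (Y l - mu (!A j) l) := by
      rw [sum_congr rfl fun l _ => show Y l + (mu (!A j) j - mu (!A j) l)
        = mu (!A j) j + (Y l - mu (!A j) l) by ring, sum_add_distrib, sum_const,
        h j hj, nsmul_eq_mul]
    rw [e0, e1, e2, mul_add, inv_mul_cancel_left₀ hM0]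
    simp only [hr]
    cases A j <;> simp [sgn] <;> ring
  rw [sum_congr rfl h1, sum_add_distrib, ← mul_sum, sum_comm, mul_sum, ← sum_add_distrib]
  refine sum_congr rfl fun l _ => ?_
  rw [← sum_filter, sum_const, nsmul_eq_mul]
  simp only [matchWeight, hr]
  ring

lemma sum_matchTerm_eq_zero (hM : 0 < M) (hS : S.Nonempty) (h : ∀ j ∈ S, (matchSet S A d M j).card =
    M) (mu : Bool → ℕ → ℝ) : ∑ j ∈ S, matchTerm S A Y d M mu (matchEst S A Y d M mu) j = 0 := by
  have hc : (S.card : ℝ) ≠ 0 := by exact_mod_cast (card_pos.2 hS).ne'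
  rw [matchEst_eq hM h]
  simp only [matchTerm]
  have : ∀ j, ∀ t : ℝ, mu true j - mu false j - t
      + sgn (A j) * matchWeight S A d M j * (Y j - mu (A j) j) = (mu true j - mu false j
      + sgn (A j) * matchWeight S A d M j * (Y j - mu (A j) j)) - t := fun j t => by ring
  simp only [this]
  rw [sum_sub_distrib, sum_const, nsmul_eq_mul, mul_inv_cancel_left₀ hc, sub_self]

/-- The total distance between the units of `S` and their matches. -/
def matchDist (S : Finset ℕ) (A : ℕ → Bool) (d : ℕ → ℕ → ℝ) (M : ℕ) : ℝ :=
  ∑ j ∈ S, ∑ l ∈ matchSet S A d M j, d j l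

/-- The bias correction changes little when the estimated mean functions change by a function with
small Lipschitz constant. -/
lemma abs_matchEst_sub_le {mu mu' : Bool → ℕ → ℝ} {c : ℝ}
    (h : ∀ a, ∀ j ∈ S, ∀ l ∈ S, |(mu a j - mu' a j) - (mu a l - mu' a l)| ≤ c * d j l) :
    |matchEst S A Y d M mu - matchEst S A Y d M mu'|
      ≤ (M : ℝ)⁻¹ * (c * ((S.card : ℝ)⁻¹ * matchDist S A d M)) := by
  rw [matchEst_eq_sum, matchEst_eq_sum, ← mul_sub, ← sum_sub_distrib, abs_mul,
    abs_of_nonneg (by positivity : (0 : ℝ) ≤ (S.card : ℝ)⁻¹)]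
  have : ∀ j ∈ S, |sgn (A j) * (Y j - (M : ℝ)⁻¹ * ∑ l ∈ matchSet S A d M j, (Y l + (mu (!A j) j - mu
      (!A j) l))) - sgn (A j) * (Y j - (M : ℝ)⁻¹ * ∑ l ∈ matchSet S A d M j, (Y l + (mu' (!A j) j -
      mu' (!A j) l)))| ≤ (M : ℝ)⁻¹ * (c * ∑ l ∈ matchSet S A d M j, d j l) := by
    intro j hj
    rw [← mul_sub, abs_mul, abs_sgn, one_mul, sub_sub_sub_cancel_left, ← mul_sub,
      ← sum_sub_distrib, abs_mul, abs_of_nonneg (by positivity : (0 : ℝ) ≤ (M : ℝ)⁻¹), mul_sum]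
    refine mul_le_mul_of_nonneg_left ((abs_sum_le_sum_abs _ _).trans
      (sum_le_sum fun l hl => ?_)) (by positivity)
    refine le_trans (le_of_eq ?_) (h (!A j) j hj l (mem_matchSet.1 hl).1)
    rw [← abs_neg]; congr 1; ring
  calc _ ≤ (S.card : ℝ)⁻¹ * ∑ j ∈ S, (M : ℝ)⁻¹ * (c * ∑ l ∈ matchSet S A d M j, d j l) :=
        mul_le_mul_of_nonneg_left ((abs_sum_le_sum_abs _ _).trans (sum_le_sum this)) (by positivity)
    _ = _ := by rw [← mul_sum, ← mul_sum, matchDist]; ring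

lemma one_le_matchWeight (S : Finset ℕ) (A : ℕ → Bool) (d : ℕ → ℕ → ℝ) (M j : ℕ) :
    1 ≤ matchWeight S A d M j := by
  unfold matchWeight
  exact le_add_of_nonneg_right (by positivity)

lemma matchWeight_le (hM : 0 < M) (S : Finset ℕ) (A : ℕ → Bool) (d : ℕ → ℕ → ℝ) (j : ℕ) :
    matchWeight S A d M j ≤ 1 + S.card := by
  unfold matchWeight
  have h1 : (M : ℝ)⁻¹ ≤ 1 := inv_le_one_of_one_le₀ (by exact_mod_cast hM)
  have h2 : (((S.filter fun l => j ∈ matchSet S A d M l).card : ℕ) : ℝ) ≤ S.card := by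
    exact_mod_cast card_filter_le _ _
  nlinarith [Nat.cast_nonneg (α := ℝ) (S.filter fun l => j ∈ matchSet S A d M l).card]

/-! #### Measurability -/

section Measurability

variable {Ω : Type*} {ℱ : MeasurableSpace Ω} {A : Ω → ℕ → Bool} {d : Ω → ℕ → ℕ → ℝ}

lemma measurable_of_validation {T : Ω → Finset ℕ} (hT : Measurable T) {β : Type*} [MeasurableSpace
    β] {F : Finset ℕ → Ω → β} (hF : ∀ s, Measurable (F s)) : Measurable fun ω => F (T ω) ω :=
  (measurable_from_prod_countable_right (f := fun x : Finset ℕ × Ω => F x.1 x.2) hF).comp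
    (hT.prodMk measurable_id)

lemma measurableSet_card_filter_lt (S : Finset ℕ) {p : ℕ → Ω → Prop}
    [∀ ω, DecidablePred fun k => p k ω] (hp : ∀ k, MeasurableSet {ω | p k ω}) (M : ℕ) :
    MeasurableSet {ω | (S.filter fun k => p k ω).card < M} := by
  have : Measurable fun ω => (S.filter fun k => p k ω).card := by
    simp only [card_filter]
    exact Finset.measurable_fun_sum _ fun k _ => Measurable.ite (hp k) measurable_const
      measurable_const
  exact this measurableSet_Iio

lemma measurableSet_closer (hd : ∀ i j, Measurable fun ω => d ω i j) (i j l : ℕ) :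
    MeasurableSet {ω | Closer (d ω) i j l} := by
  unfold Closer
  exact (measurableSet_lt (hd i j) (hd i l)).union ((measurableSet_eq_fun (hd i j) (hd i l)).inter
    (MeasurableSet.const _))

lemma measurableSet_mem_matchSet (hA : ∀ i, Measurable fun ω => A ω i)
    (hd : ∀ i j, Measurable fun ω => d ω i j) (S : Finset ℕ) (M j l : ℕ) :
    MeasurableSet {ω | l ∈ matchSet S (A ω) (d ω) M j} := by
  classical
  have hne : ∀ k, MeasurableSet {ω | A ω k ≠ A ω j} := fun k =>
    (measurableSet_eq_fun (hA k) (hA j)).compl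
  simp only [mem_matchSet, oppCloser]
  exact (MeasurableSet.const _).inter ((hne l).inter (measurableSet_card_filter_lt S
    (p := fun k ω => A ω k ≠ A ω j ∧ (d ω j k < d ω j l ∨ (d ω j k = d ω j l ∧ k < l)))
    (fun k => (hne k).inter (measurableSet_closer hd j k l)) M))

lemma measurable_matchWeight (hA : ∀ i, Measurable fun ω => A ω i)
    (hd : ∀ i j, Measurable fun ω => d ω i j) {T : Ω → Finset ℕ} (hT : Measurable T) (M j : ℕ) :
    Measurable fun ω => matchWeight (T ω) (A ω) (d ω) M j := by
  classical
  refine measurable_of_validation hT (F := fun s ω => matchWeight s (A ω) (d ω) M j) fun s => ?_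
  unfold matchWeight
  refine Measurable.const_add (Measurable.const_mul ?_ _) _
  simp only [card_filter, Nat.cast_sum, Nat.cast_ite, Nat.cast_one, Nat.cast_zero]
  exact Finset.measurable_fun_sum _ fun l _ => Measurable.ite
    (measurableSet_mem_matchSet hA hd s M l j) measurable_const measurable_const

lemma measurable_sum_matchSet (hA : ∀ i, Measurable fun ω => A ω i) (hd : ∀ i j, Measurable fun ω =>
    d ω i j) (S : Finset ℕ) (M j : ℕ) {g : ℕ → Ω → ℝ} (hg : ∀ l, Measurable (g l)) : Measurable fun
    ω => ∑ l ∈ matchSet S (A ω) (d ω) M j, g l ω := by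
  classical
  have : ∀ ω, ∑ l ∈ matchSet S (A ω) (d ω) M j, g l ω
      = ∑ l ∈ S, if l ∈ matchSet S (A ω) (d ω) M j then g l ω else 0 := by
    intro ω
    rw [← sum_filter]
    congr 1
    ext l
    simp only [mem_filter, iff_and_self]
    exact fun hl => (mem_matchSet.1 hl).1
  simp only [this]
  exact Finset.measurable_fun_sum _ fun l _ => Measurable.ite
    (measurableSet_mem_matchSet hA hd S M j l) (hg l) measurable_const

lemma measurable_matchDist (hA : ∀ i, Measurable fun ω => A ω i)
    (hd : ∀ i j, Measurable fun ω => d ω i j) {T : Ω → Finset ℕ} (hT : Measurable T) (M : ℕ) :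
    Measurable fun ω => matchDist (T ω) (A ω) (d ω) M :=
  measurable_of_validation hT (F := fun s ω => matchDist s (A ω) (d ω) M) fun s =>
    Finset.measurable_fun_sum _ fun j _ => measurable_sum_matchSet hA hd s M j fun l => hd j l

lemma measurable_matchEst (hA : ∀ i, Measurable fun ω => A ω i) (hd : ∀ i j, Measurable fun ω => d ω
    i j) {Y : Ω → ℕ → ℝ} (hY : ∀ i, Measurable fun ω => Y ω i) {mu : Ω → Bool → ℕ → ℝ} (hmu : ∀ a i,
    Measurable fun ω => mu ω a i) {T : Ω → Finset ℕ} (hT : Measurable T) (M : ℕ) : Measurable fun ω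
    => matchEst (T ω) (A ω) (Y ω) (d ω) M (mu ω) := by
  refine measurable_of_validation hT
    (F := fun s ω => matchEst s (A ω) (Y ω) (d ω) M (mu ω)) fun s => ?_
  simp only [matchEst_eq_sum]
  have hmu' : ∀ i l, Measurable fun ω => mu ω (!A ω i) l := fun i l =>
    (measurable_from_prod_countable_right (f := fun x : Bool × Ω => mu x.2 x.1 l)
      fun a => hmu a l).comp (((Measurable.of_discrete (f := fun b : Bool => !b)).comp (hA i)).prodMk measurable_id)
  refine Measurable.const_mul (Finset.measurable_fun_sum _ fun j _ =>
    (measurable_sgn.comp (hA j)).mul ((hY j).sub (Measurable.const_mul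
    (measurable_sum_matchSet hA hd s M j fun l => (hY l).add ((hmu' j j).sub (hmu' j l))) _))) _

end Measurability

end Matching

/-! ### Moments of the match counts and of the matching distances -/

section Thinning

/-- The σ-algebra of the covariates `(X, U)` of a unit. -/
abbrev covAlg (p q : ℕ) : MeasurableSpace (Rec p q) := MeasurableSpace.comap covXU inferInstance

lemma Overlap.exists_lower {Q : Measure (Rec p q)} [IsProbabilityMeasure Q] (h : Overlap Q) :
    ∃ c : ℝ, 0 < c ∧ c ≤ 1 ∧ ∀ a, ∀ᵐ r ∂Q,
      (Q[fun r' => -(if trt r' = a then (1 : ℝ) else 0) | covAlg p q]) r ≤ -c := by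
  obtain ⟨c₁, c₂, h1, h2, h⟩ := h
  have hi : Integrable (fun r : Rec p q => if trt r then (1 : ℝ) else 0) Q :=
    Integrable.of_bound (Measurable.ite (measurable_trt (measurableSet_singleton true))
      measurable_const measurable_const).aestronglyMeasurable 1
      (ae_of_all _ fun r => by split_ifs <;> simp)
  refine ⟨min (min c₁ (1 - c₂)) 1, by simp [h1, h2], min_le_right _ _, fun a => ?_⟩
  have hm : covAlg p q ≤ recAlg p q := measurable_covXU.comap_le
  cases a with
  | true =>
    have : Q[fun r' => -(if trt r' = true then (1 : ℝ) else 0) | covAlg p q]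
      =ᵐ[Q] -Q[fun r' => if trt r' then (1 : ℝ) else 0 | covAlg p q] := condExp_neg _ _
    filter_upwards [h, this] with r hr e
    rw [e, Pi.neg_apply]
    exact neg_le_neg (((min_le_left _ _).trans (min_le_left _ _)).trans hr.1)
  | false =>
    have e0 : (fun r' : Rec p q => -(if trt r' = false then (1 : ℝ) else 0))
        = (fun r' => if trt r' then (1 : ℝ) else 0) - fun _ => 1 := by
      ext r; cases hr : trt r <;> simp [hr]
    have : Q[fun r' => -(if trt r' = false then (1 : ℝ) else 0) | covAlg p q]
        =ᵐ[Q] Q[fun r' => if trt r' then (1 : ℝ) else 0 | covAlg p q]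
          - Q[fun _ => (1 : ℝ) | covAlg p q] := by
      rw [e0]; exact condExp_sub hi (integrable_const _) _
    filter_upwards [h, this] with r hr e
    rw [e, Pi.sub_apply, condExp_const hm]
    have : min (min c₁ (1 - c₂)) 1 ≤ 1 - c₂ := (min_le_left _ _).trans (min_le_right _ _)
    linarith [hr.2]

lemma Design.known_le (des : IsDesign) {m : MeasurableSpace (Rec p q)}
    (hm : m ≤ recAlg p q) (n j : ℕ) : 𝒦 m n j ≤ mΩ :=
  revealed_le (m𝒵 := recAlg p q) hm (des.measurable_S n) des.measurable_Z j

lemma integrable_of_abs_le {f : Ω → ℝ} (hf : Measurable f) {b : ℝ} (hb : ∀ ω, |f ω| ≤ b) :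
    Integrable f P :=
  Integrable.of_bound hf.aestronglyMeasurable b (ae_of_all _ hb)

/-- Given the covariates, the treatments are independent and take each value with probability at
least `c`: integrate them out one at a time. -/
lemma Design.integral_mul_prod_le (des : IsDesign) (n : ℕ) {c : ℝ} (hc1 : c ≤ 1) {a : Bool} (hc :
    ∀ᵐ r ∂Q, (Q[fun r' => -(if trt r' = a then (1 : ℝ) else 0) | covAlg p q]) r ≤ -c) {I : ℕ → Ω →
    ℝ} (hI : ∀ k j, Measurable[known (covAlg p q) (S₂ n) Z j] (I k)) (hI0 : ∀ k ω, 0 ≤ I k ω) (hI1 :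
    ∀ k ω, I k ω ≤ 1) (N : ℕ) : ∀ {G : Ω → ℝ}, (∀ j, Measurable[known (covAlg p q) (S₂ n) Z j] G) →
    (∀ ω, 0 ≤ G ω) → ∀ {b : ℝ}, (∀ ω, G ω ≤ b) → ∫ ω, G ω * ∏ k ∈ range N, (1 - I k ω * (if trt (Z k
    ω) = a then (1 : ℝ) else 0) / 2) ∂P
      ≤ ∫ ω, G ω * ∏ k ∈ range N, (1 - I k ω * c / 2) ∂P := by
  have hm : covAlg p q ≤ recAlg p q := measurable_covXU.comap_le
  have hIm : ∀ k, Measurable (I k) := fun k => (hI k 0).mono (des.known_le hm n 0) le_rfl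
  have htm : Measurable fun r : Rec p q => if trt r = a then (1 : ℝ) else 0 :=
    Measurable.ite (measurable_trt (measurableSet_singleton a)) measurable_const measurable_const
  have hfac : ∀ k ω, 0 ≤ 1 - I k ω * (if trt (Z k ω) = a then (1 : ℝ) else 0) / 2 ∧
      1 - I k ω * (if trt (Z k ω) = a then (1 : ℝ) else 0) / 2 ≤ 1 := by
    intro k ω
    have := hI0 k ω; have := hI1 k ω
    split_ifs <;> constructor <;> linarith
  induction N with
  | zero => intro G _ _ b _; simp
  | succ N ih =>
    intro G hG hG0 b hb
    set G' : Ω → ℝ := fun ω => G ω *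
      ∏ k ∈ range N, (1 - I k ω * (if trt (Z k ω) = a then (1 : ℝ) else 0) / 2) with hG'
    have hp : ∀ ω, 0 ≤ ∏ k ∈ range N, (1 - I k ω * (if trt (Z k ω) = a then (1 : ℝ) else 0) / 2) ∧
        ∏ k ∈ range N, (1 - I k ω * (if trt (Z k ω) = a then (1 : ℝ) else 0) / 2) ≤ 1 := fun ω =>
      ⟨prod_nonneg fun k _ => (hfac k ω).1,
        prod_le_one (fun k _ => (hfac k ω).1) fun k _ => (hfac k ω).2⟩
    have hG'm : Measurable[known (covAlg p q) (S₂ n) Z N] G' := by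
      refine (hG N).mul (Finset.measurable_fun_prod _ fun k hk => ?_)
      refine Measurable.const_sub (((hI k N).mul ?_).div_const 2) 1
      exact htm.comp (measurable_revealed_of_ne (m𝒵 := recAlg p q) (mem_range.1 hk).ne)
    have hG'0 : ∀ ω, 0 ≤ G' ω := fun ω => mul_nonneg (hG0 ω) (hp ω).1
    have hG'b : ∀ ω, G' ω ≤ b := fun ω => (mul_le_of_le_one_right (hG0 ω) (hp ω).2).trans (hb ω)
    have hf : Integrable (fun r : Rec p q => -(if trt r = a then (1 : ℝ) else 0)) Q :=
      Integrable.of_bound htm.neg.aestronglyMeasurable 1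
        (ae_of_all _ fun r => by split_ifs <;> simp)
    have hstep := des.integral_mul_le n hm hf N hc (G := fun ω => G' ω * I N ω)
      (hG'm.mul (hI N N)) (fun ω => mul_nonneg (hG'0 ω) (hI0 N ω)) (b := b) fun ω =>
        (mul_le_of_le_one_right (hG'0 ω) (hI1 N ω)).trans (hG'b ω)
    have hG'M : Measurable G' := hG'm.mono (des.known_le hm n N) le_rfl
    have i1 : Integrable G' P := integrable_of_abs_le hG'M fun ω => by
      rw [abs_of_nonneg (hG'0 ω)]; exact hG'b ω
    have i2 : Integrable (fun ω => G' ω * I N ω) P :=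
      integrable_of_abs_le (hG'M.mul (hIm N)) (b := b) fun ω => by
        rw [abs_of_nonneg (mul_nonneg (hG'0 ω) (hI0 N ω))]
        exact (mul_le_of_le_one_right (hG'0 ω) (hI1 N ω)).trans (hG'b ω)
    have i3 : Integrable (fun ω => G' ω * I N ω * -(if trt (Z N ω) = a then (1 : ℝ) else 0)) P :=
      integrable_of_abs_le ((hG'M.mul (hIm N)).mul (htm.comp (des.measurable_Z N)).neg)
        (b := b) fun ω => by
        have := (mul_le_of_le_one_right (hG'0 ω) (hI1 N ω)).trans (hG'b ω)
        have h0 := mul_nonneg (hG'0 ω) (hI0 N ω)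
        split_ifs
        · rw [mul_neg_one, abs_neg, abs_of_nonneg h0]; exact this
        · simpa using h0.trans this
    have e1 : ∫ ω, G ω *
          ∏ k ∈ range (N + 1), (1 - I k ω * (if trt (Z k ω) = a then (1 : ℝ) else 0) / 2) ∂P
        = ∫ ω, G' ω ∂P + 2⁻¹ *
          ∫ ω, G' ω * I N ω * -(if trt (Z N ω) = a then (1 : ℝ) else 0) ∂P := by
      rw [← integral_const_mul, ← integral_add i1 (i3.const_mul _)]
      refine integral_congr_ae (ae_of_all _ fun ω => ?_)
      simp only [hG', prod_range_succ]
      ring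
    have e2 : ∫ ω, G' ω ∂P + 2⁻¹ * (-c * ∫ ω, G' ω * I N ω ∂P) = ∫ ω, (G ω * (1 - I N ω * c / 2)) *
          ∏ k ∈ range N, (1 - I k ω * (if trt (Z k ω) = a then (1 : ℝ) else 0) / 2) ∂P := by
      rw [← integral_const_mul, ← integral_const_mul,
        ← integral_add i1 ((i2.const_mul _).const_mul _)]
      refine integral_congr_ae (ae_of_all _ fun ω => ?_)
      simp only [hG']
      ring
    have hcfac : ∀ ω, 0 ≤ 1 - I N ω * c / 2 := fun ω => by nlinarith [hI0 N ω, hI1 N ω]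
    rw [e1]
    refine (add_le_add_right (mul_le_mul_of_nonneg_left hstep (by norm_num)) _).trans ?_
    rw [e2]
    refine (ih (G := fun ω => G ω * (1 - I N ω * c / 2)) (b := b * (1 + |c|)) (fun j =>
      (hG j).mul (Measurable.const_sub (((hI N j).mul_const c).div_const 2) 1))
      (fun ω => mul_nonneg (hG0 ω) (hcfac ω)) fun ω => ?_).trans (le_of_eq ?_)
    · refine mul_le_mul (hb ω) ?_ (hcfac ω) ((hG0 ω).trans (hb ω))
      have h3 : -(I N ω * c) ≤ |c| := by
        refine (neg_le_abs _).trans ?_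
        rw [abs_mul, abs_of_nonneg (hI0 N ω)]
        exact mul_le_of_le_one_left (abs_nonneg _) (hI1 N ω)
      have := abs_nonneg c
      linarith
    · refine integral_congr_ae (ae_of_all _ fun ω => ?_)
      simp only [prod_range_succ]
      ring

lemma prod_range_ite_mem {N : ℕ} {T : Finset ℕ} (hT : T ⊆ range N) (x : ℝ) :
    ∏ k ∈ range N, (if k ∈ T then x else 1) = x ^ T.card := by
  rw [← prod_filter, filter_mem_eq_inter, inter_eq_right.2 hT, prod_const]

/-- A set of units that is determined by the covariates is unlikely to contain few units with
treatment `a` unless it is small. -/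
lemma Design.integral_mul_indicator_le (des : IsDesign) (n : ℕ) {c : ℝ} (hc1 : c ≤ 1) {a : Bool}
    (hc : ∀ᵐ r ∂Q, (Q[fun r' => -(if trt r' = a then (1 : ℝ) else 0) | covAlg p q]) r ≤ -c) {T : Ω →
    Finset ℕ} (hT : ∀ k j, MeasurableSet[known (covAlg p q) (S₂ n) Z j] {ω | k ∈ T ω}) {G : Ω → ℝ}
    (hG : ∀ j, Measurable[known (covAlg p q) (S₂ n) Z j] G) (hG0 : ∀ ω, 0 ≤ G ω) {b : ℝ} (hb : ∀ ω,
    G ω ≤ b) (hTN : ∀ ω, G ω ≠ 0 → T ω ⊆ range (n₁ n)) (M : ℕ) : ∫ ω, G ω * (if ((T ω).filter fun k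
    => trt (Z k ω) = a).card < M then 1 else 0) ∂P
      ≤ 2 ^ M * ∫ ω, G ω * (1 - c / 2) ^ (T ω).card ∂P := by
  classical
  have hm : covAlg p q ≤ recAlg p q := measurable_covXU.comap_le
  set I : ℕ → Ω → ℝ := fun k ω => if k ∈ T ω then 1 else 0 with hI
  have hI0 : ∀ k ω, 0 ≤ I k ω := fun k ω => by simp only [hI]; split_ifs <;> norm_num
  have hI1 : ∀ k ω, I k ω ≤ 1 := fun k ω => by simp only [hI]; split_ifs <;> norm_num
  have hIm : ∀ k j, Measurable[known (covAlg p q) (S₂ n) Z j] (I k) := fun k j =>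
    Measurable.ite (hT k j) measurable_const measurable_const
  have hstep := des.integral_mul_prod_le n hc1 hc hIm hI0 hI1 (n₁ n) hG hG0 hb
  have e2 : ∀ ω, G ω * ∏ k ∈ range (n₁ n), (1 - I k ω * c / 2)
      = G ω * (1 - c / 2) ^ (T ω).card := by
    intro ω
    by_cases h0 : G ω = 0
    · rw [h0, zero_mul, zero_mul]
    rw [← prod_range_ite_mem (hTN ω h0)]
    congr 1
    refine prod_congr rfl fun k _ => ?_
    simp only [hI]; split_ifs <;> ring
  simp only [e2] at hstep
  refine le_trans ?_ (mul_le_mul_of_nonneg_left hstep (by positivity))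
  have htm : ∀ k, Measurable fun ω => if trt (Z k ω) = a then (1 : ℝ) else 0 := fun k =>
    Measurable.ite ((measurable_trt.comp (des.measurable_Z k)) (measurableSet_singleton a))
      measurable_const measurable_const
  have hfac : ∀ k ω, 0 ≤ 1 - I k ω * (if trt (Z k ω) = a then (1 : ℝ) else 0) / 2 ∧
      1 - I k ω * (if trt (Z k ω) = a then (1 : ℝ) else 0) / 2 ≤ 1 := by
    intro k ω
    have := hI0 k ω; have := hI1 k ω
    split_ifs <;> constructor <;> linarith
  rw [← integral_const_mul]
  refine integral_mono_of_nonneg (ae_of_all _ fun ω => ?_) (Integrable.const_mul ?_ _)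
    (ae_of_all _ fun ω => ?_)
  · exact mul_nonneg (hG0 ω) (by split_ifs <;> norm_num)
  · refine integrable_of_abs_le (b := b) (((hG 0).mono (des.known_le hm n 0) le_rfl).mul
      (Finset.measurable_fun_prod _ fun k _ => Measurable.const_sub
        ((((hIm k 0).mono (des.known_le hm n 0) le_rfl).mul (htm k)).div_const 2) 1)) fun ω => ?_
    rw [abs_of_nonneg (mul_nonneg (hG0 ω) (prod_nonneg fun k _ => (hfac k ω).1))]
    exact (mul_le_of_le_one_right (hG0 ω) (prod_le_one (fun k _ => (hfac k ω).1)
      fun k _ => (hfac k ω).2)).trans (hb ω)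
  · dsimp only
    by_cases h0 : G ω = 0
    · rw [h0, zero_mul, zero_mul, mul_zero]
    rw [mul_left_comm]
    refine mul_le_mul_of_nonneg_left ?_ (hG0 ω)
    have e1 : ∏ k ∈ range (n₁ n), (1 - I k ω * (if trt (Z k ω) = a then (1 : ℝ) else 0) / 2)
        = (1 / 2) ^ ((T ω).filter fun k => trt (Z k ω) = a).card := by
      rw [← prod_range_ite_mem ((filter_subset _ _).trans (hTN ω h0))]
      refine prod_congr rfl fun k _ => ?_
      simp only [hI, mem_filter]
      split_ifs <;> simp_all
      norm_num
    rw [e1]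
    split_ifs with hlt
    · rw [one_div, inv_pow, ← div_eq_mul_inv, one_le_div (by positivity)]
      exact pow_le_pow_right₀ (by norm_num) hlt.le
    · positivity

end Thinning

section MatchMoments

open Classical in
/-- The units of `S` that precede `j` as a neighbour of `l`. -/
def nbrSet (S : Finset ℕ) (d : ℕ → ℕ → ℝ) (l j : ℕ) : Finset ℕ :=
  S.filter fun k => k ≠ l ∧ Closer d l k j

lemma card_nbrSet (S : Finset ℕ) (d : ℕ → ℕ → ℝ) (l j : ℕ) :
    (nbrSet S d l j).card = nbrRank S d l j := rfl

open Classical in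
/-- Indicator of the event that fewer than `M` units with treatment `a` precede `j` as a neighbour
of `l`. -/
def few (S : Finset ℕ) (A : ℕ → Bool) (d : ℕ → ℕ → ℝ) (M : ℕ) (a : Bool) (l j : ℕ) : ℝ :=
  if ((nbrSet S d l j).filter fun k => A k = a).card < M then 1 else 0

lemma few_nonneg (S : Finset ℕ) (A : ℕ → Bool) (d : ℕ → ℕ → ℝ) (M : ℕ) (a : Bool) (l j : ℕ) :
    0 ≤ few S A d M a l j := by
  unfold few; split_ifs <;> norm_num

lemma few_le_one (S : Finset ℕ) (A : ℕ → Bool) (d : ℕ → ℕ → ℝ) (M : ℕ) (a : Bool) (l j : ℕ) :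
    few S A d M a l j ≤ 1 := by
  unfold few; split_ifs <;> norm_num

lemma ne_of_mem_matchSet {S : Finset ℕ} {A : ℕ → Bool} {d : ℕ → ℕ → ℝ} {M j l : ℕ}
    (h : j ∈ matchSet S A d M l) : l ≠ j := fun e => (mem_matchSet.1 h).2.1 (by rw [e])

lemma one_le_sum_few {S : Finset ℕ} {A : ℕ → Bool} {d : ℕ → ℕ → ℝ} {M j l : ℕ}
    (h : j ∈ matchSet S A d M l) : 1 ≤ ∑ a, few S A d M a l j := by
  classical
  refine le_trans (le_of_eq ?_) (single_le_sum (fun a _ => few_nonneg S A d M a l j)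
    (mem_univ (A j)))
  rw [few, if_pos]
  obtain ⟨-, hne, hlt⟩ := mem_matchSet.1 h
  refine (card_le_card fun k hk => ?_).trans_lt hlt
  obtain ⟨hk, hkj⟩ := mem_filter.1 hk
  obtain ⟨hkS, -, hc⟩ := mem_filter.1 hk
  exact mem_oppCloser.2 ⟨hkS, hkj ▸ hne, hc⟩

open Classical in
/-- Two applications of the Cauchy–Schwarz inequality to the number of times a unit is matched. -/
lemma card_matched_pow_four_le {S : Finset ℕ} {A : ℕ → Bool} {d : ℕ → ℕ → ℝ} {M j : ℕ} {θ Γ : ℝ}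
    (h0 : 0 < θ) (hΓ : ∑ l ∈ S.erase j, θ ^ nbrRank S d l j ≤ Γ) :
    ((S.filter fun l => j ∈ matchSet S A d M l).card : ℝ) ^ 4
      ≤ Γ ^ 3 * ∑ l ∈ S.erase j, (θ ^ nbrRank S d l j)⁻¹ ^ 3 * ∑ a, few S A d M a l j := by
  set t : ℕ → ℝ := fun l => θ ^ nbrRank S d l j with ht
  have ht0 : ∀ l, 0 < t l := fun l => by positivity
  set x : ℕ → ℝ := fun l => if j ∈ matchSet S A d M l then 1 else 0 with hx
  have hx2 : ∀ l, x l ^ 2 = x l := fun l => by simp only [hx]; split_ifs <;> norm_num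
  have hx0 : ∀ l, 0 ≤ x l := fun l => by simp only [hx]; split_ifs <;> norm_num
  have hK : ((S.filter fun l => j ∈ matchSet S A d M l).card : ℝ) = ∑ l ∈ S.erase j, x l := by
    rw [card_filter, Nat.cast_sum, ← sum_erase]
    · exact sum_congr rfl fun l _ => by simp [hx]
    · rw [if_neg fun h => ne_of_mem_matchSet h rfl, Nat.cast_zero]
  have c1 := sum_sq_le_sum_mul_sum_of_sq_le_mul (S.erase j) (r := x) (f := t)
    (g := fun l => (t l)⁻¹ * x l) (fun l _ => (ht0 l).le)
    (fun l _ => mul_nonneg (inv_nonneg.2 (ht0 l).le) (hx0 l))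
    (fun l _ => by rw [mul_inv_cancel_left₀ (ht0 l).ne', hx2])
  have c2 := sum_sq_le_sum_mul_sum_of_sq_le_mul (S.erase j) (r := fun l => (t l)⁻¹ * x l)
    (f := t) (g := fun l => (t l)⁻¹ ^ 3 * x l) (fun l _ => (ht0 l).le)
    (fun l _ => mul_nonneg (by have := ht0 l; positivity) (hx0 l)) (fun l _ => by
      rw [mul_pow, hx2]
      have := (ht0 l).ne'
      exact le_of_eq (by field_simp))
  have c3 : ∑ l ∈ S.erase j, (t l)⁻¹ ^ 3 * x l
      ≤ ∑ l ∈ S.erase j, (t l)⁻¹ ^ 3 * ∑ a, few S A d M a l j := by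
    refine sum_le_sum fun l _ => mul_le_mul_of_nonneg_left ?_ (by have := ht0 l; positivity)
    simp only [hx]
    split_ifs with h
    · exact one_le_sum_few h
    · exact sum_nonneg fun a _ => few_nonneg _ _ _ _ _ _ _
  have hT0 : 0 ≤ ∑ l ∈ S.erase j, t l := sum_nonneg fun l _ => (ht0 l).le
  have hC0 : 0 ≤ ∑ l ∈ S.erase j, (t l)⁻¹ ^ 3 * x l :=
    sum_nonneg fun l _ => mul_nonneg (by have := ht0 l; positivity) (hx0 l)
  rw [hK]
  calc (∑ l ∈ S.erase j, x l) ^ 4 = ((∑ l ∈ S.erase j, x l) ^ 2) ^ 2 := by ring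
    _ ≤ ((∑ l ∈ S.erase j, t l) * ∑ l ∈ S.erase j, (t l)⁻¹ * x l) ^ 2 :=
        pow_le_pow_left₀ (sq_nonneg _) c1 2
    _ = (∑ l ∈ S.erase j, t l) ^ 2 * (∑ l ∈ S.erase j, (t l)⁻¹ * x l) ^ 2 := mul_pow _ _ _
    _ ≤ (∑ l ∈ S.erase j, t l) ^ 2 * ((∑ l ∈ S.erase j, t l) *
          ∑ l ∈ S.erase j, (t l)⁻¹ ^ 3 * x l) := mul_le_mul_of_nonneg_left c2 (sq_nonneg _)
    _ = (∑ l ∈ S.erase j, t l) ^ 3 * ∑ l ∈ S.erase j, (t l)⁻¹ ^ 3 * x l := by ring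
    _ ≤ _ := mul_le_mul (pow_le_pow_left₀ hT0 hΓ 3) c3 hC0 (pow_nonneg (hT0.trans hΓ) 3)

section

variable {Ω : Type*} {ℱ : MeasurableSpace Ω} {d : Ω → ℕ → ℕ → ℝ}

lemma measurableSet_mem_nbrSet (hd : ∀ i j, Measurable fun ω => d ω i j) {T : Ω → Finset ℕ}
    (hT : Measurable T) (l j k : ℕ) : MeasurableSet {ω | k ∈ nbrSet (T ω) (d ω) l j} := by
  have : {ω | k ∈ nbrSet (T ω) (d ω) l j}
      = {ω | k ∈ T ω} ∩ ({_ω | k ≠ l} ∩ {ω | Closer (d ω) l k j}) := by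
    ext ω; simp [nbrSet]
  rw [this]
  exact (hT (MeasurableSet.of_discrete (s := {s : Finset ℕ | k ∈ s}))).inter
    ((MeasurableSet.const _).inter (measurableSet_closer hd l k j))

lemma measurable_nbrRank (hd : ∀ i j, Measurable fun ω => d ω i j) {T : Ω → Finset ℕ}
    (hT : Measurable T) (l j : ℕ) : Measurable fun ω => nbrRank (T ω) (d ω) l j := by
  classical
  refine measurable_of_validation hT (F := fun s ω => nbrRank s (d ω) l j) fun s => ?_
  simp only [nbrRank, card_filter]
  exact Finset.measurable_fun_sum _ fun k _ => Measurable.ite ((MeasurableSet.const _).inter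
    (measurableSet_closer hd l k j)) measurable_const measurable_const

lemma measurable_few {A : Ω → ℕ → Bool} (hA : ∀ i, Measurable fun ω => A ω i)
    (hd : ∀ i j, Measurable fun ω => d ω i j) {T : Ω → Finset ℕ} (hT : Measurable T) (M : ℕ)
    (a : Bool) (l j : ℕ) : Measurable fun ω => few (T ω) (A ω) (d ω) M a l j := by
  classical
  refine measurable_of_validation hT (F := fun s ω => few s (A ω) (d ω) M a l j) fun s => ?_
  simp only [few, nbrSet, filter_filter]
  refine Measurable.ite (measurableSet_card_filter_lt s (p := fun k ω =>
    (k ≠ l ∧ Closer (d ω) l k j) ∧ A ω k = a) (fun k => ?_) M) measurable_const measurable_const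
  exact ((MeasurableSet.const _).inter (measurableSet_closer hd l k j)).inter
    (hA k (measurableSet_singleton a))

end

variable {E : Type*} [NormedAddCommGroup E] [NormedSpace ℝ E] [FiniteDimensional ℝ E]
  [MeasurableSpace E] [BorelSpace E] {ξ : Rec p q → E} {δ : Rec p q → Rec p q → ℝ} {M : ℕ}

lemma measurable_known_dist {m : MeasurableSpace (Rec p q)} (hm : m ≤ recAlg p q)
    (hξ : Measurable[m] ξ) (hδ : ∀ r r', δ r r' = dist (ξ r) (ξ r')) {S : Ω → Finset ℕ}
    (j' i k : ℕ) : Measurable[known m S Z j'] fun ω => δ (Z i ω) (Z k ω) := by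
  have : ProperSpace E := FiniteDimensional.proper ℝ E
  simp only [hδ]
  have h : ∀ i, Measurable[known m S Z j'] fun ω => ξ (Z i ω) := fun i =>
    measurable_revealed_comp (m𝒵 := recAlg p q) hm hξ i j'
  let _ : MeasurableSpace Ω := known m S Z j'
  exact (h i).dist (h k)

/-- `integral_mul_indicator_le` for the units that precede `j` as a neighbour of `l`. -/
lemma Design.integral_mul_few_le (des : IsDesign) (n : ℕ) {c : ℝ} (hc1 : c ≤ 1) {a : Bool} (hc :
    ∀ᵐ r ∂Q, (Q[fun r' => -(if trt r' = a then (1 : ℝ) else 0) | covAlg p q]) r ≤ -c) (hξ :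
    Measurable[covAlg p q] ξ) (hδ : ∀ r r', δ r r' = dist (ξ r) (ξ r')) (σ : Finset ℕ → Finset ℕ) {G
    : Ω → ℝ} (hG : ∀ j, Measurable[known (covAlg p q) (S₂ n) Z j] G) (hG0 : ∀ ω, 0 ≤ G ω) {b : ℝ}
    (hb : ∀ ω, G ω ≤ b) (hTN : ∀ ω, G ω ≠ 0 → σ (S₂ n ω) ⊆ range (n₁ n)) (M l j : ℕ) : ∫ ω, G ω *
    few (σ (S₂ n ω)) (fun i => trt (Z i ω)) (fun i k => δ (Z i ω) (Z k ω)) M a l j ∂P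
      ≤ 2 ^ M * ∫ ω, G ω * (1 - c / 2) ^
        nbrRank (σ (S₂ n ω)) (fun i k => δ (Z i ω) (Z k ω)) l j ∂P := by
  classical
  have h := des.integral_mul_indicator_le n hc1 hc (T := fun ω => nbrSet (σ (S₂ n ω)) (fun i k =>
    δ (Z i ω) (Z k ω)) l j) (fun k j' => measurableSet_mem_nbrSet
      (fun i k => measurable_known_dist measurable_covXU.comap_le hξ hδ j' i k)
      (Measurable.of_discrete.comp (measurable_revealed_set (m𝒵 := recAlg p q) j')) l j k)
    hG hG0 hb (fun ω h0 => (filter_subset _ _).trans (hTN ω h0)) M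
  simp only [card_nbrSet] at h
  simp only [few]
  convert h using 6

/-- Stone's lemma for the ranks of a unit as a neighbour of the other units. -/
lemma exists_sum_pow_nbrRank_le (E : Type*) [NormedAddCommGroup E] [NormedSpace ℝ E]
    [FiniteDimensional ℝ E] : ∃ γ : ℝ, 0 ≤ γ ∧ ∀ θ : ℝ, 0 ≤ θ → θ < 1 →
    ∀ (S : Finset ℕ) (x : ℕ → E) (j : ℕ), (∀ l ∈ S, l ≠ j → x l ≠ x j) →
      ∑ l ∈ S.erase j, θ ^ nbrRank S (fun i k => dist (x i) (x k)) l j ≤ γ / (1 - θ) := by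
  obtain ⟨γ, hγ0, hγ⟩ := exists_sum_pow_rank_le E
  refine ⟨γ, hγ0, fun θ h0 h1 S x j hx => ?_⟩
  classical
  refine le_trans (sum_le_sum_of_subset_of_nonneg (fun l hl => ?_) fun _ _ _ => by positivity)
    (hγ θ h0 h1 S x (x j) _ fun l _ _ => ?_)
  · rw [mem_erase] at hl
    exact mem_filter.2 ⟨hl.2, hx l hl.2 hl.1⟩
  · refine card_le_card fun k hk => ?_
    obtain ⟨hkS, hkl, hlt⟩ := mem_filter.1 hk
    refine mem_filter.2 ⟨hkS, hkl, Or.inl ?_⟩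
    simp only [dist_eq_norm]
    rwa [norm_sub_rev]

end MatchMoments

section MatchMoments

variable {E : Type*} [NormedAddCommGroup E] [NormedSpace ℝ E] [FiniteDimensional ℝ E]
  [MeasurableSpace E] [BorelSpace E] {ξ : Rec p q → E} {δ : Rec p q → Rec p q → ℝ} {M : ℕ}

/-- The fourth moments of the weights are bounded: a unit is matched to `l` only if few units with
its treatment precede it as a neighbour of `l`, which is exponentially unlikely in its rank, and by
Stone's lemma the ranks of a unit as a neighbour of the others are spread out. -/
theorem Design.exists_integral_weight_pow_four_le (des : IsDesign) (hO : Overlap Q) (hξ :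
    Measurable[covAlg p q] ξ) (hδ : ∀ r r', δ r r' = dist (ξ r) (ξ r')) (hne : ∀ i j, i ≠ j → ∀ᵐ ω
    ∂P, ξ (Z i ω) ≠ ξ (Z j ω)) (hM : 0 < M) : ∃ C : ℝ, 0 ≤ C ∧ ∀ (n : ℕ) (σ : Finset ℕ → Finset ℕ),
      (∀ s ∈ powersetCard (n₂ n) (range (n₁ n)), σ s ⊆ range (n₁ n)) →
      ∀ (c : Finset ℕ → ℝ) (b : ℝ), (∀ s, 0 ≤ c s) → (∀ s, c s ≤ b) → ∀ j,
      ∫ ω, c (S₂ n ω) * weightOn (σ (S₂ n ω)) (fun i => Z i ω) δ M j ^ 4 ∂P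
        ≤ C * ∫ ω, c (S₂ n ω) ∂P := by
  classical
  obtain ⟨c₀, hc0, hc1, hc⟩ := hO.exists_lower
  obtain ⟨γ, hγ0, hγ⟩ := exists_sum_pow_nbrRank_le E
  have hm : covAlg p q ≤ recAlg p q := measurable_covXU.comap_le
  -- `θ⁴` is the factor by which one more neighbour decreases the probability of a match
  set θ : ℝ := (1 - c₀ / 2) ^ (1 / 4 : ℝ) with hθ
  have hβ0 : 0 < 1 - c₀ / 2 := by linarith
  have hθ0 : 0 < θ := Real.rpow_pos_of_pos hβ0 _
  have hθ1 : θ < 1 := Real.rpow_lt_one hβ0.le (by linarith) (by norm_num)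
  have hθ4 : θ ^ 4 = 1 - c₀ / 2 := by rw [hθ, ← Real.rpow_natCast, ← Real.rpow_mul hβ0.le]; norm_num
  set Γ : ℝ := γ / (1 - θ) with hΓ
  have hΓ0 : 0 ≤ Γ := div_nonneg hγ0 (by linarith)
  refine ⟨8 + 8 * Γ ^ 3 * (2 * 2 ^ M * Γ), by positivity, fun n σ hσ c b hcn hcb j => ?_⟩
  set c' : Finset ℕ → ℝ := fun s => if s ∈ powersetCard (n₂ n) (range (n₁ n)) then c s else 0
    with hc'
  have hc'0 : ∀ s, 0 ≤ c' s := fun s => by simp only [hc']; split_ifs; exacts [hcn s, le_rfl]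
  have hb0 : 0 ≤ b := (hcn ∅).trans (hcb ∅)
  have hc'b : ∀ s, c' s ≤ b := fun s => by simp only [hc']; split_ifs; exacts [hcb s, hb0]
  have hcae : ∀ᵐ ω ∂P, c' (S₂ n ω) = c (S₂ n ω) := by
    filter_upwards [des.ae_validation n] with ω hω
    simp only [hc']; rw [if_pos hω]
  set d : Ω → ℕ → ℕ → ℝ := fun ω i k => δ (Z i ω) (Z k ω) with hd
  set A : Ω → ℕ → Bool := fun ω i => trt (Z i ω) with hA
  set T : Ω → Finset ℕ := fun ω => σ (S₂ n ω) with hT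
  have hdk : ∀ j' i k, Measurable[known (covAlg p q) (S₂ n) Z j'] fun ω => d ω i k :=
    fun j' i k => measurable_known_dist hm hξ hδ j' i k
  have hTk : ∀ j', Measurable[known (covAlg p q) (S₂ n) Z j'] T := fun j' =>
    Measurable.of_discrete.comp (measurable_revealed_set (m𝒵 := recAlg p q) j')
  have hdm : ∀ i k, Measurable fun ω => d ω i k := fun i k =>
    (hdk 0 i k).mono (des.known_le hm n 0) le_rfl
  have hTm : Measurable T := (hTk 0).mono (des.known_le hm n 0) le_rfl
  have hAm : ∀ i, Measurable fun ω => A ω i := fun i => measurable_trt.comp (des.measurable_Z i)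
  set R : ℕ → Ω → ℕ := fun l ω => nbrRank (T ω) (d ω) l j with hR
  set G : ℕ → Ω → ℝ := fun l ω =>
    c' (S₂ n ω) * if l ∈ (T ω).erase j then (θ ^ R l ω)⁻¹ ^ 3 else 0 with hG
  have hGk : ∀ l j', Measurable[known (covAlg p q) (S₂ n) Z j'] (G l) := fun l j' => by
    refine Measurable.mul (measurable_known_coef c' j') (Measurable.ite ?_ ?_ measurable_const)
    · exact hTk j' (MeasurableSet.of_discrete (s := {s : Finset ℕ | l ∈ s.erase j}))
    · exact (Measurable.of_discrete (f := fun r : ℕ => (θ ^ r)⁻¹ ^ 3)).comp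
        (measurable_nbrRank (hdk j') (hTk j') l j)
  have hG0 : ∀ l ω, 0 ≤ G l ω := fun l ω => mul_nonneg (hc'0 _) (by split_ifs <;> positivity)
  have hsub : ∀ ω, c' (S₂ n ω) ≠ 0 → T ω ⊆ range (n₁ n) := fun ω h => by
    refine hσ _ (by_contra fun h' => h ?_)
    simp only [hc']; rw [if_neg h']
  have hGb : ∀ l ω, G l ω ≤ b * (θ ^ n₁ n)⁻¹ ^ 3 := by
    intro l ω
    by_cases h0 : c' (S₂ n ω) = 0
    · simp only [hG, h0, zero_mul]; positivity
    refine mul_le_mul (hc'b _) ?_ (by split_ifs <;> positivity) hb0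
    split_ifs
    · refine pow_le_pow_left₀ (by positivity) (inv_anti₀ (by positivity) ?_) 3
      refine pow_le_pow_of_le_one hθ0.le hθ1.le ((card_filter_le _ _).trans ?_)
      simpa using card_le_card (hsub ω h0)
    · positivity
  have hGT : ∀ l ω, G l ω ≠ 0 → T ω ⊆ range (n₁ n) := fun l ω h => hsub ω (left_ne_zero_of_mul h)
  have hGm : ∀ l, Measurable (G l) := fun l => (hGk l 0).mono (des.known_le hm n 0) le_rfl
  have hfew : ∀ l a, ∫ ω, G l ω * few (T ω) (A ω) (d ω) M a l j ∂P
      ≤ 2 ^ M * ∫ ω, G l ω * (θ ^ 4) ^ R l ω ∂P := fun l a => by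
    rw [hθ4]
    exact des.integral_mul_few_le n hc1 (hc a) hξ hδ σ (hGk l) (hG0 l) (hGb l) (hGT l) M l j
  have hint1 : ∀ l a, Integrable (fun ω => G l ω * few (T ω) (A ω) (d ω) M a l j) P := fun l a =>
    integrable_of_abs_le ((hGm l).mul (measurable_few hAm hdm hTm M a l j))
      (b := b * (θ ^ n₁ n)⁻¹ ^ 3) fun ω => by
      rw [abs_of_nonneg (mul_nonneg (hG0 l ω) (few_nonneg _ _ _ _ _ _ _))]
      exact (mul_le_of_le_one_right (hG0 l ω) (few_le_one _ _ _ _ _ _ _)).trans (hGb l ω)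
  have hint2 : ∀ l, Integrable (fun ω => G l ω * (θ ^ 4) ^ R l ω) P := fun l =>
    integrable_of_abs_le ((hGm l).mul ((Measurable.of_discrete (f := fun r : ℕ => (θ ^ 4) ^ r)).comp
      (measurable_nbrRank hdm hTm l j))) (b := b * (θ ^ n₁ n)⁻¹ ^ 3) fun ω => by
      rw [abs_of_nonneg (mul_nonneg (hG0 l ω) (by positivity))]
      exact (mul_le_of_le_one_right (hG0 l ω) (pow_le_one₀ (by positivity)
        (pow_le_one₀ hθ0.le hθ1.le))).trans (hGb l ω)
  have hcint : Integrable (fun ω => c (S₂ n ω)) P := integrable_of_abs_le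
    (des.measurable_coef c n) (b := b) fun ω => by
      rw [abs_of_nonneg (hcn _)]; exact hcb _
  have hneae : ∀ᵐ ω ∂P, ∀ l, l ≠ j → ξ (Z l ω) ≠ ξ (Z j ω) := by
    rw [ae_all_iff]; intro l
    by_cases h : l = j
    · exact ae_of_all _ fun ω h' => absurd h h'
    · filter_upwards [hne l j h] with ω hω using fun _ => hω
  have hstone : ∀ᵐ ω ∂P, ∑ l ∈ (T ω).erase j, θ ^ R l ω ≤ Γ := by
    filter_upwards [hneae] with ω hω
    have := hγ θ hθ0.le hθ1 (T ω) (fun i => ξ (Z i ω)) j fun l _ h => hω l h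
    simpa only [hR, hd, hδ] using this
  have hsum : ∀ ω, c' (S₂ n ω) ≠ 0 → ∀ F : ℕ → ℝ, ∑ l ∈ range (n₁ n), (c' (S₂ n ω) * if l ∈ (T
      ω).erase j then F l else 0) = c' (S₂ n ω) * ∑ l ∈ (T ω).erase j, F l := by
    intro ω h F
    rw [← mul_sum, ← sum_filter, filter_mem_eq_inter, inter_eq_right.2
      ((erase_subset _ _).trans (hsub ω h))]
  calc ∫ ω, c (S₂ n ω) * weightOn (T ω) (fun i => Z i ω) δ M j ^ 4 ∂P
      ≤ ∫ ω, (8 * c (S₂ n ω) + 8 * Γ ^ 3 * ∑ l ∈ range (n₁ n), ∑ a,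
          G l ω * few (T ω) (A ω) (d ω) M a l j) ∂P := by
        refine integral_mono_of_nonneg (ae_of_all _ fun ω => mul_nonneg (hcn _) (by positivity))
          ((hcint.const_mul 8).add ((integrable_finsetSum _ fun l _ =>
            integrable_finsetSum _ fun a _ => hint1 l a).const_mul _)) ?_
        filter_upwards [hcae, hstone] with ω hω hst
        by_cases h0 : c' (S₂ n ω) = 0
        · rw [← hω, h0, zero_mul, mul_zero, zero_add]
          exact mul_nonneg (by positivity) (sum_nonneg fun l _ => sum_nonneg
            fun a _ => mul_nonneg (hG0 l ω) (few_nonneg _ _ _ _ _ _ _))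
        have e1 : ∑ l ∈ range (n₁ n), ∑ a, G l ω * few (T ω) (A ω) (d ω) M a l j
            = c' (S₂ n ω) * ∑ l ∈ (T ω).erase j,
              (θ ^ R l ω)⁻¹ ^ 3 * ∑ a, few (T ω) (A ω) (d ω) M a l j := by
          rw [← hsum ω h0]
          refine sum_congr rfl fun l _ => ?_
          rw [← mul_sum]
          simp only [hG]
          split_ifs <;> ring
        rw [e1, hω]
        have hK := card_matched_pow_four_le (A := A ω) (M := M) hθ0 hst
        have hw : weightOn (T ω) (fun i => Z i ω) δ M j ^ 4 ≤ 8 + 8 * (((T ω).filter fun l => j ∈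
            matchSet (T ω) (A ω) (d ω) M l).card : ℝ) ^ 4 := by
          have h1 : (M : ℝ)⁻¹ ≤ 1 := inv_le_one_of_one_le₀ (by exact_mod_cast hM)
          set K : ℝ := (((T ω).filter fun l => j ∈ matchSet (T ω) (A ω) (d ω) M l).card : ℝ) with hKd
          have hK0 : 0 ≤ K := Nat.cast_nonneg _
          have h2 : weightOn (T ω) (fun i => Z i ω) δ M j = 1 + (M : ℝ)⁻¹ * K := rfl
          have h3 : 1 + (M : ℝ)⁻¹ * K ≤ 1 + K := by nlinarith
          rw [h2]
          refine (pow_le_pow_left₀ (by positivity) h3 4).trans ?_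
          have := add_pow_le (zero_le_one (α := ℝ)) hK0 4
          norm_num at this; linarith
        calc c (S₂ n ω) * weightOn (T ω) (fun i => Z i ω) δ M j ^ 4
            ≤ c (S₂ n ω) * (8 + 8 * (Γ ^ 3 * ∑ l ∈ (T ω).erase j, (θ ^ R l ω)⁻¹ ^ 3 *
                ∑ a, few (T ω) (A ω) (d ω) M a l j)) :=
              mul_le_mul_of_nonneg_left (hw.trans (by gcongr)) (hcn _)
          _ = _ := by ring
    _ = 8 * ∫ ω, c (S₂ n ω) ∂P + 8 * Γ ^ 3 * ∑ l ∈ range (n₁ n), ∑ a,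
          ∫ ω, G l ω * few (T ω) (A ω) (d ω) M a l j ∂P := by
        have i2 : Integrable (fun ω => ∑ l ∈ range (n₁ n), ∑ a,
            G l ω * few (T ω) (A ω) (d ω) M a l j) P :=
          integrable_finsetSum _ fun l _ => integrable_finsetSum _ fun a _ => hint1 l a
        rw [integral_add (hcint.const_mul 8) (i2.const_mul _), integral_const_mul,
          integral_const_mul, integral_finsetSum _ fun l _ =>
            integrable_finsetSum _ fun a _ => hint1 l a]
        congr 2
        exact sum_congr rfl fun l _ => integral_finsetSum _ fun a _ => hint1 l a
    _ ≤ 8 * ∫ ω, c (S₂ n ω) ∂P + 8 * Γ ^ 3 * ∑ l ∈ range (n₁ n), ∑ _a : Bool,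
          2 ^ M * ∫ ω, G l ω * (θ ^ 4) ^ R l ω ∂P := by
        gcongr with l _ a _
        exact hfew l a
    _ = 8 * ∫ ω, c (S₂ n ω) ∂P + 8 * Γ ^ 3 * (2 * 2 ^ M *
          ∫ ω, ∑ l ∈ range (n₁ n), G l ω * (θ ^ 4) ^ R l ω ∂P) := by
        rw [integral_finsetSum _ fun l _ => hint2 l]
        simp only [sum_const, card_univ, Fintype.card_bool, nsmul_eq_mul]
        congr 2
        rw [mul_sum]
        exact sum_congr rfl fun l _ => by push_cast; ring
    _ ≤ 8 * ∫ ω, c (S₂ n ω) ∂P + 8 * Γ ^ 3 * (2 * 2 ^ M * (Γ * ∫ ω, c (S₂ n ω) ∂P)) := by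
        rw [← integral_const_mul Γ]
        have : ∫ ω, ∑ l ∈ range (n₁ n), G l ω * (θ ^ 4) ^ R l ω ∂P ≤ ∫ ω, Γ * c (S₂ n ω) ∂P := by
          refine integral_mono_ae (integrable_finsetSum _ fun l _ => hint2 l) (hcint.const_mul _) ?_
          filter_upwards [hcae, hstone] with ω hω hst
          by_cases h0 : c' (S₂ n ω) = 0
          · simp only [hG, h0, zero_mul, sum_const_zero]
            exact mul_nonneg hΓ0 (hcn _)
          have e1 : ∑ l ∈ range (n₁ n), G l ω * (θ ^ 4) ^ R l ω
              = c' (S₂ n ω) * ∑ l ∈ (T ω).erase j, θ ^ R l ω := by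
            rw [← hsum ω h0]
            refine sum_congr rfl fun l _ => ?_
            simp only [hG]
            split_ifs
            · have : θ ^ R l ω ≠ 0 := by positivity
              rw [← pow_mul, mul_comm 4, pow_mul]
              field_simp
            · ring
          rw [e1, hω, mul_comm]
          exact mul_le_mul_of_nonneg_right hst (hcn _)
        gcongr
    _ = _ := by ring

/-- Every unit has `M` matches with probability tending to one. -/
theorem Design.eventually_card_matchSet (des : IsDesign) (hO : Overlap Q) (σ : ℕ → Finset ℕ →
    Finset ℕ) {N : ℕ → ℕ} (hN : Tendsto N atTop atTop) (hσ : ∀ n, ∀ s ∈ powersetCard (n₂ n) (range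
    (n₁ n)), σ n s ⊆ range (n₁ n) ∧ (σ n s).card = N n) (δ : Rec p q → Rec p q → ℝ) (M : ℕ) : ∀ᶠ z
    in 𝒫, ∀ j ∈ σ z.1 (S₂ z.1 z.2), (matchSet (σ z.1 (S₂ z.1 z.2))
      (fun i => trt (Z i z.2)) (fun i k => δ (Z i z.2) (Z k z.2)) M j).card = M := by
  classical
  obtain ⟨c₀, hc0, hc1, hc⟩ := hO.exists_lower
  have hm : covAlg p q ≤ recAlg p q := measurable_covXU.comap_le
  set G : ℕ → Ω → ℝ := fun n ω =>
    if S₂ n ω ∈ powersetCard (n₂ n) (range (n₁ n)) then 1 else 0 with hG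
  set X : ℕ → Bool → Ω → ℝ := fun n a ω => G n ω *
    if ((σ n (S₂ n ω)).filter fun k => trt (Z k ω) = a).card < M then 1 else 0 with hX
  have hX0 : ∀ n a ω, 0 ≤ X n a ω := fun n a ω => by simp only [hX, hG]; split_ifs <;> norm_num
  have hXm : ∀ n a, Measurable (X n a) := fun n a => by
    refine Measurable.mul (des.measurable_coef (fun s =>
      if s ∈ powersetCard (n₂ n) (range (n₁ n)) then (1 : ℝ) else 0) n)
      (measurable_of_validation (des.measurable_S n)
      (F := fun s ω => if ((σ n s).filter fun k => trt (Z k ω) = a).card < M then (1 : ℝ) else 0)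
      fun s => Measurable.ite (measurableSet_card_filter_lt _ (p := fun k ω => trt (Z k ω) = a)
        (fun k => (measurable_trt.comp (des.measurable_Z k)) (measurableSet_singleton a)) M)
        measurable_const measurable_const)
  have hXi : ∀ n a, Integrable (X n a) P := fun n a => integrable_of_abs_le (hXm n a) (b := 1)
    fun ω => by simp only [hX, hG]; split_ifs <;> norm_num
  have hXle : ∀ n a, ∫ ω, |X n a ω| ∂P ≤ 2 ^ M * (1 - c₀ / 2) ^ N n := by
    intro n a
    simp only [abs_of_nonneg (hX0 n a _)]
    refine (des.integral_mul_indicator_le n hc1 (hc a) (T := fun ω => σ n (S₂ n ω))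
      (fun k j => measurable_revealed_set (m𝒵 := recAlg p q) j
        (MeasurableSet.of_discrete (s := {s : Finset ℕ | k ∈ σ n s}))) (G := G n)
      (fun j => measurable_known_coef (fun s =>
        if s ∈ powersetCard (n₂ n) (range (n₁ n)) then (1 : ℝ) else 0) j)
      (fun ω => by simp only [hG]; split_ifs <;> norm_num) (b := 1)
      (fun ω => by simp only [hG]; split_ifs <;> norm_num)
      (fun ω h => (hσ n _ (by_contra fun h' => h (if_neg h'))).1) M).trans ?_
    refine mul_le_mul_of_nonneg_left ?_ (by positivity)
    have : ∀ᵐ ω ∂P, G n ω * (1 - c₀ / 2) ^ (σ n (S₂ n ω)).card = (1 - c₀ / 2) ^ N n := by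
      filter_upwards [des.ae_validation n] with ω hω
      simp only [hG]
      rw [if_pos hω, one_mul, (hσ n _ hω).2]
    rw [integral_congr_ae this]
    simp
  have hlim : Tendsto (fun n => 2 ^ M * (1 - c₀ / 2) ^ N n) atTop (𝓝 0) := by
    have := (tendsto_pow_atTop_nhds_zero_of_lt_one (by linarith : (0 : ℝ) ≤ 1 - c₀ / 2)
      (by linarith)).comp hN
    simpa [Function.comp_def] using this.const_mul (2 ^ M)
  have hev : ∀ a, ∀ᶠ z in 𝒫, X z.1 a z.2 < 1 := fun a =>
    (tendsto_probFilter_of_integral_abs (Eventually.of_forall fun n => hXi n a)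
      (Eventually.of_forall fun n => hXle n a) hlim).eventually_lt_const one_pos
  filter_upwards [hev true, hev false, eventually_probFilter_of_ae
    (Eventually.of_forall des.ae_validation)] with z h1 h2 hS j _
  have hge : ∀ a, M ≤ ((σ z.1 (S₂ z.1 z.2)).filter fun k => trt (Z k z.2) = a).card := by
    intro a
    by_contra hlt
    have hlt := not_le.1 hlt
    have : X z.1 a z.2 = 1 := by simp only [hX, hG]; rw [if_pos hS, if_pos hlt, one_mul]
    cases a <;> linarith
  refine card_matchSet_eq ((hge (!trt (Z j z.2))).trans (card_le_card fun k hk => ?_))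
  rw [mem_filter] at hk ⊢
  exact ⟨hk.1, by rw [hk.2]; simp⟩

end MatchMoments

section MatchMoments

variable {E : Type*} [NormedAddCommGroup E] [NormedSpace ℝ E] [FiniteDimensional ℝ E]
  [MeasurableSpace E] [BorelSpace E] {ξ : Rec p q → E} {δ : Rec p q → Rec p q → ℝ} {M : ℕ}

lemma sum_eq_sum_range_ite {N : ℕ} {T : Finset ℕ} (hT : T ⊆ range N) (f : ℕ → ℝ) :
    ∑ j ∈ T, f j = ∑ j ∈ range N, if j ∈ T then f j else 0 := by
  rw [← sum_filter, filter_mem_eq_inter, inter_eq_right.2 hT]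

/-- The mean distance between a unit and its matches among `N` units is of the order `N ^ (-1 / k)`,
`k` being the dimension of the covariate. -/
theorem Design.exists_integral_matchDist_le [Nontrivial E] (des : IsDesign) (hO : Overlap Q) (hξ
    : Measurable[covAlg p q] ξ) (hδ : ∀ r r', δ r r' = dist (ξ r) (ξ r')) {Δ : ℝ} (hΔ : ∀ᵐ r ∂Q, ‖ξ
    r‖ ≤ Δ) (M : ℕ) : ∃ C : ℝ, 0 ≤ C ∧ ∀ (n : ℕ) (σ : Finset ℕ → Finset ℕ) (N : ℕ), 0 < N →
      (∀ s ∈ powersetCard (n₂ n) (range (n₁ n)), σ s ⊆ range (n₁ n) ∧ (σ s).card = N) →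
      Integrable (fun ω => matchDist (σ (S₂ n ω)) (fun i => trt (Z i ω))
        (fun i k => δ (Z i ω) (Z k ω)) M) P ∧
      ∫ ω, matchDist (σ (S₂ n ω)) (fun i => trt (Z i ω)) (fun i k => δ (Z i ω) (Z k ω)) M ∂P
        ≤ C * (N * (N : ℝ) ^ (-(1 / (Module.finrank ℝ E : ℝ)))) := by
  classical
  obtain ⟨c₀, hc0, hc1, hc⟩ := hO.exists_lower
  have hm : covAlg p q ≤ recAlg p q := measurable_covXU.comap_le
  set β : ℝ := 1 - c₀ / 2 with hβ
  have hβ0 : 0 ≤ β := by rw [hβ]; linarith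
  obtain ⟨C, hC0, hC⟩ := exists_sum_pow_rank_mul_dist_le E hβ0 (by rw [hβ]; linarith) Δ
  set k : ℕ := Module.finrank ℝ E with hk
  have hk0 : 0 < k := Module.finrank_pos
  have hΔ0 : 0 ≤ Δ := by
    obtain ⟨r, hr⟩ := hΔ.exists
    exact (norm_nonneg _).trans hr
  refine ⟨M + 2 * 2 ^ M * C, by positivity, fun n σ N hN hσ => ?_⟩
  set d : Ω → ℕ → ℕ → ℝ := fun ω i k => δ (Z i ω) (Z k ω) with hd
  set A : Ω → ℕ → Bool := fun ω i => trt (Z i ω) with hA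
  set T : Ω → Finset ℕ := fun ω => σ (S₂ n ω) with hT
  have hd0 : ∀ ω i k, 0 ≤ d ω i k := fun ω i k => by simp only [hd, hδ]; exact dist_nonneg
  have hdk : ∀ j' i k, Measurable[known (covAlg p q) (S₂ n) Z j'] fun ω => d ω i k :=
    fun j' i k => measurable_known_dist hm hξ hδ j' i k
  have hTk : ∀ j', Measurable[known (covAlg p q) (S₂ n) Z j'] T := fun j' =>
    Measurable.of_discrete.comp (measurable_revealed_set (m𝒵 := recAlg p q) j')
  have hdm : ∀ i k, Measurable fun ω => d ω i k := fun i k =>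
    (hdk 0 i k).mono (des.known_le hm n 0) le_rfl
  have hTm : Measurable T := (hTk 0).mono (des.known_le hm n 0) le_rfl
  have hAm : ∀ i, Measurable fun ω => A ω i := fun i => measurable_trt.comp (des.measurable_Z i)
  set g : Finset ℕ → ℕ → ℕ → Prop := fun s j l =>
    s ∈ powersetCard (n₂ n) (range (n₁ n)) ∧ j ∈ σ s ∧ l ∈ (σ s).erase j with hg
  set G : Terms := fun j l ω =>
    if g (S₂ n ω) j l then (min (d ω j l) (2 * Δ)) ^ k else 0 with hG
  have hGk : ∀ j l j', Measurable[known (covAlg p q) (S₂ n) Z j'] (G j l) := fun j l j' =>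
    Measurable.ite (measurable_revealed_set (m𝒵 := recAlg p q) j' (MeasurableSet.of_discrete (s :=
      {s : Finset ℕ | g s j l}))) (((hdk j' j l).min measurable_const).pow_const k) measurable_const
  have hG0 : ∀ j l ω, 0 ≤ G j l ω := fun j l ω => by
    have := hd0 ω j l
    simp only [hG]; split_ifs <;> positivity
  have hGb : ∀ j l ω, G j l ω ≤ (2 * Δ) ^ k := fun j l ω => by
    have := hd0 ω j l
    simp only [hG]; split_ifs
    · exact pow_le_pow_left₀ (by positivity) (min_le_right _ _) k
    · positivity
  have hGT : ∀ j l ω, G j l ω ≠ 0 → T ω ⊆ range (n₁ n) := fun j l ω h =>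
    (hσ _ (by_contra fun h' => h (if_neg fun h2 => h' h2.1))).1
  have hGm : ∀ j l, Measurable (G j l) := fun j l =>
    (hGk j l 0).mono (des.known_le hm n 0) le_rfl
  have hfew : ∀ j l a, ∫ ω, G j l ω * few (T ω) (A ω) (d ω) M a j l ∂P
      ≤ 2 ^ M * ∫ ω, G j l ω * β ^ nbrRank (T ω) (d ω) j l ∂P := fun j l a =>
    des.integral_mul_few_le n hc1 (hc a) hξ hδ σ (hGk j l) (hG0 j l) (hGb j l) (hGT j l) M j l
  have hint1 : ∀ j l a, Integrable (fun ω => G j l ω * few (T ω) (A ω) (d ω) M a j l) P :=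
    fun j l a => integrable_of_abs_le ((hGm j l).mul (measurable_few hAm hdm hTm M a j l))
      (b := (2 * Δ) ^ k) fun ω => by
      rw [abs_of_nonneg (mul_nonneg (hG0 j l ω) (few_nonneg _ _ _ _ _ _ _))]
      exact (mul_le_of_le_one_right (hG0 j l ω) (few_le_one _ _ _ _ _ _ _)).trans (hGb j l ω)
  have hint2 : ∀ j l, Integrable (fun ω => G j l ω * β ^ nbrRank (T ω) (d ω) j l) P := fun j l =>
    integrable_of_abs_le ((hGm j l).mul ((Measurable.of_discrete (f := fun r : ℕ => β ^ r)).comp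
      (measurable_nbrRank hdm hTm j l))) (b := (2 * Δ) ^ k) fun ω => by
      rw [abs_of_nonneg (mul_nonneg (hG0 j l ω) (by positivity))]
      exact (mul_le_of_le_one_right (hG0 j l ω) (pow_le_one₀ hβ0 (by rw [hβ]; linarith))).trans
        (hGb j l ω)
  -- at the scale `h` the two parts of the bound are of the same order
  set h : ℝ := (N : ℝ) ^ (-(1 / (k : ℝ))) with hh
  have hN0 : (0 : ℝ) < N := by exact_mod_cast hN
  have hh0 : 0 < h := Real.rpow_pos_of_pos hN0 _
  have hhk : h ^ k = (N : ℝ)⁻¹ := by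
    rw [hh, ← Real.rpow_natCast, ← Real.rpow_mul hN0.le]
    have : (k : ℝ) ≠ 0 := by positivity
    rw [neg_mul, one_div, inv_mul_cancel₀ this, Real.rpow_neg_one]
  have hdh : ∀ x : ℝ, 0 ≤ x → x ≤ h + h * N * x ^ k := by
    intro x hx
    rcases le_total x h with hxh | hxh
    · exact hxh.trans (le_add_of_nonneg_right (by positivity))
    · have h1 : x / h ≤ (x / h) ^ k := le_self_pow₀ ((one_le_div hh0).2 hxh) hk0.ne'
      rw [div_pow, hhk, div_inv_eq_mul, div_le_iff₀ hh0] at h1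
      nlinarith
  have hbd : ∀ᵐ ω ∂P, ∀ i, ‖ξ (Z i ω)‖ ≤ Δ := ae_all_iff.2 fun i => des.ae_unit hΔ i
  have hpt : ∀ᵐ ω ∂P, matchDist (T ω) (A ω) (d ω) M ≤ N * M * h + h * N *
      ∑ j ∈ range (n₁ n), ∑ l ∈ range (n₁ n), ∑ a, G j l ω * few (T ω) (A ω) (d ω) M a j l := by
    filter_upwards [des.ae_validation n, hbd] with ω hω hb
    obtain ⟨hsub, hcard⟩ := hσ _ hω
    have hin : ∀ j ∈ T ω, ∑ l ∈ matchSet (T ω) (A ω) (d ω) M j, d ω j l ≤ M * h + h * N *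
        ∑ l ∈ range (n₁ n), ∑ a, G j l ω * few (T ω) (A ω) (d ω) M a j l := by
      intro j hj
      calc ∑ l ∈ matchSet (T ω) (A ω) (d ω) M j, d ω j l
          ≤ ∑ l ∈ matchSet (T ω) (A ω) (d ω) M j, (h + h * N *
            ∑ a, G j l ω * few (T ω) (A ω) (d ω) M a j l) := by
            refine sum_le_sum fun l hl => (hdh _ (hd0 ω j l)).trans ?_
            have h1 := one_le_sum_few hl
            have h2 : d ω j l ≤ 2 * Δ := by
              simp only [hd, hδ]
              refine (dist_le_norm_add_norm _ _).trans ?_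
              linarith [hb j, hb l]
            have h3 : G j l ω = d ω j l ^ k := by
              simp only [hG]
              rw [if_pos ⟨hω, hj, mem_erase.2
                ⟨(ne_of_mem_matchSet hl).symm, (mem_matchSet.1 hl).1⟩⟩, min_eq_left h2]
            rw [← mul_sum, h3]
            have := hd0 ω j l
            exact add_le_add_right (mul_le_mul_of_nonneg_left
              (le_mul_of_one_le_right (by positivity) h1) (by positivity)) _
        _ ≤ _ := by
            rw [sum_add_distrib, sum_const, nsmul_eq_mul, ← mul_sum]
            refine add_le_add (mul_le_mul_of_nonneg_right ?_ hh0.le)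
              (mul_le_mul_of_nonneg_left ?_ (by positivity))
            · exact_mod_cast card_matchSet_le _ _ _ _ _
            · exact sum_le_sum_of_subset_of_nonneg
                (fun l hl => hsub (mem_matchSet.1 hl).1) fun l _ _ => sum_nonneg fun a _ =>
                  mul_nonneg (hG0 j l ω) (few_nonneg _ _ _ _ _ _ _)
    refine (sum_le_sum hin).trans ?_
    rw [sum_add_distrib, sum_const, nsmul_eq_mul, ← mul_sum,
      show (T ω).card = N from hcard, ← mul_assoc]
    refine add_le_add_right (mul_le_mul_of_nonneg_left ?_ (by positivity)) _
    exact sum_le_sum_of_subset_of_nonneg hsub fun j _ _ => sum_nonneg fun l _ =>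
      sum_nonneg fun a _ => mul_nonneg (hG0 j l ω) (few_nonneg _ _ _ _ _ _ _)
  have hint3 : Integrable (fun ω => ∑ j ∈ range (n₁ n), ∑ l ∈ range (n₁ n), ∑ a,
      G j l ω * few (T ω) (A ω) (d ω) M a j l) P :=
    integrable_finsetSum _ fun j _ => integrable_finsetSum _ fun l _ =>
      integrable_finsetSum _ fun a _ => hint1 j l a
  have hint4 : Integrable (fun ω => N * M * h + h * N * ∑ j ∈ range (n₁ n), ∑ l ∈ range (n₁ n),
      ∑ a, G j l ω * few (T ω) (A ω) (d ω) M a j l) P :=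
    (integrable_const _).add (hint3.const_mul _)
  have hD0 : ∀ ω, 0 ≤ matchDist (T ω) (A ω) (d ω) M := fun ω =>
    sum_nonneg fun j _ => sum_nonneg fun l _ => hd0 ω j l
  refine ⟨hint4.mono' (measurable_matchDist hAm hdm hTm M).aestronglyMeasurable ?_, ?_⟩
  · filter_upwards [hpt] with ω hω
    rwa [Real.norm_of_nonneg (hD0 ω)]
  calc ∫ ω, matchDist (T ω) (A ω) (d ω) M ∂P
      ≤ ∫ ω, (N * M * h + h * N * ∑ j ∈ range (n₁ n), ∑ l ∈ range (n₁ n), ∑ a,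
          G j l ω * few (T ω) (A ω) (d ω) M a j l) ∂P :=
        integral_mono_of_nonneg (ae_of_all _ hD0) hint4 hpt
    _ = N * M * h + h * N * ∑ j ∈ range (n₁ n), ∑ l ∈ range (n₁ n), ∑ a,
          ∫ ω, G j l ω * few (T ω) (A ω) (d ω) M a j l ∂P := by
        rw [integral_add (integrable_const _) (hint3.const_mul _), integral_const_mul (h * N),
          integral_finsetSum _ fun j _ => integrable_finsetSum _ fun l _ =>
            integrable_finsetSum _ fun a _ => hint1 j l a]
        simp only [integral_const, probReal_univ, one_smul]
        congr 2
        refine sum_congr rfl fun j _ => ?_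
        rw [integral_finsetSum _ fun l _ => integrable_finsetSum _ fun a _ => hint1 j l a]
        exact sum_congr rfl fun l _ => integral_finsetSum _ fun a _ => hint1 j l a
    _ ≤ N * M * h + h * N * ∑ j ∈ range (n₁ n), ∑ l ∈ range (n₁ n), ∑ _a : Bool,
          2 ^ M * ∫ ω, G j l ω * β ^ nbrRank (T ω) (d ω) j l ∂P := by
        gcongr with j _ l _ a _
        exact hfew j l a
    _ = N * M * h + h * N * (2 * 2 ^ M * ∫ ω, ∑ j ∈ range (n₁ n), ∑ l ∈ range (n₁ n),
          G j l ω * β ^ nbrRank (T ω) (d ω) j l ∂P) := by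
        rw [integral_finsetSum _ fun j _ => integrable_finsetSum _ fun l _ => hint2 j l]
        simp only [sum_const, card_univ, Fintype.card_bool, nsmul_eq_mul]
        congr 2
        rw [mul_sum]
        refine sum_congr rfl fun j _ => ?_
        rw [integral_finsetSum _ fun l _ => hint2 j l, mul_sum]
        exact sum_congr rfl fun l _ => by push_cast; ring
    _ ≤ N * M * h + h * N * (2 * 2 ^ M * C) := by
        have : ∫ ω, ∑ j ∈ range (n₁ n), ∑ l ∈ range (n₁ n),
            G j l ω * β ^ nbrRank (T ω) (d ω) j l ∂P ≤ ∫ _ω, C ∂P := by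
          refine integral_mono_ae (integrable_finsetSum _ fun j _ =>
            integrable_finsetSum _ fun l _ => hint2 j l) (integrable_const _) ?_
          filter_upwards [des.ae_validation n, hbd] with ω hω hb
          obtain ⟨hsub, -⟩ := hσ _ hω
          refine le_trans ?_ (hC (T ω) (fun i => ξ (Z i ω)) fun j _ => hb j)
          rw [sum_eq_sum_range_ite hsub]
          refine sum_le_sum fun j _ => ?_
          split_ifs with hj
          · rw [sum_eq_sum_range_ite ((erase_subset j _).trans hsub)]
            refine sum_le_sum fun l _ => ?_
            simp only [hG, hg, ← hδ]
            split_ifs with h1 h2 h2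
            · rw [mul_comm]
              refine mul_le_mul_of_nonneg_left (pow_le_pow_left₀ (le_min (hd0 ω j l)
                (by positivity)) (min_le_left _ _) k) (by positivity)
            · exact absurd h1.2.2 h2
            · have := hd0 ω j l
              rw [zero_mul]
              exact mul_nonneg (by positivity) (pow_nonneg this _)
            · rw [zero_mul]
          · refine (sum_eq_zero fun l _ => ?_).le
            simp only [hG, hg]
            rw [if_neg fun h => hj h.2.1, zero_mul]
        rw [integral_const, probReal_univ, one_smul] at this
        gcongr
    _ = _ := by ring

end MatchMoments

/-! ### Sums of terms that are centred given part of the record -/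

/-- An outcome-dependent scale that dominates the residuals. -/
def outScale (r : Rec p q) : ℝ := 1 + |outcome r|

lemma one_le_outScale (r : Rec p q) : 1 ≤ outScale r := le_add_of_nonneg_right (abs_nonneg _)

lemma measurable_outScale : Measurable (outScale : Rec p q → ℝ) :=
  measurable_outcome.abs.const_add 1

/-- Weights `W n j` that depend on the validation set and, through the σ-algebra `m`, on the records
of the units, with bounded fourth moments; and a scale `y` for the terms that depend on the rest of
the record, whose conditional fourth moment given `m` is bounded. -/
structure Layer (P : Measure Ω) (Q : Measure (Rec p q)) (Z : ℕ → Ω → Rec p q) (n₁ n₂ : ℕ → ℕ)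
    (S₂ : ℕ → Ω → Finset ℕ) (y : Rec p q → ℝ) (m : MeasurableSpace (Rec p q)) (W : Terms) : Prop where
  le : m ≤ recAlg p q
  measurable_weight : ∀ n j k, Measurable[known m (S₂ n) Z k] (W n j)
  one_le : ∀ n j ω, 1 ≤ W n j ω
  bdd : ∀ n, ∃ b, ∀ j, ∀ᵐ ω ∂P, W n j ω ≤ b
  moment : ∃ C, ∀ n, ∑ j ∈ range (n₁ n), ∫ ω, rate (n₁ n) (n₂ n) (S₂ n ω) j ^ 2 * W n j ω ^ 4 ∂P ≤ C
  one_le_scale : ∀ r, 1 ≤ y r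
  integrable_scale : Integrable (fun r => y r ^ 4) Q
  condMoment : ∃ C, ∀ᵐ r ∂Q, (Q[fun r' => y r' ^ 4 | m]) r ≤ C

/-- The quantities that dominate all error terms. -/
def Layer.dom (Z : ℕ → Ω → Rec p q) (n₁ n₂ : ℕ → ℕ) (S₂ : ℕ → Ω → Finset ℕ) (y : Rec p q → ℝ)
    (W : Terms) (n j : ℕ) (ω : Ω) : ℝ :=
  rate (n₁ n) (n₂ n) (S₂ n ω) j ^ 2 * W n j ω ^ 4 * y (Z j ω) ^ 4

section Scaled

variable {y : Rec p q → ℝ} {m : MeasurableSpace (Rec p q)} {W : ℕ → ℕ → Ω → ℝ}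

local notation "IsLayer" => Layer P Q Z n₁ n₂ S₂ y

local notation "domₙ" W:max n:max j:max ω:max => Layer.dom Z n₁ n₂ S₂ y W n j ω

namespace Layer

lemma dom_nonneg (n j : ℕ) (ω : Ω) : 0 ≤ domₙ W n j ω := by unfold dom; positivity

lemma integrable_dom_and_le (h : IsLayer m W) (des : IsDesign) : (∀ n j, Integrable
    (dom Z n₁ n₂ S₂ y W n j) P) ∧ ∃ C, 0 ≤ C ∧ ∀ n (X : ℕ → Ω → ℝ) (c : ℝ),
    (∀ j, ∀ᵐ ω ∂P, |X j ω| ≤ c * domₙ W n j ω) → ∑ j ∈ range (n₁ n), ∫ ω, |X j ω| ∂P ≤ |c| * C := by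
  obtain ⟨C₁, hC₁⟩ := h.condMoment
  obtain ⟨C₂, hC₂⟩ := h.moment
  have hrk : ∀ n j k, Measurable[𝒦 m n k]
      fun ω => rateₙ n ω j ^ 2 * W n j ω ^ 4 := fun n j k =>
    ((measurable_known_coef (fun s => rate (n₁ n) (n₂ n) s j) k).pow_const 2).mul ((h.measurable_weight n j k).pow_const 4)
  -- the weights are bounded almost surely; truncation makes them bounded everywhere
  have key : ∀ n j, Integrable (dom Z n₁ n₂ S₂ y W n j) P ∧ ∫ ω, domₙ W n j ω ∂P
      ≤ max C₁ 0 * ∫ ω, rateₙ n ω j ^ 2 * W n j ω ^ 4 ∂P := by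
    intro n j
    obtain ⟨b, hb⟩ := h.bdd n
    set G : Ω → ℝ := fun ω => min (rateₙ n ω j ^ 2 * W n j ω ^ 4)
      (4 * (n₂ n : ℝ)⁻¹ * |b| ^ 4) with hG
    have hGk : Measurable[𝒦 m n j] G := (hrk n j j).min measurable_const
    have hGm : Measurable G := hGk.mono (des.known_le h.le n j) le_rfl
    have hG0 : ∀ ω, 0 ≤ G ω := fun ω => le_min (by positivity) (by positivity)
    have hGae : ∀ᵐ ω ∂P, G ω = rateₙ n ω j ^ 2 * W n j ω ^ 4 := by
      filter_upwards [hb j] with ω hω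
      have := h.one_le n j ω
      exact min_eq_left (mul_le_mul (des.rate_sq_le n _ j) (pow_le_pow_left₀ (by linarith)
        (hω.trans (le_abs_self b)) 4) (by positivity) (by positivity))
    have e1 : (fun ω => G ω * y (Z j ω) ^ 4) =ᵐ[P] dom Z n₁ n₂ S₂ y W n j := by
      filter_upwards [hGae] with ω hω
      rw [hω, dom]
    refine ⟨(integrable_bdd_mul_comp (m𝒵 := recAlg p q) des.measurable_Z des.iid_law j h.integrable_scale hGm
      (b := 4 * (n₂ n : ℝ)⁻¹ * |b| ^ 4) fun ω => ?_).congr e1, ?_⟩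
    · rw [abs_of_nonneg (hG0 ω)]; exact min_le_right _ _
    · rw [← integral_congr_ae e1, ← integral_congr_ae hGae]
      refine des.integral_mul_le n h.le h.integrable_scale j ?_ hGk hG0
        (fun ω => min_le_right _ _)
      filter_upwards [hC₁] with r hr using hr.trans (le_max_left _ _)
  refine ⟨fun n j => (key n j).1, max C₁ 0 * max C₂ 0, by positivity, fun n X c hX => ?_⟩
  have h1 : ∀ j ∈ range (n₁ n), ∫ ω, |X j ω| ∂P
      ≤ |c| * (max C₁ 0 * ∫ ω, rateₙ n ω j ^ 2 * W n j ω ^ 4 ∂P) := fun j _ => by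
    refine (integral_mono_of_nonneg (ae_of_all _ fun ω => abs_nonneg _)
      ((key n j).1.const_mul |c|) ?_).trans ?_
    · filter_upwards [hX j] with ω hω
      exact hω.trans (mul_le_mul_of_nonneg_right (le_abs_self _) (dom_nonneg n j ω))
    · rw [integral_const_mul]
      exact mul_le_mul_of_nonneg_left (key n j).2 (abs_nonneg _)
  refine (sum_le_sum h1).trans ?_
  rw [← mul_sum, ← mul_sum]
  gcongr
  exact (hC₂ n).trans (le_max_left _ _)

lemma tendsto_sum_integral (h : IsLayer m W) (des : IsDesign) {X : Terms} {c : ℕ → ℝ}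
    (hX : ∀ n j, ∀ᵐ ω ∂P, |X n j ω| ≤ c n * domₙ W n j ω) (hc : Tendsto c atTop (𝓝 0)) :
    Tendsto (fun n => ∑ j ∈ range (n₁ n), ∫ ω, |X n j ω| ∂P) atTop (𝓝 0) := by
  obtain ⟨-, C, -, hC⟩ := h.integrable_dom_and_le des
  exact squeeze_zero (fun n => sum_nonneg fun j _ => integral_nonneg fun ω => abs_nonneg _)
    (fun n => hC n _ _ (hX n)) (by simpa using hc.abs.mul_const C)

lemma integrable_of_le (h : IsLayer m W) (des : IsDesign) {X : Ω → ℝ} (hXm : Measurable X) {c : ℝ}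
    {n j : ℕ} (hX : ∀ᵐ ω ∂P, |X ω| ≤ c * domₙ W n j ω) : Integrable X P :=
  (((h.integrable_dom_and_le des).1 n j).const_mul c).mono' hXm.aestronglyMeasurable hX

lemma integral_abs_sum_le {s : Finset ℕ} {X : ℕ → Ω → ℝ} (hX : ∀ j ∈ s, Integrable (X j) P) :
    ∫ ω, |∑ j ∈ s, X j ω| ∂P ≤ ∑ j ∈ s, ∫ ω, |X j ω| ∂P := by
  rw [← integral_finsetSum _ fun j hj => (hX j hj).abs]
  exact integral_mono_of_nonneg (ae_of_all _ fun ω => abs_nonneg _)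
    (integrable_finsetSum _ fun j hj => (hX j hj).abs) (ae_of_all _ fun ω => abs_sum_le_sum_abs _ _)

lemma tendsto_sum_of_le (h : IsLayer m W) (des : IsDesign) {X : Terms}
    (hXm : ∀ n j, Measurable (X n j)) {c : ℕ → ℝ} (hX : ∀ n j, ∀ᵐ ω ∂P, |X n j ω| ≤ c n * domₙ W n j ω)
    (hc : Tendsto c atTop (𝓝 0)) : plim (fun z => ∑ j ∈ range (n₁ z.1), X z.1 j z.2) 0 := by
  have hi := fun n j => h.integrable_of_le des (hXm n j) (hX n j)
  exact tendsto_probFilter_of_integral_abs (X := fun n ω => ∑ j ∈ range (n₁ n), X n j ω)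
    (Eventually.of_forall fun n => integrable_finsetSum _ fun j _ => hi n j)
    (Eventually.of_forall fun n => integral_abs_sum_le fun j _ => hi n j)
    (h.tendsto_sum_integral des hX hc)

lemma isTightSeq_sum (h : IsLayer m W) (des : IsDesign) {X : Terms}
    (hXm : ∀ n j, Measurable (X n j)) {c : ℝ} (hX : ∀ n j, ∀ᵐ ω ∂P, |X n j ω| ≤ c * domₙ W n j ω) :
    IsTightSeq P fun n ω => ∑ j ∈ range (n₁ n), X n j ω := by
  obtain ⟨-, C, -, hC⟩ := h.integrable_dom_and_le des
  have hi := fun n j => h.integrable_of_le des (hXm n j) (hX n j)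
  exact isTightSeq_of_integral_abs (Eventually.of_forall fun n =>
    integrable_finsetSum _ fun j _ => hi n j) (Eventually.of_forall fun n =>
      (integral_abs_sum_le fun j _ => hi n j).trans (hC n _ _ (hX n)))

/-- `|G| ≤ c rate² W²` and `|f| ≤ c' y²` give a negligible second moment. -/
lemma sq_le_dom (des : IsDesign) {n j : ℕ} {ω : Ω} {x c : ℝ}
    (hx : |x| ≤ c * (rateₙ n ω j ^ 2 * W n j ω ^ 2 * y (Z j ω) ^ 2)) :
    |x ^ 2| ≤ 4 * c ^ 2 * (n₂ n : ℝ)⁻¹ * domₙ W n j ω := by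
  rw [abs_of_nonneg (sq_nonneg x), ← sq_abs]
  refine (pow_le_pow_left₀ (abs_nonneg _) hx 2).trans ?_
  have := des.rate_sq_le n (S₂ n ω) j
  calc _ = c ^ 2 * (rateₙ n ω j ^ 2 * (rateₙ n ω j ^ 2 *
        W n j ω ^ 4 * y (Z j ω) ^ 4)) := by ring
    _ ≤ c ^ 2 * (4 * (n₂ n : ℝ)⁻¹ * (rateₙ n ω j ^ 2 *
        W n j ω ^ 4 * y (Z j ω) ^ 4)) := by gcongr
    _ = _ := by rw [dom]; ring

/-- Law of large numbers for terms that are centred given `m`. -/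
lemma tendsto_sum_mul (h : IsLayer m W) (des : IsDesign) {f : Rec p q → ℝ} (hf :
    Measurable[recAlg p q] f) {c : ℝ} (hfc : ∀ᵐ r ∂Q, |f r| ≤ c * y r ^ 2) (hf0 : Q[f | m]
    =ᵐ[Q] 0) {G : Terms} (hG : ∀ n j k, Measurable[𝒦 m n k] (G n j)) {c' : ℝ}
    (hGc : ∀ n j, ∀ᵐ ω ∂P,
      |G n j ω| ≤ c' * (rateₙ n ω j ^ 2 * W n j ω ^ 2)) :
    plim (fun z => ∑ j ∈ range (n₁ z.1), G z.1 j z.2 * f (Z j z.2)) 0 := by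
  have hGm : ∀ n j, Measurable (G n j) := fun n j => (hG n j 0).mono (des.known_le h.le n 0) le_rfl
  have hXm : ∀ n j, Measurable fun ω => G n j ω * f (Z j ω) := fun n j =>
    (hGm n j).mul (hf.comp (des.measurable_Z j))
  have hb : ∀ n j, ∀ᵐ ω ∂P, |(G n j ω * f (Z j ω)) ^ 2|
      ≤ 4 * (c' * c) ^ 2 * (n₂ n : ℝ)⁻¹ * domₙ W n j ω := by
    intro n j
    filter_upwards [hGc n j, des.ae_unit hfc j] with ω h1 h2
    refine sq_le_dom des ?_
    rw [abs_mul]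
    refine (mul_le_mul h1 h2 (abs_nonneg _) ((abs_nonneg _).trans h1)).trans (le_of_eq ?_)
    ring
  have hX2 : ∀ n j, MemLp (fun ω => G n j ω * f (Z j ω)) 2 P := fun n j =>
    (memLp_two_iff_integrable_sq (hXm n j).aestronglyMeasurable).2
      (h.integrable_of_le des ((hXm n j).pow_const 2) (hb n j))
  have hfi : Integrable f Q := by
    refine (h.integrable_scale.const_mul |c|).mono' hf.aestronglyMeasurable ?_
    filter_upwards [hfc] with r hr
    refine hr.trans ((mul_le_mul_of_nonneg_right (le_abs_self c) (by positivity)).trans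
      (mul_le_mul_of_nonneg_left (pow_le_pow_right₀ (h.one_le_scale r) (by norm_num))
        (abs_nonneg _)))
  refine des.tendsto_sum_of_condExp_eq_zero h.le (X := fun n j ω => G n j ω * f (Z j ω))
    (fun n k i hik => (hG n i k).mul
      (hf.comp (measurable_revealed_of_ne (m𝒵 := recAlg p q) hik.ne))) (fun n k _ => hX2 n k) (fun n k _ => ?_) ?_
  · filter_upwards [des.condExp_coeff_mul n h.le hfi (hG n k k)
      ((hX2 n k).integrable one_le_two), des.ae_unit hf0 k] with ω h1 h2
    rw [h1, h2, Pi.zero_apply, mul_zero, Pi.zero_apply]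
  · have := h.tendsto_sum_integral des hb (by
      simpa using des.tendsto_inv_n₂.const_mul (4 * (c' * c) ^ 2))
    simpa only [abs_of_nonneg (sq_nonneg (_ : ℝ))] using this

lemma exists_abs_condExp_le (h : IsLayer m W) {f : Rec p q → ℝ} (hf : Measurable[recAlg p q] f)
    {c : ℝ} (hfc : ∀ᵐ r ∂Q, |f r| ≤ c * y r ^ 2) :
    Integrable f Q ∧ ∃ C, 0 ≤ C ∧ ∀ᵐ r ∂Q, |(Q[f | m]) r| ≤ C := by
  obtain ⟨C, hC⟩ := h.condMoment
  have hle : ∀ᵐ r ∂Q, |f r| ≤ |c| * y r ^ 4 := by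
    filter_upwards [hfc] with r hr
    exact hr.trans ((mul_le_mul_of_nonneg_right (le_abs_self c) (by positivity)).trans
      (mul_le_mul_of_nonneg_left (pow_le_pow_right₀ (h.one_le_scale r) (by norm_num))
        (abs_nonneg _)))
  have hi := h.integrable_scale.const_mul |c|
  have hfi : Integrable f Q := hi.mono' hf.aestronglyMeasurable hle
  refine ⟨hfi, |c| * |C|, by positivity, ?_⟩
  have hs : Q[fun r => |c| * y r ^ 4 | m] =ᵐ[Q] fun r =>
      |c| * (Q[fun r => y r ^ 4 | m]) r := by
    simpa only [smul_eq_mul, Pi.smul_def] using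
      condExp_smul (μ := Q) |c| (fun r : Rec p q => y r ^ 4) m
  have h1 := condExp_mono (m := m) hfi hi (by
    filter_upwards [hle] with r hr using (le_abs_self _).trans hr)
  have h2 := condExp_mono (m := m) hfi.neg hi (by
    filter_upwards [hle] with r hr using (neg_le_abs _).trans hr)
  filter_upwards [h1, h2, hs, hC, condExp_neg (μ := Q) f m] with r h1 h2 hs hC h3
  have : |c| * (Q[fun r => y r ^ 4 | m]) r ≤ |c| * |C| :=
    mul_le_mul_of_nonneg_left (hC.trans (le_abs_self C)) (abs_nonneg c)
  rw [h3] at h2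
  simp only [Pi.neg_apply] at h2
  exact abs_le.2 ⟨by linarith, by linarith⟩

lemma tendsto_sum_mul_sub (h : IsLayer m W) (des : IsDesign) {f : Rec p q → ℝ} (hf :
    Measurable[recAlg p q] f) {c : ℝ} (hfc : ∀ᵐ r ∂Q, |f r| ≤ c * y r ^ 2) {G : Terms} (hG : ∀ n j k, Measurable[𝒦 m n k] (G n j)) {c' : ℝ} (hGc : ∀ n j, ∀ᵐ ω ∂P,
      |G n j ω| ≤ c' * (rateₙ n ω j ^ 2 * W n j ω ^ 2)) :
    plim (fun z => ∑ j ∈ range (n₁ z.1), G z.1 j z.2 * (f (Z j z.2) - (Q[f | m]) (Z j z.2))) 0 := by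
  obtain ⟨hfi, C, hC0, hC⟩ := h.exists_abs_condExp_le hf hfc
  have hqm : Measurable[recAlg p q] (Q[f | m]) := stronglyMeasurable_condExp.measurable.mono h.le le_rfl
  refine h.tendsto_sum_mul des (f := fun r => f r - (Q[f | m]) r) (hf.sub hqm) (c := c + C)
    ?_ ?_ hG hGc
  · filter_upwards [hfc, hC] with r h1 h2
    refine (abs_sub _ _).trans ?_
    have := one_le_pow₀ (h.one_le_scale r) (n := 2)
    nlinarith
  · have h1 : Q[fun r => f r - (Q[f | m]) r | m] =ᵐ[Q] Q[f | m] - Q[Q[f | m] | m] :=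
      condExp_sub hfi integrable_condExp m
    filter_upwards [h1] with r hr
    rw [hr, Pi.sub_apply, condExp_of_stronglyMeasurable h.le stronglyMeasurable_condExp
      integrable_condExp, sub_self, Pi.zero_apply]

/-- Lindeberg's condition. -/
lemma tendsto_sum_large (h : IsLayer m W) (des : IsDesign) {X : Terms} (hXm
    : ∀ n j, Measurable (X n j)) {c : ℝ} (hX : ∀ n j, ∀ᵐ ω ∂P, |X n j ω| ≤
      c * (rateₙ n ω j * W n j ω * y (Z j ω))) :
    plim (fun z => ∑ j ∈ range (n₁ z.1),
      if 1 / 2 < |X z.1 j z.2| then X z.1 j z.2 ^ 2 else 0) 0 := by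
  refine h.tendsto_sum_of_le des
    (X := fun n j ω => if 1 / 2 < |X n j ω| then X n j ω ^ 2 else 0) (fun n j => Measurable.ite
    (measurableSet_lt measurable_const (hXm n j).abs) ((hXm n j).pow_const 2) measurable_const)
    (c := fun n => 4 * (4 * (c ^ 2) ^ 2 * (n₂ n : ℝ)⁻¹)) (fun n j => ?_)
    (by simpa using (des.tendsto_inv_n₂.const_mul (4 * (c ^ 2) ^ 2)).const_mul 4)
  filter_upwards [hX n j] with ω hω
  have h1 := sq_le_dom des (W := W) (n := n) (j := j) (ω := ω) (x := X n j ω ^ 2) (c := c ^ 2) (by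
    rw [abs_of_nonneg (sq_nonneg _), ← sq_abs]
    refine (pow_le_pow_left₀ (abs_nonneg _) hω 2).trans (le_of_eq ?_)
    ring)
  rw [abs_of_nonneg (sq_nonneg _)] at h1
  rw [mul_assoc]
  split_ifs with hl
  · rw [abs_of_nonneg (sq_nonneg _)]
    have h2 : (1 / 2 : ℝ) ^ 2 ≤ X n j ω ^ 2 := by
      rw [← sq_abs (X n j ω)]; exact pow_le_pow_left₀ (by norm_num) hl.le 2
    nlinarith
  · rw [abs_zero]
    nlinarith [sq_nonneg (X n j ω ^ 2)]

end Layer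

end Scaled

section Scaled

variable {y : Rec p q → ℝ} {m : MeasurableSpace (Rec p q)} {W : ℕ → ℕ → Ω → ℝ}

local notation "IsLayer" => Layer P Q Z n₁ n₂ S₂ y

local notation "domₙ" W:max n:max j:max ω:max => Layer.dom Z n₁ n₂ S₂ y W n j ω

namespace Layer

variable {ι : Type*} [Fintype ι]

/-- The conditional variance given `m` of `∑ i, G i * f i`, evaluated at unit `j`; the maximum with
zero makes it nonnegative everywhere, for every version of the conditional expectations. -/
def stepVar (Q : Measure (Rec p q)) (m : MeasurableSpace (Rec p q)) (Z : ℕ → Ω → Rec p q)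
    (f : ι → Rec p q → ℝ) (G : ι → Terms) (n j : ℕ) (ω : Ω) : ℝ :=
  max 0 (∑ a : ι × ι, G a.1 n j ω * G a.2 n j ω * (Q[fun r => f a.1 r * f a.2 r | m]) (Z j ω))

lemma measurable_stepVar (hm : m ≤ recAlg p q) (f : ι → Rec p q → ℝ) {G : ι → Terms}
    (hG : ∀ i n j k, Measurable[𝒦 m n k] (G i n j)) (n j k : ℕ) :
    Measurable[𝒦 m n k] (stepVar Q m Z f G n j) :=
  measurable_const.max (Finset.measurable_fun_sum _ fun _ _ => ((hG _ n j k).mul (hG _ n j k)).mul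
    (measurable_revealed_comp (m𝒵 := recAlg p q) hm stronglyMeasurable_condExp.measurable j k))

lemma abs_mul_le_of_le {x y a b : ℝ} (h1 : |x| ≤ a) (h2 : |y| ≤ b) : |x * y| ≤ a * b := by
  rw [abs_mul]; exact mul_le_mul h1 h2 (abs_nonneg _) ((abs_nonneg _).trans h1)

/-- The sums of the terms `X = ∑ i, G i * f i`, which are centred given `m`: their squares add up with
those of any terms known given `m`, and their sum is approximately normal given what is known. -/
theorem step (h : IsLayer m W) (des : IsDesign) {f : ι → Rec p q → ℝ}
    (hf : ∀ i, Measurable[recAlg p q] (f i)) {c : ℝ} (hc0 : 0 ≤ c)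
    (hfc : ∀ i, ∀ᵐ r ∂Q, |f i r| ≤ c * y r) (hf0 : ∀ i, Q[f i | m] =ᵐ[Q] 0) {G : ι → Terms}
    (hG : ∀ i n j k, Measurable[𝒦 m n k] (G i n j)) {c' : ℝ}
    (hGc : ∀ i n j, ∀ᵐ ω ∂P, |G i n j ω| ≤ c' * (rateₙ n ω j * W n j ω)) :
    (∀ (H : Terms) (c'' : ℝ), (∀ n j k, Measurable[𝒦 m n k] (H n j)) →
      (∀ n j, ∀ᵐ ω ∂P, |H n j ω| ≤ c'' * (rateₙ n ω j * W n j ω)) →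
      plim (fun z => ∑ j ∈ range (n₁ z.1), ((H z.1 j z.2 + ∑ i, G i z.1 j z.2 * f i (Z j z.2)) ^ 2
        - H z.1 j z.2 ^ 2 - stepVar Q m Z f G z.1 j z.2)) 0) ∧
    ∀ F : ℕ → Ω → ℂ, (∀ n k, StronglyMeasurable[𝒦 m n k] (F n)) → (∀ n ω, ‖F n ω‖ ≤ 1) →
      Tendsto (fun n => ∫ ω, F n ω * cis (∑ j ∈ range (n₁ n), ∑ i, G i n j ω * f i (Z j ω)) ∂P
        - ∫ ω, F n ω * (Real.exp (-(∑ j ∈ range (n₁ n), stepVar Q m Z f G n j ω) / 2) : ℝ) ∂P)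
        atTop (𝓝 0) := by
  have hfs : ∀ i, ∀ᵐ r ∂Q, |f i r| ≤ c * y r ^ 2 := fun i => by
    filter_upwards [hfc i] with r hr using hr.trans (mul_le_mul_of_nonneg_left
      (le_self_pow₀ (h.one_le_scale r) two_ne_zero) hc0)
  have hp : ∀ a b, ∀ᵐ r ∂Q, |f a r * f b r| ≤ c ^ 2 * y r ^ 2 := fun a b => by
    filter_upwards [hfc a, hfc b] with r h1 h2 using (abs_mul_le_of_le h1 h2).trans (by ring_nf; rfl)
  have hcoef : ∀ {H H' : Terms} {a b : ℝ},
      (∀ n j, ∀ᵐ ω ∂P, |H n j ω| ≤ a * (rateₙ n ω j * W n j ω)) →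
      (∀ n j, ∀ᵐ ω ∂P, |H' n j ω| ≤ b * (rateₙ n ω j * W n j ω)) →
      ∀ n j, ∀ᵐ ω ∂P, |H n j ω * H' n j ω| ≤ (a * b) * (rateₙ n ω j ^ 2 * W n j ω ^ 2) :=
    fun hH hH' n j => by
      filter_upwards [hH n j, hH' n j] with ω h1 h2
      exact (abs_mul_le_of_le h1 h2).trans (le_of_eq (by ring))
  have hGm : ∀ i n j, Measurable (G i n j) := fun i n j =>
    (hG i n j 0).mono (des.known_le h.le n 0) le_rfl
  have hff : ∀ a b, Measurable[recAlg p q] fun r => f a r * f b r := fun a b => (hf a).mul (hf b)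
  have hGG : ∀ a b n j k, Measurable[𝒦 m n k] fun ω => G a n j ω * G b n j ω := fun a b n j k =>
    (hG a n j k).mul (hG b n j k)
  set X : Terms := fun n j ω => ∑ i, G i n j ω * f i (Z j ω) with hX
  set s := stepVar Q m Z f G with hs
  set e : Terms := fun n j ω => ∑ a : ι × ι,
    G a.1 n j ω * G a.2 n j ω * (Q[fun r => f a.1 r * f a.2 r | m]) (Z j ω) with he
  have hXm : ∀ n j, Measurable (X n j) := fun n j => Finset.measurable_fun_sum _ fun i _ =>
    (hGm i n j).mul ((hf i).comp (des.measurable_Z j))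
  have hint : ∀ (a b : ι) n j, Integrable (fun ω => G a n j ω * G b n j ω *
      (f a (Z j ω) * f b (Z j ω))) P := fun a b n j => by
    refine h.integrable_of_le des (c := |c' * c' * c ^ 2|) (n := n) (j := j)
      (((hGm a n j).mul (hGm b n j)).mul ((hff a b).comp (des.measurable_Z j))) ?_
    filter_upwards [hcoef (hGc a) (hGc b) n j, des.ae_unit (hp a b) j] with ω h1 h2
    have hW := h.one_le n j ω
    have hy := h.one_le_scale (Z j ω)
    calc _ ≤ c' * c' * c ^ 2 * (rateₙ n ω j ^ 2 * W n j ω ^ 2 * y (Z j ω) ^ 2) :=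
          (abs_mul_le_of_le h1 h2).trans (le_of_eq (by ring))
      _ ≤ |c' * c' * c ^ 2| * (rateₙ n ω j ^ 2 * W n j ω ^ 4 * y (Z j ω) ^ 4) := by
          gcongr
          exacts [le_abs_self _, by norm_num, by norm_num]
  have hXsq : ∀ n j ω, X n j ω ^ 2 = ∑ a : ι × ι,
      G a.1 n j ω * G a.2 n j ω * (f a.1 (Z j ω) * f a.2 (Z j ω)) := fun n j ω => by
    rw [sq, hX, sum_mul_sum, Fintype.sum_prod_type]
    exact sum_congr rfl fun a _ => sum_congr rfl fun b _ => by ring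
  have hX2 : ∀ n j, Integrable (fun ω => X n j ω ^ 2) P := fun n j => by
    simp only [hXsq]
    exact integrable_finsetSum _ fun a _ => hint a.1 a.2 n j
  have hF := fun a : ι × ι => h.exists_abs_condExp_le (hff a.1 a.2) (hp a.1 a.2)
  have hvar : ∀ n j, P[fun ω => X n j ω ^ 2 | 𝒦 m n j] =ᵐ[P] e n j := fun n j => by
    simp only [hXsq]
    exact des.condExp_sum_coeff_mul n h.le univ (fun a _ => (hF a).1) (fun a _ => hGG _ _ n j j)
      fun a _ => hint a.1 a.2 n j
  have hse : ∀ n j, s n j =ᵐ[P] e n j := fun n j => by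
    have h0 : (0 : Ω → ℝ) ≤ᵐ[P] P[fun ω => X n j ω ^ 2 | 𝒦 m n j] :=
      condExp_nonneg (ae_of_all _ fun ω => sq_nonneg _)
    filter_upwards [h0, hvar n j] with ω h1 h2
    rw [h2] at h1
    exact max_eq_right h1
  refine ⟨fun H c'' hH hHc => ?_, fun F hF0 hF1 => ?_⟩
  · have t1 := tendsto_finsetSum univ fun i _ => h.tendsto_sum_mul des (hf i) (hfs i) (hf0 i)
      (G := fun n j ω => H n j ω * G i n j ω) (fun n j k => (hH n j k).mul (hG i n j k))
      (hcoef hHc (hGc i))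
    have t2 := tendsto_finsetSum univ fun (a : ι × ι) _ => h.tendsto_sum_mul_sub des
      (hff a.1 a.2) (hp a.1 a.2) (G := fun n j ω => G a.1 n j ω * G a.2 n j ω)
      (fun n j k => hGG _ _ n j k) (hcoef (hGc a.1) (hGc a.2))
    have t := (t1.const_mul 2).add t2
    simp only [sum_const_zero, mul_zero, add_zero] at t
    refine t.congr' ?_
    filter_upwards [eventually_probFilter_of_ae (Eventually.of_forall fun n =>
      ae_all_iff.2 (hse n))] with z hz
    rw [sum_comm, sum_comm (s := (univ : Finset (ι × ι))), mul_sum, ← sum_add_distrib]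
    refine sum_congr rfl fun j _ => ?_
    rw [hz j, add_sq, hXsq, he]
    simp only [mul_sub, sum_sub_distrib, mul_sum, mul_assoc]
    ring
  · choose C hC0 hC using fun a => (hF a).2
    have hs0 : ∀ n j ω, 0 ≤ s n j ω := fun n j ω => le_max_left _ _
    set K : ℝ := ∑ a, c' * c' * C a with hK
    have hK0 : 0 ≤ K := sum_nonneg fun a _ => mul_nonneg (mul_self_nonneg _) (hC0 a)
    have hsb : ∀ n j, ∀ᵐ ω ∂P, |s n j ω ^ 2| ≤ 4 * K ^ 2 * (n₂ n : ℝ)⁻¹ * domₙ W n j ω :=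
      fun n j => by
      filter_upwards [hse n j, ae_all_iff.2 fun a : ι × ι => hcoef (hGc a.1) (hGc a.2) n j,
        ae_all_iff.2 fun a => des.ae_unit (hC a) j] with ω h0 h1 h2
      refine sq_le_dom des ?_
      rw [h0]
      refine ((abs_sum_le_sum_abs _ _).trans (sum_le_sum fun a _ =>
        abs_mul_le_of_le (h1 a) (h2 a))).trans ?_
      have hy := one_le_pow₀ (h.one_le_scale (Z j ω)) (n := 2)
      have hR : 0 ≤ rateₙ n ω j ^ 2 * W n j ω ^ 2 := by positivity
      calc _ = K * (rateₙ n ω j ^ 2 * W n j ω ^ 2) := by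
            rw [hK, sum_mul]; exact sum_congr rfl fun a _ => by ring
        _ ≤ _ := mul_le_mul_of_nonneg_left (le_mul_of_one_le_right hR hy) hK0
    set k : ℝ := |Fintype.card ι * (c' * c)| with hk
    have hXb : ∀ n j, ∀ᵐ ω ∂P, |X n j ω ^ 2 * min 1 (|X n j ω|)|
        ≤ k ^ 3 * (2 * (√(n₂ n))⁻¹) * domₙ W n j ω := fun n j => by
      filter_upwards [ae_all_iff.2 fun i => hGc i n j, ae_all_iff.2 fun i => des.ae_unit (hfc i) j]
        with ω h1 h2
      set R := rateₙ n ω j with hR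
      have hR0 : 0 ≤ R := rate_nonneg _ _ _ _
      have hR1 : R ≤ 2 * (√(n₂ n))⁻¹ := rate_le (des.size_pos n) (des.size_le n) _ _
      have hW1 := h.one_le n j ω
      have hy1 := h.one_le_scale (Z j ω)
      have hXle : |X n j ω| ≤ k * (R * W n j ω * y (Z j ω)) := by
        refine ((abs_sum_le_sum_abs _ _).trans (sum_le_card_nsmul _ _ _ fun i _ =>
          abs_mul_le_of_le (h1 i) (h2 i))).trans ?_
        rw [nsmul_eq_mul, card_univ]
        calc _ = Fintype.card ι * (c' * c) * (R * W n j ω * y (Z j ω)) := by ring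
          _ ≤ _ := mul_le_mul_of_nonneg_right (le_abs_self _) (by positivity)
      rw [abs_of_nonneg (mul_nonneg (sq_nonneg _) (le_min zero_le_one (abs_nonneg _))), ← sq_abs]
      calc |X n j ω| ^ 2 * min 1 |X n j ω|
          ≤ (k * (R * W n j ω * y (Z j ω))) ^ 2 * (k * (R * W n j ω * y (Z j ω))) := by
            gcongr; exact (min_le_right _ _).trans hXle
        _ = k ^ 3 * (R * (R ^ 2 * W n j ω ^ 3 * y (Z j ω) ^ 3)) := by ring
        _ ≤ k ^ 3 * ((2 * (√(n₂ n))⁻¹) * (R ^ 2 * W n j ω ^ 4 * y (Z j ω) ^ 4)) := by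
            gcongr <;> norm_num
        _ = _ := by rw [dom]; ring
    have l1 := (h.tendsto_sum_integral des hXb (by
      have : Tendsto (fun n => (√(n₂ n))⁻¹) atTop (𝓝 0) := by
        have := (Real.continuous_sqrt.tendsto 0).comp des.tendsto_inv_n₂
        simpa [Function.comp_def] using this
      simpa using (this.const_mul 2).const_mul (k ^ 3))).const_mul 4
    have l2 := h.tendsto_sum_integral des hsb (by
      simpa using des.tendsto_inv_n₂.const_mul (4 * K ^ 2))
    have l := l1.add l2
    rw [mul_zero, zero_add] at l
    refine squeeze_zero_norm (fun n => ?_) l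
    refine (norm_integral_cexp_sum_sub_le (P := P) (n₁ n) (ℬ := fun k => 𝒦 m n k)
      (fun k => des.known_le h.le n k) (X := X n) (s := s n) (F := F n) (hF0 n) (hF1 n)
      (fun k j hjk => Finset.measurable_fun_sum _ fun i _ => (hG i n j k).mul ((hf i).comp
        (measurable_revealed_of_ne (m𝒵 := recAlg p q) hjk.ne))) (hXm n)
      (fun k j => measurable_stepVar h.le f hG n j k) (hs0 n) (fun j _ => hX2 n j)
      (fun j _ => h.integrable_of_le des (((measurable_stepVar h.le f hG n j 0).mono
        (des.known_le h.le n 0) le_rfl).pow_const 2) (hsb n j)) (fun j _ => ?_)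
      (fun j _ => (hvar n j).trans (hse n j).symm)).trans (le_of_eq ?_)
    · have hi : ∀ i, Integrable (fun ω => G i n j ω * f i (Z j ω)) P := fun i =>
        ((memLp_two_iff_integrable_sq ((hGm i n j).mul
          ((hf i).comp (des.measurable_Z j))).aestronglyMeasurable).2
          ((hint i i n j).congr (ae_of_all _ fun ω => by
            simp only [Pi.mul_apply, Function.comp_apply]; ring))).integrable one_le_two
      filter_upwards [des.condExp_sum_coeff_mul n h.le univ
        (fun i _ => (h.exists_abs_condExp_le (hf i) (hfs i)).1) (fun i _ => hG i n j j)
        fun i _ => hi i, ae_all_iff.2 fun i => des.ae_unit (hf0 i) j] with ω h1 h2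
      exact h1.trans (sum_eq_zero fun i _ => by rw [h2 i, Pi.zero_apply, mul_zero])
    · rw [sum_add_distrib, ← mul_sum]
      simp only [abs_of_nonneg (sq_nonneg (_ : ℝ)),
        abs_of_nonneg (mul_nonneg (sq_nonneg (_ : ℝ)) (le_min zero_le_one (abs_nonneg (_ : ℝ))))]

end Layer

end Scaled

/-! ### Linear statistics with square integrable terms -/

/-- Centred truncations of an integrable function. -/
lemma exists_bounded_approx {f : Rec p q → ℝ} (hfm : Measurable f)
    {e : ℝ≥0∞} (he : 1 ≤ e) (hf : MemLp f e Q)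
    (hf0 : ∫ r, f r ∂Q = 0) : ∃ (F : ℕ → Rec p q → ℝ) (u : Rec p q → ℝ),
      MemLp u e Q ∧ (∀ k, Measurable (F k) ∧ ∫ r, F k r ∂Q = 0 ∧ ∃ c, ∀ r, |F k r| ≤ c) ∧
      (∀ k r, |F k r| ≤ u r ∧ |f r - F k r| ≤ u r) ∧
      ∀ r, Tendsto (fun k => F k r) atTop (𝓝 (f r)) := by
  set c : ℕ → ℝ → ℝ := fun k x => max (-(k : ℝ)) (min k x) with hc
  have hcm : ∀ k, Measurable fun r => c k (f r) := fun k => by fun_prop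
  have hck : ∀ k x, |c k x| ≤ k := fun k x => by
    have : (0 : ℝ) ≤ k := k.cast_nonneg
    exact abs_le.2 ⟨le_max_left _ _, max_le (by linarith) (min_le_left _ _)⟩
  have hcx : ∀ k x, |c k x| ≤ |x| ∧ |x - c k x| ≤ |x| := fun k x => by
    have : (0 : ℝ) ≤ k := k.cast_nonneg
    simp only [hc]
    rcases max_cases (-(k : ℝ)) (min k x) with h | h <;>
      rcases min_cases (k : ℝ) x with h' | h' <;> rw [h.1] <;> try rw [h'.1]
    all_goals constructor <;> apply sq_le_sq.1 <;> nlinarith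
  have hct : ∀ x, Tendsto (fun k => c k x) atTop (𝓝 x) := fun x => by
    refine tendsto_const_nhds.congr' ?_
    filter_upwards [eventually_ge_atTop ⌈|x|⌉₊] with k hk
    have := abs_le.1 (Nat.ceil_le.1 hk)
    simp only [hc]
    rw [min_eq_right this.2, max_eq_right this.1]
  have hfi := hf.integrable he
  have hmt : Tendsto (fun k => ∫ r, c k (f r) ∂Q) atTop (𝓝 0) := by
    rw [← hf0]
    exact tendsto_integral_of_dominated_convergence _ (fun k => (hcm k).aestronglyMeasurable)
      hfi.abs (fun k => ae_of_all _ fun r => (hcx k _).1) (ae_of_all _ fun r => hct _)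
  have hA : ∀ k, |∫ r, c k (f r) ∂Q| ≤ ∫ r, |f r| ∂Q := fun k => by
    rw [← Real.norm_eq_abs]
    exact norm_integral_le_of_norm_le hfi.abs (ae_of_all _ fun r => (hcx k _).1)
  have hci : ∀ k, Integrable (fun r => c k (f r)) Q := fun k =>
    hfi.abs.mono' (hcm k).aestronglyMeasurable (ae_of_all _ fun r => (hcx k _).1)
  refine ⟨fun k r => c k (f r) - ∫ r, c k (f r) ∂Q, fun r => |f r| + ∫ r, |f r| ∂Q,
    hf.abs.add (memLp_const _), fun k => ⟨(hcm k).sub_const _, ?_, k + ∫ r, |f r| ∂Q, fun r =>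
      (abs_sub _ _).trans (add_le_add (hck k _) (hA k))⟩, fun k r =>
      ⟨(abs_sub _ _).trans (add_le_add (hcx k _).1 (hA k)), ?_⟩, fun r => ?_⟩
  · rw [integral_sub (hci k) (integrable_const _)]; simp
  · rw [sub_sub_eq_add_sub, add_sub_right_comm]
    exact (abs_add_le _ _).trans (add_le_add (hcx k _).2 (hA k))
  · simpa using (hct (f r)).sub hmt

lemma tendsto_integral_mul_of_dominated {u v f g : Rec p q → ℝ}
    {F G : ℕ → Rec p q → ℝ} (hu : MemLp u 2 Q) (hv : MemLp v 2 Q) (hF : ∀ k, Measurable (F k))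
    (hG : ∀ k, Measurable (G k)) (hFu : ∀ k r, |F k r| ≤ u r) (hGv : ∀ k r, |G k r| ≤ v r)
    (hFf : ∀ r, Tendsto (fun k => F k r) atTop (𝓝 (f r)))
    (hGg : ∀ r, Tendsto (fun k => G k r) atTop (𝓝 (g r))) :
    Tendsto (fun k => ∫ r, F k r * G k r ∂Q) atTop (𝓝 (∫ r, f r * g r ∂Q)) :=
  tendsto_integral_of_dominated_convergence _ (fun k => ((hF k).mul (hG k)).aestronglyMeasurable)
    (hu.integrable_mul hv) (fun k => ae_of_all _ fun r => Layer.abs_mul_le_of_le (hFu k r) (hGv k r))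
    (ae_of_all _ fun r => (hFf r).mul (hGg r))

namespace Design

/-- The data with weights one form a layer for terms that are centred and bounded. -/
lemma layer_bot (des : IsDesign) : Layer P Q Z n₁ n₂ S₂ (fun _ => 1) ⊥ fun _ _ _ => 1 where
  le := bot_le
  measurable_weight _ _ _ := measurable_const
  one_le _ _ _ := le_rfl
  bdd _ := ⟨1, fun _ => ae_of_all _ fun _ => le_rfl⟩
  moment := ⟨4, fun n => by simpa using
    des.integral_sum_rate_sq_mul_le n (f := fun _ => 1) (integrable_const _) fun _ => zero_le_one⟩
  one_le_scale _ := le_rfl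
  integrable_scale := by simp
  condMoment := ⟨1, ae_of_all _ fun r => by simp [condExp_bot]⟩

/-- Weak law of large numbers for sums weighted by coefficients that depend on the sampling
only. -/
lemma tendsto_weighted_sum (des : IsDesign) {f : Rec p q → ℝ} (hfm : Measurable f)
    (hf : Integrable f Q) {c : ℕ → Finset ℕ → ℕ → ℝ} {C : ℝ} (hC0 : 0 ≤ C)
    (hc : ∀ n s j, |c n s j| ≤ C * rate (n₁ n) (n₂ n) s j ^ 2) :
    plim (fun z => ∑ j ∈ range (n₁ z.1), c z.1 (S₂ z.1 z.2) j * (f (Z j z.2) - ∫ r, f r ∂Q)) 0 := by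
  set g : Rec p q → ℝ := fun r => f r - ∫ r, f r ∂Q with hg
  have hgm : Measurable g := hfm.sub_const _
  have hgi : Integrable g Q := hf.sub (integrable_const _)
  obtain ⟨F, u, hu, hF, hFu, hFt⟩ := exists_bounded_approx hgm le_rfl (memLp_one_iff_integrable.2 hgi)
    (by rw [hg, integral_sub hf (integrable_const _)]; simp)
  have hFm : ∀ k, AEStronglyMeasurable (fun r => g r - F k r) Q := fun k =>
    (hgm.sub (hF k).1).aestronglyMeasurable
  have ht : Tendsto (fun k => ∫ r, |g r - F k r| ∂Q) atTop (𝓝 0) := by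
    have := tendsto_integral_of_dominated_convergence (μ := Q) (f := fun _ => (0 : ℝ)) u
      (fun k => (hFm k).norm) (hu.integrable le_rfl)
      (fun k => ae_of_all _ fun r => by rw [norm_norm]; exact (hFu k r).2)
      (ae_of_all _ fun r => by simpa using ((hFt r).const_sub (g r)).norm)
    simpa using this
  refine tendsto_probFilter_of_approx
    (X := fun n ω => ∑ j ∈ range (n₁ n), c n (S₂ n ω) j * g (Z j ω)) fun δ hδ => ?_
  obtain ⟨k, hk⟩ := (ht.eventually_lt_const (show 0 < δ / (4 * (C + 1)) by positivity)).exists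
  obtain ⟨b, hb⟩ := (hF k).2.2
  have hcm : ∀ n j, Measurable fun ω => c n (S₂ n ω) j := fun n j =>
    des.measurable_coef (fun s => c n s j) n
  have hi : ∀ n j, Integrable (fun ω => c n (S₂ n ω) j * (g (Z j ω) - F k (Z j ω))) P := fun n j =>
    integrable_bdd_mul_comp des.measurable_Z des.iid_law j (f := fun r => g r - F k r)
      (hu.integrable le_rfl |>.mono' (hFm k) (ae_of_all _ fun r => (hFu k r).2)) (hcm n j)
      (b := C * (4 * (n₂ n : ℝ)⁻¹)) fun ω => (hc n _ j).trans (by gcongr; exact des.rate_sq_le n _ j)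
  refine ⟨fun n ω => ∑ j ∈ range (n₁ n), c n (S₂ n ω) j * F k (Z j ω),
    fun n ω => ∑ j ∈ range (n₁ n), c n (S₂ n ω) j * (g (Z j ω) - F k (Z j ω)), fun n ω => ?_, ?_,
    Eventually.of_forall fun n => ⟨integrable_finsetSum _ fun j _ => hi n j, ?_⟩⟩
  · simp only [mul_sub, sum_sub_distrib]
    exact (le_of_eq (by congr 1; ring)).trans (abs_add_le _ _)
  · refine des.layer_bot.tendsto_sum_mul des (hF k).1 (c := b) (c' := C)
      (G := fun n j ω => c n (S₂ n ω) j) (ae_of_all _ fun r => by simpa using hb r)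
      (by rw [condExp_bot, (hF k).2.1]; rfl) (fun n j k => measurable_known_coef (fun s => c n s j) k) fun n j => ae_of_all _ fun ω => by
        simpa using hc n _ j
  · refine (Layer.integral_abs_sum_le fun j _ => hi n j).trans ?_
    have hi' : Integrable (fun r => |g r - F k r|) Q :=
      (hu.integrable le_rfl |>.mono' (hFm k) (ae_of_all _ fun r => (hFu k r).2)).abs
    calc _ ≤ ∑ j ∈ range (n₁ n), C * ∫ ω, rateₙ n ω j ^ 2 * |g (Z j ω) - F k (Z j ω)| ∂P := by
          refine sum_le_sum fun j _ => ?_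
          rw [← integral_const_mul]
          refine integral_mono (hi n j).abs ((des.integrable_rate_sq_mul n j hi').const_mul C)
            fun ω => ?_
          rw [abs_mul, ← mul_assoc]
          exact mul_le_mul_of_nonneg_right (hc n _ j) (abs_nonneg _)
      _ ≤ C * (4 * ∫ r, |g r - F k r| ∂Q) := by
          rw [← mul_sum]
          exact mul_le_mul_of_nonneg_left
            (des.integral_sum_rate_sq_mul_le n hi' fun r => abs_nonneg _) hC0
      _ ≤ δ := by
          rw [lt_div_iff₀ (by positivity)] at hk
          have : 0 ≤ ∫ r, |g r - F k r| ∂Q := integral_nonneg fun r => abs_nonneg _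
          linarith

/-- The sum of the squares of `a_j f(Z_j) + b_j g(Z_j)`, for the coefficients of the validation mean
and of the difference of the two means. -/
lemma tendsto_sum_linear_sq (des : IsDesign) {f g : Rec p q → ℝ}
    (hfm : Measurable f) (hgm : Measurable g) (hf : MemLp f 2 Q) (hg : MemLp g 2 Q) :
    plim (fun z => ∑ j ∈ range (n₁ z.1), (valₙ z.1 z.2 j * f (Z j z.2)
        + diffₙ z.1 z.2 j * g (Z j z.2)) ^ 2) (∫ r, f r ^ 2 ∂Q + (1 - ρ) * (2 * ∫ r, f r * g r ∂Q + ∫ r, g r ^ 2 ∂Q)) := by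
  have e1 := des.tendsto_weighted_sum (f := fun r => f r ^ 2) (hfm.pow_const 2) hf.integrable_sq
    (c := fun n s j => coefVal (n₂ n) s j ^ 2) (C := 1) zero_le_one (fun n s j => by
      rw [abs_pow, one_mul]; exact pow_le_pow_left₀ (abs_nonneg _) (abs_coefVal_le _ _ _ _) 2)
  have e2 := des.tendsto_weighted_sum (f := fun r => f r * g r) (hfm.mul hgm)
    (hf.integrable_mul hg) (c := fun n s j => coefVal (n₂ n) s j * coefDiff (n₁ n) (n₂ n) s j)
    (C := 1) zero_le_one (fun n s j => by
      rw [abs_mul, one_mul, sq]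
      exact mul_le_mul (abs_coefVal_le _ _ _ _) (abs_coefDiff_le (des.size_le n) _ _)
        (abs_nonneg _) (rate_nonneg _ _ _ _))
  have e3 := des.tendsto_weighted_sum (f := fun r => g r ^ 2) (hgm.pow_const 2) hg.integrable_sq
    (c := fun n s j => coefDiff (n₁ n) (n₂ n) s j ^ 2) (C := 1) zero_le_one (fun n s j => by
      rw [abs_pow, one_mul]
      exact pow_le_pow_left₀ (abs_nonneg _) (abs_coefDiff_le (des.size_le n) _ _) 2)
  have hr := tendsto_probFilter_of_tendsto (P := P) des.ratio_tendsto'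
  have h := ((e1.add (e2.const_mul 2)).add e3).add ((tendsto_const_nhds (x := ∫ r, f r ^ 2 ∂Q)).add
      (hr.mul_const (2 * ∫ r, f r * g r ∂Q + ∫ r, g r ^ 2 ∂Q)))
  simp only [mul_zero, add_zero, zero_add] at h
  refine h.congr' ?_
  filter_upwards [eventually_probFilter_of_ae (Eventually.of_forall des.ae_validation)] with z hz
  have h2 := des.size_pos z.1
  have h12 := des.size_le z.1
  have s1 := sum_coefVal_sq h2 hz
  have s2 := sum_coefVal_mul_coefDiff h2 h12 hz
  have s3 := sum_coefDiff_sq h2 h12 hz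
  simp only [mul_sub, sum_sub_distrib, ← sum_mul, s1, s2, s3]
  have : ∑ j ∈ range (n₁ z.1), (valₙ z.1 z.2 j * f (Z j z.2)
        + diffₙ z.1 z.2 j * g (Z j z.2)) ^ 2
      = ∑ j ∈ range (n₁ z.1), valₙ z.1 z.2 j ^ 2 * f (Z j z.2) ^ 2
        + 2 * ∑ j ∈ range (n₁ z.1), valₙ z.1 z.2 j *
          diffₙ z.1 z.2 j * (f (Z j z.2) * g (Z j z.2))
        + ∑ j ∈ range (n₁ z.1), diffₙ z.1 z.2 j ^ 2 * g (Z j z.2) ^ 2 := by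
    rw [mul_sum, ← sum_add_distrib, ← sum_add_distrib]
    exact sum_congr rfl fun j _ => by ring
  rw [this]
  ring

lemma tendsto_charFun_linear_of_bdd (des : IsDesign) {f g : Rec p q → ℝ} (hfm : Measurable f)
    (hgm : Measurable g) {c : ℝ} (hf : ∀ r, |f r| ≤ c) (hg : ∀ r, |g r| ≤ c) (hf0 : ∫ r, f r ∂Q = 0)
    (hg0 : ∫ r, g r ∂Q = 0) : Tendsto (fun n => ∫ ω, cis (∑ j ∈ range (n₁ n),
      (valₙ n ω j * f (Z j ω) + diffₙ n ω j * g (Z j ω))) ∂P) atTop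
      (𝓝 (Complex.exp (-((∫ r, f r ^ 2 ∂Q + (1 - ρ) * (2 * ∫ r, f r * g r ∂Q + ∫ r, g r ^ 2 ∂Q)
        : ℝ) : ℂ) / 2))) := by
  have hsm : ∀ (c : Finset ℕ → ℝ) n k, Measurable[𝒦 ⊥ n k] fun ω => c (S₂ n ω) :=
    fun c n k => measurable_known_coef c k
  have hGm : ∀ (i : Fin 2) n j k, Measurable[𝒦 ⊥ n k]
      ((![fun n j ω => valₙ n ω j, fun n j ω => diffₙ n ω j] : Fin 2 → Terms) i n j) := by
    simp only [Fin.forall_fin_two]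
    exact ⟨fun n j k => hsm (fun s => coefVal (n₂ n) s j) n k,
      fun n j k => hsm (fun s => coefDiff (n₁ n) (n₂ n) s j) n k⟩
  obtain ⟨h1, h2⟩ := des.layer_bot.step des (f := ![f, g])
    (G := ![fun n j ω => valₙ n ω j, fun n j ω => diffₙ n ω j]) (c := c) (c' := 1)
    (by simpa only [Fin.forall_fin_two] using ⟨hfm, hgm⟩)
    ((abs_nonneg _).trans (hf (Classical.choice Q.nonempty_of_neZero)))
    (by simpa only [Fin.forall_fin_two, mul_one] using ⟨ae_of_all _ hf, ae_of_all _ hg⟩)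
    (by simp only [Fin.forall_fin_two, condExp_bot, cons_val_zero, cons_val_one, hf0, hg0]
        exact ⟨ae_eq_rfl, ae_eq_rfl⟩) hGm (by
      simp only [Fin.forall_fin_two, one_mul, mul_one]
      exact ⟨fun n j => ae_of_all _ fun ω => abs_coefVal_le _ _ _ _,
        fun n j => ae_of_all _ fun ω => abs_coefDiff_le (des.size_le n) _ _⟩)
  have h1 := h1 (fun _ _ _ => 0) 0 (fun _ _ _ => measurable_const)
    fun n j => ae_of_all _ fun ω => by simp
  have h2 := h2 (fun _ _ => 1) (fun _ _ => stronglyMeasurable_const) fun _ _ => by simp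
  set s := Layer.stepVar Q ⊥ Z ![f, g]
    (![fun n j ω => valₙ n ω j, fun n j ω => diffₙ n ω j] : Fin 2 → Terms) with hs
  simp only [Fin.sum_univ_two, cons_val_zero, cons_val_one, zero_add, one_mul, ne_eq,
    OfNat.ofNat_ne_zero, not_false_eq_true, zero_pow, sub_zero, sum_sub_distrib] at h1 h2
  have hsq := des.tendsto_sum_linear_sq hfm hgm
    (MemLp.of_bound hfm.aestronglyMeasurable c (ae_of_all _ hf))
    (MemLp.of_bound hgm.aestronglyMeasurable c (ae_of_all _ hg))
  set v := ∫ r, f r ^ 2 ∂Q + (1 - ρ) * (2 * ∫ r, f r * g r ∂Q + ∫ r, g r ^ 2 ∂Q) with hv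
  have hsv : plim (fun z => ∑ j ∈ range (n₁ z.1), s z.1 j z.2) v := by
    simpa only [sub_sub_cancel, sub_zero] using hsq.sub h1
  have hsm : ∀ n, Measurable fun ω => ∑ j ∈ range (n₁ n), s n j ω := fun n =>
    Finset.measurable_fun_sum _ fun j _ => (Layer.measurable_stepVar bot_le _ hGm n j 0).mono
      (revealed_le (m𝒵 := recAlg p q) bot_le (des.measurable_S n) des.measurable_Z 0) le_rfl
  have hm : ∀ n, Measurable fun ω =>
      ((Real.exp (-(∑ j ∈ range (n₁ n), s n j ω) / 2) : ℝ) : ℂ) := fun n => by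
    have := hsm n; fun_prop
  have hb : ∀ n ω, ‖((Real.exp (-(∑ j ∈ range (n₁ n), s n j ω) / 2) : ℝ) : ℂ)‖ ≤ 1 := fun n ω => by
    rw [Complex.norm_real, Real.norm_of_nonneg (Real.exp_nonneg _), Real.exp_le_one_iff]
    linarith [sum_nonneg fun j (_ : j ∈ range (n₁ n)) => le_max_left (0 : ℝ) _ |>.trans_eq
      (show _ = s n j ω from rfl)]
  have h3 := tendsto_integral_of_bounded_probFilter (P := P) (C := 1 + ‖Complex.exp (-(v : ℂ) / 2)‖)
    (F := fun n ω => ((Real.exp (-(∑ j ∈ range (n₁ n), s n j ω) / 2) : ℝ) : ℂ)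
      - Complex.exp (-(v : ℂ) / 2)) (fun n => ((hm n).sub_const _).aestronglyMeasurable)
    (fun n ω => (norm_sub_le _ _).trans (by gcongr; exact hb n ω)) (by
      have : Continuous fun x : ℝ => ((Real.exp (-x / 2) : ℝ) : ℂ) := by fun_prop
      have t := ((this.tendsto v).comp hsv).sub_const (Complex.exp (-(v : ℂ) / 2))
      simpa [Function.comp_def] using t)
  have t := (h2.add h3).add_const (Complex.exp (-(v : ℂ) / 2))
  rw [add_zero, zero_add] at t
  refine t.congr fun n => ?_
  rw [integral_sub (Integrable.of_bound (hm n).aestronglyMeasurable 1 (ae_of_all _ (hb n)))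
    (integrable_const _)]
  simp

lemma integral_abs_sum_linear_le (des : IsDesign) {f g : Rec p q → ℝ} (hfm : Measurable f)
    (hgm : Measurable g) (hf : MemLp f 2 Q) (hg : MemLp g 2 Q) (hf0 : ∫ r, f r ∂Q = 0)
    (hg0 : ∫ r, g r ∂Q = 0) (n : ℕ) : Integrable (fun ω => ∑ j ∈ range (n₁ n),
        (valₙ n ω j * f (Z j ω) + diffₙ n ω j * g (Z j ω))) P ∧
      ∫ ω, |∑ j ∈ range (n₁ n), (valₙ n ω j * f (Z j ω) + diffₙ n ω j * g (Z j ω))| ∂P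
        ≤ √(4 * ∫ r, (|f r| + |g r|) ^ 2 ∂Q) := by
  set X : ℕ → Ω → ℝ := fun j ω => valₙ n ω j * f (Z j ω) + diffₙ n ω j * g (Z j ω) with hX
  have hi : Integrable (fun r => (|f r| + |g r|) ^ 2) Q := (hf.abs.add hg.abs).integrable_sq
  have hsm : ∀ (c : Finset ℕ → ℝ) k, Measurable[𝒦 ⊥ n k] fun ω => c (S₂ n ω) :=
    fun c k => measurable_known_coef c k
  have hle : ∀ k, 𝒦 ⊥ n k ≤ mΩ := fun k =>
    revealed_le (m𝒵 := recAlg p q) bot_le (des.measurable_S n) des.measurable_Z k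
  have hXm : ∀ k j {μ : MeasurableSpace Ω}, 𝒦 ⊥ n k ≤ μ → Measurable[μ] (Z j) → Measurable[μ] (X j) :=
    fun k j μ hμ hZ => (((hsm (fun s => coefVal (n₂ n) s j) k).mono hμ le_rfl).mul
      (hfm.comp hZ)).add (((hsm (fun s => coefDiff (n₁ n) (n₂ n) s j) k).mono hμ le_rfl).mul
      (hgm.comp hZ))
  have hXb : ∀ j ω, X j ω ^ 2 ≤ rateₙ n ω j ^ 2 * (|f (Z j ω)| + |g (Z j ω)|) ^ 2 := fun j ω => by
    rw [← sq_abs, ← mul_pow]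
    exact pow_le_pow_left₀ (abs_nonneg _) (des.abs_linear_le n _ j _ _) 2
  have hXL : ∀ j, MemLp (X j) 2 P := fun j => by
    have hm := hXm 0 j (hle 0) (des.measurable_Z j)
    refine (memLp_two_iff_integrable_sq hm.aestronglyMeasurable).2
      ((des.integrable_rate_sq_mul n j hi).mono' (hm.pow_const 2).aestronglyMeasurable
        (ae_of_all _ fun ω => ?_))
    rw [Real.norm_of_nonneg (sq_nonneg _)]
    exact hXb j ω
  obtain ⟨h1, h2⟩ := integral_sq_sum_of_condExp_eq_zero (P := P) (n₁ n) hle (X := X)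
    (fun k j hjk => hXm k j le_rfl (measurable_revealed_of_ne hjk.ne)) (fun j _ => hXL j)
    fun j _ => by
      have hcf : ∀ (c : Finset ℕ → ℝ) {h : Rec p q → ℝ}, Integrable h Q →
          (∀ s, |c s| ≤ rate (n₁ n) (n₂ n) s j) → Integrable (fun ω => c (S₂ n ω) * h (Z j ω)) P :=
        fun c h hh hc => integrable_bdd_mul_comp des.measurable_Z des.iid_law j hh
          ((hsm c 0).mono (hle 0) le_rfl)
          fun ω => (hc _).trans (rate_le (des.size_pos n) (des.size_le n) _ _)
      have i1 := hcf (fun s => coefVal (n₂ n) s j) (hf.integrable one_le_two)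
        fun s => abs_coefVal_le _ _ _ _
      have i2 := hcf (fun s => coefDiff (n₁ n) (n₂ n) s j) (hg.integrable one_le_two)
        fun s => abs_coefDiff_le (des.size_le n) _ _
      have a1 := des.condExp_coeff_mul n (m := ⊥) bot_le (hf.integrable one_le_two)
        (hsm (fun s => coefVal (n₂ n) s j) j) i1
      have a2 := des.condExp_coeff_mul n (m := ⊥) bot_le (hg.integrable one_le_two)
        (hsm (fun s => coefDiff (n₁ n) (n₂ n) s j) j) i2
      have a3 : P[X j | 𝒦 ⊥ n j] =ᵐ[P] _ := condExp_add i1 i2 _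
      filter_upwards [a1, a2, a3] with ω h1 h2 h3
      rw [h3, Pi.add_apply, h1, h2]
      simp [condExp_bot, hf0, hg0]
  refine ⟨h1.integrable one_le_two, Real.le_sqrt_of_sq_le ?_⟩
  have h1' : MemLp (fun ω => |∑ j ∈ range (n₁ n), X j ω|) 2 P := h1.abs
  have hv := variance_eq_sub h1'
  have h3 := (variance_nonneg (fun ω => |∑ j ∈ range (n₁ n), X j ω|) P)
  rw [hv] at h3
  simp only [Pi.pow_apply, sq_abs] at h3
  refine (sub_nonneg.1 h3).trans (h2.le.trans ((sum_le_sum fun j _ => ?_).trans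
    (des.integral_sum_rate_sq_mul_le n hi fun r => sq_nonneg _)))
  exact integral_mono (hXL j).integrable_sq (des.integrable_rate_sq_mul n j hi) (hXb j)

/-- Central limit theorem for linear statistics of the main and the validation data. -/
lemma tendsto_charFun_linear (des : IsDesign) {f g : Rec p q → ℝ} (hfm : Measurable f) (hgm :
    Measurable g) (hf : MemLp f 2 Q) (hg : MemLp g 2 Q) (hf0 : ∫ r, f r ∂Q = 0)
    (hg0 : ∫ r, g r ∂Q = 0) : Tendsto (fun n => ∫ ω, cis (∑ j ∈ range (n₁ n),
      (valₙ n ω j * f (Z j ω) + diffₙ n ω j * g (Z j ω))) ∂P) atTop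
      (𝓝 (Complex.exp (-((∫ r, f r ^ 2 ∂Q + (1 - ρ) * (2 * ∫ r, f r * g r ∂Q + ∫ r, g r ^ 2 ∂Q)
        : ℝ) : ℂ) / 2))) := by
  obtain ⟨F, u, hu, hF, hFu, hFf⟩ := exists_bounded_approx hfm one_le_two hf hf0
  obtain ⟨G, v, hv, hG, hGv, hGg⟩ := exists_bounded_approx hgm one_le_two hg hg0
  have hL : ∀ k, MemLp (F k) 2 Q ∧ MemLp (G k) 2 Q := fun k =>
    ⟨hu.mono' (hF k).1.aestronglyMeasurable (ae_of_all _ fun r => (hFu k r).1),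
      hv.mono' (hG k).1.aestronglyMeasurable (ae_of_all _ fun r => (hGv k r).1)⟩
  have hd : Tendsto (fun k => √(4 * ∫ r, (|f r - F k r| + |g r - G k r|) ^ 2 ∂Q)) atTop (𝓝 0) := by
    have hm : ∀ k, Measurable fun r => |f r - F k r| + |g r - G k r| := fun k =>
      (hfm.sub (hF k).1).abs.add (hgm.sub (hG k).1).abs
    have hb : ∀ k r, |(|f r - F k r| + |g r - G k r|)| ≤ u r + v r := fun k r => by
      rw [abs_of_nonneg (by positivity)]
      exact add_le_add (hFu k r).2 (hGv k r).2
    have ht : ∀ r, Tendsto (fun k => |f r - F k r| + |g r - G k r|) atTop (𝓝 0) := fun r => by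
      simpa using ((hFf r).const_sub (f r)).abs.add ((hGg r).const_sub (g r)).abs
    have t := tendsto_integral_mul_of_dominated (hu.add hv) (hu.add hv) hm hm hb hb ht ht
    simpa [sq] using (t.const_mul 4).sqrt
  refine TendstoUniformlyOnFilter.tendsto_of_eventually_tendsto (p := atTop)
    (F := fun k n => ∫ ω, cis (∑ j ∈ range (n₁ n),
      (valₙ n ω j * F k (Z j ω) + diffₙ n ω j * G k (Z j ω))) ∂P)
    (L := fun k => Complex.exp (-((∫ r, F k r ^ 2 ∂Q + (1 - ρ) *
      (2 * ∫ r, F k r * G k r ∂Q + ∫ r, G k r ^ 2 ∂Q) : ℝ) : ℂ) / 2))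
    (TendstoUniformly.tendstoUniformlyOnFilter ?_ |>.mono_right le_top)
    (Eventually.of_forall fun k => ?_) ?_
  · refine Metric.tendstoUniformly_iff.2 fun ε hε => ?_
    filter_upwards [hd.eventually_lt_const hε] with k hk n
    obtain ⟨i1, -⟩ := des.integral_abs_sum_linear_le hfm hgm hf hg hf0 hg0 n
    obtain ⟨i2, -⟩ := des.integral_abs_sum_linear_le (hF k).1 (hG k).1 (hL k).1 (hL k).2
      (hF k).2.1 (hG k).2.1 n
    obtain ⟨i3, h3⟩ := des.integral_abs_sum_linear_le (hfm.sub (hF k).1) (hgm.sub (hG k).1)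
      (hf.sub (hL k).1) (hg.sub (hL k).2)
      (by simp [integral_sub (hf.integrable one_le_two) ((hL k).1.integrable one_le_two), hf0, hF])
      (by simp [integral_sub (hg.integrable one_le_two) ((hL k).2.integrable one_le_two), hg0, hG]) n
    refine lt_of_le_of_lt ?_ (h3.trans_lt hk)
    have hci : ∀ {Y : Ω → ℝ}, Integrable Y P → Integrable (fun ω => cis (Y ω)) P := fun hY =>
      Integrable.of_bound (by have := hY.aestronglyMeasurable; fun_prop) 1
        (ae_of_all _ fun _ => (norm_cis _).le)
    rw [dist_eq_norm, ← integral_sub (hci i1) (hci i2)]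
    refine norm_integral_le_of_norm_le i3.abs (ae_of_all _ fun ω => (norm_cis_sub_le _ _).trans
      (le_of_eq ?_))
    rw [← sum_sub_distrib]
    congr 1
    exact sum_congr rfl fun j _ => by simp only [Pi.sub_apply]; ring
  · obtain ⟨c, hc⟩ := (hF k).2.2
    obtain ⟨c', hc'⟩ := (hG k).2.2
    exact des.tendsto_charFun_linear_of_bdd (hF k).1 (hG k).1
      (fun r => (hc r).trans (le_max_left c c')) (fun r => (hc' r).trans (le_max_right c c'))
      (hF k).2.1 (hG k).2.1
  · have hFm := fun k => (hF k).1
    have hGm := fun k => (hG k).1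
    have hFu := fun k r => (hFu k r).1
    have hGv := fun k r => (hGv k r).1
    have t := (tendsto_integral_mul_of_dominated hu hu hFm hFm hFu hFu hFf hFf).add
      ((((tendsto_integral_mul_of_dominated hu hv hFm hGm hFu hGv hFf hGg).const_mul 2).add
      (tendsto_integral_mul_of_dominated hv hv hGm hGm hGv hGv hGg hGg)).const_mul (1 - ρ))
    simp only [← sq] at t
    exact (Complex.continuous_exp.tendsto _).comp
      (((Complex.continuous_ofReal.tendsto _).comp t).neg.div_const 2)

/-- Lindeberg's condition: a large term is at most twice its difference from a bounded approximation. -/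
lemma tendsto_sum_linear_large (des : IsDesign) {f g : Rec p q → ℝ} (hfm : Measurable f) (hgm :
    Measurable g) (hf : MemLp f 2 Q) (hg : MemLp g 2 Q) (hf0 : ∫ r, f r ∂Q = 0)
    (hg0 : ∫ r, g r ∂Q = 0) : plim (fun z => ∑ j ∈ range (n₁ z.1),
      if 1 / 2 < |valₙ z.1 z.2 j * f (Z j z.2) + diffₙ z.1 z.2 j * g (Z j z.2)| then
        (valₙ z.1 z.2 j * f (Z j z.2) + diffₙ z.1 z.2 j * g (Z j z.2)) ^ 2 else 0) 0 := by
  obtain ⟨F, u, hu, hF, hFu, hFf⟩ := exists_bounded_approx hfm one_le_two hf hf0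
  obtain ⟨G, v, hv, hG, hGv, hGg⟩ := exists_bounded_approx hgm one_le_two hg hg0
  have hfF := fun k => hfm.sub (hF k).1
  have hgG := fun k => hgm.sub (hG k).1
  have hf' : ∀ r, Tendsto (fun k => f r - F k r) atTop (𝓝 0) := fun r => by
    simpa using (hFf r).const_sub (f r)
  have hg' : ∀ r, Tendsto (fun k => g r - G k r) atTop (𝓝 0) := fun r => by
    simpa using (hGg r).const_sub (g r)
  have hFu' := fun k r => (hFu k r).2
  have hGv' := fun k r => (hGv k r).2
  have t := (tendsto_integral_mul_of_dominated hu hu hfF hfF hFu' hFu' hf' hf').add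
    ((((tendsto_integral_mul_of_dominated hu hv hfF hgG hFu' hGv' hf' hg').const_mul 2).add
    (tendsto_integral_mul_of_dominated hv hv hgG hgG hGv' hGv' hg' hg')).const_mul (1 - ρ))
  simp only [mul_zero, integral_zero, add_zero] at t
  rw [Metric.tendsto_nhds]
  intro ε hε
  obtain ⟨k, hk⟩ := (t.eventually_lt_const (div_pos hε four_pos)).exists
  obtain ⟨c, hc⟩ := (hF k).2.2
  obtain ⟨c', hc'⟩ := (hG k).2.2
  have hsq := des.tendsto_sum_linear_sq (hfF k) (hgG k)
    (hu.mono' (hfF k).aestronglyMeasurable (ae_of_all _ fun r => (hFu k r).2))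
    (hv.mono' (hgG k).aestronglyMeasurable (ae_of_all _ fun r => (hGv k r).2))
  simp only [Pi.sub_apply, sq (_ - _)] at hsq hk
  have hr : plim (fun z => 2 * (√(n₂ z.1))⁻¹ * (c + c')) 0 := by
    have := des.tendsto_inv_n₂.sqrt
    simpa [Real.sqrt_inv] using
      tendsto_probFilter_of_tendsto (P := P) ((this.const_mul 2).mul_const (c + c'))
  filter_upwards [hsq.eventually_lt_const hk,
    hr.eventually_lt_const (show (0 : ℝ) < 1 / 4 by norm_num)] with z h1 h2
  rw [dist_zero_right, Real.norm_of_nonneg (sum_nonneg fun j _ => by positivity)]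
  refine lt_of_le_of_lt ?_ ((lt_div_iff₀ four_pos).1 h1)
  rw [sum_mul]
  refine sum_le_sum fun j _ => ?_
  have hs : |valₙ z.1 z.2 j * F k (Z j z.2) + diffₙ z.1 z.2 j * G k (Z j z.2)| < 1 / 4 :=
    ((des.abs_linear_le z.1 _ j _ _).trans (mul_le_mul
      (rate_le (des.size_pos z.1) (des.size_le z.1) _ _) (add_le_add (hc _) (hc' _))
      (by positivity) (by positivity))).trans_lt h2
  set x := valₙ z.1 z.2 j * F k (Z j z.2) + diffₙ z.1 z.2 j * G k (Z j z.2) with hx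
  set y := valₙ z.1 z.2 j * f (Z j z.2) + diffₙ z.1 z.2 j * g (Z j z.2) with hy
  rw [show valₙ z.1 z.2 j * (f (Z j z.2) - F k (Z j z.2)) + diffₙ z.1 z.2 j *
    (g (Z j z.2) - G k (Z j z.2)) = y - x by rw [hx, hy]; ring]
  split_ifs with h
  · have h3 : |y| ≤ |2 * (y - x)| := by
      rw [abs_mul, abs_two]
      linarith [abs_sub_abs_le_abs_sub y x]
    linarith [sq_le_sq.2 h3]
  · positivity

end Design

lemma Design.normalLimit_influence (des : IsDesign) {ψ : Rec p q → ℝ} {φ : Rec p q → Fin L → ℝ}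
    (hψm : Measurable ψ) (hφm : Measurable φ) (hψ : MemLp ψ 2 Q) (hφ : MemLp φ 2 Q)
    (hψ0 : ∫ r, ψ r ∂Q = 0) (hφ0 : ∫ r, φ r ∂Q = 0) (t : Unit ⊕ Fin L → ℝ) :
    NormalLimit P n₁ (fun n j ω => t ⬝ᵥ scaledTerm (n₁ n) (n₂ n) (S₂ n ω) (fun j => ψ (Z j ω))
        (fun j => φ (Z j ω)) (fun j => φ (Z j ω)) j)
      (t ⬝ᵥ blockCov (Var[ψ; Q]) (fun l => (1 - ρ) * cov[ψ, fun r => φ r l; Q])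
        (Matrix.of fun k l => (1 - ρ) * cov[fun r => φ r k, fun r => φ r l; Q]) *ᵥ t) := by
  have hφL := memLp_pi_iff.1 hφ
  have hφ0 : ∀ l, ∫ r, φ r l ∂Q = 0 := fun l => by
    rw [← eval_integral (fun i => (hφL i).integrable one_le_two), hφ0, Pi.zero_apply]
  set f : Rec p q → ℝ := fun r => t (.inl ()) * ψ r with hf
  set g : Rec p q → ℝ := fun r => ∑ l, t (.inr l) * φ r l with hg
  have hfm : Measurable f := hψm.const_mul _
  have hgm : Measurable g := Finset.measurable_fun_sum _ fun l _ =>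
    ((measurable_pi_apply l).comp hφm).const_mul _
  have hfL : MemLp f 2 Q := hψ.const_mul _
  have hgl : ∀ l, MemLp (fun r => t (.inr l) * φ r l) 2 Q := fun l => (hφL l).const_mul _
  have hgL : MemLp g 2 Q := memLp_finsetSum _ fun l _ => hgl l
  have hf0 : ∫ r, f r ∂Q = 0 := by simp [hf, integral_const_mul, hψ0]
  have hg0 : ∫ r, g r ∂Q = 0 := by
    rw [hg, integral_finsetSum _ fun l _ => (hgl l).integrable one_le_two]
    simp [integral_const_mul, hφ0]
  have hcov : ∀ {x y : Rec p q → ℝ}, ∫ r, x r ∂Q = 0 → ∫ r, y r ∂Q = 0 →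
      ∫ r, x r * y r ∂Q = cov[x, y; Q] := fun hx hy => by simp [covariance, hx, hy]
  have hquad : ∫ r, f r ^ 2 ∂Q + (1 - ρ) * (2 * ∫ r, f r * g r ∂Q + ∫ r, g r ^ 2 ∂Q) =
      t ⬝ᵥ blockCov (Var[ψ; Q]) (fun l => (1 - ρ) * cov[ψ, fun r => φ r l; Q])
        (Matrix.of fun k l => (1 - ρ) * cov[fun r => φ r k, fun r => φ r l; Q]) *ᵥ t := by
    simp only [sq (f _), sq (g _), hcov hf0 hf0, hcov hf0 hg0, hcov hg0 hg0]
    rw [dotProduct_blockCov, hg, covariance_fun_sum_fun_sum hgl hgl,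
      covariance_fun_sum_right hgl hfL, hf, ← covariance_self hψm.aemeasurable]
    simp only [covariance_const_mul_left, covariance_const_mul_right, of_apply, mul_sum, mul_add]
    rw [sq, mul_assoc, add_assoc]
    congr 2 <;> refine sum_congr rfl fun k _ => ?_
    · ring
    · exact sum_congr rfl fun l _ => by ring
  rw [← hquad]
  exact NormalLimit.congr ⟨des.tendsto_charFun_linear hfm hgm hfL hgL hf0 hg0,
    des.tendsto_sum_linear_sq hfm hgm hfL hgL,
    des.tendsto_sum_linear_large hfm hgm hfL hgL hf0 hg0⟩ fun n ω j hj =>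
      dotProduct_scaledTerm (S₂ n ω) t (fun j => ψ (Z j ω)) (fun j => φ (Z j ω)) hj

/-- The bootstrap is consistent for regular asymptotically linear estimators. -/
theorem Design.bootstrapConsistent_of_isRAL (des : IsDesign) {τ₂ : ℕ → Ω → ℝ}
    {ep₁ ep₂ : ℕ → Ω → Fin L → ℝ} {τ : ℝ} {τep : Fin L → ℝ} {ψ : Bool × (𝕏 × 𝕌) × ℝ → ℝ}
    {φ : Bool × 𝕏 × ℝ → Fin L → ℝ} {ψhat : ℕ → Ω → Bool × (𝕏 × 𝕌) × ℝ → ℝ}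
    {φhat₁ φhat₂ : ℕ → Ω → Bool × 𝕏 × ℝ → Fin L → ℝ} (h₂ : IsRAL P Q Z n₂ S₂ τ₂ τ obsFull ψ)
    (h₁e : IsRAL P Q Z n₁ (fun n _ => range (n₁ n)) ep₁ τep obsMain φ)
    (h₂e : IsRAL P Q Z n₂ S₂ ep₂ τep obsMain φ)
    (hψ : EstimatesInfluence P 𝒢 Z n₂ S₂ obsFull ψ ψhat)
    (hφ₁ : EstimatesInfluence P 𝒢 Z n₁ (fun n _ => range (n₁ n)) obsMain φ φhat₁)
    (hφ₂ : EstimatesInfluence P 𝒢 Z n₂ S₂ obsMain φ φhat₂) :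
    BootstrapConsistent P n₁ n₂ B S₂ D τ τ₂ ep₁ ep₂
        (fun n ω j => ψhat n ω (obsFull (Z j ω)))
        (fun n ω j => φhat₁ n ω (obsMain (Z j ω)))
        (fun n ω j => φhat₂ n ω (obsMain (Z j ω)))
        (Var[fun r => ψ (obsFull r); Q])
        (fun l => (1 - ρ) * cov[fun r => ψ (obsFull r), fun r => φ (obsMain r) l; Q])
        (Matrix.of fun k l =>
          (1 - ρ) * cov[fun r => φ (obsMain r) k, fun r => φ (obsMain r) l; Q]) := by
  have a := des.linearApprox_of_isRAL (fun _ => le_rfl) measurable_obsFull h₂ hψ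
    (ContinuousLinearMap.id ℝ ℝ) fun _ => le_rfl
  have a₁ := fun l => des.linearApprox_of_isRAL des.size_le measurable_obsMain h₁e hφ₁
    (ContinuousLinearMap.proj (R := ℝ) (φ := fun _ : Fin L => ℝ) l) fun x => norm_le_pi_norm x l
  have a₂ := fun l => des.linearApprox_of_isRAL (fun _ => le_rfl) measurable_obsMain h₂e hφ₂
    (ContinuousLinearMap.proj (R := ℝ) (φ := fun _ : Fin L => ℝ) l) fun x => norm_le_pi_norm x l
  simp only [ContinuousLinearMap.proj_apply, ContinuousLinearMap.id_apply] at a a₁ a₂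
  refine des.bootstrapConsistent_of_linearApprox (Matrix.IsSymm.ext fun k l => ?_) a a₁ a₂
    (des.normalLimit_influence (ψ := fun r => ψ (obsFull r)) (φ := fun r => φ (obsMain r))
      (h₂.measurable_influence.comp measurable_obsFull)
      (h₁e.measurable_influence.comp measurable_obsMain) h₂.memLp_influence h₁e.memLp_influence
      h₂.mean_influence h₁e.mean_influence)
  simp only [of_apply]
  rw [covariance_comm]

local notation "IsLayer" => Layer P Q Z n₁ n₂ S₂ outScale

local notation "domₙ" W:max n:max j:max ω:max => Layer.dom Z n₁ n₂ S₂ outScale W n j ω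

/-! ### Consequences of the conditions on the population -/

section Population

variable {K : Set (EuclideanSpace ℝ (Fin p) × EuclideanSpace ℝ (Fin q))}

/-- The σ-algebra of the treatment and a covariate vector `V`. -/
abbrev trtAlg {E : Type*} [MeasurableSpace E] (V : Rec p q → E) : MeasurableSpace (Rec p q) :=
  MeasurableSpace.comap (fun r => (trt r, V r)) inferInstance

/-- The signed residual of the outcome for regression functions `m`. -/
def resid {E : Type*} (V : Rec p q → E) (m : Bool → E → ℝ) (r : Rec p q) : ℝ :=
  sgn (trt r) * (outcome r - m (trt r) (V r))

lemma trtAlg_le {E : Type*} [MeasurableSpace E] {V : Rec p q → E} (hV : Measurable V) :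
    trtAlg V ≤ recAlg p q := (measurable_trt.prodMk hV).comap_le

lemma trtAlg_covX_le : (trtAlg covX : MeasurableSpace (Rec p q)) ≤ trtAlg covXU := by
  refine Measurable.comap_le (m₁ := trtAlg covXU) ?_
  exact (measurable_id.prodMap measurable_fst).comp
    (comap_measurable (fun r : Rec p q => (trt r, covXU r)))

lemma RegularCovariates.ae_mem (h : RegularCovariates Q K) : ∀ᵐ r ∂Q, covXU r ∈ K := by
  obtain ⟨hK, -, f, hf, -, h0, hQ⟩ := h
  have : ∀ᵐ w ∂(Q.map covXU), w ∈ K := by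
    rw [ae_iff, hQ]
    change (volume.withDensity _) Kᶜ = 0
    rw [withDensity_apply _ hK.measurableSet.compl]
    refine (setLIntegral_congr_fun hK.measurableSet.compl fun w hw => ?_).trans lintegral_zero
    simp [h0 w hw]
  exact ae_of_ae_map measurable_covXU.aemeasurable this

lemma RegularCovariates.covX_eq_null (h : RegularCovariates Q K) (hp : 0 < p)
    (x : 𝕏) : Q (covX ⁻¹' {x}) = 0 := by
  obtain ⟨-, -, f, -, -, -, hQ⟩ := h
  have : NeZero p := ⟨hp.ne'⟩
  have hs : MeasurableSet ((Prod.fst : 𝕏 × 𝕌 → _)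
    ⁻¹' {x}) := measurable_fst (measurableSet_singleton x)
  have : Q.map covXU (Prod.fst ⁻¹' {x}) = 0 := by
    rw [hQ]
    refine withDensity_absolutelyContinuous _ _ ?_
    rw [← Set.prod_univ, Measure.volume_eq_prod, Measure.prod_prod]
    simp
  rwa [Measure.map_apply measurable_covXU hs] at this

lemma RegularCovariates.covX_ne (h : RegularCovariates Q K) (hp : 0 < p) (des : IsDesign) {i j :
    ℕ} (hij : i ≠ j) : ∀ᵐ ω ∂P, covX (Z i ω) ≠ covX (Z j ω) := by
  have hm : MeasurableSet {z : Rec p q × Rec p q | covX z.1 = covX z.2} :=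
    measurableSet_eq_fun (measurable_covX.comp measurable_fst) (measurable_covX.comp measurable_snd)
  have hlaw := (indepFun_iff_map_prod_eq_prod_map_map (des.measurable_Z i).aemeasurable
    (des.measurable_Z j).aemeasurable).1 (des.iid_indep.indepFun hij)
  rw [des.iid_law, des.iid_law] at hlaw
  have h0 : (Q.prod Q) {z | covX z.1 = covX z.2} = 0 := by
    rw [Measure.measure_prod_null hm]
    refine ae_of_all _ fun r => ?_
    have : Prod.mk r ⁻¹' {z : Rec p q × Rec p q | covX z.1 = covX z.2} = covX ⁻¹' {covX r} :=
      Set.ext fun _ => eq_comm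
    exact (congrArg Q this).trans (h.covX_eq_null hp (covX r))
  rw [← hlaw, Measure.map_apply ((des.measurable_Z i).prodMk (des.measurable_Z j)) hm] at h0
  exact measure_eq_zero_iff_ae_notMem.1 h0

lemma integral_mul_condExp {𝒱 : MeasurableSpace (Rec p q)} (h𝒱 : 𝒱 ≤ recAlg p q)
    {h f : Rec p q → ℝ} (hh : Measurable[𝒱] h) {b : ℝ} (hb : ∀ᵐ r ∂Q, ‖h r‖ ≤ b)
    (hf : Integrable f Q) : ∫ r, h r * f r ∂Q = ∫ r, h r * (Q[f | 𝒱]) r ∂Q := by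
  have hi : Integrable (h * f) Q := hf.bdd_mul (hh.mono h𝒱 le_rfl).aestronglyMeasurable hb
  rw [← integral_condExp h𝒱 (f := fun r => h r * f r)]
  exact integral_congr_ae (condExp_mul_of_stronglyMeasurable_left hh.stronglyMeasurable hi hf)

namespace RegularOutcome

variable {E : Type*} [PseudoMetricSpace E] [MeasurableSpace E] {V : Rec p q → E} {KV : Set E}
  {m s : Bool → E → ℝ}

lemma exists_bound (h : RegularOutcome Q V KV m s) (hK : Bornology.IsBounded KV) :
    ∃ c : ℝ, 0 ≤ c ∧ ∀ a, ∀ w ∈ KV, |m a w| ≤ c ∧ |s a w| ≤ c := by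
  obtain ⟨C, hC⟩ := h.lipschitz
  have : ∀ f : E → ℝ, LipschitzOnWith C f KV → ∃ c : ℝ, 0 ≤ c ∧ ∀ w ∈ KV, |f w| ≤ c := by
    intro f hf
    rcases KV.eq_empty_or_nonempty with rfl | ⟨w₀, hw₀⟩
    · exact ⟨0, le_rfl, by simp⟩
    · refine ⟨|f w₀| + C * Metric.diam KV, by positivity, fun w hw => ?_⟩
      have h1 := hf.dist_le_mul w hw w₀ hw₀
      have h2 := mul_le_mul_of_nonneg_left (Metric.dist_le_diam_of_mem hK hw hw₀) C.coe_nonneg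
      rw [Real.dist_eq] at h1
      have := abs_sub_abs_le_abs_sub (f w) (f w₀)
      linarith
  choose c hc0 hc using fun a => this (m a) (hC a).1
  choose c' hc0' hc' using fun a => this (s a) (hC a).2
  refine ⟨∑ a, (c a + c' a), sum_nonneg fun a _ => add_nonneg (hc0 a) (hc0' a), fun a w hw => ?_⟩
  have := single_le_sum (f := fun a => c a + c' a)
    (fun a _ => add_nonneg (hc0 a) (hc0' a)) (mem_univ a)
  constructor
  · linarith [hc a w hw, hc0' a]
  · linarith [hc' a w hw, hc0 a]

lemma measurable_resid (h : RegularOutcome Q V KV m s) (hV : Measurable V) : Measurable[trtAlg V]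
    (fun r => m (trt r) (V r)) ∧ Measurable[trtAlg V] (fun r => s (trt r) (V r)) ∧ Measurable fun r
    => outcome r - m (trt r) (V r) := by
  have hc : Measurable[trtAlg V] fun r : Rec p q => (trt r, V r) := comap_measurable _
  have h1 : Measurable[trtAlg V] (fun r => m (trt r) (V r)) :=
    (measurable_from_prod_countable_right (f := fun z : Bool × E => m z.1 z.2)
      h.measurable_mean).comp hc
  exact ⟨h1, (measurable_from_prod_countable_right (f := fun z : Bool × E => s z.1 z.2)
    h.measurable_var).comp hc, measurable_outcome.sub (h1.mono (trtAlg_le hV) le_rfl)⟩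

lemma layer_moments (h : RegularOutcome Q V KV m s) (hV : Measurable V) :
    Integrable (outcome : Rec p q → ℝ) Q ∧ Integrable (fun r : Rec p q => outScale r ^ 4) Q ∧
    ∃ C, ∀ᵐ r ∂Q, (Q[fun r' => outScale r' ^ 4 | trtAlg V]) r ≤ C := by
  have hle : ∀ r : Rec p q, outScale r ^ 4 ≤ 8 + 8 * outcome r ^ 4 := fun r => by
    have h1 : outScale r ^ 2 ≤ 2 * (1 + outcome r ^ 2) := by
      unfold outScale
      nlinarith [sq_nonneg (1 - |outcome r|), sq_abs (outcome r)]
    have h2 := pow_le_pow_left₀ (sq_nonneg _) h1 2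
    nlinarith [sq_nonneg (1 - outcome r ^ 2)]
  have hi : Integrable (fun r : Rec p q => 8 + 8 * outcome r ^ 4) Q :=
    (integrable_const _).add (h.integrable_pow_four.const_mul 8)
  have hi' : Integrable (fun r : Rec p q => outScale r ^ 4) Q :=
    hi.mono' (measurable_outScale.pow_const 4).aestronglyMeasurable (ae_of_all _ fun r => by
      rw [Real.norm_of_nonneg (pow_nonneg (zero_le_one.trans (one_le_outScale r)) 4)]
      exact hle r)
  obtain ⟨C, hC⟩ := h.fourth_moment
  refine ⟨hi'.mono' measurable_outcome.aestronglyMeasurable (ae_of_all _ fun r =>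
    (le_add_of_nonneg_left zero_le_one).trans (le_self_pow₀ (one_le_outScale r) four_ne_zero)),
    hi', 8 + 8 * C, ?_⟩
  have h1 : Q[fun r' => outScale r' ^ 4 | trtAlg V] ≤ᵐ[Q] _ := condExp_mono hi' hi (ae_of_all _ hle)
  have h2 : Q[fun r' => 8 + 8 * outcome r' ^ 4 | trtAlg V] =ᵐ[Q] _ :=
    condExp_add (integrable_const (8 : ℝ)) (h.integrable_pow_four.const_mul 8) _
  have h3 : Q[fun r' => 8 * outcome r' ^ 4 | trtAlg V] =ᵐ[Q] _ := condExp_smul (8 : ℝ) _ _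
  filter_upwards [h1, h2, h3, hC] with r a1 a2 a3 a4
  rw [a2, Pi.add_apply, condExp_const (trtAlg_le hV), a3, Pi.smul_apply, smul_eq_mul] at a1
  linarith

/-- Given treatment and covariates the signed residual has mean zero and variance `s`; it is
dominated by the scale of the outcome. -/
lemma resid_facts (h : RegularOutcome Q V KV m s) (hV : Measurable V)
    (hK : Bornology.IsBounded KV) (hVK : ∀ᵐ r ∂Q, V r ∈ KV) :
    (∃ c : ℝ, 0 ≤ c ∧ (∀ᵐ r ∂Q, ∀ a, |m a (V r)| ≤ c ∧ |s a (V r)| ≤ c) ∧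
      ∀ᵐ r ∂Q, |resid V m r| ≤ c * outScale r) ∧
    Q[resid V m | trtAlg V] =ᵐ[Q] 0 ∧
    Q[fun r => resid V m r ^ 2 | trtAlg V] =ᵐ[Q] fun r => s (trt r) (V r) := by
  obtain ⟨hY, -, -⟩ := h.layer_moments hV
  obtain ⟨hm, -, hr⟩ := h.measurable_resid hV
  obtain ⟨c, hc0, hc⟩ := h.exists_bound hK
  have hmi : Integrable (fun r => m (trt r) (V r)) Q :=
    Integrable.of_bound (hm.mono (trtAlg_le hV) le_rfl).aestronglyMeasurable c
      (hVK.mono fun r hr => (hc _ _ hr).1)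
  refine ⟨⟨c + 1, by positivity, hVK.mono fun r hr a => ⟨?_, ?_⟩, hVK.mono fun r hr => ?_⟩, ?_, ?_⟩
  · linarith [(hc a _ hr).1]
  · linarith [(hc a _ hr).2]
  · rw [resid, abs_mul, abs_sgn, one_mul]
    have h1 := abs_sub (outcome r) (m (trt r) (V r))
    have h2 := (hc (trt r) _ hr).1
    unfold outScale
    nlinarith [abs_nonneg (outcome r)]
  · have hs : Measurable[trtAlg V] fun r : Rec p q => sgn (trt r) :=
      have ht : Measurable[trtAlg V] fun r : Rec p q => trt r :=
        (comap_measurable (fun r : Rec p q => (trt r, V r))).fst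
      measurable_sgn.comp ht
    have h1 : Q[fun r => outcome r - m (trt r) (V r) | trtAlg V] =ᵐ[Q] _ := condExp_sub hY hmi _
    have hi : Integrable (fun r => outcome r - m (trt r) (V r)) Q := hY.sub hmi
    have h2 : Q[resid V m | trtAlg V] =ᵐ[Q] _ := condExp_mul_of_stronglyMeasurable_left
      hs.stronglyMeasurable (hi.bdd_mul (hs.mono (trtAlg_le hV) le_rfl).aestronglyMeasurable
        (ae_of_all _ fun r => (abs_sgn _).le)) hi
    filter_upwards [h1, h2, h.condMean] with r a1 a2 a3
    rw [a2, Pi.mul_apply, a1, Pi.sub_apply, a3, condExp_of_stronglyMeasurable (trtAlg_le hV)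
      hm.stronglyMeasurable hmi]
    simp
  · have : (fun r => resid V m r ^ 2) = fun r => (outcome r - m (trt r) (V r)) ^ 2 := by
      ext r
      rw [resid, mul_pow, sq (sgn _), sgn_mul_self, one_mul]
    rw [this]
    exact h.condVar

end RegularOutcome

/-- Under ignorability and overlap, weighting by the inverse of the treatment probability does not
change the law of a potential outcome, so that the treatment effect is identified by the regression
functions. -/
lemma ace_eq_integral_effect (hY : ∀ a, Integrable (pot a) Q) (hI : Ignorable Q) (hO : Overlap Q) {m
    s : Bool → 𝕏 × 𝕌 → ℝ} (h : RegularOutcome Q covXU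
    K m s) (hYi : Integrable outcome Q) {c : ℝ} (hc : ∀ a, ∀ᵐ r ∂Q, |m a (covXU r)| ≤ c) : ace Q = ∫
    r, effect m (covXU r) ∂Q := by
  obtain ⟨b, hb, -, hO⟩ := hO.exists_lower
  have hcov : covAlg p q ≤ recAlg p q := measurable_covXU.comap_le
  have hcov' : covAlg p q ≤ trtAlg covXU :=
    (measurable_snd.comp (comap_measurable (fun r : Rec p q => (trt r, covXU r)))).comap_le
  have hmm : ∀ a, Measurable[covAlg p q] fun r => m a (covXU r) := fun a =>
    (h.measurable_mean a).comp (comap_measurable covXU)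
  have hmi : ∀ a, Integrable (fun r => m a (covXU r)) Q := fun a =>
    Integrable.of_bound ((hmm a).mono hcov le_rfl).aestronglyMeasurable c (hc a)
  have key : ∀ a, ∫ r, pot a r ∂Q = ∫ r, m a (covXU r) ∂Q := by
    intro a
    set A : Set (Rec p q) := trt ⁻¹' {a} with hAdef
    have hA : MeasurableSet A := measurable_trt (measurableSet_singleton a)
    have hA3 : MeasurableSet[trtAlg covXU] A :=
      (measurable_fst.comp (comap_measurable (fun r : Rec p q => (trt r, covXU r))))
        (measurableSet_singleton a)
    set e := Q[A.indicator fun _ => (1 : ℝ) | covAlg p q] with he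
    have h1i : ∀ {B : Set (Rec p q)}, MeasurableSet B →
        Integrable (B.indicator fun _ => (1 : ℝ)) Q := fun hB => (integrable_const 1).indicator hB
    have heb : ∀ᵐ r ∂Q, b ≤ e r := by
      have e0 : (fun r' : Rec p q => -(if trt r' = a then (1 : ℝ) else 0))
          = -(A.indicator fun _ => (1 : ℝ)) := by
        ext r; by_cases hr : trt r = a <;> simp [A, hr]
      have e1 : Q[-(A.indicator fun _ => (1 : ℝ)) | covAlg p q] =ᵐ[Q] -e := condExp_neg _ _
      have := hO a
      rw [e0] at this
      filter_upwards [this, e1] with r h1 h2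
      rw [h2, Pi.neg_apply] at h1
      linarith
    set v : Rec p q → ℝ := fun r => (max b (e r))⁻¹ with hv
    have hvm : Measurable[covAlg p q] v :=
      (measurable_const.max stronglyMeasurable_condExp.measurable).inv
    have hv0 : ∀ r, 0 ≤ v r := fun r => inv_nonneg.2 (hb.le.trans (le_max_left _ _))
    have hvb : ∀ r, ‖v r‖ ≤ b⁻¹ := fun r => by
      rw [Real.norm_of_nonneg (hv0 r)]
      exact inv_anti₀ hb (le_max_left _ _)
    have hve : ∀ᵐ r ∂Q, v r * e r = 1 := by
      filter_upwards [heb] with r hr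
      simp only [hv]
      rw [max_eq_right hr, inv_mul_cancel₀ (hb.trans_le hr).ne']
    set g : Rec p q → ℝ := fun r => v r * A.indicator (fun _ => (1 : ℝ)) r with hg
    have hg0 : ∀ r, 0 ≤ g r := fun r =>
      mul_nonneg (hv0 r) (Set.indicator_nonneg (fun _ _ => zero_le_one) _)
    have hg3 : Measurable[trtAlg covXU] g :=
      (hvm.mono hcov' le_rfl).mul (measurable_const.indicator hA3)
    have hgm : Measurable g := hg3.mono (trtAlg_le measurable_covXU) le_rfl
    have hgb : ∀ r, ‖g r‖ ≤ b⁻¹ := fun r => by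
      rw [hg, norm_mul]
      refine (mul_le_of_le_one_right (norm_nonneg _) ?_).trans (hvb r)
      by_cases hr : r ∈ A <;> simp [hr]
    have hgi : Integrable g Q := Integrable.of_bound hgm.aestronglyMeasurable _ (ae_of_all _ hgb)
    have hlaw : (Q.withDensity fun r => ENNReal.ofReal (g r)).map (pot a) = Q.map (pot a) := by
      ext t ht
      have hB := measurable_pot (p := p) (q := q) a ht
      rw [Measure.map_apply (measurable_pot a) ht, Measure.map_apply (measurable_pot a) ht,
        withDensity_apply _ hB, ← ofReal_integral_eq_lintegral_ofReal hgi.integrableOn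
          (ae_of_all _ hg0), ← ofReal_measureReal]
      congr 1
      calc ∫ r in pot a ⁻¹' t, g r ∂Q
          = ∫ r, v r * (pot a ⁻¹' t ∩ A).indicator (fun _ => (1 : ℝ)) r ∂Q := by
            rw [← integral_indicator hB]
            refine integral_congr_ae (ae_of_all _ fun r => ?_)
            by_cases h1 : r ∈ pot a ⁻¹' t <;> by_cases h2 : r ∈ A <;> simp [hg, h1, h2]
        _ = ∫ r, v r * (Q[(pot a ⁻¹' t ∩ A).indicator (fun _ => (1 : ℝ)) | covAlg p q]) r ∂Q :=
            integral_mul_condExp hcov hvm (ae_of_all _ hvb) (h1i (hB.inter hA))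
        _ = ∫ r, (Q[(pot a ⁻¹' t).indicator (fun _ => (1 : ℝ)) | covAlg p q]) r ∂Q := by
            have := (condIndepFun_iff_condExp_inter_preimage_eq_mul (measurable_pot a)
              measurable_trt).1 (hI a) t {a} ht (measurableSet_singleton a)
            refine integral_congr_ae ?_
            filter_upwards [this, hve] with r h1 h2
            rw [h1, mul_left_comm, h2, mul_one]
        _ = Q.real (pot a ⁻¹' t) := by
            rw [integral_condExp hcov, integral_indicator hB]
            simp
    have e1 : ∫ r, pot a r ∂Q = ∫ r, g r * outcome r ∂Q := by
      have := congrArg (fun μ : Measure ℝ => ∫ y, y ∂μ) hlaw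
      simp only [integral_map (measurable_pot a).aemeasurable
        measurable_id'.aestronglyMeasurable] at this
      rw [← this, integral_withDensity_eq_integral_toReal_smul hgm.ennreal_ofReal
        (ae_of_all _ fun _ => ENNReal.ofReal_lt_top)]
      refine integral_congr_ae (ae_of_all _ fun r => ?_)
      by_cases h2 : r ∈ A
      · have : trt r = a := h2
        simp [ENNReal.toReal_ofReal (hg0 r), outcome, this]
      · simp [hg, h2]
    rw [e1, integral_mul_condExp (trtAlg_le measurable_covXU) hg3 (ae_of_all _ hgb) hYi]
    calc ∫ r, g r * (Q[outcome | trtAlg covXU]) r ∂Q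
        = ∫ r, v r * m a (covXU r) * A.indicator (fun _ => (1 : ℝ)) r ∂Q := by
          refine integral_congr_ae ?_
          filter_upwards [h.condMean] with r hr
          rw [hr]
          by_cases h2 : r ∈ A
          · have : trt r = a := h2
            simp [hg, h2, this]
          · simp [hg, h2]
      _ = ∫ r, v r * m a (covXU r) * e r ∂Q := by
          refine integral_mul_condExp (b := b⁻¹ * c) hcov (hvm.mul (hmm a)) ?_ (h1i hA)
          filter_upwards [hc a] with r hr
          rw [norm_mul]
          exact mul_le_mul (hvb r) hr (norm_nonneg _) (inv_nonneg.2 hb.le)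
      _ = _ := by
          refine integral_congr_ae ?_
          filter_upwards [hve] with r hr
          rw [mul_right_comm, hr, one_mul]
  rw [ace, integral_sub (hY _) (hY _), key, key, ← integral_sub (hmi _) (hmi _)]
  rfl

end Population

/-! ### Linearization of a matching estimator -/

section Estimator

variable {E : Type*} [PseudoMetricSpace E] [MeasurableSpace E] {V : Rec p q → E} {KV : Set E}
  {m s : Bool → E → ℝ} {δ : Rec p q → Rec p q → ℝ} {M dim : ℕ}
  {mhat : ℕ → Ω → Bool → E → ℝ} {σ : ℕ → Finset ℕ → Finset ℕ} {N : ℕ → ℕ}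

lemma IsTightSeq.tendsto_zero_of_le {X Y : ℕ → Ω → ℝ} (hX : IsTightSeq P X) (h : ∀ ε : ℝ, 0 < ε → ∀ᶠ
    z in 𝒫, |Y z.1 z.2| ≤ ε * |X z.1 z.2|) : plim (fun z => Y z.1 z.2) 0 := by
  have h0 : plim (fun z => Y z.1 z.2 / |X z.1 z.2|) 0 := by
    rw [Metric.tendsto_nhds]
    intro ε hε
    filter_upwards [h (ε / 2) (half_pos hε)] with z hz
    rw [dist_zero_right, norm_div, Real.norm_eq_abs, Real.norm_eq_abs, abs_abs]
    exact (div_le_of_le_mul₀ (abs_nonneg _) (half_pos hε).le hz).trans_lt (half_lt_self hε)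
  have hX' : IsTightSeq P fun n ω => |X n ω| := fun ε hε => by simpa only [abs_abs] using hX ε hε
  refine (hX'.mul_tendsto_zero (Y := fun n ω => Y n ω / |X n ω|) h0).congr' ?_
  filter_upwards [h 1 one_pos] with z hz
  rcases eq_or_ne |X z.1 z.2| 0 with h' | h'
  · rw [h', mul_zero] at hz
    rw [h', zero_mul, abs_nonpos_iff.1 hz]
  · rw [mul_div_cancel₀ _ h']

/-- The linear term of a matching estimator with the true regression functions and estimand. -/
def oracleTerm (Q : Measure (Rec p q)) (S : Finset ℕ) (z : ℕ → Rec p q)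
    (δ : Rec p q → Rec p q → ℝ) (M : ℕ) (V : Rec p q → E) (m : Bool → E → ℝ) (j : ℕ) : ℝ :=
  effect m (V (z j)) - ∫ r, effect m (V r) ∂Q + weightOn S z δ M j * resid V m (z j)

lemma measurable_matchOn (des : IsDesign) (hV : Measurable V) (hδ : Measurable fun r : Rec p q ×
    Rec p q => δ r.1 r.2) (hmhat : MeanEstimator P 𝒢 n₂ dim KV m mhat) (n : ℕ) : Measurable[𝒢 n]
    (fun ω => matchEstOn (σ n (S₂ n ω)) (fun i => Z i ω) δ M V (mhat n ω)) ∧ ∀ j, Measurable[𝒢 n]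
    fun ω => matchTermOn (σ n (S₂ n ω)) (fun i => Z i ω) δ M V (mhat n ω) j := by
  have hZ := des.measurable_unit n
  have hA : ∀ i, Measurable[𝒢 n] fun ω => trt (Z i ω) := fun i => measurable_trt.comp (hZ i)
  have hY : ∀ i, Measurable[𝒢 n] fun ω => outcome (Z i ω) := fun i => measurable_outcome.comp (hZ i)
  have hd : ∀ i j, Measurable[𝒢 n] fun ω => δ (Z i ω) (Z j ω) := fun i j =>
    hδ.comp ((hZ i).prodMk (hZ j))
  have hT : Measurable[𝒢 n] fun ω => σ n (S₂ n ω) :=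
    (Measurable.of_discrete (f := σ n)).comp (des.measurable_validation n)
  have hmu : ∀ a i, Measurable[𝒢 n] fun ω => mhat n ω a (V (Z i ω)) := fun a i =>
    measurable_comp_of_prod (hmhat.measurable_est n a) (hV.comp (hZ i))
  have hest := measurable_matchEst (mu := fun ω a i => mhat n ω a (V (Z i ω))) hA hd hY hmu hT M
  refine ⟨hest, fun j => ?_⟩
  have hmuA : Measurable[𝒢 n] fun ω => mhat n ω (trt (Z j ω)) (V (Z j ω)) := by
    have hp : Measurable[𝒢 n] fun ω (a : Bool) => mhat n ω a (V (Z j ω)) :=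
      @measurable_pi_lambda _ _ _ (𝒢 n) _ _ fun a => hmu a j
    exact (measurable_from_prod_countable_right (f := fun z : Bool × (Bool → ℝ) => z.2 z.1)
      measurable_pi_apply).comp ((hA j).prodMk hp)
  exact (((hmu true j).sub (hmu false j)).sub hest).add
    (((measurable_sgn.comp (hA j)).mul
      (measurable_matchWeight hA hd hT M j)).mul ((hY j).sub hmuA))

set_option maxHeartbeats 400000 in
/-- With probability tending to one every unit has `M` matches; then the error of the estimator with
the true regression functions is the average of the oracle terms, and the estimation error of the
regression functions enters only through differences between matched units. -/
theorem Layer.linearApprox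
    (h : IsLayer (trtAlg V) fun n j ω => weightOn (σ n (S₂ n ω)) (fun i => Z i ω) δ M j)
    (des : IsDesign) (hO : Overlap Q) (hV : Measurable V) (hR : RegularOutcome Q V KV m s)
    (hK : Bornology.IsBounded KV) (hVK : ∀ᵐ r ∂Q, V r ∈ KV)
    (hmhat : MeanEstimator P 𝒢 n₂ dim KV m mhat) (hM : 0 < M)
    (hδ : Measurable fun r : Rec p q × Rec p q => δ r.1 r.2) (hδV : ∀ r r', dist (V r) (V r') ≤ δ r r')
    (hnN : ∀ n, n₂ n ≤ N n) (hσ : ∀ n, ∀ s ∈ powersetCard (n₂ n) (range (n₁ n)),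
      σ n s ⊆ range (n₁ n) ∧ (σ n s).card = N n)
    (hrate : ∀ n s j, (N n : ℝ)⁻¹ * (if j ∈ σ n s then 1 else 0) ≤ rate (n₁ n) (n₂ n) s j ^ 2)
    (hdist : IsTightSeq P fun n ω => (N n : ℝ) ^ (1 / (dim : ℝ)) * ((N n : ℝ)⁻¹ *
      matchDist (σ n (S₂ n ω)) (fun i => trt (Z i ω)) (fun i k => δ (Z i ω) (Z k ω)) M)) :
    LinearApprox P 𝒢 n₂ N (fun n ω => σ n (S₂ n ω))
      (fun n ω => matchEstOn (σ n (S₂ n ω)) (fun i => Z i ω) δ M V (mhat n ω))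
      (∫ r, effect m (V r) ∂Q)
      (fun n ω => matchTermOn (σ n (S₂ n ω)) (fun i => Z i ω) δ M V (mhat n ω))
      fun n ω => oracleTerm Q (σ n (S₂ n ω)) (fun i => Z i ω) δ M V m := by
  have hme := measurable_matchOn (σ := σ) (M := M) des hV hδ hmhat
  set θ : ℝ := ∫ r, effect m (V r) ∂Q with hθ
  set T : ℕ × Ω → Finset ℕ := fun z => σ z.1 (S₂ z.1 z.2) with hT
  set w : Terms := fun n j ω => weightOn (σ n (S₂ n ω)) (fun i => Z i ω) δ M j with hw
  set ψ₀ : ℕ × Ω → ℕ → ℝ := fun z j => oracleTerm Q (T z) (fun i => Z i z.2) δ M V m j with hψ₀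
  set est : (ℕ × Ω → Bool → E → ℝ) → ℕ × Ω → ℝ :=
    fun f z => matchEstOn (T z) (fun i => Z i z.2) δ M V (f z) with hest
  set μh : ℕ × Ω → Bool → E → ℝ := fun z => mhat z.1 z.2 with hμh
  set th : ℕ × Ω → ℕ → ℝ := fun z j => matchTermOn (T z) (fun i => Z i z.2) δ M V (μh z) j with hth
  suffices H : (∀ n j, Measurable fun ω => ψ₀ (n, ω) j) ∧
      Tendsto (fun z => (N z.1 : ℝ)⁻¹ * ∑ j ∈ T z, (th z j - ψ₀ z j) ^ 2) 𝒫 (𝓝 0) ∧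
      Tendsto (fun z => (√(N z.1))⁻¹ * ∑ j ∈ T z, th z j) 𝒫 (𝓝 0) ∧
      Tendsto (fun z => √(n₂ z.1) * (est μh z - θ - (N z.1 : ℝ)⁻¹ * ∑ j ∈ T z, ψ₀ z j)) 𝒫 (𝓝 0) from
    ⟨fun n => (hme n).1.mono (des.le_ambient n) le_rfl, fun n => (hme n).2, H.1, H.2.1, H.2.2.1,
      H.2.2.2⟩
  have hψ : ∀ z j, ψ₀ z j = effect m (V (Z j z.2)) - θ + w z.1 j z.2 * resid V m (Z j z.2) :=
    fun _ _ => rfl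
  clear_value ψ₀ θ
  have hw1 : ∀ n j ω, 1 ≤ w n j ω := fun n j ω => one_le_matchWeight _ _ _ _ _
  have hM1 : (1 : ℝ) ≤ M := by exact_mod_cast hM
  have hN0 : ∀ n, 0 < N n := fun n => (des.size_pos n).trans_le (hnN n)
  have hNt : Tendsto N atTop atTop := tendsto_atTop_mono hnN des.size_tendsto
  have hEm : ∀ᶠ z in 𝒫, ∀ j ∈ T z, (matchSet (T z) (fun i => trt (Z i z.2))
      (fun i k => δ (Z i z.2) (Z k z.2)) M j).card = M :=
    des.eventually_card_matchSet hO σ hNt hσ δ M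
  have hES : ∀ᶠ z in 𝒫, T z ⊆ range (n₁ z.1) ∧ (T z).card = N z.1 :=
    eventually_probFilter_of_ae (p := fun n ω => σ n (S₂ n ω) ⊆ range (n₁ n) ∧
      (σ n (S₂ n ω)).card = N n) (Eventually.of_forall fun n =>
      (des.ae_validation n).mono fun ω hω => hσ n _ hω)
  have hEV : ∀ᶠ z in 𝒫, ∀ j, V (Z j z.2) ∈ KV :=
    eventually_probFilter_of_ae (p := fun _ ω => ∀ j, V (Z j ω) ∈ KV)
      (Eventually.of_forall fun n => ae_all_iff.2 fun j => des.ae_unit hVK j)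
  obtain ⟨⟨c, hc0, hc, hrc⟩, hr0, -⟩ := hR.resid_facts hV hK hVK
  obtain ⟨-, -, hrm⟩ := hR.measurable_resid hV
  have hrm' : Measurable[recAlg p q] (resid V m) :=
    (measurable_sgn.comp measurable_trt).mul hrm
  have heff : Measurable[recAlg p q] fun r => effect m (V r) :=
    ((hR.measurable_mean true).comp hV).sub ((hR.measurable_mean false).comp hV)
  have heffi : Integrable (fun r => effect m (V r)) Q :=
    Integrable.of_bound heff.aestronglyMeasurable (c + c) (hc.mono fun r hr =>
      (abs_sub _ _).trans (add_le_add (hr true).1 (hr false).1))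
  -- with complete matching the estimator with the true regression functions averages the terms
  have hid : ∀ᶠ z in 𝒫, est (fun _ => m) z - θ = (N z.1 : ℝ)⁻¹ * ∑ j ∈ T z, ψ₀ z j := by
    filter_upwards [hEm, hES] with z h1 h2
    have hN : (N z.1 : ℝ) ≠ 0 := by exact_mod_cast (hN0 z.1).ne'
    simp only [hest, matchEstOn]
    rw [matchEst_eq hM h1, h2.2]
    have : ∑ j ∈ T z, ψ₀ z j + (N z.1 : ℝ) * θ = ∑ j ∈ T z, (ψ₀ z j + θ) := by
      rw [sum_add_distrib, sum_const, h2.2, nsmul_eq_mul]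
    rw [eq_comm, ← sub_eq_zero]
    have e : ∀ j, m true (V (Z j z.2)) - m false (V (Z j z.2)) + sgn (trt (Z j z.2)) *
        matchWeight (T z) (fun i => trt (Z i z.2)) (fun i l => δ (Z i z.2) (Z l z.2)) M j *
        (outcome (Z j z.2) - m (trt (Z j z.2)) (V (Z j z.2))) = ψ₀ z j + θ := fun j => by
      rw [hψ]; simp only [hw, weightOn, resid, effect]; ring
    rw [sum_congr rfl fun j _ => e j, ← this]
    field_simp
    ring
  have hA0 : Tendsto (fun z => √(n₂ z.1) * (est μh z - est (fun _ => m) z)) 𝒫 (𝓝 0) := by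
    refine hdist.tendsto_zero_of_le
      (Y := fun n ω => √(n₂ n) * (est μh (n, ω) - est (fun _ => m) (n, ω))) fun ε hε => ?_
    have hL : ∀ᶠ z in 𝒫, ∀ a, ∀ x ∈ KV, ∀ x' ∈ KV,
        |(μh z a x - m a x) - (μh z a x' - m a x')|
          ≤ ε * (n₂ z.1 : ℝ) ^ (-(1 / 2 : ℝ) + 1 / (dim : ℝ)) * dist x x' := by
      refine eventually_all.2 fun a => eventually_probFilter.2 ?_
      simpa only [not_forall, not_le, exists_prop] using hmhat.lipschitz a ε hε
    filter_upwards [hL, hES, hEV] with z h1 h2 h3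
    have hn : 0 < (n₂ z.1 : ℝ) := by exact_mod_cast des.size_pos z.1
    have hN : 0 < (N z.1 : ℝ) := by exact_mod_cast hN0 z.1
    have h4 := abs_matchEst_sub_le (S := T z) (A := fun i => trt (Z i z.2))
      (Y := fun i => outcome (Z i z.2)) (d := fun i l => δ (Z i z.2) (Z l z.2)) (M := M)
      (mu := fun a i => μh z a (V (Z i z.2))) (mu' := fun a i => m a (V (Z i z.2)))
      (c := ε * (n₂ z.1 : ℝ) ^ (-(1 / 2 : ℝ) + 1 / (dim : ℝ))) fun a j _ l _ =>
        (h1 a _ (h3 j) _ (h3 l)).trans (mul_le_mul_of_nonneg_left (hδV _ _) (by positivity))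
    rw [h2.2] at h4
    have hd0 : 0 ≤ (N z.1 : ℝ)⁻¹ * matchDist (T z) (fun i => trt (Z i z.2))
        (fun i k => δ (Z i z.2) (Z k z.2)) M :=
      mul_nonneg (by positivity) (sum_nonneg fun i _ => sum_nonneg fun k _ =>
        dist_nonneg.trans (hδV _ _))
    rw [abs_mul, abs_of_nonneg (Real.sqrt_nonneg _), abs_of_nonneg (mul_nonneg (by positivity) hd0)]
    have hpow : √(n₂ z.1) * (n₂ z.1 : ℝ) ^ (-(1 / 2 : ℝ) + 1 / (dim : ℝ))
        ≤ (N z.1 : ℝ) ^ (1 / (dim : ℝ)) := by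
      rw [Real.sqrt_eq_rpow, ← Real.rpow_add hn, add_neg_cancel_left]
      exact Real.rpow_le_rpow hn.le (by exact_mod_cast hnN z.1) (by positivity)
    calc √(n₂ z.1) * |est μh z - est (fun _ => m) z|
        ≤ √(n₂ z.1) * (1 * (ε * (n₂ z.1 : ℝ) ^ (-(1 / 2 : ℝ) + 1 / (dim : ℝ)) *
          ((N z.1 : ℝ)⁻¹ * matchDist (T z) (fun i => trt (Z i z.2))
            (fun i k => δ (Z i z.2) (Z k z.2)) M))) :=
          mul_le_mul_of_nonneg_left (h4.trans (mul_le_mul_of_nonneg_right (inv_le_one_of_one_le₀ hM1)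
            (mul_nonneg (by positivity) hd0))) (Real.sqrt_nonneg _)
      _ = ε * (√(n₂ z.1) * (n₂ z.1 : ℝ) ^ (-(1 / 2 : ℝ) + 1 / (dim : ℝ)) * ((N z.1 : ℝ)⁻¹ *
          matchDist (T z) (fun i => trt (Z i z.2)) (fun i k => δ (Z i z.2) (Z k z.2)) M)) := by ring
      _ ≤ _ := mul_le_mul_of_nonneg_left (mul_le_mul_of_nonneg_right hpow hd0) hε.le
  have hsum : ∀ᶠ z in 𝒫, ∀ f : ℕ → ℝ, (N z.1 : ℝ)⁻¹ * ∑ j ∈ T z, f j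
      = ∑ j ∈ range (n₁ z.1), (N z.1 : ℝ)⁻¹ * (if j ∈ T z then 1 else 0) * f j := by
    filter_upwards [hES] with z hz f
    rw [sum_eq_sum_range_ite hz.1, mul_sum]
    exact sum_congr rfl fun j _ => by split_ifs <;> ring
  have hcn : ∀ n s j, |(N n : ℝ)⁻¹ * (if j ∈ σ n s then 1 else 0)|
      ≤ 1 * rate (n₁ n) (n₂ n) s j ^ 2 := fun n s j => by
    rw [abs_of_nonneg (by positivity), one_mul]; exact hrate n s j
  have hcm : ∀ n j k, Measurable[known (trtAlg V) (S₂ n) Z k] fun ω =>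
      (N n : ℝ)⁻¹ * (if j ∈ σ n (S₂ n ω) then 1 else 0 : ℝ) := fun n j k =>
    measurable_known_coef (fun s => (N n : ℝ)⁻¹ * (if j ∈ σ n s then 1 else 0 : ℝ)) k
  have hWw : ∀ n j ω, |w n j ω| ≤ w n j ω := fun n j ω =>
    (abs_of_nonneg (zero_le_one.trans (hw1 n j ω))).le
  have hmean : Tendsto (fun z => (N z.1 : ℝ)⁻¹ * ∑ j ∈ T z, ψ₀ z j) 𝒫 (𝓝 0) := by
    have t1 := des.tendsto_weighted_sum heff heffi zero_le_one hcn
    have t2 := h.tendsto_sum_mul des hrm' (c := c) (hrc.mono fun r hr => hr.trans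
      (mul_le_mul_of_nonneg_left (le_self_pow₀ (one_le_outScale r) two_ne_zero) hc0)) hr0
      (G := fun n j ω => (N n : ℝ)⁻¹ * (if j ∈ σ n (S₂ n ω) then 1 else 0 : ℝ) * w n j ω)
      (fun n j k => (hcm n j k).mul (h.measurable_weight n j k)) (c' := 1) fun n j => ae_of_all _ fun ω => by
        rw [one_mul]
        refine (abs_mul_le_of_le (hcn n _ j) (hWw n j ω)).trans ?_
        rw [one_mul]
        exact mul_le_mul_of_nonneg_left (le_self_pow₀ (h.one_le n j ω) two_ne_zero) (sq_nonneg _)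
    have t := t1.add t2
    rw [add_zero] at t
    refine t.congr' ?_
    filter_upwards [hsum] with z hz
    rw [hz, ← sum_add_distrib]
    refine sum_congr rfl fun j _ => ?_
    rw [hψ, hθ]
    ring
  have hinv : plim (fun z => (√(n₂ z.1))⁻¹) 0 := by
    have := (Real.continuous_sqrt.tendsto 0).comp
      (tendsto_probFilter_of_tendsto (P := P) des.tendsto_inv_n₂)
    simpa only [Function.comp_def, Real.sqrt_inv, Real.sqrt_zero] using this
  have hcons : Tendsto (fun z => est μh z - θ) 𝒫 (𝓝 0) := by
    have t := (hinv.mul hA0).add hmean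
    rw [mul_zero, add_zero] at t
    refine t.congr' ?_
    filter_upwards [hid] with z hz
    have : √(n₂ z.1) ≠ 0 := (Real.sqrt_pos.2 (by exact_mod_cast des.size_pos z.1)).ne'
    rw [← hz, inv_mul_cancel_left₀ this]
    ring
  refine ⟨fun n j => ?_, ?_, ?_, hA0.congr' ?_⟩
  · simp only [hψ]
    exact ((heff.comp (des.measurable_Z j)).sub_const _).add
      (((h.measurable_weight n j 0).mono (des.known_le h.le n 0) le_rfl).mul
        (hrm'.comp (des.measurable_Z j)))
  · have htight : IsTightSeq P fun n ω => ∑ j ∈ range (n₁ n),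
        (N n : ℝ)⁻¹ * (if j ∈ σ n (S₂ n ω) then 1 else 0 : ℝ) * w n j ω ^ 2 := by
      refine h.isTightSeq_sum des (c := 1) (X := fun n j ω =>
        (N n : ℝ)⁻¹ * (if j ∈ σ n (S₂ n ω) then 1 else 0 : ℝ) * w n j ω ^ 2) (fun n j =>
        ((hcm n j 0).mul ((h.measurable_weight n j 0).pow_const 2)).mono (des.known_le h.le n 0) le_rfl)
        fun n j => ae_of_all _ fun ω => ?_
      refine (abs_mul_le_of_le (hcn n _ j) (b := w n j ω ^ 4) ?_).trans ?_
      · rw [abs_pow]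
        exact (pow_le_pow_left₀ (abs_nonneg _) (hWw n j ω) 2).trans
          (pow_le_pow_right₀ (h.one_le n j ω) (by norm_num))
      · have := h.one_le n j ω
        rw [one_mul, one_mul]
        exact le_mul_of_one_le_right (by positivity) (one_le_pow₀ (one_le_outScale _))
    have hR0 : plim (fun z => max 0 ((N z.1 : ℝ)⁻¹ * ∑ j ∈ T z,
        (th z j - ψ₀ z j) ^ 2 - 2 * (est μh z - θ) ^ 2)) 0 := by
      refine htight.tendsto_zero_of_le (Y := fun n ω => max 0 ((N n : ℝ)⁻¹ * ∑ j ∈ T (n, ω),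
        (th (n, ω) j - ψ₀ (n, ω) j) ^ 2 - 2 * (est μh (n, ω) - θ) ^ 2)) fun ε hε => ?_
      set e : ℝ := √(ε / 18) with he
      have he0 : 0 < e := Real.sqrt_pos.2 (by positivity)
      have he2 : 18 * e ^ 2 = ε := by rw [he, Real.sq_sqrt (by positivity)]; ring
      have hU : ∀ᶠ z in 𝒫, ∀ a, ∀ x ∈ KV, |μh z a x - m a x| < e := by
        refine eventually_all.2 fun a => eventually_probFilter.2 ?_
        simpa only [not_forall, not_lt, exists_prop] using hmhat.uniform a e he0
      filter_upwards [hU, hEV, hES, hsum] with z h1 h2 h3 h4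
      have hN : (N z.1 : ℝ) ≠ 0 := by exact_mod_cast (hN0 z.1).ne'
      rw [abs_of_nonneg (le_max_left _ _)]
      refine max_le (by positivity) ?_
      rw [sub_le_iff_le_add, ← h4 (fun j => w z.1 j z.2 ^ 2), abs_of_nonneg (by positivity)]
      have hb : ∀ j ∈ T z, (th z j - ψ₀ z j) ^ 2
          ≤ ε * w z.1 j z.2 ^ 2 + 2 * (est μh z - θ) ^ 2 := by
        intro j _
        set x : Bool → ℝ := fun a => μh z a (V (Z j z.2)) - m a (V (Z j z.2)) with hx
        have hxe : ∀ a, |x a| ≤ e := fun a => (h1 a _ (h2 j)).le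
        have hd : th z j - ψ₀ z j
            = (x true - x false - sgn (trt (Z j z.2)) * w z.1 j z.2 * x (trt (Z j z.2)))
              - (est μh z - θ) := by
          rw [hψ]
          simp only [hth, matchTermOn, matchTerm, resid, effect, hx, hw, hest, weightOn]
          ring
        have hb' : |x true - x false - sgn (trt (Z j z.2)) * w z.1 j z.2 * x (trt (Z j z.2))|
            ≤ 3 * e * w z.1 j z.2 := by
          have a1 := (abs_sub (x true) (x false)).trans (add_le_add (hxe true) (hxe false))
          have a2 : |sgn (trt (Z j z.2)) * w z.1 j z.2 * x (trt (Z j z.2))| ≤ w z.1 j z.2 * e := by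
            rw [mul_assoc, abs_mul, abs_sgn, one_mul]
            exact abs_mul_le_of_le (abs_of_nonneg (zero_le_one.trans (hw1 _ _ _))).le (hxe _)
          have a3 := le_mul_of_one_le_right he0.le (hw1 z.1 j z.2)
          linarith [abs_sub (x true - x false)
            (sgn (trt (Z j z.2)) * w z.1 j z.2 * x (trt (Z j z.2)))]
        rw [hd, ← he2]
        have := sq_le_sq' (abs_le.1 hb').1 (abs_le.1 hb').2
        nlinarith [sq_nonneg ((x true - x false - sgn (trt (Z j z.2)) * w z.1 j z.2 *
          x (trt (Z j z.2))) + (est μh z - θ))]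
      calc (N z.1 : ℝ)⁻¹ * ∑ j ∈ T z,
            (th z j - ψ₀ z j) ^ 2
          ≤ (N z.1 : ℝ)⁻¹ * ∑ j ∈ T z, (ε * w z.1 j z.2 ^ 2 + 2 * (est μh z - θ) ^ 2) :=
            mul_le_mul_of_nonneg_left (sum_le_sum hb) (by positivity)
        _ = _ := by
            rw [sum_add_distrib, sum_const, h3.2, nsmul_eq_mul, ← mul_sum]
            field_simp
    have t := hR0.add ((hcons.pow 2).const_mul 2)
    simp only [ne_eq, OfNat.ofNat_ne_zero, not_false_eq_true, zero_pow, mul_zero, add_zero] at t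
    refine squeeze_zero (fun z => mul_nonneg (by positivity) (sum_nonneg fun j _ =>
      sq_nonneg _)) (fun z => ?_) t
    exact sub_le_iff_le_add.1 (le_max_right _ _)
  · refine tendsto_const_nhds.congr' ?_
    filter_upwards [hEm, hES] with z h1 h2
    have hne : (T z).Nonempty := card_pos.1 (h2.2 ▸ hN0 z.1)
    have := sum_matchTerm_eq_zero (A := fun i => trt (Z i z.2)) (Y := fun i => outcome (Z i z.2))
      (d := fun i l => δ (Z i z.2) (Z l z.2)) hM hne h1 (fun a i => mhat z.1 z.2 a (V (Z i z.2)))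
    simp only [hth, matchTermOn, matchEstOn]
    rw [this, mul_zero]
  · filter_upwards [hid] with z hz
    rw [← hz]
    ring

end Estimator

/-! ### Sums with two layers of conditioning -/

section TwoLayers

/-- The ingredients of a sum of terms that consist of a linear part, with functions `T` of validation
units and `E` of all units, of a residual `η` that is centred given `m₂`, and of a residual `ε` that
is centred given the finer `m₃`; their coefficients `g` and `u + g` depend on all units. -/
structure TwoLayer (P : Measure Ω) (Q : Measure (Rec p q)) (Z : ℕ → Ω → Rec p q) (n₁ n₂ : ℕ → ℕ)
    (S₂ : ℕ → Ω → Finset ℕ) (m₂ m₃ : MeasurableSpace (Rec p q)) (W₂ W₃ : Terms)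
    (T E η ε : Rec p q → ℝ) (u g : Terms) : Prop where
  layer₂ : Layer P Q Z n₁ n₂ S₂ outScale m₂ W₂
  layer₃ : Layer P Q Z n₁ n₂ S₂ outScale m₃ W₃
  le : m₂ ≤ m₃
  weight_le : ∀ n j ω, W₂ n j ω ≤ W₃ n j ω
  measurable_T : Measurable[m₃] T
  measurable_E : Measurable[m₂] E
  measurable_η : Measurable[m₃] η
  measurable_ε : Measurable[recAlg p q] ε
  bdd : ∃ c : ℝ, 0 ≤ c ∧ ∀ᵐ r ∂Q, |T r| ≤ c ∧ |E r| ≤ c ∧ |η r| ≤ c ∧ |ε r| ≤ c * outScale r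
  mean_T : ∫ r, T r ∂Q = 0
  mean_E : ∫ r, E r ∂Q = 0
  condExp_η : Q[η | m₂] =ᵐ[Q] 0
  condExp_ε : Q[ε | m₃] =ᵐ[Q] 0
  measurable_u : ∀ n j k, Measurable[known m₃ (S₂ n) Z k] (u n j)
  measurable_g : ∀ n j k, Measurable[known m₂ (S₂ n) Z k] (g n j)
  bdd_coef : ∃ c : ℝ, 0 ≤ c ∧ ∀ n j ω,
    |u n j ω| ≤ c * (rate (n₁ n) (n₂ n) (S₂ n ω) j * W₃ n j ω) ∧
    |g n j ω| ≤ c * (rate (n₁ n) (n₂ n) (S₂ n ω) j * W₂ n j ω)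

/-- The part of the term that is known given `m₃`. -/
def TwoLayer.inner (n₁ n₂ : ℕ → ℕ) (S₂ : ℕ → Ω → Finset ℕ) (Z : ℕ → Ω → Rec p q) (T E η : Rec p q → ℝ)
    (g : Terms) (n j : ℕ) (ω : Ω) : ℝ :=
  coefVal (n₂ n) (S₂ n ω) j * T (Z j ω) + coefDiff (n₁ n) (n₂ n) (S₂ n ω) j * E (Z j ω)
    + g n j ω * η (Z j ω)

/-- The terms of the sum. -/
def TwoLayer.term (n₁ n₂ : ℕ → ℕ) (S₂ : ℕ → Ω → Finset ℕ) (Z : ℕ → Ω → Rec p q) (T E η ε : Rec p q → ℝ)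
    (u g : Terms) (n j : ℕ) (ω : Ω) : ℝ :=
  TwoLayer.inner n₁ n₂ S₂ Z T E η g n j ω + (u n j ω + g n j ω) * ε (Z j ω)

/-- The outermost, linear part of the sum: `T` is replaced by its conditional mean given `m₂`. -/
def TwoLayer.outer (Q : Measure (Rec p q)) (m₂ : MeasurableSpace (Rec p q)) (n₁ n₂ : ℕ → ℕ)
    (S₂ : ℕ → Ω → Finset ℕ) (Z : ℕ → Ω → Rec p q) (T E : Rec p q → ℝ) (n j : ℕ) (ω : Ω) : ℝ :=
  coefVal (n₂ n) (S₂ n ω) j * (Q[T | m₂]) (Z j ω) + coefDiff (n₁ n) (n₂ n) (S₂ n ω) j * E (Z j ω)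

variable {m₂ m₃ : MeasurableSpace (Rec p q)} {W₂ W₃ : ℕ → ℕ → Ω → ℝ} {T E η ε : Rec p q → ℝ}
  {u g : ℕ → ℕ → Ω → ℝ}

local notation "expₙ" x:max => ((Real.exp (-x / 2) : ℝ) : ℂ)

local notation "IsTwoLayer" => TwoLayer P Q Z n₁ n₂ S₂ m₂ m₃ W₂ W₃ T E η ε u g

local notation "innerₙ" => TwoLayer.inner n₁ n₂ S₂ Z T E η g

local notation "termₙ" => TwoLayer.term n₁ n₂ S₂ Z T E η ε u g

local notation "outerₙ" => TwoLayer.outer Q m₂ n₁ n₂ S₂ Z T E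

namespace TwoLayer

lemma known_le_known (h : IsTwoLayer) (n k : ℕ) : 𝒦 m₂ n k ≤ 𝒦 m₃ n k :=
  sup_le_sup le_rfl (MeasurableSpace.comap_mono h.le)

lemma measurable_inner (h : IsTwoLayer) (n j k : ℕ) :
    Measurable[𝒦 m₃ n k] (innerₙ n j) := by
  have hc : ∀ c : Finset ℕ → ℝ, Measurable[𝒦 m₃ n k] fun ω => c (S₂ n ω) := fun c =>
    measurable_known_coef c k
  have hf : ∀ {f : Rec p q → ℝ}, Measurable[m₃] f →
      Measurable[𝒦 m₃ n k] fun ω => f (Z j ω) := fun hf =>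
    measurable_revealed_comp (m𝒵 := recAlg p q) h.layer₃.le hf j k
  exact (((hc fun s => coefVal (n₂ n) s j).mul (hf h.measurable_T)).add
    ((hc fun s => coefDiff (n₁ n) (n₂ n) s j).mul (hf (h.measurable_E.mono h.le le_rfl)))).add
    (((h.measurable_g n j k).mono (h.known_le_known n k) le_rfl).mul (hf h.measurable_η))

lemma measurable_term (h : IsTwoLayer)
    (des : IsDesign) (n j : ℕ) : Measurable (termₙ n j) := by
  have hk := des.known_le h.layer₃.le n 0
  exact ((h.measurable_inner n j 0).mono hk le_rfl).add ((((h.measurable_u n j 0).mono hk le_rfl).add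
    ((h.measurable_g n j 0).mono (des.known_le h.layer₂.le n 0) le_rfl)).mul
    (h.measurable_ε.comp (des.measurable_Z j)))

lemma exists_abs_le (h : IsTwoLayer) (des : IsDesign) : ∃ c
    : ℝ, 0 ≤ c ∧ ∀ n j, ∀ᵐ ω ∂P,
    |innerₙ n j ω| ≤ c * (rateₙ n ω j * W₃ n j ω) ∧
    |u n j ω + g n j ω| ≤ c * (rateₙ n ω j * W₃ n j ω) ∧
    |termₙ n j ω| ≤ c * (rateₙ n ω j * W₃ n j ω * outScale (Z j ω)) := by
  obtain ⟨c, hc0, hc⟩ := h.bdd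
  obtain ⟨c', hc0', hc'⟩ := h.bdd_coef
  have hle : ∀ {x y : ℝ}, 0 ≤ y → x ≤ 2 * c' → x * y ≤ (2 * c + c' * c + 2 * c' * c + 2 * c') * y :=
    fun hy hx => mul_le_mul_of_nonneg_right (hx.trans (le_add_of_nonneg_left (by positivity))) hy
  refine ⟨2 * c + c' * c + 2 * c' * c + 2 * c', by positivity, fun n j => ?_⟩
  filter_upwards [des.ae_unit hc j] with ω hω
  obtain ⟨hT, hE, hη, hε⟩ := hω
  obtain ⟨hu, hg⟩ := hc' n j ω
  have hy := one_le_outScale (Z j ω)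
  have hW := h.layer₃.one_le n j ω
  set R := rateₙ n ω j with hR
  have hR0 : 0 ≤ R := rate_nonneg _ _ _ _
  have hRW : R ≤ R * W₃ n j ω := le_mul_of_one_le_right hR0 hW
  have hRW0 : 0 ≤ R * W₃ n j ω := hR0.trans hRW
  have hg' : |g n j ω| ≤ c' * (R * W₃ n j ω) := hg.trans (mul_le_mul_of_nonneg_left
    (mul_le_mul_of_nonneg_left (h.weight_le n j ω) hR0) hc0')
  have h1 : |innerₙ n j ω| ≤ (2 * c + c' * c) * (R * W₃ n j ω) := by
    have a1 := Layer.abs_mul_le_of_le ((abs_coefVal_le (n₁ n) (n₂ n) (S₂ n ω) j).trans hRW) hT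
    have a2 := Layer.abs_mul_le_of_le ((abs_coefDiff_le (des.size_le n) (S₂ n ω) j).trans hRW) hE
    have a3 := Layer.abs_mul_le_of_le hg' hη
    refine ((abs_add_le _ _).trans (add_le_add ((abs_add_le _ _).trans (add_le_add a1 a2)) a3)).trans
      (le_of_eq (by ring))
  have h2 : |u n j ω + g n j ω| ≤ 2 * c' * (R * W₃ n j ω) :=
    (abs_add_le _ _).trans ((add_le_add hu hg').trans (le_of_eq (by ring)))
  refine ⟨h1.trans ?_, h2.trans (hle hRW0 le_rfl), ?_⟩
  · nlinarith [mul_nonneg hc0' hRW0, mul_nonneg (mul_nonneg hc0' hc0) hRW0]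
  · have h3 := Layer.abs_mul_le_of_le h2 hε
    refine ((abs_add_le _ _).trans (add_le_add (h1.trans (le_mul_of_one_le_right (by positivity) hy))
      h3)).trans ?_
    have : 0 ≤ c' * (R * W₃ n j ω * outScale (Z j ω)) := by positivity
    nlinarith

lemma tendsto_sum_large (h : IsTwoLayer) (des : IsDesign) :
    plim (fun z => ∑ j ∈ range (n₁ z.1), if 1 / 2 < |termₙ z.1 j z.2| then
    termₙ z.1 j z.2 ^ 2 else 0) 0 := by
  obtain ⟨c, -, hc⟩ := h.exists_abs_le des
  exact h.layer₃.tendsto_sum_large des (h.measurable_term des)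
    fun n j => (hc n j).mono fun ω hω => hω.2.2

/-- The conditional variances of the terms given `m₃`. -/
local notation "varₙ" => Layer.stepVar Q m₃ Z (fun _ : Unit => ε) fun _ n j ω => u n j ω + g n j ω

/-- Removing the innermost layer from the sum of squares, and from the sum, replaces it by its
conditional variance. -/
lemma step_inner (h : IsTwoLayer) (des : IsDesign) : plim (fun z => ∑ j ∈ range (n₁ z.1),
      (termₙ z.1 j z.2 ^ 2 - innerₙ z.1 j z.2 ^ 2 - varₙ z.1 j z.2)) 0 ∧
    ∀ F : ℕ → Ω → ℂ, (∀ n k, StronglyMeasurable[𝒦 m₃ n k] (F n)) → (∀ n ω, ‖F n ω‖ ≤ 1) →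
      Tendsto (fun n => ∫ ω, F n ω * cis (∑ j ∈ range (n₁ n), (u n j ω + g n j ω) * ε (Z j ω)) ∂P
        - ∫ ω, F n ω * expₙ (∑ j ∈ range (n₁ n), varₙ n j ω) ∂P) atTop (𝓝 0) := by
  obtain ⟨c, hc0, hc⟩ := h.exists_abs_le des
  obtain ⟨c', hc0', hc'⟩ := h.bdd
  have := h.layer₃.step des (f := fun _ : Unit => ε) (fun _ => h.measurable_ε) hc0'
    (fun _ => hc'.mono fun r hr => hr.2.2.2) (fun _ => h.condExp_ε)
    (fun _ n j k => (h.measurable_u n j k).add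
      ((h.measurable_g n j k).mono (h.known_le_known n k) le_rfl))
    fun _ n j => (hc n j).mono fun ω hω => hω.2.1
  simp only [Finset.univ_unique, sum_singleton] at this
  exact ⟨this.1 innerₙ c h.measurable_inner fun n j => (hc n j).mono fun ω hω => hω.1, this.2⟩

/-- The same for the middle layer. -/
lemma step_outer (h : IsTwoLayer) (des : IsDesign) : (∀ n j
    k, Measurable[𝒦 m₂ n k] (outerₙ n j)) ∧ ∃ S : Terms, (∀ n
    j ω, 0 ≤ S n j ω) ∧ (∀ n j k, Measurable[𝒦 m₂ n k] (S n j)) ∧ plim (fun z => ∑ j ∈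
    range (n₁ z.1), (innerₙ z.1 j z.2 ^ 2
      - outerₙ z.1 j z.2 ^ 2 - S z.1 j z.2)) 0 ∧
    ∀ F : ℕ → Ω → ℂ, (∀ n k, StronglyMeasurable[𝒦 m₂ n k] (F n)) → (∀ n ω, ‖F n ω‖ ≤ 1) →
      Tendsto (fun n => ∫ ω, F n ω * cis (∑ j ∈ range (n₁ n),
          (innerₙ n j ω - outerₙ n j ω)) ∂P
        - ∫ ω, F n ω * expₙ (∑ j ∈ range (n₁ n), S n j ω) ∂P) atTop (𝓝 0) := by
  obtain ⟨c, hc0, hc⟩ := h.bdd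
  obtain ⟨c', hc0', hc'⟩ := h.bdd_coef
  have hm₂ := h.layer₂.le
  have hTm : Measurable[recAlg p q] T := h.measurable_T.mono h.layer₃.le le_rfl
  have hTi : Integrable T Q := Integrable.of_bound hTm.aestronglyMeasurable c
    (hc.mono fun r hr => hr.1)
  have hπm : Measurable[m₂] (Q[T | m₂]) := stronglyMeasurable_condExp.measurable
  have hπb : ∀ᵐ r ∂Q, |(Q[T | m₂]) r| ≤ c :=
    ae_bdd_abs_condExp_of_ae_bdd_abs (hc.mono fun r hr => hr.1)
  have hπ0 : Q[fun r => T r - (Q[T | m₂]) r | m₂] =ᵐ[Q] 0 := by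
    have h1 : Q[fun r => T r - (Q[T | m₂]) r | m₂] =ᵐ[Q] _ := condExp_sub hTi integrable_condExp _
    filter_upwards [h1] with r hr
    rw [hr, Pi.sub_apply, condExp_of_stronglyMeasurable hm₂ stronglyMeasurable_condExp
      integrable_condExp]
    simp
  have hcm : ∀ (f : Finset ℕ → ℝ) n k, Measurable[𝒦 m₂ n k] fun ω => f (S₂ n ω) :=
    fun f n k => measurable_known_coef f k
  have houtm : ∀ n j k, Measurable[𝒦 m₂ n k] (outerₙ n j) :=
    fun n j k => ((hcm (fun s => coefVal (n₂ n) s j) n k).mul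
      (measurable_revealed_comp (m𝒵 := recAlg p q) hm₂ hπm j k)).add
      ((hcm (fun s => coefDiff (n₁ n) (n₂ n) s j) n k).mul
      (measurable_revealed_comp (m𝒵 := recAlg p q) hm₂ h.measurable_E j k))
  have hRW : ∀ n j ω, rateₙ n ω j ≤ rateₙ n ω j * W₂ n j ω := fun n j ω =>
    le_mul_of_one_le_right (rate_nonneg _ _ _ _) (h.layer₂.one_le n j ω)
  have hle : ∀ {x y : ℝ}, 0 ≤ y → x ≤ y → x ≤ (c' + 1) * y := fun hy hx => by nlinarith
  have hbig : ∀ r : Rec p q, ∀ x : ℝ, |x| ≤ 2 * c → |x| ≤ 2 * c * outScale r := fun r x hx =>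
    hx.trans (le_mul_of_one_le_right (by positivity) (one_le_outScale r))
  have hGm : ∀ i n j k, Measurable[𝒦 m₂ n k]
      ((![fun n j ω => valₙ n ω j, g] : Fin 2 → Terms) i n j) := Fin.forall_fin_two.2
    ⟨fun n j k => hcm (fun s => coefVal (n₂ n) s j) n k, h.measurable_g⟩
  have hst := h.layer₂.step des (f := ![fun r => T r - (Q[T | m₂]) r, η]) (c := 2 * c) (c' := c' + 1)
    (G := ![fun n j ω => valₙ n ω j, g]) (Fin.forall_fin_two.2
      ⟨hTm.sub (hπm.mono hm₂ le_rfl), h.measurable_η.mono h.layer₃.le le_rfl⟩) (by positivity)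
    (Fin.forall_fin_two.2 ⟨by
      filter_upwards [hc, hπb] with r h1 h2
      exact hbig r _ ((abs_sub _ _).trans ((add_le_add h1.1 h2).trans_eq (two_mul c).symm)),
      hc.mono fun r hr => hbig r _ (hr.2.2.1.trans (by linarith))⟩)
    (Fin.forall_fin_two.2 ⟨hπ0, h.condExp_η⟩) hGm
    (Fin.forall_fin_two.2
      ⟨fun n j => ae_of_all _ fun ω => hle ((rate_nonneg _ _ _ _).trans (hRW n j ω))
        ((abs_coefVal_le _ _ _ _).trans (hRW n j ω)),
      fun n j => ae_of_all _ fun ω => (hc' n j ω).2.trans (mul_le_mul_of_nonneg_right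
        (le_add_of_nonneg_right zero_le_one) ((rate_nonneg _ _ _ _).trans (hRW n j ω)))⟩)
  have e : ∀ n j ω, valₙ n ω j * (T (Z j ω) - (Q[T | m₂]) (Z j ω)) + g n j ω * η (Z j
      ω) = innerₙ n j ω - outerₙ n j ω := fun n j ω => by
    simp only [inner, outer]; ring
  have h1 := hst.1 (outerₙ) (2 * c) houtm fun n j => by
    filter_upwards [des.ae_unit hc j, des.ae_unit hπb j] with ω h1 h2
    have a1 := Layer.abs_mul_le_of_le ((abs_coefVal_le (n₁ n) (n₂ n) (S₂ n ω) j).trans (hRW n j ω)) h2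
    have a2 := Layer.abs_mul_le_of_le ((abs_coefDiff_le (des.size_le n) (S₂ n ω) j).trans
      (hRW n j ω)) h1.2.1
    exact (abs_add_le _ _).trans ((add_le_add a1 a2).trans (le_of_eq (by ring)))
  have h2 := hst.2
  simp only [Fin.sum_univ_two, Matrix.cons_val_zero, Matrix.cons_val_one, e, add_sub_cancel]
    at h1 h2
  exact ⟨houtm, _, fun n j ω => le_max_left _ _, fun n j k =>
    Layer.measurable_stepVar hm₂ _ hGm n j k, h1, h2⟩

/-- If the sum of squares converges, so does the sum, to the normal law with that variance: the
conditional variance of the innermost layer depends on the other layers, but can be replaced by what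
the middle layer's conditional variance leaves of the limit, and the two add up to a constant. -/
theorem tendsto_charFun (h : IsTwoLayer) (des : IsDesign) {κ
    : ℝ} (hκ : plim (fun z => ∑ j ∈ range (n₁ z.1),
      termₙ z.1 j z.2 ^ 2) κ) :
    Tendsto (fun n => ∫ ω, cis (∑ j ∈ range (n₁ n), termₙ n j ω) ∂P) atTop (𝓝 (Complex.exp (-(κ : ℂ) / 2))) := by
  obtain ⟨c, hc0, hc⟩ := h.bdd
  have hm₂ := h.layer₂.le
  have hπm : Measurable[recAlg p q] (Q[T | m₂]) := stronglyMeasurable_condExp.measurable.mono hm₂ le_rfl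
  have hEm : Measurable[recAlg p q] E := h.measurable_E.mono hm₂ le_rfl
  have hπL : MemLp (Q[T | m₂]) 2 Q := MemLp.of_bound hπm.aestronglyMeasurable c
    (ae_bdd_abs_condExp_of_ae_bdd_abs (hc.mono fun r hr => hr.1))
  have hEL : MemLp E 2 Q := MemLp.of_bound hEm.aestronglyMeasurable c (hc.mono fun r hr => hr.2.1)
  have hclt := des.tendsto_charFun_linear hπm hEm hπL hEL
    ((integral_condExp hm₂).trans h.mean_T) h.mean_E
  have hsq := des.tendsto_sum_linear_sq hπm hEm hπL hEL
  obtain ⟨hi1, hi2⟩ := h.step_inner des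
  obtain ⟨hom, S, hS0, hSm, ho1, ho2⟩ := h.step_outer des
  set v : ℝ := ∫ r, (Q[T | m₂]) r ^ 2 ∂Q + (1 - ρ) * (2 * ∫ r, (Q[T | m₂]) r * E r ∂Q
    + ∫ r, E r ^ 2 ∂Q) with hv
  set X : ℕ → Ω → ℝ := fun n ω => ∑ j ∈ range (n₁ n), termₙ n j ω with hX
  set I : ℕ → Ω → ℝ := fun n ω => ∑ j ∈ range (n₁ n), innerₙ n j ω with hI
  set O : ℕ → Ω → ℝ := fun n ω => ∑ j ∈ range (n₁ n), outerₙ n j ω with hO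
  set R : ℕ → Ω → ℝ := fun n ω => ∑ j ∈ range (n₁ n), varₙ n j ω with hR
  set V : ℕ → Ω → ℝ := fun n ω => ∑ j ∈ range (n₁ n), S n j ω with hV
  have hR0 : ∀ n ω, 0 ≤ R n ω := fun n ω => sum_nonneg fun j _ => le_max_left _ _
  have hV0 : ∀ n ω, 0 ≤ V n ω := fun n ω => sum_nonneg fun j _ => hS0 n j ω
  have hk₂ := fun n => des.known_le h.layer₂.le n 0
  have hk₃ := fun n => des.known_le h.layer₃.le n 0
  have hIm : ∀ n k, Measurable[𝒦 m₃ n k] (I n) := fun n k =>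
    Finset.measurable_fun_sum _ fun j _ => h.measurable_inner n j k
  have hOm : ∀ n k, Measurable[𝒦 m₂ n k] (O n) := fun n k =>
    Finset.measurable_fun_sum _ fun j _ => hom n j k
  have hVm : ∀ n k, Measurable[𝒦 m₂ n k] (V n) := fun n k =>
    Finset.measurable_fun_sum _ fun j _ => hSm n j k
  have hRm : ∀ n, Measurable (R n) := fun n => Finset.measurable_fun_sum _ fun j _ =>
    (Layer.measurable_stepVar (S₂ := S₂) h.layer₃.le _ (fun _ n j k => (h.measurable_u n j k).add
      ((h.measurable_g n j k).mono (h.known_le_known n k) le_rfl)) n j 0).mono (hk₃ n) le_rfl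
  -- the conditional variances of the two residual layers add up to a constant in the limit
  have hRV : plim (fun z => R z.1 z.2 + V z.1 z.2) (κ - v) := by
    have t := ((hκ.sub hi1).sub ho1).sub hsq
    simp only [sub_zero] at t
    refine t.congr fun z => ?_
    simp only [sum_sub_distrib, hR, hV, outer]
    ring
  set w : ℝ := κ - v with hw
  have hexp1 : ∀ x : ℝ, 0 ≤ x → ‖expₙ x‖ ≤ 1 := fun x hx => by
    rw [Complex.norm_real, Real.norm_of_nonneg (Real.exp_nonneg _), Real.exp_le_one_iff]
    linarith
  have hrm : ∀ {𝒱 : MeasurableSpace Ω} {f : Ω → ℝ}, Measurable[𝒱] f →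
      Measurable[𝒱] fun ω => expₙ (f ω) := fun hf =>
    Complex.measurable_ofReal.comp (Real.measurable_exp.comp (hf.neg.div_const 2))
  -- bounded convergence for products with factors of modulus one
  have hbc : ∀ {Y : ℕ → Ω → ℝ} {A A' : ℕ → Ω → ℝ}, (∀ n, Measurable (Y n)) → (∀ n, Measurable (A n))
      → (∀ n, Measurable (A' n)) → (∀ n ω, 0 ≤ A n ω) → (∀ n ω, 0 ≤ A' n ω) → plim (fun z => A z.1
      z.2 - A' z.1 z.2) 0 → Tendsto (fun n => ∫ ω, cis (Y n ω) *
          expₙ (A n ω) ∂P - ∫ ω, cis (Y n ω) *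
          expₙ (A' n ω) ∂P) atTop (𝓝 0) := by
    intro Y A A' hY hA hA' hA0 hA0' hAA
    have hint : ∀ {A : ℕ → Ω → ℝ}, (∀ n, Measurable (A n)) → (∀ n ω, 0 ≤ A n ω) → ∀ n,
        Integrable (fun ω => cis (Y n ω) *
          expₙ (A n ω)) P := fun hA hA0 n =>
      Integrable.of_bound ((measurable_cis (hY n)).mul (hrm (hA n))).aestronglyMeasurable 1
        (ae_of_all _ fun ω => by rw [norm_mul, norm_cis, one_mul]; exact hexp1 _ (hA0 n ω))
    simp_rw [← fun n => integral_sub (hint hA hA0 n) (hint hA' hA0' n)]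
    refine tendsto_integral_of_bounded_probFilter (C := 2) (fun n =>
      ((hint hA hA0 n).sub (hint hA' hA0' n)).aestronglyMeasurable) (fun n ω => ?_) ?_
    · refine (norm_sub_le _ _).trans ?_
      rw [norm_mul, norm_mul, norm_cis, one_mul, one_mul]
      linarith [hexp1 _ (hA0 n ω), hexp1 _ (hA0' n ω)]
    · refine squeeze_zero_norm (fun z => ?_) (by simpa using hAA.abs)
      rw [← mul_sub, norm_mul, norm_cis, one_mul, ← Complex.ofReal_sub, Complex.norm_real,
        Real.norm_eq_abs]
      have key : ∀ x y : ℝ, 0 ≤ x → 0 ≤ y →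
          Real.exp (-x / 2) - Real.exp (-y / 2) ≤ |x - y| := fun x y hx hy => by
        have h1 := Real.add_one_le_exp (x / 2 - y / 2)
        have h2 : Real.exp (-y / 2) = Real.exp (-x / 2) * Real.exp (x / 2 - y / 2) := by
          rw [← Real.exp_add]; congr 1; ring
        have h3 : Real.exp (-x / 2) ≤ 1 := Real.exp_le_one_iff.2 (by linarith)
        have h4 := Real.exp_nonneg (-x / 2)
        rw [h2]
        nlinarith [abs_nonneg (x - y), neg_abs_le (x - y), le_abs_self (x - y)]
      refine abs_sub_le_iff.2 ⟨key _ _ (hA0 _ _) (hA0' _ _), ?_⟩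
      rw [abs_sub_comm]
      exact key _ _ (hA0' _ _) (hA0 _ _)
  have hw0 : 0 ≤ max w 0 := le_max_right _ _
  have hmaxm : ∀ n k, Measurable[𝒦 m₂ n k] fun ω => max (w - V n ω) 0 := fun n k =>
    ((hVm n k).const_sub w).max measurable_const
  have s1 := hi2 (fun n ω => cis (I n ω))
    (fun n k => (measurable_cis (hIm n k)).stronglyMeasurable) fun n ω => (norm_cis _).le
  have s2 := hbc (Y := I) (A := R) (A' := fun n ω => max (w - V n ω) 0)
    (fun n => (hIm n 0).mono (hk₃ n) le_rfl) hRm (fun n => (hmaxm n 0).mono (hk₂ n) le_rfl) hR0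
    (fun n ω => le_max_right _ _) (by
      refine squeeze_zero_norm (fun z => ?_) (a := fun z => |R z.1 z.2 + V z.1 z.2 - w|) ?_
      · have h1 := abs_max_sub_max_le_abs (R z.1 z.2) (w - V z.1 z.2) 0
        rw [max_eq_left (hR0 z.1 z.2)] at h1
        rw [Real.norm_eq_abs]
        exact h1.trans_eq (by congr 1; ring)
      · simpa using (hRV.sub_const w).abs)
  have s3 := ho2 (fun n ω => cis (O n ω) *
      expₙ (max (w - V n ω) 0))
    (fun n k => ((measurable_cis (hOm n k)).mul (hrm (hmaxm n k))).stronglyMeasurable) fun n ω => by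
      rw [norm_mul, norm_cis, one_mul]; exact hexp1 _ (le_max_right _ _)
  have hwlim : plim (fun z => R z.1 z.2 + V z.1 z.2) w := hRV
  have s4 := hbc (Y := O) (A := fun n ω => max (w - V n ω) 0 + V n ω) (A' := fun _ _ => max w 0)
    (fun n => (hOm n 0).mono (hk₂ n) le_rfl)
    (fun n => ((hmaxm n 0).add (hVm n 0)).mono (hk₂ n) le_rfl) (fun _ => measurable_const)
    (fun n ω => add_nonneg (le_max_right _ _) (hV0 n ω)) (fun _ _ => hw0) (by
      refine squeeze_zero_norm (fun z => ?_) (a := fun z => |R z.1 z.2 + V z.1 z.2 - w|) ?_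
      · rw [Real.norm_eq_abs, max_add, sub_add_cancel, zero_add]
        have hr := hR0 z.1 z.2
        have hv := hV0 z.1 z.2
        have h1 := le_abs_self (R z.1 z.2 + V z.1 z.2 - w)
        rcases le_total w (V z.1 z.2) with h2 | h2
        · rw [max_eq_right h2, abs_of_nonneg (sub_nonneg.2 (max_le h2 hv))]
          linarith [le_max_left w 0]
        · rw [max_eq_left h2, max_eq_left (hv.trans h2), sub_self, abs_zero]
          exact abs_nonneg _
      · simpa using (hRV.sub_const w).abs)
  have := probFilter_neBot P
  have hwn : 0 ≤ w := ge_of_tendsto' hRV fun z => add_nonneg (hR0 _ _) (hV0 _ _)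
  have s5 := hclt.mul_const (expₙ w)
  have e2 : ∀ x y : ℝ, expₙ x * expₙ y
      = ((Real.exp (-(x + y) / 2) : ℝ) : ℂ) := fun x y => by
    rw [← Complex.ofReal_mul, ← Real.exp_add]; congr 3; ring
  have hI' : ∀ n ω, I n ω + ∑ j ∈ range (n₁ n), (u n j ω + g n j ω) * ε (Z j ω) = X n ω :=
    fun n ω => by simp only [hI, hX, term, sum_add_distrib]
  have hO' : ∀ n ω, O n ω + ∑ j ∈ range (n₁ n), (innerₙ n j ω
      - outerₙ n j ω) = I n ω := fun n ω => by
    simp only [hI, hO, sum_sub_distrib]; ring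
  simp_rw [cis_mul_cis, hI'] at s1
  simp_rw [mul_right_comm _ _ (Complex.exp _), cis_mul_cis, hO', mul_assoc, e2] at s3
  simp only [max_eq_left hwn, integral_mul_const] at s4
  have t := (((s1.add s2).add s3).add s4).add s5
  have hlim : Complex.exp (-((v : ℝ) : ℂ) / 2) * expₙ w
      = Complex.exp (-(κ : ℂ) / 2) := by
    rw [Complex.ofReal_exp, ← Complex.exp_add]
    congr 1
    rw [hw]
    push_cast
    ring
  rw [hlim] at t
  simp only [zero_add] at t
  refine t.congr fun n => ?_
  simp only [hO, outer]
  ring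

end TwoLayer

end TwoLayers

section TwoLayers

/-- The sum of squares: products of the layers average out, and the squares of the residuals can be
replaced by conditional variances, those of `ε` and `η` together by `sX`. -/
theorem TwoLayer.tendsto_sum_sq {m₂ m₃ : MeasurableSpace (Rec p q)} {W₂ W₃ : Terms} {T E η ε
    σ2 sX : Rec p q → ℝ} {u g : Terms} (h : TwoLayer P Q Z n₁ n₂ S₂ m₂ m₃ W₂ W₃ T E η ε u g)
    (des : IsDesign) (hσ : Q[fun r => ε r ^ 2 | m₃] =ᵐ[Q] σ2) (hσm : Measurable[recAlg p q] σ2)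
    (hsm : Measurable[recAlg p q] sX) {b : ℝ} (hb : ∀ᵐ r ∂Q, |σ2 r| ≤ b ∧ |sX r| ≤ b) (hζ : Q[fun r
    => η r ^ 2 + σ2 r - sX r | m₂] =ᵐ[Q] 0) {κ : ℝ} (hκ : plim (fun z => ∑ j ∈ range (n₁ z.1), ((u
    z.1 j z.2 ^ 2
        + 2 * u z.1 j z.2 * g z.1 j z.2) * σ2 (Z j z.2)
        + 2 * valₙ z.1 z.2 j * T (Z j z.2) * g z.1 j z.2 * η (Z j z.2)
        + g z.1 j z.2 ^ 2 * sX (Z j z.2))) κ) :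
    plim (fun z => ∑ j ∈ range (n₁ z.1),
      TwoLayer.term n₁ n₂ S₂ Z T E η ε u g z.1 j z.2 ^ 2) (∫ r, T r ^ 2 ∂Q + (1 - ρ) * (2 * ∫ r, T r * E r ∂Q + ∫ r, E r ^ 2 ∂Q) + κ) := by
  obtain ⟨c, hc0, hc⟩ := h.bdd
  obtain ⟨c', hc0', hc'⟩ := h.bdd_coef
  have hm₂ := h.layer₂.le
  have hTm : Measurable[recAlg p q] T := h.measurable_T.mono h.layer₃.le le_rfl
  have hEm : Measurable[recAlg p q] E := h.measurable_E.mono hm₂ le_rfl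
  have hηm : Measurable[recAlg p q] η := h.measurable_η.mono h.layer₃.le le_rfl
  have hy : ∀ r : Rec p q, 1 ≤ outScale r ^ 2 := fun r => one_le_pow₀ (one_le_outScale r)
  have hsq := des.tendsto_sum_linear_sq hTm hEm
    (MemLp.of_bound hTm.aestronglyMeasurable c (hc.mono fun r hr => hr.1))
    (MemLp.of_bound hEm.aestronglyMeasurable c (hc.mono fun r hr => hr.2.1))
  have hW : ∀ n j ω, rateₙ n ω j ≤ rateₙ n ω j * W₂ n j ω := fun n j ω =>
    le_mul_of_one_le_right (rate_nonneg _ _ _ _) (h.layer₂.one_le n j ω)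
  have t1 := h.layer₂.tendsto_sum_mul des hηm (c := c) (hc.mono fun r hr =>
      hr.2.2.1.trans (le_mul_of_one_le_right hc0 (hy r))) h.condExp_η
    (G := fun n j ω => 2 * (diffₙ n ω j * E (Z j ω)) * g n j ω)
    (fun n j k => (((measurable_known_coef (fun s => coefDiff (n₁ n) (n₂ n) s j) k).mul
      (measurable_revealed_comp (m𝒵 := recAlg p q) hm₂ h.measurable_E j k)).const_mul 2).mul
      (h.measurable_g n j k)) (c' := 2 * c * c') fun n j => by
      filter_upwards [des.ae_unit hc j] with ω hω
      have a1 := Layer.abs_mul_le_of_le ((abs_coefDiff_le (des.size_le n) (S₂ n ω) j).trans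
        (hW n j ω)) hω.2.1
      have a2 := Layer.abs_mul_le_of_le (Layer.abs_mul_le_of_le abs_two.le a1) (hc' n j ω).2
      exact a2.trans (le_of_eq (by ring))
  have t2 := h.layer₂.tendsto_sum_mul des (f := fun r => η r ^ 2 + σ2 r - sX r)
    (((hηm.pow_const 2).add hσm).sub hsm) (c := c ^ 2 + b + b) (by
      filter_upwards [hc, hb] with r h1 h2
      have a1 : |η r ^ 2| ≤ c ^ 2 := by
        rw [abs_pow]; exact pow_le_pow_left₀ (abs_nonneg _) h1.2.2.1 2
      have a2 := (abs_sub (η r ^ 2 + σ2 r) (sX r)).trans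
        (add_le_add ((abs_add_le _ _).trans (add_le_add a1 h2.1)) h2.2)
      exact a2.trans (le_mul_of_one_le_right ((abs_nonneg _).trans a2) (hy r))) hζ
    (G := fun n j ω => g n j ω ^ 2) (fun n j k => (h.measurable_g n j k).pow_const 2)
    (c' := c' ^ 2) fun n j => ae_of_all _ fun ω => by
      rw [abs_pow, ← mul_pow, ← mul_pow]
      exact pow_le_pow_left₀ (abs_nonneg _) (hc' n j ω).2 2
  have t := ((((h.step_inner des).1.add t1).add t2).add hsq).add hκ
  simp only [zero_add] at t
  refine t.congr' ?_
  have hv : ∀ᵐ r ∂Q, 0 ≤ σ2 r ∧ (Q[fun r => ε r ^ 2 | m₃]) r = σ2 r := by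
    have h0 : (0 : Rec p q → ℝ) ≤ᵐ[Q] Q[fun r => ε r ^ 2 | m₃] :=
      condExp_nonneg (ae_of_all _ fun r => sq_nonneg _)
    filter_upwards [h0, hσ] with r h1 h2
    exact ⟨h2 ▸ h1, h2⟩
  filter_upwards [eventually_probFilter_of_ae (p := fun _ ω => ∀ j, _) (Eventually.of_forall
    fun _ => ae_all_iff.2 fun j => des.ae_unit hv j)] with z hz
  simp only [← sum_add_distrib]
  refine sum_congr rfl fun j _ => ?_
  obtain ⟨h1, h2⟩ := hz j
  have : Layer.stepVar Q m₃ Z (fun _ : Unit => ε) (fun _ n j ω => u n j ω + g n j ω) z.1 j z.2 = (u z.1 j z.2 + g z.1 j z.2) ^ 2 * σ2 (Z j z.2) := by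
    simp only [Layer.stepVar, Fintype.sum_prod_type, Finset.univ_unique, sum_singleton, ← sq, h2]
    exact max_eq_right (mul_nonneg (sq_nonneg _) h1)
  rw [this, TwoLayer.inner]
  ring

/-! ### Matching weights and matching estimators -/

lemma Layer.add {m : MeasurableSpace (Rec p q)} {W W' : Terms} (h : IsLayer m
    W) (h' : IsLayer m W') (des : IsDesign) : IsLayer m (fun n j ω => W
    n j ω + W' n j ω) where
  le := h.le
  measurable_weight n j k := (h.measurable_weight n j k).add (h'.measurable_weight n j k)
  one_le n j ω := (h.one_le n j ω).trans
    (le_add_of_nonneg_right (zero_le_one.trans (h'.one_le n j ω)))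
  bdd n := by
    obtain ⟨b, hb⟩ := h.bdd n
    obtain ⟨b', hb'⟩ := h'.bdd n
    refine ⟨b + b', fun j => ?_⟩
    filter_upwards [hb j, hb' j] with ω h1 h2 using add_le_add h1 h2
  moment := by
    have hi : ∀ {W : Terms}, IsLayer m W → ∀ n j,
        Integrable (fun ω => rateₙ n ω j ^ 2 * W n j ω ^ 4) P := by
      intro W h n j
      refine ((h.integrable_dom_and_le des).1 n j).mono' ?_ (ae_of_all _ fun ω => ?_)
      · exact ((des.measurable_coef (fun s => rate (n₁ n) (n₂ n) s j ^ 2) n).mul (((h.measurable_weight n j 0).mono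
          (des.known_le h.le n 0) le_rfl).pow_const 4)).aestronglyMeasurable
      · rw [Real.norm_of_nonneg (by positivity)]
        exact le_mul_of_one_le_right (by positivity) (one_le_pow₀ (one_le_outScale _))
    obtain ⟨C, hC⟩ := h.moment
    obtain ⟨C', hC'⟩ := h'.moment
    refine ⟨8 * C + 8 * C', fun n => (sum_le_sum (g := fun j =>
      8 * ∫ ω, rateₙ n ω j ^ 2 * W n j ω ^ 4 ∂P
      + 8 * ∫ ω, rateₙ n ω j ^ 2 * W' n j ω ^ 4 ∂P) fun j _ => ?_).trans ?_⟩
    · have i1 := (hi h n j).const_mul 8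
      have i2 := (hi h' n j).const_mul 8
      rw [← integral_const_mul, ← integral_const_mul, ← integral_add i1 i2]
      refine integral_mono_of_nonneg (ae_of_all _ fun ω => by positivity) (i1.add i2)
        (ae_of_all _ fun ω => ?_)
      have h1 := add_sq_le (a := W n j ω) (b := W' n j ω)
      have h2 := pow_le_pow_left₀ (sq_nonneg _) h1 2
      have h3 := add_sq_le (a := W n j ω ^ 2) (b := W' n j ω ^ 2)
      have : (W n j ω + W' n j ω) ^ 4 ≤ 8 * W n j ω ^ 4 + 8 * W' n j ω ^ 4 := by nlinarith
      exact (mul_le_mul_of_nonneg_left this (sq_nonneg _)).trans (le_of_eq (by ring))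
    · rw [sum_add_distrib, ← mul_sum, ← mul_sum]
      exact add_le_add (mul_le_mul_of_nonneg_left (hC n) (by norm_num))
        (mul_le_mul_of_nonneg_left (hC' n) (by norm_num))
  one_le_scale := h.one_le_scale
  integrable_scale := h.integrable_scale
  condMoment := h.condMoment

variable {F : Type*} [NormedAddCommGroup F] [NormedSpace ℝ F] [FiniteDimensional ℝ F]
  [MeasurableSpace F] [BorelSpace F] {ξ : Rec p q → F} {δ : Rec p q → Rec p q → ℝ} {M : ℕ}
  {σ : ℕ → Finset ℕ → Finset ℕ} {N : ℕ → ℕ}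

lemma Design.layer_weightOn (des : IsDesign) (hO : Overlap Q) (hξ : Measurable[covAlg p q] ξ) (hδ
    : ∀ r r', δ r r' = dist (ξ r) (ξ r')) (hne : ∀ i j, i ≠ j → ∀ᵐ ω ∂P, ξ (Z i ω) ≠ ξ (Z j ω)) (hM
    : 0 < M) (hσ : ∀ n, ∀ s ∈ powersetCard (n₂ n) (range (n₁ n)), σ n s ⊆ range (n₁ n)) {m :
    MeasurableSpace (Rec p q)} (hm : m ≤ recAlg p q) (htrt : Measurable[m] (trt : Rec p q → _)) (hξm
    : Measurable[m] ξ) (hi : Integrable (fun r : Rec p q => outScale r ^ 4) Q) (hc : ∃ C, ∀ᵐ r ∂Q,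
    (Q[fun r' => outScale r' ^ 4 | m]) r ≤ C) : IsLayer m (fun n j ω => weightOn (σ n
    (S₂ n ω)) (fun i => Z i ω) δ M j) where
  le := hm
  measurable_weight n j k := measurable_matchWeight (fun i => measurable_revealed_comp
    (m𝒵 := recAlg p q) hm htrt i k) (fun i i' => measurable_known_dist hm hξm hδ k i i')
    (measurable_known_coef (σ n) k) M j
  one_le n j ω := one_le_matchWeight _ _ _ _ _
  bdd n := ⟨1 + n₁ n, fun j => (des.ae_validation n).mono fun ω hω =>
    (matchWeight_le hM _ _ _ j).trans (add_le_add le_rfl (by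
      simpa using Nat.cast_le (α := ℝ).2 (card_le_card (hσ n _ hω))))⟩
  moment := by
    obtain ⟨C, hC0, hC⟩ := des.exists_integral_weight_pow_four_le hO hξ hδ hne hM
    refine ⟨C * 4, fun n => (sum_le_sum fun j _ => hC n (σ n) (hσ n) (fun s => rate (n₁ n) (n₂ n) s
      j ^ 2) _ (fun s => sq_nonneg _) (fun s => des.rate_sq_le n s j) j).trans ?_⟩
    have := des.integral_sum_rate_sq_mul_le n (f := fun _ => 1) (integrable_const 1)
      fun _ => zero_le_one
    simp only [mul_one, integral_const, probReal_univ, smul_eq_mul] at this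
    rw [← mul_sum]
    exact mul_le_mul_of_nonneg_left this hC0
  one_le_scale := one_le_outScale
  integrable_scale := hi
  condMoment := hc

lemma Design.isTightSeq_matchDist [Nontrivial F] (des : IsDesign) (hO : Overlap Q) (hξ :
    Measurable[covAlg p q] ξ) (hδ : ∀ r r', δ r r' = dist (ξ r) (ξ r')) {Δ : ℝ} (hΔ : ∀ᵐ r ∂Q, ‖ξ r‖
    ≤ Δ) (M : ℕ) (hN : ∀ n, 0 < N n) (hσ : ∀ n, ∀ s ∈ powersetCard (n₂ n) (range (n₁ n)),
      σ n s ⊆ range (n₁ n) ∧ (σ n s).card = N n) :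
    IsTightSeq P fun n ω => (N n : ℝ) ^ (1 / (Module.finrank ℝ F : ℝ)) * ((N n : ℝ)⁻¹ *
      matchDist (σ n (S₂ n ω)) (fun i => trt (Z i ω)) (fun i k => δ (Z i ω) (Z k ω)) M) := by
  obtain ⟨C, -, hC⟩ := des.exists_integral_matchDist_le hO hξ hδ hΔ M
  refine isTightSeq_of_integral_abs (C := C) (Eventually.of_forall fun n =>
    ((hC n (σ n) (N n) (hN n) (hσ n)).1.const_mul _).const_mul _) (Eventually.of_forall fun n => ?_)
  have hN' : 0 < (N n : ℝ) := by exact_mod_cast hN n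
  have h0 : ∀ ω, 0 ≤ matchDist (σ n (S₂ n ω)) (fun i => trt (Z i ω))
      (fun i k => δ (Z i ω) (Z k ω)) M := fun ω =>
    sum_nonneg fun i _ => sum_nonneg fun k _ => by simp only [hδ]; exact dist_nonneg
  simp only [abs_of_nonneg (mul_nonneg (Real.rpow_nonneg hN'.le _)
    (mul_nonneg (inv_nonneg.2 hN'.le) (h0 _)))]
  rw [integral_const_mul, integral_const_mul]
  refine (mul_le_mul_of_nonneg_left (mul_le_mul_of_nonneg_left (hC n (σ n) (N n) (hN n) (hσ n)).2
    (inv_nonneg.2 hN'.le)) (Real.rpow_nonneg hN'.le _)).trans (le_of_eq ?_)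
  rw [Real.rpow_neg hN'.le]
  have := (Real.rpow_pos_of_pos hN' (1 / (Module.finrank ℝ F : ℝ))).ne'
  field_simp

end TwoLayers

/-! ### Validity of the bootstrap for matching estimators -/

section Matching

variable {K : Set (EuclideanSpace ℝ (Fin p) × EuclideanSpace ℝ (Fin q))}
  {m s : Bool → EuclideanSpace ℝ (Fin p) × EuclideanSpace ℝ (Fin q) → ℝ}
  {mX sX : Bool → EuclideanSpace ℝ (Fin p) → ℝ}

/-- The signed difference between the regressions on `(X, U)` and on `X`. -/
def regGap (m : Bool → 𝕏 × 𝕌 → ℝ)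
    (mX : Bool → 𝕏 → ℝ) (r : Rec p q) : ℝ :=
  sgn (trt r) * (m (trt r) (covXU r) - mX (trt r) (covX r))

lemma resid_covX (m : Bool → 𝕏 × 𝕌 → ℝ)
    (mX : Bool → 𝕏 → ℝ) (r : Rec p q) :
    resid covX mX r = resid covXU m r + regGap m mX r := by
  simp only [resid, regGap]; ring

lemma measurable_regGap (hR : RegularOutcome Q covXU K m s) (hX : RegularOutcome Q covX (Prod.fst ''
    K) mX sX) : Measurable[trtAlg covXU] (regGap m mX : Rec p q → ℝ) := by
  have ht : Measurable[trtAlg covXU] fun r : Rec p q => trt r :=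
    (comap_measurable (fun r : Rec p q => (trt r, covXU r))).fst
  exact (measurable_sgn.comp ht).mul
    ((hR.measurable_resid measurable_covXU).1.sub
      ((hX.measurable_resid measurable_covX).1.mono trtAlg_covX_le le_rfl))

/-- Decomposition of the residual given `X`, and of its conditional variance, into the parts within
and between the levels of `U`. -/
lemma condExp_regGap (hC : RegularCovariates Q K) (hR : RegularOutcome Q covXU K m s) (hX :
    RegularOutcome Q covX (Prod.fst '' K) mX sX) : Q[regGap m mX | trtAlg covX] =ᵐ[Q] 0 ∧ Q[fun r =>
    regGap m mX r ^ 2 + s (trt r) (covXU r) - sX (trt r) (covX r) | trtAlg covX] =ᵐ[Q] 0 := by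
  have hKb := hC.1.isBounded
  obtain ⟨⟨c, hc0, hc, hεc⟩, hε0, hε2⟩ := hR.resid_facts measurable_covXU hKb hC.ae_mem
  obtain ⟨⟨c', hc0', hc', hec⟩, he0, he2⟩ := hX.resid_facts measurable_covX
    (hC.1.image continuous_fst).isBounded (hC.ae_mem.mono fun r hr => ⟨_, hr, rfl⟩)
  have h3 := trtAlg_le (measurable_covXU : Measurable (covXU : Rec p q → _))
  have h2 := trtAlg_le (measurable_covX : Measurable (covX : Rec p q → _))
  obtain ⟨-, hsm, hrm⟩ := hR.measurable_resid measurable_covXU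
  obtain ⟨-, hsXm, hrXm⟩ := hX.measurable_resid measurable_covX
  obtain ⟨-, hi4, -⟩ := hR.layer_moments measurable_covXU
  have hsg : Measurable[recAlg p q] fun r : Rec p q => sgn (trt r) :=
    measurable_sgn.comp measurable_trt
  have hεm : Measurable[recAlg p q] (resid covXU m) := hsg.mul hrm
  have hem : Measurable[recAlg p q] (resid covX mX) := hsg.mul hrXm
  have hηm := measurable_regGap hR hX
  have hint : ∀ {f : Rec p q → ℝ} {b : ℝ}, Measurable[recAlg p q] f →
      (∀ᵐ r ∂Q, |f r| ≤ b * outScale r ^ 2) → Integrable f Q := fun {f b} hf hb =>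
    (hi4.const_mul |b|).mono' hf.aestronglyMeasurable (hb.mono fun r hr => by
      have := one_le_outScale r
      exact hr.trans (mul_le_mul (le_abs_self b) (pow_le_pow_right₀ this (by norm_num))
        (by positivity) (abs_nonneg _)))
  have hb1 : ∀ {f : Rec p q → ℝ} {b : ℝ}, 0 ≤ b → (∀ᵐ r ∂Q, |f r| ≤ b * outScale r) →
      ∀ᵐ r ∂Q, |f r| ≤ b * outScale r ^ 2 := fun hb h => h.mono fun r hr => hr.trans
    (mul_le_mul_of_nonneg_left (le_self_pow₀ (one_le_outScale r) two_ne_zero) hb)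
  have hεi := hint hεm (hb1 hc0 hεc)
  have hei := hint hem (hb1 hc0' hec)
  have hmul : ∀ {f f' : Rec p q → ℝ} {b b' : ℝ}, (∀ᵐ r ∂Q, |f r| ≤ b * outScale r) →
      (∀ᵐ r ∂Q, |f' r| ≤ b' * outScale r) → ∀ᵐ r ∂Q, |f r * f' r| ≤ b * b' * outScale r ^ 2 :=
    fun h h' => by
      filter_upwards [h, h'] with r h1 h2
      exact (Layer.abs_mul_le_of_le h1 h2).trans (le_of_eq (by ring))
  have hηc : ∀ᵐ r ∂Q, |regGap m mX r| ≤ (c' + c) * outScale r := by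
    filter_upwards [hεc, hec] with r h1 h2
    rw [show regGap m mX r = resid covX mX r - resid covXU m r by rw [resid_covX m]; ring]
    exact (abs_sub _ _).trans ((add_le_add h2 h1).trans_eq (by ring))
  have hηm' := hηm.mono h3 le_rfl
  have hεεi : Integrable (fun r => resid covXU m r ^ 2) Q := by
    simpa only [sq] using hint (f := fun r => _ * _) (hεm.mul hεm) (hmul hεc hεc)
  have hηηi : Integrable (fun r => regGap m mX r ^ 2) Q := by
    simpa only [sq] using hint (f := fun r => _ * _) (hηm'.mul hηm') (hmul hηc hηc)
  have hηεi : Integrable (fun r => (2 * regGap m mX r) * resid covXU m r) Q := by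
    simpa only [mul_assoc] using
      (hint (f := fun r => _ * _) (hηm'.mul hεm) (hmul hηc hεc)).const_mul 2
  have htow : ∀ {f : Rec p q → ℝ}, Q[Q[f | trtAlg covXU] | trtAlg covX] =ᵐ[Q] Q[f | trtAlg covX] :=
    condExp_condExp_of_le trtAlg_covX_le h3
  have hsXi : Integrable (fun r => sX (trt r) (covX r)) Q := Integrable.of_bound
    (hsXm.mono h2 le_rfl).aestronglyMeasurable c' (hc'.mono fun r hr => (hr _).2)
  have hsi : Integrable (fun r => s (trt r) (covXU r)) Q := Integrable.of_bound
    (hsm.mono h3 le_rfl).aestronglyMeasurable c (hc.mono fun r hr => (hr _).2)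
  constructor
  · have e : regGap m mX = resid covX mX - resid covXU m := by
      ext r; rw [Pi.sub_apply, resid_covX m]; ring
    have a1 : Q[regGap m mX | trtAlg covX] =ᵐ[Q] _ := e ▸ condExp_sub hei hεi _
    have a2 : Q[Q[resid covXU m | trtAlg covXU] | trtAlg covX] =ᵐ[Q] _ := condExp_congr_ae hε0
    filter_upwards [a1, he0, a2, htow (f := resid covXU m)] with r b1 b2 b3 b4
    rw [b1, Pi.sub_apply, b2, ← b4, b3, condExp_zero]
    simp
  · have e : (fun r => resid covX mX r ^ 2) = (fun r => resid covXU m r ^ 2)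
        + (fun r => (2 * regGap m mX r) * resid covXU m r) + fun r => regGap m mX r ^ 2 := by
      ext r; simp only [Pi.add_apply]; rw [resid_covX m]; ring
    have a1 : Q[fun r => resid covX mX r ^ 2 | trtAlg covXU] =ᵐ[Q]
        fun r => regGap m mX r ^ 2 + s (trt r) (covXU r) := by
      rw [e]
      have b1 := condExp_add (hεεi.add hηεi) hηηi (trtAlg covXU)
      have b2 := condExp_add hεεi hηεi (trtAlg covXU)
      have b3 : Q[fun r => (2 * regGap m mX r) * resid covXU m r | trtAlg covXU] =ᵐ[Q] _ :=
        condExp_mul_of_stronglyMeasurable_left (hηm.const_mul 2).stronglyMeasurable hηεi hεi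
      filter_upwards [b1, b2, b3, hε0, hε2] with r b1 b2 b3 b4 b5
      rw [b1, Pi.add_apply, b2, Pi.add_apply, b3, Pi.mul_apply, b4, b5,
        condExp_of_stronglyMeasurable h3 (hηm.pow_const 2).stronglyMeasurable hηηi]
      simp only [Pi.zero_apply, mul_zero, add_zero]
      ring
    have a2 : Q[Q[fun r => resid covX mX r ^ 2 | trtAlg covXU] | trtAlg covX] =ᵐ[Q] _ :=
      condExp_congr_ae a1
    have a3 : Q[fun r => regGap m mX r ^ 2 + s (trt r) (covXU r) - sX (trt r) (covX r) |
      trtAlg covX] =ᵐ[Q] _ := condExp_sub (hηηi.add hsi) hsXi _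
    filter_upwards [a2, a3, htow (f := fun r => resid covX mX r ^ 2), he2] with r b1 b2 b3 b4
    rw [b2, Pi.sub_apply, condExp_of_stronglyMeasurable h2 hsXm.stronglyMeasurable hsXi]
    rw [b1, b4] at b3
    exact sub_eq_zero.2 b3

/-- The coefficient of the residual of unit `j` given `X` in `√n₂` times the difference of the two
error-prone estimators. -/
def epCoef (N₁ N₂ : ℕ) (s : Finset ℕ) (w₁ w₂ : ℝ) (j : ℕ) : ℝ :=
  √N₂ * ((N₂ : ℝ)⁻¹ * (if j ∈ s then w₂ else 0) - (N₁ : ℝ)⁻¹ * w₁)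

lemma abs_epCoef_le {N₁ N₂ : ℕ} (h : N₂ ≤ N₁) (s : Finset ℕ) {w₁ w₂ : ℝ} (h1 : 0 ≤ w₁)
    (h2 : 0 ≤ w₂) (j : ℕ) : |epCoef N₁ N₂ s w₁ w₂ j| ≤ rate N₁ N₂ s j * (w₁ + w₂) := by
  have e : epCoef N₁ N₂ s w₁ w₂ j = (√N₂)⁻¹ * (if j ∈ s then w₂ else 0)
      - √N₂ * (N₁ : ℝ)⁻¹ * w₁ := by rw [epCoef, ← sqrt_mul_inv_self]; ring
  have a1 : √N₂ * (N₁ : ℝ)⁻¹ * w₁ ≤ (√N₁)⁻¹ * w₁ :=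
    mul_le_mul_of_nonneg_right (sqrt_mul_inv_le h) h1
  have a2 : 0 ≤ √N₂ * (N₁ : ℝ)⁻¹ * w₁ := by positivity
  have a3 : 0 ≤ (√N₁)⁻¹ * w₂ := by positivity
  have a4 : 0 ≤ (√N₂)⁻¹ * w₁ := by positivity
  have a5 : 0 ≤ (√N₂)⁻¹ * w₂ := by positivity
  rw [e, rate, abs_le]
  split_ifs <;> constructor <;> nlinarith

/-- The matching-dependent part of the sum of squares, in terms of the sums whose limits are
assumed: the sampling fraction `n₂ / n₁` can be replaced by its limit. -/
lemma Design.tendsto_sum_weights (des : IsDesign) {x y v : Rec p q → ℝ} {w w₁ w₂ : Terms}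
    {κv κΓ κV : ℝ} (α β : ℝ) (hv : plim (fun z => (n₂ z.1 : ℝ)⁻¹ * ∑ j ∈ S₂ z.1 z.2,
      w z.1 j z.2 ^ 2 * x (Z j z.2)) κv)
    (hΓ : plim (fun z => (n₂ z.1 : ℝ)⁻¹ * ∑ j ∈ S₂ z.1 z.2,
      (w₂ z.1 j z.2 - ρ * w₁ z.1 j z.2) * (w z.1 j z.2 * x (Z j z.2) + y (Z j z.2))) κΓ)
    (hV : plim (fun z => (n₂ z.1 : ℝ)⁻¹ * ∑ j ∈ S₂ z.1 z.2,
        (w₂ z.1 j z.2 ^ 2 - 2 * ρ * w₁ z.1 j z.2 * w₂ z.1 j z.2) * v (Z j z.2)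
      + ρ * ((n₁ z.1 : ℝ)⁻¹ * ∑ i ∈ range (n₁ z.1), w₁ z.1 i z.2 ^ 2 * v (Z i z.2))) κV)
    (hR : IsTightSeq P fun n ω => ∑ j ∈ range (n₁ n), ((n₂ n : ℝ)⁻¹ * (if j ∈ S₂ n ω then 1 else 0) *
      (-2 * α * β * w₁ n j ω * (w n j ω * x (Z j ω) + y (Z j ω))
        - 2 * β ^ 2 * w₁ n j ω * w₂ n j ω * v (Z j ω))
      + (n₁ n : ℝ)⁻¹ * (β ^ 2 * w₁ n j ω ^ 2 * v (Z j ω)))) :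
    plim (fun z => ∑ j ∈ range (n₁ z.1), (((α * valₙ z.1 z.2 j * w z.1 j z.2) ^ 2
        + 2 * (α * valₙ z.1 z.2 j * w z.1 j z.2) *
          (β * epCoef (n₁ z.1) (n₂ z.1) (S₂ z.1 z.2) (w₁ z.1 j z.2) (w₂ z.1 j z.2) j)) * x (Z j z.2)
        + 2 * valₙ z.1 z.2 j * α *
          (β * epCoef (n₁ z.1) (n₂ z.1) (S₂ z.1 z.2) (w₁ z.1 j z.2) (w₂ z.1 j z.2) j) * y (Z j z.2)
        + (β * epCoef (n₁ z.1) (n₂ z.1) (S₂ z.1 z.2) (w₁ z.1 j z.2) (w₂ z.1 j z.2) j) ^ 2 *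
          v (Z j z.2))) (α ^ 2 * κv + 2 * α * β * κΓ + β ^ 2 * κV) := by
  have hr : plim (fun z => (n₂ z.1 : ℝ) / n₁ z.1 - ρ) 0 := by
    have := (tendsto_probFilter_of_tendsto (P := P) des.ratio_tendsto).sub_const ρ
    rwa [sub_self] at this
  have hRr := hR.mul_tendsto_zero (Y := fun n _ => (n₂ n : ℝ) / n₁ n - ρ) hr
  have t := (((hv.const_mul (α ^ 2)).add (hΓ.const_mul (2 * α * β))).add (hV.const_mul (β ^ 2))).add
    hRr
  rw [add_zero] at t
  refine t.congr' ?_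
  filter_upwards [eventually_probFilter_of_ae (p := fun n ω => S₂ n ω ∈ powersetCard (n₂ n) (range (n₁ n)))
    (Eventually.of_forall des.ae_validation)] with z hz
  have hs := (mem_powersetCard.1 hz).1
  have h2 : (0 : ℝ) < n₂ z.1 := by exact_mod_cast des.size_pos z.1
  have h1 : (0 : ℝ) < n₁ z.1 := by exact_mod_cast des.n₁_pos z.1
  obtain ⟨a, ha0, ha⟩ : ∃ a : ℝ, 0 < a ∧ (n₂ z.1 : ℝ) = a ^ 2 :=
    ⟨√(n₂ z.1), Real.sqrt_pos.2 h2, (Real.sq_sqrt h2.le).symm⟩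
  simp only [sum_eq_sum_range_ite hs, epCoef, coefVal]
  rw [ha, Real.sqrt_sq ha0.le]
  have e : a * (a ^ 2)⁻¹ = a⁻¹ := by field_simp
  have e1 : a * a⁻¹ = 1 := mul_inv_cancel₀ ha0.ne'
  simp only [mul_sum, sum_mul, ← sum_add_distrib]
  refine sum_congr rfl fun j _ => ?_
  generalize x (Z j z.2) = x, y (Z j z.2) = y, v (Z j z.2) = v, w z.1 j z.2 = w,
    w₁ z.1 j z.2 = w₁, w₂ z.1 j z.2 = w₂, (n₁ z.1 : ℝ) = N
  rw [← mul_assoc a, mul_sub a, ← mul_assoc a, ← mul_assoc a, e, ← inv_pow, div_eq_mul_inv]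
  generalize a⁻¹ = b, N⁻¹ = c at e1 ⊢
  split_ifs
  · linear_combination
      (-2 * α * β * w₁ * c * (w * x + y) - 2 * β ^ 2 * w₁ * w₂ * v * c) * (a * b) * e1
  · ring

end Matching

section Matching

variable {K : Set (EuclideanSpace ℝ (Fin p) × EuclideanSpace ℝ (Fin q))}
  {m s : Bool → EuclideanSpace ℝ (Fin p) × EuclideanSpace ℝ (Fin q) → ℝ}
  {mX sX : Bool → EuclideanSpace ℝ (Fin p) → ℝ}

lemma inv_le_rate_sq (N₁ N₂ : ℕ) (s : Finset ℕ) (j : ℕ) : (N₂ : ℝ)⁻¹ * (if j ∈ s then 1 else 0) ≤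
    rate N₁ N₂ s j ^ 2 ∧ (N₁ : ℝ)⁻¹ ≤ rate N₁ N₂ s j ^ 2 := by
  have e : ∀ N : ℕ, (N : ℝ)⁻¹ = (√N)⁻¹ ^ 2 := fun N => by
    rw [inv_pow, Real.sq_sqrt (Nat.cast_nonneg _)]
  have h1 : 0 ≤ (√N₁)⁻¹ := by positivity
  have h2 : 0 ≤ (√N₂)⁻¹ := by positivity
  rw [e, e, rate]
  split_ifs <;> constructor <;> nlinarith

lemma measurable_effect_comp {E : Type*} [MeasurableSpace E] {V : Rec p q → E} {m : Bool → E → ℝ}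
    (hm : ∀ a, Measurable (m a)) : Measurable[trtAlg V] fun r => effect m (V r) := by
  have h : Measurable[trtAlg V] V := (comap_measurable (fun r : Rec p q => (trt r, V r))).snd
  exact ((hm true).comp h).sub ((hm false).comp h)

lemma abs_effect_sub_le {E : Type*} {V : Rec p q → E} {m : Bool → E → ℝ} {c : ℝ}
    (hc : ∀ᵐ r ∂Q, ∀ a, |m a (V r)| ≤ c) :
    ∀ᵐ r ∂Q, |effect m (V r)| ≤ 2 * c ∧ |effect m (V r) - ∫ r, effect m (V r) ∂Q| ≤ 4 * c := by
  have h1 : ∀ᵐ r ∂Q, |effect m (V r)| ≤ 2 * c := hc.mono fun r hr =>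
    (abs_sub _ _).trans ((add_le_add (hr true) (hr false)).trans_eq (by ring))
  have h2 : |∫ r, effect m (V r) ∂Q| ≤ 2 * c := by
    simpa using norm_integral_le_of_norm_le_const (μ := Q) (f := fun r => effect m (V r)) h1
  exact h1.mono fun r hr => ⟨hr, (abs_sub _ _).trans ((add_le_add hr h2).trans_eq (by ring))⟩

lemma integral_centred {f : Rec p q → ℝ} (hf : Integrable f Q) (a : ℝ) :
    ∫ r, a * (f r - ∫ r, f r ∂Q) ∂Q = 0 := by
  rw [integral_const_mul, integral_sub hf (integrable_const _)]
  simp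

/-- The linear combination of the oracle terms with coefficients `α` and `β` has two layers: given
`(A, X, U)` the outcomes, and given `(A, X)` the covariate `U`. -/
lemma twoLayer_matching {w w₁ w₂ : Terms} (des : IsDesign) (hC : RegularCovariates Q K)
    (hR : RegularOutcome Q covXU K m s) (hX : RegularOutcome Q covX (Prod.fst '' K) mX sX) (h :
    IsLayer (trtAlg covXU) w) (h₁ : IsLayer (trtAlg covX) w₁) (h₂ : IsLayer (trtAlg covX) w₂) (h₁' : IsLayer (trtAlg covXU) w₁) (h₂' : IsLayer (trtAlg covXU) w₂) (α β : ℝ) : TwoLayer P Q Z n₁ n₂ S₂ (trtAlg covX) (trtAlg covXU)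
    (fun n j ω => w₁ n j ω + w₂ n j ω)
      (fun n j ω => w n j ω + (w₁ n j ω + w₂ n j ω))
      (fun r => α * (effect m (covXU r) - ∫ r, effect m (covXU r) ∂Q))
      (fun r => β * (effect mX (covX r) - ∫ r, effect mX (covX r) ∂Q)) (regGap m mX)
      (resid covXU m) (fun n j ω => α * valₙ n ω j * w n j ω)
      (fun n j ω => β * epCoef (n₁ n) (n₂ n) (S₂ n ω) (w₁ n j ω) (w₂ n j ω) j) := by
  have hKX : Bornology.IsBounded (Prod.fst '' K) := (hC.1.image continuous_fst).isBounded
  have hVX : ∀ᵐ r ∂Q, covX r ∈ Prod.fst '' K := hC.ae_mem.mono fun r hr => ⟨_, hr, rfl⟩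
  obtain ⟨⟨c, hc0, hc, hεc⟩, hε0, -⟩ := hR.resid_facts measurable_covXU hC.1.isBounded hC.ae_mem
  obtain ⟨⟨c', hc0', hc', -⟩, -, -⟩ := hX.resid_facts measurable_covX hKX hVX
  have b1 := abs_effect_sub_le (hc.mono fun r hr a => (hr a).1)
  have b2 := abs_effect_sub_le (hc'.mono fun r hr a => (hr a).1)
  have m1 := measurable_effect_comp (V := (covXU : Rec p q → _)) hR.measurable_mean
  have m2 := measurable_effect_comp (V := (covX : Rec p q → _)) hX.measurable_mean
  have hS : ∀ {m : MeasurableSpace (Rec p q)} (c : Finset ℕ → ℝ) (n k : ℕ),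
      Measurable[𝒦 m n k] fun ω => c (S₂ n ω) := fun c n k =>
    measurable_known_coef c k
  refine
  { layer₂ := h₁.add h₂ des
    layer₃ := h.add (h₁'.add h₂' des) des
    le := trtAlg_covX_le
    weight_le := fun n j ω => le_add_of_nonneg_left (zero_le_one.trans (h.one_le n j ω))
    measurable_T := (m1.sub_const _).const_mul α
    measurable_E := (m2.sub_const _).const_mul β
    measurable_η := measurable_regGap hR hX
    measurable_ε := (measurable_sgn.comp measurable_trt).mul
      (hR.measurable_resid measurable_covXU).2.2
    bdd := ⟨|α| * (4 * c) + |β| * (4 * c') + (c + c'), by positivity, ?_⟩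
    mean_T := integral_centred (Integrable.of_bound (m1.mono h.le le_rfl).aestronglyMeasurable
      (2 * c) (b1.mono fun r hr => hr.1)) α
    mean_E := integral_centred (Integrable.of_bound (m2.mono h₁.le le_rfl).aestronglyMeasurable
      (2 * c') (b2.mono fun r hr => hr.1)) β
    condExp_η := (condExp_regGap hC hR hX).1
    condExp_ε := hε0
    measurable_u := fun n j k => ((hS (fun s => coefVal (n₂ n) s j) n k).const_mul α).mul
      (h.measurable_weight n j k)
    measurable_g := fun n j k => ?_
    bdd_coef := ⟨|α| + |β|, by positivity, fun n j ω => ?_⟩ }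
  · filter_upwards [b1, b2, hc, hc', hεc] with r h1 h2 h3 h4 h5
    have p1 : 0 ≤ |α| * (4 * c) := by positivity
    have p2 : 0 ≤ |β| * (4 * c') := by positivity
    have hs : |regGap m mX r| ≤ c + c' := by
      rw [regGap, abs_mul, abs_sgn, one_mul]
      exact (abs_sub _ _).trans (add_le_add (h3 _).1 (h4 _).1)
    have e1 : |α * (effect m (covXU r) - ∫ r, effect m (covXU r) ∂Q)| ≤ |α| * (4 * c) := by
      rw [abs_mul]; exact mul_le_mul_of_nonneg_left h1.2 (abs_nonneg _)
    have e2 : |β * (effect mX (covX r) - ∫ r, effect mX (covX r) ∂Q)| ≤ |β| * (4 * c') := by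
      rw [abs_mul]; exact mul_le_mul_of_nonneg_left h2.2 (abs_nonneg _)
    refine ⟨by linarith, by linarith, by linarith, h5.trans (mul_le_mul_of_nonneg_right
      (by linarith) (zero_le_one.trans (one_le_outScale r)))⟩
  · have e : ∀ ω, epCoef (n₁ n) (n₂ n) (S₂ n ω) (w₁ n j ω) (w₂ n j ω) j
        = √(n₂ n) * ((n₂ n : ℝ)⁻¹ * ((if j ∈ S₂ n ω then 1 else 0) * w₂ n j ω)
          - (n₁ n : ℝ)⁻¹ * w₁ n j ω) := fun ω => by
      rw [epCoef]; split_ifs <;> simp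
    simp only [e]
    exact ((((((hS (fun s => if j ∈ s then 1 else 0) n k).mul (h₂.measurable_weight n j k)).const_mul
      _).sub ((h₁.measurable_weight n j k).const_mul _)).const_mul _).const_mul _)
  · have w0 := zero_le_one.trans (h.one_le n j ω)
    have w1 := zero_le_one.trans (h₁.one_le n j ω)
    have w2 := zero_le_one.trans (h₂.one_le n j ω)
    have r0 := rate_nonneg (n₁ n) (n₂ n) (S₂ n ω) j
    constructor
    · rw [mul_assoc, abs_mul, abs_mul, abs_of_nonneg w0]
      refine mul_le_mul (le_add_of_nonneg_right (abs_nonneg β)) ?_ (by positivity) (by positivity)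
      exact mul_le_mul (abs_coefVal_le _ _ _ _) (le_add_of_nonneg_right (add_nonneg w1 w2)) w0 r0
    · rw [abs_mul]
      exact mul_le_mul (le_add_of_nonneg_left (abs_nonneg α)) (abs_epCoef_le (des.size_le n) _ w1
        w2 j) (abs_nonneg _) (by positivity)

/-- Tightness of the sums that multiply `n₂ / n₁ - ρ` in `Design.tendsto_sum_weights`. -/
lemma isTightSeq_sum_weights {w w₁ w₂ : Terms} {μ : MeasurableSpace (Rec p q)} (des :
    IsDesign) (h : IsLayer μ fun n j ω => w n j ω + (w₁ n j ω + w₂ n j ω)) (hw : ∀ n j,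
    Measurable (w n j)) (hw₁ : ∀ n j, Measurable (w₁ n j)) (hw₂ : ∀ n j, Measurable (w₂ n j)) (h0 :
    ∀ n j ω, 0 ≤ w n j ω) (h1 : ∀ n j ω, 0 ≤ w₁ n j ω) (h2 : ∀ n j ω, 0 ≤ w₂ n j ω) {x y v : Rec p q
    → ℝ} (hx : Measurable[recAlg p q] x) (hy : Measurable[recAlg p q] y) (hv : Measurable[recAlg p
    q] v) {b : ℝ} (hb : ∀ᵐ r ∂Q, |x r| ≤ b ∧ |y r| ≤ b ∧ |v r| ≤ b) (α β : ℝ) : IsTightSeq P fun n ω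
    => ∑ j ∈ range (n₁ n), ((n₂ n : ℝ)⁻¹ * (if j ∈ S₂ n ω then 1 else 0) *
      (-2 * α * β * w₁ n j ω * (w n j ω * x (Z j ω) + y (Z j ω))
        - 2 * β ^ 2 * w₁ n j ω * w₂ n j ω * v (Z j ω))
      + (n₁ n : ℝ)⁻¹ * (β ^ 2 * w₁ n j ω ^ 2 * v (Z j ω))) := by
  have hZ : ∀ {f : Rec p q → ℝ}, Measurable[recAlg p q] f → ∀ j, Measurable fun ω => f (Z j ω) :=
    fun hf j => hf.comp (des.measurable_Z j)
  refine h.isTightSeq_sum des (X := fun n j ω => (n₂ n : ℝ)⁻¹ * (if j ∈ S₂ n ω then 1 else 0) *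
      (-2 * α * β * w₁ n j ω * (w n j ω * x (Z j ω) + y (Z j ω))
        - 2 * β ^ 2 * w₁ n j ω * w₂ n j ω * v (Z j ω))
      + (n₁ n : ℝ)⁻¹ * (β ^ 2 * w₁ n j ω ^ 2 * v (Z j ω)))
    (c := (4 * |α * β| + 3 * β ^ 2) * b) (fun n j => ?_) fun n j => ?_
  · have hS : Measurable fun ω => (n₂ n : ℝ)⁻¹ * (if j ∈ S₂ n ω then 1 else 0) :=
      des.measurable_coef (fun s : Finset ℕ => (n₂ n : ℝ)⁻¹ * (if j ∈ s then 1 else 0)) n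
    exact (hS.mul ((((hw₁ n j).const_mul _).mul (((hw n j).mul (hZ hx j)).add (hZ hy j))).sub
      ((((hw₁ n j).const_mul _).mul (hw₂ n j)).mul (hZ hv j)))).add
      (((((hw₁ n j).pow_const 2).const_mul _).mul (hZ hv j)).const_mul _)
  · filter_upwards [des.ae_unit hb j] with ω hω
    have hb0 := (abs_nonneg _).trans hω.1
    have hW := h.one_le n j ω
    have ho := one_le_pow₀ (n := 4) (one_le_outScale (Z j ω))
    obtain ⟨r1, r2⟩ := inv_le_rate_sq (n₁ n) (n₂ n) (S₂ n ω) j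
    have i1 : (0 : ℝ) ≤ (n₂ n : ℝ)⁻¹ * (if j ∈ S₂ n ω then 1 else 0) := by positivity
    have i2 : (0 : ℝ) ≤ (n₁ n : ℝ)⁻¹ := by positivity
    have a0 := h0 n j ω
    have a1 := h1 n j ω
    have a2 := h2 n j ω
    rw [Layer.dom]
    set W : ℝ := w n j ω + (w₁ n j ω + w₂ n j ω) with hWdef
    generalize (n₂ n : ℝ)⁻¹ * (if j ∈ S₂ n ω then 1 else 0) = i, (n₁ n : ℝ)⁻¹ = i',
      rateₙ n ω j ^ 2 = R, outScale (Z j ω) ^ 4 = o at *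
    obtain ⟨c0, c1, c2⟩ : w n j ω ≤ W ∧ w₁ n j ω ≤ W ∧ w₂ n j ω ≤ W :=
      ⟨by linarith, by linarith, by linarith⟩
    generalize w n j ω = w0, w₁ n j ω = w1, w₂ n j ω = w2, x (Z j ω) = x, y (Z j ω) = y,
      v (Z j ω) = v at *
    clear hWdef
    clear_value W
    have hW0 := zero_le_one.trans hW
    have hab : ∀ {u U z : ℝ}, 0 ≤ u → u ≤ U → |z| ≤ b → |u * z| ≤ U * b := fun h0 hu hz => by
      rw [abs_mul, abs_of_nonneg h0]
      exact mul_le_mul hu hz (abs_nonneg _) (h0.trans hu)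
    have d1 : |w1 * (w0 * x + y)| ≤ 2 * (W ^ 2 * b) := by
      have e1 := hab (mul_nonneg a1 a0) (mul_le_mul c1 c0 a0 hW0) hω.1
      have e2 := hab a1 (c1.trans (le_mul_of_one_le_left hW0 hW)) hω.2.1
      rw [mul_add, ← mul_assoc]
      exact (abs_add_le _ _).trans ((add_le_add e1 e2).trans_eq (by ring))
    have d2 := hab (mul_nonneg a1 a2) (mul_le_mul c1 c2 a2 hW0) hω.2.2
    have d3 := hab (mul_nonneg a1 a1) (mul_le_mul c1 c1 a1 hW0) hω.2.2
    have f1 : |-2 * α * β * w1 * (w0 * x + y) - 2 * β ^ 2 * w1 * w2 * v|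
        ≤ (4 * |α * β| + 2 * β ^ 2) * (W ^ 2 * b) := by
      rw [show -2 * α * β * w1 * (w0 * x + y) - 2 * β ^ 2 * w1 * w2 * v
        = -2 * (α * β) * (w1 * (w0 * x + y)) - 2 * β ^ 2 * (w1 * w2 * v) by ring]
      refine (abs_sub _ _).trans ?_
      rw [abs_mul (-2 * (α * β)), abs_mul (-2 : ℝ), abs_mul (2 * β ^ 2),
        abs_of_nonneg (show 0 ≤ 2 * β ^ 2 by positivity), abs_neg, abs_two]
      have k1 := mul_le_mul_of_nonneg_left d1 (show 0 ≤ 2 * |α * β| by positivity)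
      have k2 := mul_le_mul_of_nonneg_left d2 (show 0 ≤ 2 * β ^ 2 by positivity)
      exact (add_le_add k1 k2).trans_eq (by ring)
    have f2 : |β ^ 2 * w1 ^ 2 * v| ≤ β ^ 2 * (W ^ 2 * b) := by
      rw [mul_assoc, abs_mul, abs_of_nonneg (sq_nonneg β), sq w1]
      exact mul_le_mul_of_nonneg_left (d3.trans_eq (by ring)) (sq_nonneg β)
    have hR0 := i2.trans r2
    have g1 := mul_le_mul r1 f1 (abs_nonneg _) hR0
    have g2 := mul_le_mul r2 f2 (abs_nonneg _) hR0
    rw [← abs_of_nonneg i1, ← abs_mul] at g1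
    rw [← abs_of_nonneg i2, ← abs_mul] at g2
    refine (abs_add_le _ _).trans ((add_le_add g1 g2).trans ?_)
    have hW2 : W ^ 2 ≤ W ^ 4 * o := (pow_le_pow_right₀ hW (by norm_num)).trans
      (le_mul_of_one_le_right (by positivity) ho)
    calc _ = (4 * |α * β| + 3 * β ^ 2) * b * (R * W ^ 2) := by ring
      _ ≤ (4 * |α * β| + 3 * β ^ 2) * b * (R * (W ^ 4 * o)) := mul_le_mul_of_nonneg_left
        (mul_le_mul_of_nonneg_left hW2 hR0) (by positivity)
      _ = _ := by ring

end Matching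

section Matching

variable {K : Set (EuclideanSpace ℝ (Fin p) × EuclideanSpace ℝ (Fin q))}
  {m s : Bool → EuclideanSpace ℝ (Fin p) × EuclideanSpace ℝ (Fin q) → ℝ}
  {mX sX : Bool → EuclideanSpace ℝ (Fin p) → ℝ}

/-- The covariates `(X, U)` as a point of the Euclidean space in which units are matched. -/
def euclXU (r : Rec p q) : WithLp 2 (𝕏 × 𝕌) :=
  WithLp.toLp 2 (covXU r)

lemma distXU_eq (r r' : Rec p q) : distXU r r' = dist (euclXU r) (euclXU r') :=
  (WithLp.prod_dist_eq_of_L2 (euclXU r) (euclXU r')).symm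

lemma dist_covXU_le (r r' : Rec p q) : dist (covXU r) (covXU r') ≤ distXU r r' :=
  max_le (Real.le_sqrt_of_sq_le (le_add_of_nonneg_right (sq_nonneg _)))
    (Real.le_sqrt_of_sq_le (le_add_of_nonneg_left (sq_nonneg _)))

/-- The limit theorems for the linear combinations of the scaled oracle terms. The sums whose limits
are assumed enter through `Design.tendsto_sum_weights`. -/
lemma oracle_limits {w w₁ w₂ : Terms} (des : IsDesign) (hC : RegularCovariates Q K) (hR :
    RegularOutcome Q covXU K m s) (hX : RegularOutcome Q covX (Prod.fst '' K) mX sX) (h : IsLayer (trtAlg covXU) w) (h₁ : IsLayer (trtAlg covX) w₁) (h₂ : IsLayer (trtAlg covX) w₂) (h₁' : IsLayer (trtAlg covXU) w₁) (h₂' : IsLayer (trtAlg covXU) w₂) {τ : ℝ} (hτ : τ = ∫ r, effect m (covXU r) ∂Q) {κv κΓ κV : ℝ} (hv : plim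
    (fun z => (n₂ z.1 : ℝ)⁻¹ * ∑ j ∈ S₂ z.1 z.2,
      w z.1 j z.2 ^ 2 * s (trt (Z j z.2)) (covXU (Z j z.2))) κv)
    (hΓ : plim (fun z => (n₂ z.1 : ℝ)⁻¹ * ∑ j ∈ S₂ z.1 z.2,
      (w₂ z.1 j z.2 - ρ * w₁ z.1 j z.2) * (w z.1 j z.2 * s (trt (Z j z.2)) (covXU (Z j z.2))
        + sgn (trt (Z j z.2)) * (effect m (covXU (Z j z.2)) - τ) *
          (m (trt (Z j z.2)) (covXU (Z j z.2)) - mX (trt (Z j z.2)) (covX (Z j z.2))))) κΓ)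
    (hV : plim (fun z => (n₂ z.1 : ℝ)⁻¹ * ∑ j ∈ S₂ z.1 z.2,
        (w₂ z.1 j z.2 ^ 2 - 2 * ρ * w₁ z.1 j z.2 * w₂ z.1 j z.2) * sX (trt (Z j z.2)) (covX (Z j z.2))
      + ρ * ((n₁ z.1 : ℝ)⁻¹ * ∑ i ∈ range (n₁ z.1),
        w₁ z.1 i z.2 ^ 2 * sX (trt (Z i z.2)) (covX (Z i z.2)))) κV)
    (t : Unit ⊕ Fin 1 → ℝ) : NormalLimit P n₁ (fun n j ω => t ⬝ᵥ scaledTerm (n₁ n) (n₂ n) (S₂ n ω)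
        (fun j => effect m (covXU (Z j ω)) - ∫ r, effect m (covXU r) ∂Q
          + w n j ω * resid covXU m (Z j ω))
        (fun j _ => effect mX (covX (Z j ω)) - ∫ r, effect mX (covX r) ∂Q
          + w₁ n j ω * resid covX mX (Z j ω))
        (fun j _ => effect mX (covX (Z j ω)) - ∫ r, effect mX (covX r) ∂Q
          + w₂ n j ω * resid covX mX (Z j ω)) j)
      (t ⬝ᵥ blockCov (Var[fun r => effect m (covXU r); Q] + κv)
        (fun _ => (1 - ρ) * cov[fun r => effect m (covXU r), fun r => effect mX (covX r); Q] + κΓ)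
        (Matrix.of fun _ _ => (1 - ρ) * Var[fun r => effect mX (covX r); Q] + κV) *ᵥ t) := by
  set α := t (Sum.inl ()) with hα
  set β := t (Sum.inr 0) with hβ
  set θ := ∫ r, effect m (covXU r) ∂Q with hθ
  set θX := ∫ r, effect mX (covX r) ∂Q with hθX
  have hT : TwoLayer P Q Z n₁ n₂ S₂ (trtAlg covX) (trtAlg covXU) (fun n j ω => w₁ n j ω + w₂ n j ω)
      (fun n j ω => w n j ω + (w₁ n j ω + w₂ n j ω)) (fun r => α * (effect m (covXU r) - θ))
      (fun r => β * (effect mX (covX r) - θX)) (regGap m mX) (resid covXU m)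
      (fun n j ω => α * valₙ n ω j * w n j ω)
      (fun n j ω => β * epCoef (n₁ n) (n₂ n) (S₂ n ω) (w₁ n j ω) (w₂ n j ω) j) :=
    twoLayer_matching des hC hR hX h h₁ h₂ h₁' h₂' α β
  have hKX : Bornology.IsBounded (Prod.fst '' K) := (hC.1.image continuous_fst).isBounded
  have hVX : ∀ᵐ r ∂Q, covX r ∈ Prod.fst '' K := hC.ae_mem.mono fun r hr => ⟨_, hr, rfl⟩
  obtain ⟨⟨c, hc0, hc, -⟩, -, hε2⟩ := hR.resid_facts measurable_covXU hC.1.isBounded hC.ae_mem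
  obtain ⟨⟨c', hc0', hc', -⟩, -, -⟩ := hX.resid_facts measurable_covX hKX hVX
  obtain ⟨hmm, hsm, -⟩ := hR.measurable_resid measurable_covXU
  obtain ⟨hmXm, hsXm, -⟩ := hX.measurable_resid measurable_covX
  have m1 := measurable_effect_comp (V := (covXU : Rec p q → _)) hR.measurable_mean
  have m2 := measurable_effect_comp (V := (covX : Rec p q → _)) hX.measurable_mean
  have hw : ∀ {w : Terms} {μ : MeasurableSpace (Rec p q)}, IsLayer μ w →
      (∀ n j, Measurable (w n j)) ∧ ∀ n j ω, 0 ≤ w n j ω := fun h =>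
    ⟨fun n j => (h.measurable_weight n j 0).mono (des.known_le h.le n 0) le_rfl,
      fun n j ω => zero_le_one.trans (h.one_le n j ω)⟩
  have hsum := des.tendsto_sum_weights (x := fun r => s (trt r) (covXU r))
    (y := fun r => sgn (trt r) * (effect m (covXU r) - τ) *
      (m (trt r) (covXU r) - mX (trt r) (covX r))) (v := fun r => sX (trt r) (covX r))
    α β hv hΓ hV (isTightSeq_sum_weights des hT.layer₃ (hw h).1 (hw h₁).1 (hw h₂).1 (hw h).2
      (hw h₁).2 (hw h₂).2 (hsm.mono h.le le_rfl) (((measurable_sgn.comp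
      measurable_trt).mul ((m1.mono h.le le_rfl).sub_const τ)).mul ((hmm.mono h.le le_rfl).sub
      (hmXm.mono h₁.le le_rfl))) (hsXm.mono h₁.le le_rfl) (b := c + c' + 4 * c * (c + c')) (by
        filter_upwards [hc, hc', abs_effect_sub_le (hc.mono fun r hr a => (hr a).1)] with r h3 h4 h5
        have p1 : 0 ≤ 4 * c * (c + c') := by positivity
        refine ⟨(h3 _).2.trans (by linarith), ?_, (h4 _).2.trans (by linarith)⟩
        change |sgn (trt r) * (effect m (covXU r) - τ)
          * (m (trt r) (covXU r) - mX (trt r) (covX r))| ≤ _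
        rw [abs_mul, abs_mul, abs_sgn, one_mul, hτ]
        exact (mul_le_mul h5.2 ((abs_sub _ _).trans (add_le_add (h3 _).1 (h4 _).1)) (abs_nonneg _)
          (by positivity)).trans (le_add_of_nonneg_left (by positivity))) α β)
  have hsq := hT.tendsto_sum_sq des hε2 (hsm.mono h.le le_rfl) (hsXm.mono h₁.le le_rfl)
    (b := c + c') (by
      filter_upwards [hc, hc'] with r h3 h4
      exact ⟨(h3 _).2.trans (by linarith), (h4 _).2.trans (by linarith)⟩)
    (condExp_regGap hC hR hX).2 (hsum.congr fun z => sum_congr rfl fun j _ => by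
      simp only [regGap, hτ]; ring)
  have hlim : ∫ r, (α * (effect m (covXU r) - θ)) ^ 2 ∂Q + (1 - ρ) * (2 * ∫ r, α * (effect m (covXU
      r) - θ) * (β * (effect mX (covX r) - θX)) ∂Q + ∫ r, (β * (effect mX (covX r) - θX)) ^ 2 ∂Q) +
      (α ^ 2 * κv + 2 * α * β * κΓ + β ^ 2 * κV) = t ⬝ᵥ blockCov (Var[fun r => effect m (covXU r); Q]
        + κv) (fun _ => (1 - ρ) * cov[fun r => effect m (covXU r), fun r => effect mX (covX r); Q]
        + κΓ) (Matrix.of fun _ _ => (1 - ρ) * Var[fun r => effect mX (covX r); Q] + κV) *ᵥ t := by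
    rw [dotProduct_blockCov, variance_eq_integral (m1.mono h.le le_rfl).aemeasurable,
      variance_eq_integral (m2.mono h₁.le le_rfl).aemeasurable, covariance]
    simp only [univ_unique, sum_singleton, Fin.default_eq_zero, Fin.isValue, mul_pow,
      of_apply, mul_mul_mul_comm α _ β, integral_const_mul]
    rw [← hα, ← hβ, ← hθ, ← hθX]
    ring
  rw [hlim] at hsq
  refine NormalLimit.congr ⟨hT.tendsto_charFun des hsq, hsq, hT.tendsto_sum_large des⟩
    fun n ω j hj => ?_
  rw [TwoLayer.term, TwoLayer.inner]
  simp only [dotProduct, Fintype.sum_sum_type, univ_unique, sum_singleton,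
    scaledTerm, Sum.elim_inl, Sum.elim_inr, coefVal, coefDiff, epCoef, if_pos hj,
    PUnit.default_eq_unit, resid_covX m mX, Fin.default_eq_zero, Fin.isValue]
  rw [← hα, ← hβ]
  split_ifs <;> ring

/-- The bootstrap is consistent for matching estimators: these are asymptotically linear with the
oracle terms, for which the limit theorems of two layers hold. -/
theorem Design.bootstrapConsistent_of_matching (des : IsDesign) (hY : ∀ a, Integrable (pot a) Q)
    {mhat : ℕ → Ω → Bool → 𝕏 × 𝕌 → ℝ} {mXhat₁ mXhat₂ :
    ℕ → Ω → Bool → 𝕏 → ℝ} {M : ℕ} {κv κΓ κV : ℝ} (hp : 0 < p) (hM : 0 < M)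
    (hI : Ignorable Q) (hO : Overlap Q) (hC : RegularCovariates Q K) (hR : RegularOutcome Q covXU K
    m s) (hX : RegularOutcome Q covX (Prod.fst '' K) mX sX) (hm : MeanEstimator P 𝒢 n₂ (p + q) K m
    mhat) (hm₁ : MeanEstimator P 𝒢 n₂ p (Prod.fst '' K) mX mXhat₁) (hm₂ : MeanEstimator P 𝒢 n₂ p
    (Prod.fst '' K) mX mXhat₂) (hL : MatchingLimits P Z n₁ n₂ ρ S₂ M (ace Q) m s mX sX κv κΓ κV) :
    BootstrapConsistent P n₁ n₂ B S₂ D (ace Q)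
      (fun n ω => matchEstOn (S₂ n ω) (fun i => Z i ω) distXU M covXU (mhat n ω))
      (fun n ω (_ : Fin 1) => matchEstOn (range (n₁ n)) (fun i => Z i ω) distX M covX (mXhat₁ n ω))
      (fun n ω (_ : Fin 1) => matchEstOn (S₂ n ω) (fun i => Z i ω) distX M covX (mXhat₂ n ω))
      (fun n ω j => matchTermOn (S₂ n ω) (fun i => Z i ω) distXU M covXU (mhat n ω) j)
      (fun n ω j (_ : Fin 1) =>
        matchTermOn (range (n₁ n)) (fun i => Z i ω) distX M covX (mXhat₁ n ω) j)
      (fun n ω j (_ : Fin 1) => matchTermOn (S₂ n ω) (fun i => Z i ω) distX M covX (mXhat₂ n ω) j)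
      (Var[fun r => effect m (covXU r); Q] + κv)
      (fun _ => (1 - ρ) * cov[fun r => effect m (covXU r), fun r => effect mX (covX r); Q] + κΓ)
      (Matrix.of fun _ _ => (1 - ρ) * Var[fun r => effect mX (covX r); Q] + κV) := by
  have : NeZero p := ⟨hp.ne'⟩
  have : Nontrivial (WithLp 2 (𝕏 × 𝕌)) :=
    (WithLp.equiv 2 (𝕏 × 𝕌)).nontrivial
  have hKX : Bornology.IsBounded (Prod.fst '' K) := (hC.1.image continuous_fst).isBounded
  have hVX : ∀ᵐ r ∂Q, covX r ∈ Prod.fst '' K := hC.ae_mem.mono fun r hr => ⟨_, hr, rfl⟩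
  obtain ⟨⟨c, hc0, hc, -⟩, -, hε2⟩ := hR.resid_facts measurable_covXU hC.1.isBounded hC.ae_mem
  obtain ⟨⟨c', hc0', hc', -⟩, -, -⟩ := hX.resid_facts measurable_covX hKX hVX
  obtain ⟨hYi, hi4, hi4c⟩ := hR.layer_moments measurable_covXU
  obtain ⟨-, -, hi4c'⟩ := hX.layer_moments measurable_covX
  have hace : ace Q = ∫ r, effect m (covXU r) ∂Q :=
    ace_eq_integral_effect hY hI hO hR hYi fun a => hc.mono fun r hr => (hr a).1
  -- the covariates in which units are matched
  have hξ3c : Measurable[covAlg p q] (euclXU : Rec p q → _) :=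
    (WithLp.measurable_toLp 2 _).comp (comap_measurable covXU)
  have hξXc : Measurable[covAlg p q] (covX : Rec p q → _) :=
    measurable_fst.comp (comap_measurable covXU)
  have hV3 : Measurable[trtAlg covXU] (covXU : Rec p q → _) :=
    (comap_measurable (fun r : Rec p q => (trt r, covXU r))).snd
  have hVX3 : Measurable[trtAlg covXU] (covX : Rec p q → _) := measurable_fst.comp hV3
  have hξ3 : Measurable[trtAlg covXU] (euclXU : Rec p q → _) :=
    (WithLp.measurable_toLp 2 _).comp hV3
  have hξX : Measurable[trtAlg covX] (covX : Rec p q → _) :=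
    (comap_measurable (fun r : Rec p q => (trt r, covX r))).snd
  have ht3 : Measurable[trtAlg covXU] (trt : Rec p q → _) :=
    (comap_measurable (fun r : Rec p q => (trt r, covXU r))).fst
  have htX : Measurable[trtAlg covX] (trt : Rec p q → _) :=
    (comap_measurable (fun r : Rec p q => (trt r, covX r))).fst
  have hneX : ∀ i j, i ≠ j → ∀ᵐ ω ∂P, covX (Z i ω) ≠ covX (Z j ω) :=
    fun i j hij => hC.covX_ne hp des hij
  have hne3 : ∀ i j, i ≠ j → ∀ᵐ ω ∂P, euclXU (Z i ω) ≠ euclXU (Z j ω) :=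
    fun i j hij => (hneX i j hij).mono fun ω h h' =>
      h (congrArg Prod.fst ((WithLp.toLp_injective 2) h'))
  obtain ⟨Δ, hΔ⟩ : ∃ Δ : ℝ, ∀ᵐ r ∂Q, ‖euclXU r‖ ≤ Δ := by
    obtain ⟨Δ, hΔ⟩ := (hC.1.image (WithLp.prod_continuous_toLp 2 (𝕏)
      (𝕌))).isBounded.exists_norm_le
    exact ⟨Δ, hC.ae_mem.mono fun r hr => hΔ _ ⟨_, hr, rfl⟩⟩
  obtain ⟨ΔX, hΔX⟩ : ∃ Δ : ℝ, ∀ᵐ r ∂Q, ‖covX r‖ ≤ Δ := by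
    obtain ⟨Δ, hΔ⟩ := hKX.exists_norm_le
    exact ⟨Δ, hVX.mono fun r hr => hΔ _ hr⟩
  have hdX : ∀ r r' : Rec p q, distX r r' = dist (covX r) (covX r') := fun _ _ => rfl
  have hδX : Measurable fun r : Rec p q × Rec p q => distX r.1 r.2 :=
    (measurable_covX.comp measurable_fst).dist (measurable_covX.comp measurable_snd)
  have hmξ : Measurable (euclXU : Rec p q → _) := hξ3c.mono measurable_covXU.comap_le le_rfl
  have hδ : Measurable fun r : Rec p q × Rec p q => distXU r.1 r.2 := by
    simp only [distXU_eq]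
    exact (hmξ.comp measurable_fst).dist (hmξ.comp measurable_snd)
  have hdim : Module.finrank ℝ (WithLp 2 (𝕏 × 𝕌))
      = p + q := by
    rw [(WithLp.linearEquiv 2 ℝ _).finrank_eq]; simp
  have hdimX := finrank_euclideanSpace_fin (𝕜 := ℝ) (n := p)
  have hσ₂ : ∀ n, ∀ s ∈ powersetCard (n₂ n) (range (n₁ n)), s ⊆ range (n₁ n) ∧ s.card = n₂ n :=
    fun n s hs => mem_powersetCard.1 hs
  have hσ₁ : ∀ n, ∀ s ∈ powersetCard (n₂ n) (range (n₁ n)),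
      range (n₁ n) ⊆ range (n₁ n) ∧ (range (n₁ n)).card = n₁ n :=
    fun n _ _ => ⟨subset_rfl, card_range _⟩
  have hr₁ : ∀ n s j, (n₁ n : ℝ)⁻¹ * (if j ∈ range (n₁ n) then 1 else 0)
      ≤ rate (n₁ n) (n₂ n) s j ^ 2 := fun n s j =>
    (mul_le_of_le_one_right (by positivity) (by split_ifs <;> norm_num)).trans
      (inv_le_rate_sq _ _ _ _).2
  -- layers
  have L := des.layer_weightOn (σ := fun _ s => s) hO hξ3c distXU_eq hne3 hM
    (fun n s hs => (hσ₂ n s hs).1) (trtAlg_le measurable_covXU) ht3 hξ3 hi4 hi4c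
  have L₁ := des.layer_weightOn (σ := fun n _ => range (n₁ n)) hO hξXc hdX hneX hM
    (fun n s hs => (hσ₁ n s hs).1) (trtAlg_le measurable_covX) htX hξX hi4 hi4c'
  have L₂ := des.layer_weightOn (σ := fun _ s => s) hO hξXc hdX hneX hM
    (fun n s hs => (hσ₂ n s hs).1) (trtAlg_le measurable_covX) htX hξX hi4 hi4c'
  have L₁' := des.layer_weightOn (σ := fun n _ => range (n₁ n)) hO hξXc hdX hneX hM
    (fun n s hs => (hσ₁ n s hs).1) (trtAlg_le measurable_covXU) ht3 hVX3 hi4 hi4c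
  have L₂' := des.layer_weightOn (σ := fun _ s => s) hO hξXc hdX hneX hM
    (fun n s hs => (hσ₂ n s hs).1) (trtAlg_le measurable_covXU) ht3 hVX3 hi4 hi4c
  -- linearization
  have d := des.isTightSeq_matchDist (σ := fun _ s => s) hO hξ3c distXU_eq hΔ M
    des.size_pos hσ₂
  have d₂ := des.isTightSeq_matchDist (σ := fun _ s => s) hO hξXc hdX hΔX M des.size_pos hσ₂
  have d₁ := des.isTightSeq_matchDist (σ := fun n _ => range (n₁ n)) hO hξXc hdX hΔX M
    des.n₁_pos hσ₁
  rw [hdim] at d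
  rw [hdimX] at d₁ d₂
  have A := L.linearApprox (σ := fun _ s => s) (N := n₂) (δ := distXU) (M := M)
    des hO measurable_covXU hR hC.1.isBounded hC.ae_mem hm hM hδ dist_covXU_le (fun _ => le_rfl) hσ₂
    (fun n s j => (inv_le_rate_sq _ _ _ _).1) d
  have A₂ := L₂.linearApprox (σ := fun _ s => s) (N := n₂) (δ := distX) (M := M)
    des hO measurable_covX hX hKX hVX hm₂ hM hδX (fun _ _ => le_rfl) (fun _ => le_rfl) hσ₂
    (fun n s j => (inv_le_rate_sq _ _ _ _).1) d₂
  have A₁ := L₁.linearApprox (σ := fun n _ => range (n₁ n)) (N := n₁) (δ := distX) (M := M)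
    des hO measurable_covX hX hKX hVX hm₁ hM hδX (fun _ _ => le_rfl) des.size_le hσ₁ hr₁ d₁
  rw [← hace] at A
  have hv := tendstoInMeasure_iff_probFilter.1 hL.limit_v
  have hΓ := tendstoInMeasure_iff_probFilter.1 hL.limit_Γ
  have hV := tendstoInMeasure_iff_probFilter.1 hL.limit_V
  have H := @oracle_limits p q Ω mΩ P _ Q _ 𝒢 Z n₁ n₂ B ρ S₂ D
    K m s mX sX (fun n j ω => weightOn (S₂ n ω) (fun i => Z i ω) distXU M j)
    (fun n j ω => weightOn (range (n₁ n)) (fun i => Z i ω) distX M j)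
    (fun n j ω => weightOn (S₂ n ω) (fun i => Z i ω) distX M j) des hC hR hX L L₁ L₂ L₁' L₂' _ hace
    κv κΓ κV hv hΓ hV
  exact des.bootstrapConsistent_of_linearApprox (θ := fun _ => ∫ r, effect mX (covX r) ∂Q)
    (φ₁₀ := fun n ω j _ => oracleTerm Q (range (n₁ n)) (fun i => Z i ω) distX M covX mX j)
    (φ₂₀ := fun n ω j _ => oracleTerm Q (S₂ n ω) (fun i => Z i ω) distX M covX mX j)
    (by ext; rfl) A (fun _ => A₁) (fun _ => A₂) H

end Matching

end Studies

end TwoPhase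

end

open TwoPhase in
theorem mainTheorem5 {p q : ℕ} {Ω : Type*} [mΩ : MeasurableSpace Ω]
    (P : Measure Ω) [IsProbabilityMeasure P]
    (Q : Measure (Rec p q)) [IsProbabilityMeasure Q]
    (hY : ∀ a, Integrable (pot a) Q)
    (𝒢 : ℕ → MeasurableSpace Ω) (Z : ℕ → Ω → Rec p q) (n₁ n₂ B : ℕ → ℕ) (ρ : ℝ)
    (S₂ : ℕ → Ω → Finset ℕ) (D : ℕ → ℕ → ℕ → Ω → ℕ)
    (design : Design P Q 𝒢 Z n₁ n₂ B ρ S₂ D) :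
    -- regular asymptotically linear estimators
    (∀ (L : ℕ) (τ₂ : ℕ → Ω → ℝ) (ep₁ ep₂ : ℕ → Ω → Fin L → ℝ) (τep : Fin L → ℝ)
      (ψ : Bool × (EuclideanSpace ℝ (Fin p) × EuclideanSpace ℝ (Fin q)) × ℝ → ℝ)
      (φ : Bool × EuclideanSpace ℝ (Fin p) × ℝ → Fin L → ℝ)
      (ψhat : ℕ → Ω → Bool × (EuclideanSpace ℝ (Fin p) × EuclideanSpace ℝ (Fin q)) × ℝ → ℝ)
      (φhat₁ φhat₂ : ℕ → Ω → Bool × EuclideanSpace ℝ (Fin p) × ℝ → Fin L → ℝ),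
      IsRAL P Q Z n₂ S₂ τ₂ (ace Q) obsFull ψ →
      IsRAL P Q Z n₁ (fun n _ => range (n₁ n)) ep₁ τep obsMain φ →
      IsRAL P Q Z n₂ S₂ ep₂ τep obsMain φ →
      EstimatesInfluence P 𝒢 Z n₂ S₂ obsFull ψ ψhat →
      EstimatesInfluence P 𝒢 Z n₁ (fun n _ => range (n₁ n)) obsMain φ φhat₁ →
      EstimatesInfluence P 𝒢 Z n₂ S₂ obsMain φ φhat₂ →
      BootstrapConsistent P n₁ n₂ B S₂ D (ace Q) τ₂ ep₁ ep₂
        (fun n ω j => ψhat n ω (obsFull (Z j ω)))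
        (fun n ω j => φhat₁ n ω (obsMain (Z j ω)))
        (fun n ω j => φhat₂ n ω (obsMain (Z j ω)))
        (Var[fun r => ψ (obsFull r); Q])
        (fun l => (1 - ρ) * cov[fun r => ψ (obsFull r), fun r => φ (obsMain r) l; Q])
        (Matrix.of fun k l =>
          (1 - ρ) * cov[fun r => φ (obsMain r) k, fun r => φ (obsMain r) l; Q])) ∧
    -- matching estimators
    (∀ (K : Set (EuclideanSpace ℝ (Fin p) × EuclideanSpace ℝ (Fin q)))
      (m s : Bool → EuclideanSpace ℝ (Fin p) × EuclideanSpace ℝ (Fin q) → ℝ)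
      (mX sX : Bool → EuclideanSpace ℝ (Fin p) → ℝ)
      (mhat : ℕ → Ω → Bool → EuclideanSpace ℝ (Fin p) × EuclideanSpace ℝ (Fin q) → ℝ)
      (mXhat₁ mXhat₂ : ℕ → Ω → Bool → EuclideanSpace ℝ (Fin p) → ℝ)
      (M : ℕ) (κv κΓ κV : ℝ),
      0 < p → 0 < M →
      Ignorable Q → Overlap Q → RegularCovariates Q K →
      RegularOutcome Q covXU K m s → RegularOutcome Q covX (Prod.fst '' K) mX sX →
      MeanEstimator P 𝒢 n₂ (p + q) K m mhat →
      MeanEstimator P 𝒢 n₂ p (Prod.fst '' K) mX mXhat₁ →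
      MeanEstimator P 𝒢 n₂ p (Prod.fst '' K) mX mXhat₂ →
      MatchingLimits P Z n₁ n₂ ρ S₂ M (ace Q) m s mX sX κv κΓ κV →
      BootstrapConsistent P n₁ n₂ B S₂ D (ace Q)
        (fun n ω => matchEstOn (S₂ n ω) (fun i => Z i ω) distXU M covXU (mhat n ω))
        (fun n ω (_ : Fin 1) =>
          matchEstOn (range (n₁ n)) (fun i => Z i ω) distX M covX (mXhat₁ n ω))
        (fun n ω (_ : Fin 1) => matchEstOn (S₂ n ω) (fun i => Z i ω) distX M covX (mXhat₂ n ω))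
        (fun n ω j => matchTermOn (S₂ n ω) (fun i => Z i ω) distXU M covXU (mhat n ω) j)
        (fun n ω j (_ : Fin 1) =>
          matchTermOn (range (n₁ n)) (fun i => Z i ω) distX M covX (mXhat₁ n ω) j)
        (fun n ω j (_ : Fin 1) =>
          matchTermOn (S₂ n ω) (fun i => Z i ω) distX M covX (mXhat₂ n ω) j)
        (Var[fun r => effect m (covXU r); Q] + κv)
        (fun _ => (1 - ρ) * cov[fun r => effect m (covXU r), fun r => effect mX (covX r); Q] + κΓ)
        (Matrix.of fun _ _ => (1 - ρ) * Var[fun r => effect mX (covX r); Q] + κV)) := by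
  refine ⟨fun L τ₂ ep₁ ep₂ τep ψ φ ψhat φhat₁ φhat₂ h₂ h₁e h₂e hψ hφ₁ hφ₂ =>
    design.bootstrapConsistent_of_isRAL h₂ h₁e h₂e hψ hφ₁ hφ₂, ?_⟩
  intro K m s mX sX mhat mXhat₁ mXhat₂ M κv κΓ κV hp hM hI hO hC hR hX hm hm₁ hm₂ hL
  exact design.bootstrapConsistent_of_matching hY hp hM hI hO hC hR hX hm hm₁ hm₂ hL
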